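/- **Notation.** Let $S$ be a finite set of odd primes, $\mathbb Z_S=\prod_{p\in S}\mathbb Z_p$, and let $m\ge 1$ be an integer. For an abelian group $G$ let $G(S^\infty)$ be the subgroup of elements whose order is a product of primes in $S$; call $G$ an $S$-group if $G=G(S^\infty)$. Let $C_2=\{1,g\}$. Put $$\mu_{CL}^-(E)=\prod_{p\in S}\prod_{k\ge1}(1-p^{-k})\cdot\frac1{\#\mathrm{Aut}\,E},\qquad \mu_{CL}^+(E)=\prod_{p\in S}\prod_{k\ge2}(1-p^{-k})\cdot\frac1{\#\mathrm{Aut}\,E\cdot\#E}$$ for finite abelian $S$-groups $E$. *The ring $R$.* For every prime $p\mid m$ fix an étale $\mathbb Q_p$-algebra $A_p$ of degree $2$, on which $g$ acts as the non-trivial automorphism. Let $\mathcal O_A$ be the integral closure of $\prod_{p\mid m}\mathbb Z_p$ in $\prod_{p\mid m}A_p$, let $R=\mathcal O_A/m$, $U_R=R^\times/\{\pm1\}$, $U=U_R(S^\infty)$, and $U_-=\{u\in U: g(u)=u^{-1}\}$. Let $\mathrm{Aut}_{ring}U$ be the group of $C_2$-automorphisms of $U$ induced by ring automorphisms of $R$.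 *Sequences.* $\mathcal G_{R,cpt}^{\pm}$ is the set of isomorphism classes of exact sequences $\Theta:0\to U\to B\to C\to0$ of compact Hausdorff topological $C_2$-modules, where $g$ acts on $C$ by inversion and $C$ is: a finite $S$-group (sign $-$); a group with identity component $\cong\mathbb R/\mathbb Z$ whose group of components is a finite $S$-group (sign $+$). $\mathcal G_{R,S}^{\pm}$ is the set of isomorphism classes of exact sequences of discrete $C_2$-modules $0\to U\to B\to C\to 0$ with $C\cong C'(S^\infty)$ for such a $C'$, $g$ acting on $C$ by inversion. Isomorphisms are $C_2$-isomorphisms (homeomorphic in the compact case) of middle terms that are induced on $U$ by a ring automorphism of $R$; $\mathrm{Aut}_{ring}(\Theta)$ is the resulting automorphism group. $\mathbb P_{cpt}^\pm$ is the probability measure on $\mathcal G_{R,cpt}^\pm$ with $\mathbb P^\pm_{cpt}\{\Theta\}$ proportional to $1/\#\mathrm{Aut}_{ring}(\Theta)$, and $\mathbb P^\pm$ is its pushforward to $\mathcal G_{R,S}^\pm$ under $\Theta\mapsto\Theta(S^\infty)$. For an abelian group $M$ let $\pi^0(M)$ be its quotient by its maximal divisible subgroup. For $\Theta\in\mathcal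 G_{R,cpt}^+$ let $u(\Theta)=\gamma(1)\in U_-$, where $\gamma:\mathbb R\to B$ lifts the universal covering $\mathbb R\to C_0$ of the identity component of $C$, with kernel $\mathbb Z$; its $\mathrm{Aut}_{ring}U$-orbit depends only on the class of $\Theta$. Every $\Theta\in\mathcal G_{R,S}^{\pm}$ yields an exact sequence $\pi^0(\Theta):U\to\pi^0(B)\to\pi^0(C)\to0$; for sign $+$ the kernel on the left is cyclic, generated by an element of $U_-$; for sign $-$ it is trivial. For a finite $S$-group $E$ with $g$ acting by inversion and a $C_2$-submodule $V\subset U$, $\mathrm{Ext}^1(E,U/V)=\mathrm{Ext}^1_{\mathbb Z_S[C_2]}(E,U/V)$ is the set of equivalence classes of exact sequences $U\to X\to E\to0$ of $C_2$-modules with kernel $V$ on the left. *Fields.* $\mathcal F_X^-(R)$, $\mathcal F_X^+(R)$ is the set of pairs $(F,r)$ with $F$ an imaginary, resp. real, quadratic field (up to isomorphism) of conductor $|\mathrm{disc}\,F|<X$, and $r:R\to\mathcal O_F/m$ a $C_2$-equivariant ring isomorphism. Let $\mathrm{Id}_F(m)$ be the group of fractional ideals coprime to $m$, $F^1(m)$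 the group of $\alpha\in F^\times$ that are multiplicatively $\equiv1\bmod m$ (no condition at infinity), $\mathrm{Cl}_F(m)=\mathrm{Id}_F(m)/F^1(m)$, and let $\mathrm{Pic}^0_F(m)$ be the quotient by $F^1(m)$ of the fibre product of $\mathrm{Id}_F(m)$ and $\prod_{v\mid\infty}\mathbb R_{>0}$ over $\mathbb R_{>0}$, taken with respect to the norm maps. Then $r$ and $\alpha\mapsto((\alpha),(|\alpha|_v)_v)$ give $U_R\to\mathrm{Pic}^0_F(m)$, hence the sequence $\mathcal S_F^{Ara}(m):U_R\to\mathrm{Pic}^0_F(m)\to\mathrm{Pic}^0_F\to 0$, its $S^\infty$-torsion $\mathcal S_F^{Ara}(m)(S^\infty)$ in $\mathcal G_{R,S}^\pm$ (for $F\ne\mathbb Q(\sqrt{-1}),\mathbb Q(\sqrt{-3})$), and for real $F$ its compact $S$-part in $\mathcal G_{R,cpt}^+$ (divide by the prime-to-$S$ part of $U_R$ and restrict to the preimage of $\mathrm{Cl}_F(S^\infty)$). Composing with $\mathrm{Pic}^0_F(m)\to\mathrm{Cl}_F(m)$ gives the exact sequence $\mathcal S_F^{fin}(m)(S^\infty):U\to\mathrm{Cl}_F(m)(S^\infty)\to\mathrm{Cl}_F(S^\infty)\to0$.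 *The heuristic.* For a complex function $f$ on $\mathcal G_{R,S}^\pm$, "the heuristic holds for $f$" means that the average of $f(\mathcal S_F^{Ara}(m)(S^\infty))$ over $\mathcal F^\pm_X(R)$ (with summand $0$ for $F=\mathbb Q(\sqrt{-1}),\mathbb Q(\sqrt{-3})$) tends to the $\mathbb P^{\pm}$-expectation of $f$ as $X\to\infty$. For $f$ on $\mathcal G_{R,cpt}^+$ it means that the average over $\mathcal F^+_X(R)$ of the values at the compact $S$-parts tends to the $\mathbb P^+_{cpt}$-expectation. **Theorem.** A. *(Unconditional.)* For every choice of the $A_p$: (a) The pushforward of $\mathbb P^\pm$ under $\Theta\mapsto\pi^0(C)$ is $\mu_{CL}^\pm$. (b) For every $\mathrm{Aut}_{ring}U$-orbit $O\subset U_-$, $\mathbb P^+_{cpt}(u(\Theta)\in O)=\#O/\#U_-$. (c) Under $\mathbb P^+_{cpt}$ the maps $\Theta\mapsto\pi^0(C(S^\infty))$ and $\Theta\mapsto u(\Theta)$ of (a) and (b) are independent, with joint law the product of $\mu_{CL}^+$ and the law in (b). (d) Let $E$ be a finite abelian $S$-group, $u\in U_-$, $\varepsilon\in\mathrm{Ext}^1(E,U/\langle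 u\rangle)$. The $\mathbb P^+$-probability, conditional on $\pi^0(C)\cong E$, that $\pi^0(\Theta)$ is isomorphic to $\varepsilon$ up to $\mathrm{Aut}_{ring}U\times\mathrm{Aut}\,E$ is $N/(\#U_-\cdot\#\mathrm{Ext}^1(E,U/\langle u\rangle))$, where $N$ is the number of pairs $(u',\varepsilon')$ with $u'\in U_-$ and $\varepsilon'\in\mathrm{Ext}^1(E,U/\langle u'\rangle)$ in the orbit of $\varepsilon$. (e) Let $E$ be a finite abelian $S$-group. For every $(\mathrm{Aut}_{ring}U\times\mathrm{Aut}\,E)$-orbit $O\subset\mathrm{Ext}^1(E,U)$, the $\mathbb P^-$-probability, conditional on $C\cong E$, that the class of $\Theta$ lies in $O$ is $\#O/\#\mathrm{Ext}^1(E,U)$. B. *(Conditional.)* For every choice of the $A_p$: (1) For each sign, if the heuristic holds for the indicator functions of the fibres of the map in (a), then for every finite abelian $S$-group $E$ the proportion of $(F,r)\in\mathcal F_X^\pm(R)$ with $\mathrm{Cl}_F(S^\infty)\cong E$ tends to $\mu_{CL}^\pm(E)$. If for a given sign this heuristic holds for all choices of the $A_p$, then the same limit holds for all imaginary (sign $-$),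 resp. real (sign $+$), quadratic fields ordered by conductor. (2) If the heuristic holds for the indicator functions of the fibres of the map in (b), then, as $(F,r)$ runs over $\mathcal F_X^+(R)$ and $X\to\infty$, the image of a fundamental unit of $\mathcal O_F$ (any choice of one for each $F$) in $\frac{\mathbb Z_S[C_2]}{(g+1)}\otimes_{\mathbb Z[C_2]}\frac{R^\times}{\{\pm1\}}$ becomes uniformly distributed. (3) If the heuristic holds for the indicator functions of the fibres of the map in (c), then in the same limit $\mathrm{Cl}_F(S^\infty)$ and the image of the fundamental unit are independent: their joint distribution tends to the product of $\mu_{CL}^+$ and the uniform distribution. (4) If the heuristic holds for the indicator functions of the fibres of $\Theta\mapsto$ orbit of the class of $\Theta$ on $\mathcal G_{R,S}^-$, then, for every finite abelian $S$-group $G$, as $(F,r)$ runs over $\mathcal F_X^-(R)$ and $\iota$ over the isomorphisms $\mathrm{Cl}_F(S^\infty)\to G$, the class of $\mathcal S_F^{fin}(m)(S^\infty)$ becomes equidistributed in $\mathrm{Ext}^1_{\mathbb Z_S[C_2]}(G,U)$ as $X\to\infty$. (This is the Pagano–Sofos heuristic.) (5) If the heuristic holds for the indicator functions of the fibres of the map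 $\Theta\mapsto$ orbit of $\pi^0(\Theta)$ on $\mathcal G_{R,S}^+$, then for every $u\in U_-$ and every finite abelian $S$-group $A$, as $(F,r,\iota)$ runs over all $(F,r)\in\mathcal F_X^+(R)$ and isomorphisms $\iota:\mathrm{Cl}_F(S^\infty)\to A$ for which the kernel of $U\to\mathrm{Cl}_F(m)$ is $\langle u\rangle$, the class of $\mathcal S_F^{fin}(m)(S^\infty)$ becomes equidistributed in $\mathrm{Ext}^1_{\mathbb Z_S[C_2]}(A,U/\langle u\rangle)$ as $X\to\infty$. -/

import Mathlib

open NumberField Filter Topology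
open scoped nonZeroDivisors

noncomputable section

namespace RayClass

/-! ### `S`-parts of abelian groups -/

/-- `n` is a product of primes in `S`. -/
def IsSNumber (S : Finset ℕ) (n : ℕ) : Prop :=
  n ≠ 0 ∧ ∀ p : ℕ, p.Prime → p ∣ n → p ∈ S

lemma IsSNumber.one {S : Finset ℕ} : IsSNumber S 1 :=
  ⟨one_ne_zero, fun _ hp h => absurd (Nat.dvd_one.1 h) hp.ne_one⟩

lemma IsSNumber.mul {S : Finset ℕ} {a b : ℕ} (ha : IsSNumber S a) (hb : IsSNumber S b) :
    IsSNumber S (a * b) :=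
  ⟨mul_ne_zero ha.1 hb.1, fun p hp h =>
    (hp.dvd_mul.1 h).elim (ha.2 p hp) (hb.2 p hp)⟩

/-- The `S^∞`-torsion subgroup `G(S^∞)`: all elements whose order is a product of primes in `S`. -/
def sTorsion (S : Finset ℕ) (G : Type*) [CommGroup G] : Subgroup G where
  carrier := {x | ∃ n, IsSNumber S n ∧ x ^ n = 1}
  one_mem' := ⟨1, IsSNumber.one, one_pow 1⟩
  mul_mem' := by
    rintro x y ⟨a, ha, hx⟩ ⟨b, hb, hy⟩
    exact ⟨a * b, ha.mul hb, by rw [mul_pow, pow_mul, hx, one_pow, mul_comm a b, pow_mul, hy,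
      one_pow, one_mul]⟩
  inv_mem' := by
    rintro x ⟨a, ha, hx⟩
    exact ⟨a, ha, by rw [inv_pow, hx, inv_one]⟩

/-- The map induced on `S^∞`-torsion subgroups. -/
def sTorsionMap (S : Finset ℕ) {G H : Type*} [CommGroup G] [CommGroup H] (f : G →* H) :
    sTorsion S G →* sTorsion S H :=
  (f.comp (sTorsion S G).subtype).codRestrict (sTorsion S H) (by
    rintro ⟨x, n, hn, hx⟩
    exact ⟨n, hn, by simp [← map_pow, hx]⟩)

/-- `G` is an `S`-group. -/
def IsSGroup (S : Finset ℕ) (G : Type*) [CommGroup G] : Prop := sTorsion S G = ⊤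

/-- The subgroup of elements of `G` whose order is finite and coprime to all primes in `S`. -/
def primeToS (S : Finset ℕ) (G : Type*) [CommGroup G] : Subgroup G where
  carrier := {x | ∃ n : ℕ, n ≠ 0 ∧ (∀ p ∈ S, n.Coprime p) ∧ x ^ n = 1}
  one_mem' := ⟨1, one_ne_zero, fun p _ => Nat.coprime_one_left p, one_pow 1⟩
  mul_mem' := by
    rintro x y ⟨a, ha, ha', hx⟩ ⟨b, hb, hb', hy⟩
    exact ⟨a * b, mul_ne_zero ha hb, fun p hp => (ha' p hp).mul_left (hb' p hp),
      by rw [mul_pow, pow_mul, hx, one_pow, mul_comm a b, pow_mul, hy, one_pow, one_mul]⟩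
  inv_mem' := by
    rintro x ⟨a, ha, ha', hx⟩
    exact ⟨a, ha, ha', by rw [inv_pow, hx, inv_one]⟩

/-- The maximal divisible subgroup of an abelian group. -/
def divSub (G : Type*) [CommGroup G] : Subgroup G :=
  sSup {D : Subgroup G | ∀ n : ℕ, n ≠ 0 → ∀ x ∈ D, ∃ y ∈ D, y ^ n = x}

/-! ### Arakelov ray class groups -/

section Arakelov

variable (F : Type) [Field F] [NumberField F]

/-- The group of fractional ideals of `F`, with the discrete topology. -/
def FracId : Type := (FractionalIdeal (𝓞 F)⁰ F)ˣ

instance : CommGroup (FracId F) := inferInstanceAs (CommGroup (FractionalIdeal (𝓞 F)⁰ F)ˣ)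
instance : TopologicalSpace (FracId F) := ⊥
instance : DiscreteTopology (FracId F) := ⟨rfl⟩

/-- The principal fractional ideal `(α)`. -/
def prId : Fˣ →* FracId F := toPrincipalIdeal (𝓞 F) F

/-- The group `Id_F(m)` of fractional ideals that are coprime to `m`,
i.e. quotients of integral ideals coprime to `m`. -/
def idSub (m : ℕ) : Subgroup (FracId F) where
  carrier := {I | ∃ a b : Ideal (𝓞 F), IsCoprime a (Ideal.span {(m : 𝓞 F)}) ∧
    IsCoprime b (Ideal.span {(m : 𝓞 F)}) ∧
    (Units.val I : FractionalIdeal (𝓞 F)⁰ F) * b = a}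
  one_mem' := ⟨1, 1, isCoprime_one_left, isCoprime_one_left, by
    change ((1 : (FractionalIdeal (𝓞 F)⁰ F)ˣ) : FractionalIdeal (𝓞 F)⁰ F) * _ = _
    simp⟩
  mul_mem' := by
    rintro I J ⟨a, b, ha, hb, h⟩ ⟨a', b', ha', hb', h'⟩
    refine ⟨a * a', b * b', ha.mul_left ha', hb.mul_left hb', ?_⟩
    change ((Units.val I : FractionalIdeal (𝓞 F)⁰ F) * Units.val J) * _ = _
    rw [FractionalIdeal.coeIdeal_mul, FractionalIdeal.coeIdeal_mul, ← h, ← h']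
    ring
  inv_mem' := by
    rintro I ⟨a, b, ha, hb, h⟩
    refine ⟨b, a, hb, ha, ?_⟩
    rw [← h, ← mul_assoc]
    erw [Units.inv_mul]
    rw [one_mul]

/-- The ray `F^1(m)` (no condition at infinity): all `α ∈ F^×` with `α ≡ 1` modulo `m` in the
multiplicative sense, i.e. `α = a / b` with `a, b ∈ 𝓞_F` coprime to `m` and `a ≡ b mod m`. -/
def ray (m : ℕ) : Subgroup Fˣ where
  carrier := {α | ∃ a b : 𝓞 F, b ≠ 0 ∧ IsCoprime b (m : 𝓞 F) ∧ (m : 𝓞 F) ∣ a - b ∧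
    (α : F) * algebraMap (𝓞 F) F b = algebraMap (𝓞 F) F a}
  one_mem' := ⟨1, 1, one_ne_zero, isCoprime_one_left, by simp, by simp⟩
  mul_mem' := by
    rintro α β ⟨a, b, hb, hbm, hab, h⟩ ⟨a', b', hb', hbm', hab', h'⟩
    refine ⟨a * a', b * b', mul_ne_zero hb hb', hbm.mul_left hbm', ?_, ?_⟩
    · have : a * a' - b * b' = a * (a' - b') + b' * (a - b) := by ring
      rw [this]
      exact dvd_add (hab'.mul_left _) (hab.mul_left _)
    · simp only [Units.val_mul, map_mul]
      rw [← h, ← h']; ring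
  inv_mem' := by
    rintro α ⟨a, b, hb, hbm, ⟨c, hc⟩, h⟩
    have ha : a = b + m * c := by rw [← hc]; ring
    have ha0 : a ≠ 0 := by
      rintro rfl
      rw [map_zero] at h
      exact (mul_ne_zero α.ne_zero (by simpa using hb)) h
    refine ⟨b, a, ha0, ?_, ⟨-c, by rw [ha]; ring⟩, ?_⟩
    · rw [ha]
      exact hbm.add_mul_left_left c
    · rw [← h, ← mul_assoc, Units.inv_mul, one_mul]

/-- The ray class group `Cl_F(m)`. -/
def RayCl (m : ℕ) : Type := idSub F m ⧸ ((ray F m).map (prId F)).subgroupOf (idSub F m)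

instance (m : ℕ) : CommGroup (RayCl F m) :=
  inferInstanceAs (CommGroup (idSub F m ⧸ ((ray F m).map (prId F)).subgroupOf (idSub F m)))

/-- The product of the group of fractional ideals and of `∏_v ℝˣ`; the group
`∏_v ℝ_{>0}`, i.e. the quotient of `(F ⊗ ℝ)^×` by its maximal compact subgroup, is a subgroup
of the second factor. -/
abbrev IdReal : Type := FracId F × (InfinitePlace F → ℝˣ)

/-- The fibre product of `Id_F(m)` and `∏_v ℝ_{>0}` over `ℝ_{>0}`. -/
def araDiv (m : ℕ) : Subgroup (IdReal F) where
  carrier := {x | x.1 ∈ idSub F m ∧ (∀ v, 0 < (x.2 v : ℝ)) ∧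
    ((FractionalIdeal.absNorm (Units.val x.1 : FractionalIdeal (𝓞 F)⁰ F) : ℚ) : ℝ) =
      ∏ v : InfinitePlace F, (x.2 v : ℝ) ^ v.mult}
  one_mem' := ⟨one_mem _, fun v => by simp, by
    change ((FractionalIdeal.absNorm ((1 : (FractionalIdeal (𝓞 F)⁰ F)ˣ) :
      FractionalIdeal (𝓞 F)⁰ F) : ℚ) : ℝ) = _
    simp⟩
  mul_mem' := by
    rintro x y ⟨h1, h2, h3⟩ ⟨h1', h2', h3'⟩
    refine ⟨mul_mem h1 h1', fun v => by simpa using mul_pos (h2 v) (h2' v), ?_⟩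
    change ((FractionalIdeal.absNorm ((Units.val x.1 : FractionalIdeal (𝓞 F)⁰ F) *
      Units.val y.1) : ℚ) : ℝ) = _
    simp only [map_mul, Rat.cast_mul, h3, h3', Prod.snd_mul, Pi.mul_apply, Units.val_mul, mul_pow,
      Finset.prod_mul_distrib]
  inv_mem' := by
    rintro x ⟨h1, h2, h3⟩
    refine ⟨inv_mem h1, fun v => by simpa using h2 v, ?_⟩
    have key : FractionalIdeal.absNorm (Units.val x.1 : FractionalIdeal (𝓞 F)⁰ F) *
        FractionalIdeal.absNorm (Units.val (x.1⁻¹) : FractionalIdeal (𝓞 F)⁰ F) = 1 := by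
      rw [← map_mul]
      erw [Units.mul_inv]
      simp
    have key' := congrArg (fun q : ℚ => (q : ℝ)) key
    simp only [Rat.cast_mul, Rat.cast_one, h3] at key'
    change ((FractionalIdeal.absNorm (Units.val (x.1⁻¹) : FractionalIdeal (𝓞 F)⁰ F) : ℚ) : ℝ) = _
    simp only [Prod.snd_inv, Pi.inv_apply, Units.val_inv_eq_inv_val, inv_pow,
      Finset.prod_inv_distrib]
    exact eq_inv_of_mul_eq_one_right key'

/-- The map `α ↦ ((α), (|α|_v)_v)`. -/
def prIdReal : Fˣ →* IdReal F :=
  (prId F).prod (MonoidHom.pi fun v : InfinitePlace F => Units.map v.1.toMonoidHom)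

/-- The Arakelov ray class group `Pic_F^0(m)`, with its quotient topology. -/
def Pic (m : ℕ) : Type := araDiv F m ⧸ ((ray F m).map (prIdReal F)).subgroupOf (araDiv F m)

instance (m : ℕ) : CommGroup (Pic F m) :=
  inferInstanceAs (CommGroup (araDiv F m ⧸ ((ray F m).map (prIdReal F)).subgroupOf (araDiv F m)))

instance (m : ℕ) : TopologicalSpace (Pic F m) :=
  inferInstanceAs (TopologicalSpace
    (araDiv F m ⧸ ((ray F m).map (prIdReal F)).subgroupOf (araDiv F m)))

instance (m : ℕ) : IsTopologicalGroup (Pic F m) :=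
  inferInstanceAs (IsTopologicalGroup
    (araDiv F m ⧸ ((ray F m).map (prIdReal F)).subgroupOf (araDiv F m)))

end Arakelov

section Arakelov

variable {F : Type} [Field F] [NumberField F]

/-! The action of an automorphism of `F`. -/

/-- The automorphism of `𝓞 F` induced by an automorphism `g` of `F`. -/
def gInt (g : F ≃ₐ[ℚ] F) : 𝓞 F ≃+* 𝓞 F := RingOfIntegers.mapRingEquiv (g : F ≃+* F)

lemma coe_gInt (g : F ≃ₐ[ℚ] F) (x : 𝓞 F) : algebraMap (𝓞 F) F (gInt g x) = g (algebraMap _ F x) :=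
  rfl

lemma gInt_natCast (g : F ≃ₐ[ℚ] F) (m : ℕ) : gInt g (m : 𝓞 F) = m := map_natCast _ m

lemma gInt_nzd (g : F ≃ₐ[ℚ] F) :
    (𝓞 F)⁰ ≤ (𝓞 F)⁰.comap ((gInt g : 𝓞 F ≃+* 𝓞 F) : 𝓞 F →+* 𝓞 F) := by
  intro x hx
  rw [Submonoid.mem_comap, mem_nonZeroDivisors_iff_ne_zero]
  simp [nonZeroDivisors.ne_zero hx]

lemma map_gInt (g : F ≃ₐ[ℚ] F) (x : F) :
    IsLocalization.map F ((gInt g : 𝓞 F ≃+* 𝓞 F) : 𝓞 F →+* 𝓞 F) (gInt_nzd g) x = g x := by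
  have : IsLocalization.map F ((gInt g : 𝓞 F ≃+* 𝓞 F) : 𝓞 F →+* 𝓞 F) (gInt_nzd g) =
      ((g : F ≃+* F) : F →+* F) := by
    apply IsLocalization.ringHom_ext (𝓞 F)⁰
    ext y
    simp only [RingHom.comp_apply, IsLocalization.map_eq]
    rfl
  rw [this]
  rfl

/-- The action of `g` on fractional ideals. -/
def gFrac (g : F ≃ₐ[ℚ] F) : FractionalIdeal (𝓞 F)⁰ F →+* FractionalIdeal (𝓞 F)⁰ F :=
  FractionalIdeal.extendedHom' F (gInt_nzd g)

/-- The action of `g` on the group of fractional ideals. -/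
def gId (g : F ≃ₐ[ℚ] F) : FracId F →* FracId F :=
  Units.map (gFrac g : FractionalIdeal (𝓞 F)⁰ F →* FractionalIdeal (𝓞 F)⁰ F)

lemma val_gId (g : F ≃ₐ[ℚ] F) (I : FracId F) :
    (Units.val (gId g I) : FractionalIdeal (𝓞 F)⁰ F) = gFrac g (Units.val I) := rfl

lemma gFrac_coeIdeal (g : F ≃ₐ[ℚ] F) (a : Ideal (𝓞 F)) :
    gFrac g (a : FractionalIdeal (𝓞 F)⁰ F) =
      (a.map ((gInt g : 𝓞 F ≃+* 𝓞 F) : 𝓞 F →+* 𝓞 F) : Ideal (𝓞 F)) :=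
  FractionalIdeal.extended_coeIdeal_eq_map F (gInt_nzd g) a

lemma gFrac_span (g : F ≃ₐ[ℚ] F) (x : F) :
    gFrac g (FractionalIdeal.spanSingleton (𝓞 F)⁰ x) =
      FractionalIdeal.spanSingleton (𝓞 F)⁰ (g x) := by
  have := FractionalIdeal.extended_spanSingleton (M := (𝓞 F)⁰) F (gInt_nzd g) x
  rw [map_gInt] at this
  exact this

lemma gId_prId (g : F ≃ₐ[ℚ] F) (α : Fˣ) :
    gId g (prId F α) = prId F (Units.map (g : F →* F) α) := by
  apply Units.ext
  rw [val_gId]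
  change gFrac g (Units.val (toPrincipalIdeal (𝓞 F) F α)) =
    Units.val (toPrincipalIdeal (𝓞 F) F _)
  rw [coe_toPrincipalIdeal, coe_toPrincipalIdeal, gFrac_span]
  rfl

lemma absNorm_map_gInt (g : F ≃ₐ[ℚ] F) (a : Ideal (𝓞 F)) :
    Ideal.absNorm (a.map ((gInt g : 𝓞 F ≃+* 𝓞 F) : 𝓞 F →+* 𝓞 F)) = Ideal.absNorm a :=
  (Nat.card_congr (Ideal.quotientEquiv a _ (gInt g) rfl).toEquiv).symm

lemma absNorm_gFrac (g : F ≃ₐ[ℚ] F) (I : FractionalIdeal (𝓞 F)⁰ F) :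
    FractionalIdeal.absNorm (gFrac g I) = FractionalIdeal.absNorm I := by
  have h := FractionalIdeal.den_mul_self_eq_num' (𝓞 F)⁰ F I
  have h2 := congrArg (gFrac g) h
  rw [map_mul, gFrac_span, gFrac_coeIdeal] at h2
  have h3 := congrArg FractionalIdeal.absNorm h
  have h4 := congrArg FractionalIdeal.absNorm h2
  rw [map_mul, FractionalIdeal.absNorm_span_singleton, FractionalIdeal.coeIdeal_absNorm] at h3 h4
  rw [absNorm_map_gInt, ← h3, Algebra.norm_eq_of_algEquiv] at h4
  refine mul_left_cancel₀ ?_ h4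
  have : algebraMap (𝓞 F) F (I.den : 𝓞 F) ≠ 0 := by
    simp [nonZeroDivisors.ne_zero I.den.2]
  simp

lemma gId_mem (g : F ≃ₐ[ℚ] F) {m : ℕ} {I : FracId F} (h : I ∈ idSub F m) :
    gId g I ∈ idSub F m := by
  obtain ⟨a, b, ha, hb, h⟩ := h
  have key : ∀ c : Ideal (𝓞 F), IsCoprime c (Ideal.span {(m : 𝓞 F)}) →
      IsCoprime (c.map ((gInt g : 𝓞 F ≃+* 𝓞 F) : 𝓞 F →+* 𝓞 F)) (Ideal.span {(m : 𝓞 F)}) := by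
    intro c hc
    have h1 := hc.map (Ideal.mapHom ((gInt g : 𝓞 F ≃+* 𝓞 F) : 𝓞 F →+* 𝓞 F))
    simpa [Ideal.map_span] using h1
  refine ⟨_, _, key a ha, key b hb, ?_⟩
  rw [val_gId, ← gFrac_coeIdeal, ← gFrac_coeIdeal, ← map_mul, h]

lemma g_mem_ray (g : F ≃ₐ[ℚ] F) {m : ℕ} {α : Fˣ} (h : α ∈ ray F m) :
    Units.map (g : F →* F) α ∈ ray F m := by
  obtain ⟨a, b, hb, hbm, hab, h⟩ := h
  refine ⟨gInt g a, gInt g b, by simpa using hb, ?_, ?_, ?_⟩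
  · simpa using hbm.map ((gInt g : 𝓞 F ≃+* 𝓞 F) : 𝓞 F →+* 𝓞 F)
  · simpa using map_dvd (gInt g) hab
  · rw [coe_gInt, coe_gInt, ← h]
    simp

/-- The action of `g` on `Id_F(m)`. -/
def gIdSub (g : F ≃ₐ[ℚ] F) (m : ℕ) : idSub F m →* idSub F m :=
  ((gId g).comp (idSub F m).subtype).codRestrict (idSub F m) fun x => gId_mem g x.2

/-- The action of `g` on `Cl_F(m)`. -/
def gRayCl (g : F ≃ₐ[ℚ] F) (m : ℕ) : RayCl F m →* RayCl F m :=
  QuotientGroup.map (((ray F m).map (prId F)).subgroupOf (idSub F m))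
    (((ray F m).map (prId F)).subgroupOf (idSub F m)) (gIdSub g m) (by
    rintro ⟨I, hI⟩ ⟨α, hα, h⟩
    refine ⟨_, g_mem_ray g hα, ?_⟩
    rw [← gId_prId, h]
    rfl)

/-- The action of `g` on `∏_v ℝˣ`. -/
def gInf (g : F ≃ₐ[ℚ] F) : (InfinitePlace F → ℝˣ) →* (InfinitePlace F → ℝˣ) where
  toFun a v := a (v.comap (g : F →+* F))
  map_one' := rfl
  map_mul' _ _ := rfl

/-- The action of `g` on the product of the ideal group and `∏_v ℝˣ`. -/
def gIdReal (g : F ≃ₐ[ℚ] F) : IdReal F →* IdReal F := (gId g).prodMap (gInf g)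

lemma gIdReal_prIdReal (g : F ≃ₐ[ℚ] F) (α : Fˣ) :
    gIdReal g (prIdReal F α) = prIdReal F (Units.map (g : F →* F) α) := by
  refine Prod.ext (gId_prId g α) ?_
  funext v
  apply Units.ext
  rfl

/-- The permutation of the infinite places induced by `g`. -/
def gPlaces (g : F ≃ₐ[ℚ] F) : InfinitePlace F ≃ InfinitePlace F where
  toFun v := v.comap (g : F →+* F)
  invFun v := v.comap (g.symm : F →+* F)
  left_inv v := by
    change (v.comap (g : F →+* F)).comap (g.symm : F →+* F) = v
    rw [← InfinitePlace.comap_comp]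
    convert InfinitePlace.comap_id v
    ext x; simp
  right_inv v := by
    change (v.comap (g.symm : F →+* F)).comap (g : F →+* F) = v
    rw [← InfinitePlace.comap_comp]
    convert InfinitePlace.comap_id v
    ext x; simp

lemma mult_gPlaces (g : F ≃ₐ[ℚ] F) (v : InfinitePlace F) : (gPlaces g v).mult = v.mult := by
  have : (gPlaces g v).IsReal ↔ v.IsReal := InfinitePlace.isReal_comap_iff (g : F ≃+* F)
  by_cases h : v.IsReal
  · rw [InfinitePlace.mult, InfinitePlace.mult, if_pos h, if_pos (this.2 h)]
  · rw [InfinitePlace.mult, InfinitePlace.mult, if_neg h, if_neg (fun h' => h (this.1 h'))]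

lemma gIdReal_mem (g : F ≃ₐ[ℚ] F) {m : ℕ} {x : IdReal F} (h : x ∈ araDiv F m) :
    gIdReal g x ∈ araDiv F m := by
  obtain ⟨h1, h2, h3⟩ := h
  refine ⟨gId_mem g h1, fun v => h2 _, ?_⟩
  change ((FractionalIdeal.absNorm (gFrac g (Units.val x.1)) : ℚ) : ℝ) =
    ∏ v, ((x.2 (gPlaces g v) : ℝˣ) : ℝ) ^ v.mult
  rw [absNorm_gFrac, h3, ← (gPlaces g).prod_comp]
  simp only [mult_gPlaces]

/-- The action of `g` on the fibre product. -/
def gAraDiv (g : F ≃ₐ[ℚ] F) (m : ℕ) : araDiv F m →* araDiv F m :=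
  ((gIdReal g).comp (araDiv F m).subtype).codRestrict (araDiv F m) fun x => gIdReal_mem g x.2

lemma gAraDiv_continuous (g : F ≃ₐ[ℚ] F) (m : ℕ) : Continuous (gAraDiv g m) := by
  refine Continuous.subtype_mk ?_ _
  have h1 : Continuous (gId g) := continuous_of_discreteTopology
  have h2 : Continuous (gInf g) := continuous_pi fun v => continuous_apply _
  have h3 : Continuous (gIdReal g) := h1.prodMap h2
  exact h3.comp continuous_subtype_val

/-- The action of `g` on `Pic_F^0(m)`. -/
def gPic (g : F ≃ₐ[ℚ] F) (m : ℕ) : Pic F m →* Pic F m :=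
  QuotientGroup.map (((ray F m).map (prIdReal F)).subgroupOf (araDiv F m))
    (((ray F m).map (prIdReal F)).subgroupOf (araDiv F m)) (gAraDiv g m) (by
    rintro ⟨x, hx⟩ ⟨α, hα, h⟩
    refine ⟨_, g_mem_ray g hα, ?_⟩
    rw [← gIdReal_prIdReal, h]
    rfl)

lemma gPic_continuous (g : F ≃ₐ[ℚ] F) (m : ℕ) : Continuous (gPic g m) :=
  (QuotientGroup.continuous_mk.comp (gAraDiv_continuous g m)).quotient_lift _

variable (F)

/-- The projection `Pic_F^0(m) → Cl_F(m)`. -/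
def picToRayCl (m : ℕ) : Pic F m →* RayCl F m :=
  QuotientGroup.map (((ray F m).map (prIdReal F)).subgroupOf (araDiv F m))
    (((ray F m).map (prId F)).subgroupOf (idSub F m))
    (((MonoidHom.fst _ _).comp (araDiv F m).subtype).codRestrict (idSub F m) fun x => x.2.1) (by
    rintro ⟨x, hx⟩ ⟨α, hα, h⟩
    exact ⟨α, hα, congrArg Prod.fst h⟩)

/-- The projection `Cl_F(m) → Cl_F`. -/
def rayClToCl (m : ℕ) : RayCl F m →* ClassGroup (𝓞 F) :=
  QuotientGroup.lift (((ray F m).map (prId F)).subgroupOf (idSub F m)) ((ClassGroup.mk (R := 𝓞 F) F).comp (idSub F m).subtype) (by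
    rintro ⟨I, hI⟩ ⟨α, hα, h⟩
    change ClassGroup.mk F I = 1
    refine (ClassGroup.mk_eq_one_iff).2 ?_
    have h' : toPrincipalIdeal (𝓞 F) F α = I := h
    rw [← h', coe_toPrincipalIdeal]
    exact ⟨⟨_, FractionalIdeal.coe_spanSingleton _ _⟩⟩)

variable {F}

/-! The map `(𝓞_F / m)^× → Pic_F^0(m)`. -/

lemma isCoprime_iff_isUnit {m : ℕ} {α : 𝓞 F} :
    IsCoprime α (m : 𝓞 F) ↔ IsUnit (Ideal.Quotient.mk (Ideal.span {(m : 𝓞 F)}) α) := by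
  constructor
  · rintro ⟨x, y, h⟩
    refine IsUnit.of_mul_eq_one (Ideal.Quotient.mk _ x) ?_
    rw [← map_mul, ← map_one (Ideal.Quotient.mk _), Ideal.Quotient.mk_eq_mk_iff_sub_mem,
      Ideal.mem_span_singleton]
    exact ⟨-y, by rw [← h]; ring⟩
  · intro h
    obtain ⟨y, hy⟩ := h.exists_right_inv
    obtain ⟨x, rfl⟩ := Ideal.Quotient.mk_surjective y
    rw [← map_mul, ← map_one (Ideal.Quotient.mk _), Ideal.Quotient.mk_eq_mk_iff_sub_mem,
      Ideal.mem_span_singleton] at hy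
    obtain ⟨c, hc⟩ := hy
    exact ⟨x, -c, by linear_combination hc⟩

/-- The nonzero integers of `F` that are coprime to `m`. -/
def copInt (F : Type) [Field F] [NumberField F] (m : ℕ) : Submonoid (𝓞 F) where
  carrier := {α | α ≠ 0 ∧ IsCoprime α (m : 𝓞 F)}
  one_mem' := ⟨one_ne_zero, isCoprime_one_left⟩
  mul_mem' h h' := ⟨mul_ne_zero h.1 h'.1, h.2.mul_left h'.2⟩

/-- A nonzero integer of `F`, as an element of `F^×`. -/
def copUnit (m : ℕ) : copInt F m →* Fˣ where
  toFun α := Units.mk0 (algebraMap (𝓞 F) F α) (by simpa using α.2.1)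
  map_one' := Units.ext (by simp)
  map_mul' _ _ := Units.ext (by simp)

lemma prIdReal_mem (m : ℕ) (α : copInt F m) : prIdReal F (copUnit m α) ∈ araDiv F m := by
  refine ⟨⟨Ideal.span {(α : 𝓞 F)}, 1, ?_, isCoprime_one_left, ?_⟩, fun v => ?_, ?_⟩
  · rw [Ideal.isCoprime_span_singleton_iff]
    exact α.2.2
  · change Units.val (toPrincipalIdeal (𝓞 F) F (copUnit m α)) * _ = _
    rw [coe_toPrincipalIdeal, FractionalIdeal.coeIdeal_span_singleton]
    simp [copUnit]
  · exact InfinitePlace.pos_iff.2 (Units.ne_zero _)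
  · change ((FractionalIdeal.absNorm (Units.val (toPrincipalIdeal (𝓞 F) F (copUnit m α))) : ℚ) : ℝ)
      = ∏ v : InfinitePlace F, (v (copUnit m α : F)) ^ v.mult
    rw [coe_toPrincipalIdeal, FractionalIdeal.absNorm_span_singleton,
      InfinitePlace.prod_eq_abs_norm]

/-- The class in `Pic_F^0(m)` of `((α), (|α|_v)_v)`, for a nonzero `α ∈ 𝓞_F` coprime to `m`. -/
def picCls (m : ℕ) : copInt F m →* Pic F m :=
  (QuotientGroup.mk' (((ray F m).map (prIdReal F)).subgroupOf (araDiv F m))).comp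
    (((prIdReal F).comp (copUnit m)).codRestrict (araDiv F m) (prIdReal_mem m))

lemma picCls_eq (m : ℕ) {α β : copInt F m}
    (h : Ideal.Quotient.mk (Ideal.span {(m : 𝓞 F)}) (α : 𝓞 F) = Ideal.Quotient.mk _ (β : 𝓞 F)) :
    picCls m α = picCls m β := by
  refine (QuotientGroup.eq).2 ?_
  refine ⟨(copUnit m α)⁻¹ * copUnit m β, ?_, by simp⟩
  rw [Ideal.Quotient.mk_eq_mk_iff_sub_mem, Ideal.mem_span_singleton] at h
  refine ⟨β, α, α.2.1, α.2.2, by simpa using (dvd_neg.2 h), ?_⟩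
  simp only [Units.val_mul]
  rw [mul_right_comm]
  change _ * Units.val (copUnit m α) * _ = _
  rw [Units.inv_mul, one_mul]
  rfl

lemma exists_lift (m : ℕ) (a : (𝓞 F ⧸ Ideal.span {(m : 𝓞 F)})ˣ) :
    ∃ α : copInt F m, Ideal.Quotient.mk (Ideal.span {(m : 𝓞 F)}) (α : 𝓞 F) = a := by
  obtain ⟨x, hx⟩ := Ideal.Quotient.mk_surjective (a : 𝓞 F ⧸ Ideal.span {(m : 𝓞 F)})
  have hu : IsUnit (Ideal.Quotient.mk (Ideal.span {(m : 𝓞 F)}) x) := hx ▸ a.isUnit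
  by_cases h0 : x = 0
  · subst h0
    have hs : (1 : 𝓞 F ⧸ Ideal.span {(m : 𝓞 F)}) = 0 := by
      rw [map_zero] at hu
      exact (isUnit_zero_iff.1 hu).symm
    refine ⟨1, ?_⟩
    rw [← hx]
    simp [hs]
  · exact ⟨⟨x, h0, isCoprime_iff_isUnit.2 hu⟩, hx⟩

/-- The map `(𝓞_F / m)^× → Pic_F^0(m)`, sending the residue class of `α` to the class of
`((α), (|α|_v)_v)`. -/
def resToPic (m : ℕ) : (𝓞 F ⧸ Ideal.span {(m : 𝓞 F)})ˣ →* Pic F m where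
  toFun a := picCls m (exists_lift m a).choose
  map_one' := by
    refine Eq.trans ?_ (map_one (picCls m))
    refine picCls_eq m ?_
    rw [(exists_lift m 1).choose_spec]
    simp
  map_mul' a b := by
    rw [← map_mul]
    refine picCls_eq m ?_
    rw [(exists_lift m (a * b)).choose_spec]
    simp [(exists_lift m a).choose_spec, (exists_lift m b).choose_spec]

lemma resToPic_eq (m : ℕ) (a : (𝓞 F ⧸ Ideal.span {(m : 𝓞 F)})ˣ) (α : copInt F m)
    (h : Ideal.Quotient.mk (Ideal.span {(m : 𝓞 F)}) (α : 𝓞 F) = a) :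
    resToPic m a = picCls m α :=
  picCls_eq m ((exists_lift m a).choose_spec.trans h.symm)

lemma resToPic_neg_one (m : ℕ) : resToPic (F := F) m (-1) = 1 := by
  have hm : (-1 : 𝓞 F) ∈ copInt F m := ⟨by simp, isCoprime_one_left.neg_left⟩
  rw [resToPic_eq m (-1) ⟨-1, hm⟩ (by simp)]
  refine (QuotientGroup.eq_one_iff _).2 ?_
  refine ⟨1, one_mem _, ?_⟩
  rw [map_one]
  symm
  refine Prod.ext ?_ ?_
  · apply Units.ext
    change Units.val (toPrincipalIdeal (𝓞 F) F _) =
      ((1 : (FractionalIdeal (𝓞 F)⁰ F)ˣ) : FractionalIdeal (𝓞 F)⁰ F)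
    rw [coe_toPrincipalIdeal]
    have : ((copUnit m ⟨-1, hm⟩ : Fˣ) : F) = algebraMap (𝓞 F) F (-1) := by simp [copUnit]
    rw [this, Units.val_one, ← FractionalIdeal.coeIdeal_span_singleton, Ideal.span_singleton_neg]
    simp
  · funext v
    apply Units.ext
    change v (((copUnit m ⟨-1, hm⟩ : Fˣ)) : F) = 1
    have : ((copUnit m ⟨-1, hm⟩ : Fˣ) : F) = -1 := by simp [copUnit]
    rw [this]
    have h1 : v (-1) * v (-1) = 1 := by rw [← map_mul]; simp
    have h2 : 0 ≤ v (-1) := apply_nonneg v _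
    nlinarith

lemma gPic_resToPic (g : F ≃ₐ[ℚ] F) (m : ℕ) (a b : (𝓞 F ⧸ Ideal.span {(m : 𝓞 F)})ˣ)
    (h : ∀ α : 𝓞 F, Ideal.Quotient.mk (Ideal.span {(m : 𝓞 F)}) α = a →
      Ideal.Quotient.mk (Ideal.span {(m : 𝓞 F)}) (gInt g α) = b) :
    gPic g m (resToPic m a) = resToPic m b := by
  obtain ⟨α, hα⟩ := exists_lift m a
  have hm : gInt g (α : 𝓞 F) ∈ copInt F m :=
    ⟨by simpa using α.2.1, by
      simpa using α.2.2.map ((gInt g : 𝓞 F ≃+* 𝓞 F) : 𝓞 F →+* 𝓞 F)⟩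
  rw [resToPic_eq m a α hα, resToPic_eq m b ⟨_, hm⟩ (h α hα)]
  refine congrArg
    (QuotientGroup.mk' (((ray F m).map (prIdReal F)).subgroupOf (araDiv F m))) (Subtype.ext ?_)
  change gIdReal g (prIdReal F (copUnit m α)) = prIdReal F (copUnit m ⟨_, hm⟩)
  rw [gIdReal_prIdReal]
  exact congrArg _ (Units.ext rfl)

end Arakelov

/-! ### The finite ring `R` and its unit group -/

section UnitGroup

/-- `U_R = R^× / {±1}`. -/
abbrev UR (R : Type) [CommRing R] : Type := Rˣ ⧸ Subgroup.zpowers (-1 : Rˣ)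

/-- The map `U_R → U_R'` induced by a ring homomorphism. -/
def urMap {R R' : Type} [CommRing R] [CommRing R'] (f : R →+* R') : UR R →* UR R' :=
  QuotientGroup.map _ _ (Units.map (f : R →* R')) (by
    rw [Subgroup.zpowers_le]
    refine Subgroup.mem_zpowers_iff.2 ⟨1, ?_⟩
    apply Units.ext
    simp)

/-- `U_R(S^∞)`. -/
abbrev US (S : Finset ℕ) (R : Type) [CommRing R] : Type := sTorsion S (UR R)

/-- The map `U_R(S^∞) → U_R'(S^∞)` induced by a ring homomorphism. -/
def usMap (S : Finset ℕ) {R R' : Type} [CommRing R] [CommRing R'] (f : R →+* R') :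
    US S R →* US S R' := sTorsionMap S (urMap f)

lemma usMap_id (S : Finset ℕ) {R : Type} [CommRing R] (u : US S R) :
    usMap S (RingHom.id R) u = u := by
  obtain ⟨⟨u⟩, hu⟩ := u
  exact Subtype.ext (congrArg QuotientGroup.mk (Units.ext rfl))

lemma usMap_comp (S : Finset ℕ) {R : Type} [CommRing R] (f f' : R →+* R) (u : US S R) :
    usMap S (f'.comp f) u = usMap S f' (usMap S f u) := by
  obtain ⟨⟨u⟩, hu⟩ := u
  exact Subtype.ext (congrArg QuotientGroup.mk (Units.ext rfl))

/-- The quotient `ℤ_S[C₂]/(g+1) ⊗ U_R` of `U_R`, i.e. the quotient of the finite group `U_R` by its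
prime-to-`S` part and by all `x · g(x)`; the generator `g` of `C₂` acts as `σ`. -/
abbrev MinusQuot (S : Finset ℕ) (R : Type) [CommRing R] (σ : R ≃+* R) : Type :=
  UR R ⧸ (primeToS S (UR R) ⊔
    Subgroup.closure (Set.range fun x : UR R => x * urMap (σ : R →+* R) x))

end UnitGroup

/-! ### Étale algebras at the primes dividing `m` -/

instance primeFactorFact {m : ℕ} (p : m.primeFactors) : Fact (p : ℕ).Prime :=
  ⟨Nat.prime_of_mem_primeFactors p.2⟩

/-- A choice, for every prime `p ∣ m`, of an étale `ℚ_p`-algebra `A_p` of degree `2`, together with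
its (unique) non-trivial automorphism. -/
structure LocalData (m : ℕ) where
  A : m.primeFactors → Type
  [ring : ∀ p : m.primeFactors, CommRing (A p)]
  [alg : ∀ p : m.primeFactors, Algebra ℚ_[(p : ℕ)] (A p)]
  [etale : ∀ p : m.primeFactors, Algebra.Etale ℚ_[(p : ℕ)] (A p)]
  finrank_eq : ∀ p : m.primeFactors, Module.finrank ℚ_[(p : ℕ)] (A p) = 2
  τ : ∀ p : m.primeFactors, A p ≃ₐ[ℚ_[(p : ℕ)]] A p
  τ_ne : ∀ p : m.primeFactors, τ p ≠ AlgEquiv.refl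

attribute [instance] LocalData.ring LocalData.alg LocalData.etale

namespace LocalData

variable {m : ℕ} (D : LocalData m)

instance algInt (p : m.primeFactors) : Algebra ℤ_[(p : ℕ)] (D.A p) :=
  ((algebraMap ℚ_[(p : ℕ)] (D.A p)).comp (algebraMap ℤ_[(p : ℕ)] ℚ_[(p : ℕ)])).toAlgebra

instance (p : m.primeFactors) : IsScalarTower ℤ_[(p : ℕ)] ℚ_[(p : ℕ)] (D.A p) :=
  IsScalarTower.of_algebraMap_eq fun _ => rfl

/-- The integral closure `𝓞_A` of `∏ ℤ_p` in `∏ A_p`. -/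
abbrev OA : Type := ∀ p : m.primeFactors, integralClosure ℤ_[(p : ℕ)] (D.A p)

/-- The action of the generator of `C₂` on `𝓞_A`. -/
def τO : D.OA ≃+* D.OA :=
  RingEquiv.piCongrRight fun p : m.primeFactors =>
    (AlgEquiv.mapIntegralClosure ((D.τ p).restrictScalars ℤ_[(p : ℕ)])).toRingEquiv

/-- The ring `R = 𝓞_A / m`. -/
abbrev R : Type := D.OA ⧸ Ideal.span {(m : D.OA)}

/-- The action of the generator of `C₂` on `R`. -/
def σ : D.R ≃+* D.R :=
  Ideal.quotientEquiv _ _ D.τO (by simp [Ideal.map_span])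

end LocalData

/-! ### Extensions by `U_R(S^∞)` and the probability measures -/

/-- The two signs: `minus` for imaginary and `plus` for real quadratic fields. -/
inductive QSign
  | minus
  | plus

/-- Membership in `𝒢_cpt^±` (locally at `S`), where the generator of `C₂` acts by inversion:
finite abelian `S`-groups for the sign `-`; for the sign `+` compact abelian groups whose identity
component is isomorphic to `ℝ/ℤ` and whose group of components is a finite `S`-group. -/
def IsCptGroup (S : Finset ℕ) (s : QSign) (C : Type) [CommGroup C] [TopologicalSpace C]
    [IsTopologicalGroup C] : Prop :=
  CompactSpace C ∧ T2Space C ∧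
  match s with
  | .minus => Finite C ∧ IsSGroup S C
  | .plus => Nonempty (Subgroup.connectedComponentOfOne C ≃ₜ* Circle) ∧
      Finite (C ⧸ Subgroup.connectedComponentOfOne C) ∧
      IsSGroup S (C ⧸ Subgroup.connectedComponentOfOne C)

/-- The data `U_R(S^∞) → B` underlying a sequence `Θ : 0 → U_R(S^∞) → B → C → 0` of topological
`C₂`-modules; `C` is the cokernel of `i`, and `g` is the action of the generator of `C₂` on `B`.
The requirements on the data are stated in `ThetaSeq.IsExt`. -/
structure ThetaSeq (S : Finset ℕ) (R : Type) [CommRing R] where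
  B : Type
  [grp : CommGroup B]
  [top : TopologicalSpace B]
  [tgrp : IsTopologicalGroup B]
  g : B →* B
  g_cont : Continuous g
  i : US S R →* B

attribute [instance] ThetaSeq.grp ThetaSeq.top ThetaSeq.tgrp

namespace ThetaSeq

variable {S : Finset ℕ} {R : Type} [CommRing R]

/-- The right hand term of the sequence. -/
abbrev C (Θ : ThetaSeq S R) : Type := Θ.B ⧸ Θ.i.range

/-- `Θ` is a short exact sequence of `C₂`-modules, with `C₂` acting on `U_R(S^∞)` through `σ`
and with the generator of `C₂` acting on `C` by inversion. -/
def IsExt (σ : R ≃+* R) (Θ : ThetaSeq S R) : Prop :=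
  (∀ b, Θ.g (Θ.g b) = b) ∧ (∀ u, Θ.g (Θ.i u) = Θ.i (usMap S (σ : R →+* R) u)) ∧
  Function.Injective Θ.i ∧ ∀ b, b * Θ.g b ∈ Θ.i.range

/-- Sequences with `C ∈ 𝒢_cpt^±`. -/
def IsCpt (σ : R ≃+* R) (s : QSign) (Θ : ThetaSeq S R) : Prop :=
  Θ.IsExt σ ∧ CompactSpace Θ.B ∧ T2Space Θ.B ∧ IsCptGroup S s Θ.C

/-- Sequences with `C ∈ 𝒢_S^±`, i.e. with `C` isomorphic to the `S^∞`-torsion of an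
element of `𝒢_cpt^±`, and discrete topology. -/
def IsDisc (σ : R ≃+* R) (s : QSign) (Θ : ThetaSeq S R) : Prop :=
  Θ.IsExt σ ∧ DiscreteTopology Θ.B ∧
  ∃ (C' : Type) (_ : CommGroup C') (_ : TopologicalSpace C') (_ : IsTopologicalGroup C'),
    IsCptGroup S s C' ∧ Nonempty (Θ.C ≃* sTorsion S C')

/-- The condition on an isomorphism `f : B → B'` of topological groups to be an isomorphism of
sequences: it is `C₂`-equivariant, and is on `U_R(S^∞)` induced by a ring automorphism of `R`. -/
def IsIso (Θ Θ' : ThetaSeq S R) (f : Θ.B ≃ₜ* Θ'.B) : Prop :=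
  (∀ b, f (Θ.g b) = Θ'.g (f b)) ∧
  ∃ ρ : R ≃+* R, ∀ u, f (Θ.i u) = Θ'.i (usMap S (ρ : R →+* R) u)

/-- Isomorphism of sequences. -/
instance setoid (S : Finset ℕ) (R : Type) [CommRing R] : Setoid (ThetaSeq S R) where
  r Θ Θ' := ∃ f, IsIso Θ Θ' f
  iseqv := by
    refine ⟨fun Θ => ⟨ContinuousMulEquiv.refl _, fun _ => rfl, RingEquiv.refl R, fun u => ?_⟩, ?_, ?_⟩
    · exact congrArg Θ.i (usMap_id S u).symm
    · rintro Θ Θ' ⟨f, h1, ρ, h2⟩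
      refine ⟨f.symm, fun b => ?_, ρ.symm, fun u => ?_⟩
      · apply f.injective
        rw [h1]
        simp
      · apply f.injective
        rw [h2, ← usMap_comp]
        have : ((ρ : R →+* R).comp (ρ.symm : R →+* R)) = RingHom.id R := by ext; simp
        rw [this, usMap_id]
        simp
    · rintro Θ Θ' Θ'' ⟨f, h1, ρ, h2⟩ ⟨f', h1', ρ', h2'⟩
      refine ⟨f.trans f', fun b => ?_, ρ.trans ρ', fun u => ?_⟩
      · change f' (f (Θ.g b)) = Θ''.g (f' (f b))
        rw [h1, h1']
      · change f' (f (Θ.i u)) = _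
        rw [h2, h2', ← usMap_comp]
        rfl

/-- `#Aut_ring(Θ)`. -/
def autCard (Θ : ThetaSeq S R) : ℕ := Nat.card {f : Θ.B ≃ₜ* Θ.B // IsIso Θ Θ f}

/-- The `S^∞`-torsion `Θ(S^∞)` of a sequence, with the discrete topology. -/
def tors (Θ : ThetaSeq S R) : ThetaSeq S R :=
  letI : TopologicalSpace (sTorsion S Θ.B) := ⊥
  haveI : DiscreteTopology (sTorsion S Θ.B) := ⟨rfl⟩
  { B := sTorsion S Θ.B
    top := ⊥
    tgrp := inferInstance
    g := sTorsionMap S Θ.g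
    g_cont := continuous_of_discreteTopology
    i := Θ.i.codRestrict (sTorsion S Θ.B) (by
      rintro ⟨u, n, hn, hu⟩
      refine ⟨n, hn, ?_⟩
      rw [← map_pow]
      have : (⟨u, n, hn, hu⟩ : US S R) ^ n = 1 := Subtype.ext hu
      rw [this, map_one]) }

/-- The subgroup of all elements whose image in the group of components is `S^∞`-torsion. -/
def compSub (S : Finset ℕ) (B : Type) [CommGroup B] [TopologicalSpace B] [IsTopologicalGroup B] :
    Subgroup B :=
  (sTorsion S (B ⧸ Subgroup.connectedComponentOfOne B)).comap (QuotientGroup.mk' _)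

/-- The subsequence of `Θ` whose middle term consists of the components of `B` that
are `S^∞`-torsion in the group of components. -/
def compPart (Θ : ThetaSeq S R) : ThetaSeq S R where
  B := compSub S Θ.B
  g := (Θ.g.comp (compSub S Θ.B).subtype).codRestrict (compSub S Θ.B) (by
    rintro ⟨b, n, hn, hb⟩
    refine ⟨n, hn, ?_⟩
    change ((Θ.g b ^ n : Θ.B) : Θ.B ⧸ Subgroup.connectedComponentOfOne Θ.B) = 1
    change ((b ^ n : Θ.B) : Θ.B ⧸ Subgroup.connectedComponentOfOne Θ.B) = 1 at hb
    rw [QuotientGroup.eq_one_iff] at hb ⊢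
    rw [← map_pow]
    have := Θ.g_cont.image_connectedComponent_subset 1 ⟨_, hb, rfl⟩
    rwa [map_one] at this)
  g_cont := (Θ.g_cont.comp continuous_subtype_val).subtype_mk _
  i := Θ.i.codRestrict (compSub S Θ.B) (by
    rintro ⟨u, n, hn, hu⟩
    refine ⟨n, hn, ?_⟩
    rw [← map_pow, ← map_pow]
    have : (⟨u, n, hn, hu⟩ : US S R) ^ n = 1 := Subtype.ext hu
    rw [this, map_one, map_one])

/-- `u` is the value of `φ(Θ)` at a generator of `Λ = ker (ℝ → C₀)`, where `ℝ → C₀` is a universal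
covering of the identity component of `C`: the covering lifts to a continuous homomorphism
`γ : ℝ → B`, and `u = γ(1)`. -/
def IsUnitValue (Θ : ThetaSeq S R) (u : US S R) : Prop :=
  ∃ γ : Multiplicative ℝ →* Θ.B, Continuous γ ∧
    (∀ t : ℝ, γ (Multiplicative.ofAdd t) ∈ Θ.i.range ↔ ∃ n : ℤ, t = n) ∧
    γ (Multiplicative.ofAdd 1) = Θ.i u

end ThetaSeq

/-- Isomorphism classes of sequences. -/
abbrev ThetaCls (S : Finset ℕ) (R : Type) [CommRing R] : Type 1 :=
  Quotient (ThetaSeq.setoid S R)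

section Prob

variable {S : Finset ℕ} {R : Type} [CommRing R] (σ : R ≃+* R) (s : QSign)

/-- `𝒢_{R,cpt}^±`. -/
def GCpt (S : Finset ℕ) {R : Type} [CommRing R] (σ : R ≃+* R) (s : QSign) : Type 1 :=
  {c : ThetaCls S R // c.out.IsCpt σ s}

/-- `𝒢_{R,S}^±`. -/
def GDisc (S : Finset ℕ) {R : Type} [CommRing R] (σ : R ≃+* R) (s : QSign) : Type 1 :=
  {c : ThetaCls S R // c.out.IsDisc σ s}

/-- The class of `Θ(S^∞)`. -/
def torsCls (c : ThetaCls S R) : ThetaCls S R := ⟦c.out.tors⟧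

/-- The probability measure `ℙ_cpt^±` on `𝒢_{R,cpt}^±`. -/
def probCpt (c : GCpt S σ s) : ℝ :=
  (∑' d : GCpt S σ s, ((d.1.out.autCard : ℝ))⁻¹)⁻¹ * ((c.1.out.autCard : ℝ))⁻¹

open Classical in
/-- The probability measure `ℙ^±` on `𝒢_{R,S}^±`, the pushforward of `ℙ_cpt^±`. -/
def probDisc (c : GDisc S σ s) : ℝ :=
  ∑' d : GCpt S σ s, if torsCls d.1 = c.1 then probCpt σ s d else 0

/-- The expected value of `f` with respect to `ℙ_cpt^±`. -/
def expCpt (f : ThetaCls S R → ℂ) : ℂ := ∑' c : GCpt S σ s, (probCpt σ s c : ℂ) * f c.1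

/-- The expected value `𝔼^±(f)` of `f` with respect to `ℙ^±`. -/
def expDisc (f : ThetaCls S R → ℂ) : ℂ := ∑' c : GDisc S σ s, (probDisc σ s c : ℂ) * f c.1

/-- The `ℙ_cpt^±`-probability of `T`. -/
def measCpt (T : Set (ThetaCls S R)) : ℝ :=
  ∑' c : GCpt S σ s, T.indicator (fun _ => probCpt σ s c) c.1

/-- The `ℙ^±`-probability of `T`. -/
def measDisc (T : Set (ThetaCls S R)) : ℝ :=
  ∑' c : GDisc S σ s, T.indicator (fun _ => probDisc σ s c) c.1

end Prob

/-! ### Quadratic fields and their sequences -/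

/-- A quadratic number field (as a subfield of `ℂ`, so that every isomorphism class
occurs exactly once), together with its (unique) non-trivial automorphism. -/
structure QuadField where
  K : IntermediateField ℚ ℂ
  finrank_eq : Module.finrank ℚ K = 2
  g : K ≃ₐ[ℚ] K
  g_ne : g ≠ AlgEquiv.refl

namespace QuadField

instance (F : QuadField) : NumberField F.K where
  to_finiteDimensional := Module.finite_of_finrank_pos (by rw [F.finrank_eq]; norm_num)

/-- `F` is imaginary (sign `-`) or real (sign `+`). -/
def HasSign (F : QuadField) : QSign → Prop
  | .minus => IsTotallyComplex F.K
  | .plus => IsTotallyReal F.K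

/-- The conductor of a quadratic field, which is the absolute value of its discriminant. -/
def conductor (F : QuadField) : ℕ := (discr F.K).natAbs

/-- `F` is `ℚ(√-1)` or `ℚ(√-3)`. -/
def Exceptional (F : QuadField) : Prop := ∃ z : F.K, z ^ 2 + 1 = 0 ∨ z ^ 2 + z + 1 = 0

/-- The `S^∞`-torsion of the class group of `F`. -/
abbrev ClS (F : QuadField) (S : Finset ℕ) : Type := sTorsion S (ClassGroup (𝓞 F.K))

/-- `ε` is a fundamental unit of the real quadratic field `F`. -/
def IsFundUnit (F : QuadField) (ε : (𝓞 F.K)ˣ) : Prop :=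
  ∀ v : (𝓞 F.K)ˣ, ∃ n : ℤ, v = ε ^ n ∨ v = -ε ^ n

end QuadField

/-- A pair `(F, r)`, where `F` is an imaginary (`-`) or real (`+`) quadratic field and
`r : R → 𝓞_F / m` is a `C₂`-equivariant ring isomorphism. -/
structure FieldPair (s : QSign) (m : ℕ) (R : Type) [CommRing R] (σ : R ≃+* R) where
  F : QuadField
  r : R ≃+* 𝓞 F.K ⧸ Ideal.span {(m : 𝓞 F.K)}
  hasSign : F.HasSign s
  equivariant : ∀ (x : R) (α : 𝓞 F.K), Ideal.Quotient.mk (Ideal.span {(m : 𝓞 F.K)}) α = r x →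
    Ideal.Quotient.mk (Ideal.span {(m : 𝓞 F.K)}) (gInt F.g α) = r (σ x)

/-- The set `ℱ_X^±(R)`. -/
abbrev Fam (s : QSign) (m : ℕ) (R : Type) [CommRing R] (σ : R ≃+* R) (X : ℝ) : Type :=
  {q : FieldPair s m R σ // (q.F.conductor : ℝ) < X}

namespace FieldPair

variable {s : QSign} {m : ℕ} {R : Type} [CommRing R] {σ : R ≃+* R} (q : FieldPair s m R σ)

/-- The map `U_R → Pic_F^0(m)` obtained from `r` and `(𝓞_F/m)^× → Pic_F^0(m)`. -/
def toPic : UR R →* Pic q.F.K m :=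
  QuotientGroup.lift _ ((resToPic m).comp (Units.map (q.r : R →* _))) (by
    have h : Subgroup.zpowers (-1 : Rˣ) ≤
        ((resToPic (F := q.F.K) m).comp (Units.map (q.r : R →* _))).ker := by
      rw [Subgroup.zpowers_le, MonoidHom.mem_ker]
      have : Units.map (q.r : R →* 𝓞 q.F.K ⧸ Ideal.span {(m : 𝓞 q.F.K)}) (-1 : Rˣ) = -1 := by
        apply Units.ext
        simp
      rw [MonoidHom.comp_apply, this, resToPic_neg_one]
    exact fun x hx => h hx)

lemma gPic_toPic (x : UR R) : gPic q.F.g m (q.toPic x) = q.toPic (urMap (σ : R →+* R) x) := by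
  obtain ⟨x⟩ := x
  exact gPic_resToPic q.F.g m _ _ (q.equivariant x)

/-- The Arakelov ray class sequence restricted to `U_R(S^∞)`. -/
def araSeq (S : Finset ℕ) : ThetaSeq S R where
  B := Pic q.F.K m
  g := gPic q.F.g m
  g_cont := gPic_continuous q.F.g m
  i := q.toPic.comp (sTorsion S (UR R)).subtype

/-- The class of the `S^∞`-torsion `𝒮_F^Ara(m)(S^∞)` of the Arakelov ray class sequence. -/
def araTorsCls (S : Finset ℕ) : ThetaCls S R := ⟦(q.araSeq S).tors⟧

/-- The quotient of the Arakelov ray class sequence by the prime-to-`S` part of `U_R`. -/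
def araQuot (S : Finset ℕ) : ThetaSeq S R where
  B := Pic q.F.K m ⧸ (primeToS S (UR R)).map q.toPic
  g := QuotientGroup.map _ _ (gPic q.F.g m) (by
    rintro _ ⟨x, ⟨n, hn, hn', hx⟩, rfl⟩
    refine ⟨urMap (σ : R →+* R) x, ⟨n, hn, hn', ?_⟩, (q.gPic_toPic x).symm⟩
    rw [← map_pow, hx, map_one])
  g_cont := (QuotientGroup.continuous_mk.comp (gPic_continuous q.F.g m)).quotient_lift _
  i := (QuotientGroup.mk' _).comp (q.toPic.comp (sTorsion S (UR R)).subtype)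

/-- The class of the `S`-part of the Arakelov ray class sequence in the category of compact groups:
the left hand term is replaced by `U_R(S^∞)`, and `Pic_F^0` by the preimage of
`Cl_F(S^∞)` in it. -/
def araCptCls (S : Finset ℕ) : ThetaCls S R := ⟦(q.araQuot S).compPart⟧

/-- The image of a unit of `𝓞_F` in `ℤ_S[C₂]/(g+1) ⊗ U_R`. -/
def unitImage (S : Finset ℕ) (ε : (𝓞 q.F.K)ˣ) : MinusQuot S R σ :=
  QuotientGroup.mk (QuotientGroup.mk (Units.map (q.r.symm : _ →* R)
    (Units.map (Ideal.Quotient.mk (Ideal.span {(m : 𝓞 q.F.K)})).toMonoidHom ε)) : UR R)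

end FieldPair

/-! ### Yoneda extension groups -/

/-- The data `U_R(S^∞) → X → E` underlying an exact sequence `U_R(S^∞) → X → E → 0`; the
map `g` is the action of the generator of `C₂` on `X`. -/
structure ExtData (S : Finset ℕ) (R : Type) [CommRing R] (E : Type) [CommGroup E] where
  X : Type
  [grp : CommGroup X]
  g : X →* X
  i : US S R →* X
  p : X →* E

attribute [instance] ExtData.grp

namespace ExtData

variable {S : Finset ℕ} {R : Type} [CommRing R] {E : Type} [CommGroup E]

/-- `U_R(S^∞) → X → E → 0` is exact with kernel `V` on the left, i.e. `0 → U_R(S^∞)/V → X → E → 0`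
is a short exact sequence, and it is a sequence of `C₂`-modules, where the generator of `C₂` acts
on `E` by inversion. -/
def IsExt (σ : R ≃+* R) (V : Subgroup (US S R)) (Y : ExtData S R E) : Prop :=
  (∀ x, Y.g (Y.g x) = x) ∧ (∀ u, Y.g (Y.i u) = Y.i (usMap S (σ : R →+* R) u)) ∧
  (∀ x, Y.p (Y.g x) = (Y.p x)⁻¹) ∧
  Y.i.ker = V ∧ Y.p.ker = Y.i.range ∧ Function.Surjective Y.p

/-- Equivalence of extensions. -/
instance setoid (S : Finset ℕ) (R : Type) [CommRing R] (E : Type) [CommGroup E] :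
    Setoid (ExtData S R E) where
  r Y Y' := ∃ f : Y.X ≃* Y'.X, (∀ x, f (Y.g x) = Y'.g (f x)) ∧ (∀ u, f (Y.i u) = Y'.i u) ∧
    ∀ x, Y'.p (f x) = Y.p x
  iseqv := by
    refine ⟨fun Y => ⟨MulEquiv.refl _, fun _ => rfl, fun _ => rfl, fun _ => rfl⟩, ?_, ?_⟩
    · rintro Y Y' ⟨f, h1, h2, h3⟩
      refine ⟨f.symm, fun x => ?_, fun u => ?_, fun x => ?_⟩
      · apply f.injective
        rw [h1]
        simp
      · apply f.injective
        rw [h2]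
        simp
      · rw [← h3]
        simp
    · rintro Y Y' Y'' ⟨f, h1, h2, h3⟩ ⟨f', h1', h2', h3'⟩
      refine ⟨f.trans f', fun x => ?_, fun u => ?_, fun x => ?_⟩
      · simp [h1, h1']
      · simp [h2, h2']
      · simp [h3, h3']

end ExtData

/-- Equivalence classes of exact sequences `U_R(S^∞) → X → E → 0`. -/
abbrev ExtCls (S : Finset ℕ) (R : Type) [CommRing R] (E : Type) [CommGroup E] : Type 1 :=
  Quotient (ExtData.setoid S R E)

section Ext

variable {S : Finset ℕ} {R : Type} [CommRing R] {E : Type} [CommGroup E]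

/-- The Yoneda group `Ext¹_{ℤ_S[C₂]}(E, U_R(S^∞)/V)`, as a set; the generator of `C₂` acts on `E` by
inversion. -/
def extSet (E : Type) [CommGroup E] (σ : R ≃+* R) (V : Subgroup (US S R)) :
    Set (ExtCls S R E) := {ε | ε.out.IsExt σ V}

/-- Two classes lie in the same orbit under `Aut_ring(U_R(S^∞)) × Aut(E)`. -/
def SameOrbit (ε ε' : ExtCls S R E) : Prop :=
  ∃ (f : ε.out.X ≃* ε'.out.X) (ρ : R ≃+* R) (β : E ≃* E),
    (∀ x, f (ε.out.g x) = ε'.out.g (f x)) ∧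
    (∀ u, f (ε.out.i u) = ε'.out.i (usMap S (ρ : R →+* R) u)) ∧
    ∀ x, ε'.out.p (f x) = β (ε.out.p x)

/-- The `(-1)`-part of `U_R(S^∞)`. -/
def UMinus (S : Finset ℕ) (σ : R ≃+* R) : Set (US S R) := {u | usMap S (σ : R →+* R) u = u⁻¹}

/-- The orbit of `u` in `UMinus` under `Aut_ring(U_R(S^∞))`, the group of those `C₂`-module
automorphisms of `U_R(S^∞)` that are induced by ring automorphisms of `R`. -/
def uOrbit (σ : R ≃+* R) (u : US S R) : Set (US S R) :=
  {u' | ∃ ρ : R ≃+* R, (∀ w : US S R, usMap S (ρ : R →+* R) (usMap S (σ : R →+* R) w) =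
    usMap S (σ : R →+* R) (usMap S (ρ : R →+* R) w)) ∧ u' = usMap S (ρ : R →+* R) u}

/-- `Y` is the extension `0 → U_R(S^∞)/im φ(Θ) → π⁰(B) → π⁰(C) → 0` attached to `Θ`, for some
identification of `π⁰(C)` with `E`. Here `π⁰` is the quotient by the maximal divisible
subgroup. -/
def Realizes (Θ : ThetaSeq S R) (Y : ExtData S R E) : Prop :=
  ∃ q : Θ.B →* Y.X, Function.Surjective q ∧ q.ker = divSub Θ.B ∧
    (∀ b, q (Θ.g b) = Y.g (q b)) ∧ (∀ u, q (Θ.i u) = Y.i u) ∧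
    Function.Surjective Y.p ∧
    (Y.p.comp q).ker = (divSub Θ.C).comap (QuotientGroup.mk' Θ.i.range)

end Ext

/-! ### The functions on isomorphism classes of sequences -/

section Functions

variable {S : Finset ℕ} {R : Type} [CommRing R]

/-- The classes of sequences with `π⁰(C) ≅ E`. -/
def compEvent (S : Finset ℕ) (R : Type) [CommRing R] (E : Type) [CommGroup E] :
    Set (ThetaCls S R) :=
  {c | Nonempty ((c.out.C ⧸ divSub c.out.C) ≃* E)}

/-- The classes of sequences that are mapped to the orbit of `u` by `Θ ↦ φ(Θ)(λ)`, with `λ` a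
generator of `Λ_C`. -/
def unitEvent (u : US S R) : Set (ThetaCls S R) :=
  {c | ∃ Θ : ThetaSeq S R, ⟦Θ⟧ = c ∧ Θ.IsUnitValue u}

/-- The classes of sequences such that `π⁰(C) ≅ E` and `Θ ↦ (φ(Θ), π⁰(Θ))` takes a value in the
orbit of `ε`. -/
def extEvent {E : Type} [CommGroup E] (ε : ExtCls S R E) : Set (ThetaCls S R) :=
  {c | ∃ (Θ : ThetaSeq S R) (Y : ExtData S R E), ⟦Θ⟧ = c ∧ ⟦Y⟧ = ε ∧ Realizes Θ Y}

/-- The indicator function of `T`. -/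
def ind (T : Set (ThetaCls S R)) : ThetaCls S R → ℂ := T.indicator fun _ => 1

end Functions

/-! ### The heuristic -/

section Heuristic

variable (S : Finset ℕ) (s : QSign) (m : ℕ) {R : Type} [CommRing R] (σ : R ≃+* R)

open Classical in
/-- The main heuristic for a function `f` on `𝒢_{R,S}^±`: the average of `f(𝒮_F^Ara(m)(S^∞))` over
`ℱ_X^±(R)` (without `ℚ(√-1)` and `ℚ(√-3)` in the sum) tends to `𝔼^±(f)`. -/
def HeuristicHolds (f : ThetaCls S R → ℂ) : Prop :=
  Tendsto (fun X : ℝ =>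
    (∑ᶠ q : Fam s m R σ X, if q.1.F.Exceptional then 0 else f (q.1.araTorsCls S)) /
      (Nat.card (Fam s m R σ X) : ℂ)) atTop (𝓝 (expDisc σ s f))

/-- The main heuristic for real quadratic fields and a function `f` on `𝒢_{R,cpt}^+`. -/
def HeuristicHoldsCpt (f : ThetaCls S R → ℂ) : Prop :=
  Tendsto (fun X : ℝ =>
    (∑ᶠ q : Fam .plus m R σ X, f (q.1.araCptCls S)) / (Nat.card (Fam .plus m R σ X) : ℂ))
    atTop (𝓝 (expCpt σ .plus f))

/-- The proportion of those elements of `ℱ_X^±(R)` that satisfy `P` tends to `a`. -/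
def Proportion (P : FieldPair s m R σ → Prop) (a : ℝ) : Prop :=
  Tendsto (fun X : ℝ => (Nat.card {q : Fam s m R σ X // P q.1} : ℝ) / Nat.card (Fam s m R σ X))
    atTop (𝓝 a)

end Heuristic

/-! ### Ray class group sequences -/

/-- The class of the exact sequence
`U_R(S^∞) → Cl_F(m)(S^∞) → Cl_F(S^∞) ≅ E → 0` obtained from `𝒮_F^fin(m)(S^∞)`, from
`r`, and from an isomorphism `ι`. -/
def FieldPair.finCls {s : QSign} {m : ℕ} {R : Type} [CommRing R] {σ : R ≃+* R}
    (q : FieldPair s m R σ) {S : Finset ℕ} {E : Type} [CommGroup E] (ι : q.F.ClS S ≃* E) :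
    ExtCls S R E :=
  ⟦{ X := sTorsion S (RayCl q.F.K m)
     g := sTorsionMap S (gRayCl q.F.g m)
     i := sTorsionMap S ((picToRayCl q.F.K m).comp q.toPic)
     p := (ι : q.F.ClS S →* E).comp (sTorsionMap S (rayClToCl q.F.K m)) }⟧

/-- The kernel of the map `U_R(S^∞) → Cl_F(m)`, so that `(𝓞_F/m)^× / (𝓞_F^×)_{mod m}` has
`S^∞`-torsion identified by `r` with the quotient of `U_R(S^∞)` by this kernel. -/
def FieldPair.unitKer {s : QSign} {m : ℕ} {R : Type} [CommRing R] {σ : R ≃+* R}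
    (q : FieldPair s m R σ) (S : Finset ℕ) : Subgroup (US S R) :=
  (sTorsionMap S ((picToRayCl q.F.K m).comp q.toPic)).ker

/-- The set of triples `(F, r, ι)` where `(F, r) ∈ ℱ_X^±(R)`, `ι` is an isomorphism
`Cl_F(S^∞) → E`, and the kernel of `U_R(S^∞) → Cl_F(m)` satisfies `P`. -/
abbrev Triples (S : Finset ℕ) (s : QSign) (m : ℕ) {R : Type} [CommRing R] (σ : R ≃+* R)
    (E : Type) [CommGroup E] (P : Subgroup (US S R) → Prop) (X : ℝ) : Type :=
  Σ q : {q : Fam s m R σ X // P (q.1.unitKer S)}, (q.1.1.F.ClS S ≃* E)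

/-- The class of `𝒮_F^fin(m)(S^∞)`, for `(F, r, ι)` in `Triples`, is equidistributed in `T`. -/
def Equidistributed (S : Finset ℕ) (s : QSign) (m : ℕ) {R : Type} [CommRing R] (σ : R ≃+* R)
    (E : Type) [CommGroup E] (P : Subgroup (US S R) → Prop) (T : Set (ExtCls S R E)) : Prop :=
  ∀ ε ∈ T, Tendsto (fun X : ℝ =>
    (Nat.card {t : Triples S s m σ E P X // t.1.1.1.finCls t.2 = ε} : ℝ) /
      Nat.card (Triples S s m σ E P X)) atTop (𝓝 (1 / (T.ncard : ℝ)))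

/-! ### The Cohen–Lenstra measures -/

/-- `c^-` and `2c^+`: the product of `(1 - p^{-k})⁻¹` over `p ∈ S` and all `k ≥ 1` (sign `-`),
respectively all `k ≥ 2` (sign `+`). -/
def clConst (S : Finset ℕ) : QSign → ℝ
  | .minus => ∏ p ∈ S, ∏' k : ℕ, (1 - ((p : ℝ) ^ (k + 1))⁻¹)⁻¹
  | .plus => ∏ p ∈ S, ∏' k : ℕ, (1 - ((p : ℝ) ^ (k + 2))⁻¹)⁻¹

/-- The Cohen–Lenstra measure `μ_CL^±` of the isomorphism class of `E`. -/
def clMeasure (S : Finset ℕ) (E : Type) [CommGroup E] : QSign → ℝ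
  | .minus => (clConst S .minus)⁻¹ / (Nat.card (E ≃* E) : ℝ)
  | .plus => (clConst S .plus)⁻¹ / ((Nat.card (E ≃* E) : ℝ) * (Nat.card E : ℝ))

end RayClass

end

open RayClass

noncomputable section

namespace RayClass

open Multiplicative (ofAdd toAdd)
open Subgroup (zpowers)
open QuotientGroup (mk' eq_one_iff mk_surjective continuous_mk quotientKerEquivOfSurjective)

/-! ### `S`-numbers and `S`-torsion -/

lemma IsSNumber.coprime {S : Finset ℕ} {n k : ℕ} (hn : IsSNumber S n)
    (hk : ∀ p ∈ S, k.Coprime p) : n.Coprime k := by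
  refine Nat.coprime_of_dvd fun p hp hpn hpk => ?_
  have := hk p (hn.2 p hp hpn)
  exact hp.one_lt.ne' (Nat.eq_one_of_dvd_coprimes this hpk dvd_rfl)

lemma IsSNumber.of_dvd {S : Finset ℕ} {n k : ℕ} (hn : IsSNumber S n) (h : k ∣ n) :
    IsSNumber S k :=
  ⟨ne_zero_of_dvd_ne_zero hn.1 h, fun p hp hpk => hn.2 p hp (hpk.trans h)⟩

lemma exists_isSNumber_mul {S : Finset ℕ} (hS : ∀ p ∈ S, p.Prime) (n : ℕ) (hn : n ≠ 0) :
    ∃ a b, IsSNumber S a ∧ b ≠ 0 ∧ (∀ p ∈ S, b.Coprime p) ∧ n = a * b := by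
  induction n using Nat.recOnMul with
  | zero => exact absurd rfl hn
  | one => exact ⟨1, 1, IsSNumber.one, one_ne_zero, fun p _ => Nat.coprime_one_left p, rfl⟩
  | prime q hq =>
    by_cases h : q ∈ S
    · refine ⟨q, 1, ⟨hq.ne_zero, fun p hp hpq => ?_⟩, one_ne_zero,
        fun p _ => Nat.coprime_one_left p, (mul_one q).symm⟩
      rwa [(Nat.prime_dvd_prime_iff_eq hp hq).1 hpq]
    · refine ⟨1, q, IsSNumber.one, hq.ne_zero, fun p hp => ?_, (one_mul q).symm⟩
      exact (Nat.coprime_primes hq (hS p hp)).2 (by rintro rfl; exact h hp)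
  | mul x y hx hy =>
    obtain ⟨a, b, ha, hb0, hb, h⟩ := hx (left_ne_zero_of_mul hn)
    obtain ⟨a', b', ha', hb0', hb', h'⟩ := hy (right_ne_zero_of_mul hn)
    exact ⟨a * a', b * b', ha.mul ha', mul_ne_zero hb0 hb0',
      fun p hp => (hb p hp).mul_left (hb' p hp), by rw [h, h']; ring⟩

lemma exists_mul_mod_one {a k : ℕ} (h : a.Coprime k) (hk : k ≠ 0) :
    ∃ j, ∃ l, k * j = 1 + a * l := by
  have h1 := Nat.pos_of_ne_zero hk
  rcases Nat.eq_zero_or_pos a with rfl | ha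
  · exact ⟨1, 0, by simpa using h⟩
  · obtain ⟨j, -, hj⟩ := Nat.exists_mul_mod_eq_of_coprime 1 h.symm ha.ne'
    have h0 : 1 ≤ k * (j + a) := Nat.mul_pos h1 (by omega)
    have hj' : 1 ≡ k * (j + a) [MOD a] := by
      rw [mul_add]
      exact (show 1 ≡ k * j [MOD a] from hj.symm).trans (by simp [Nat.ModEq])
    obtain ⟨l, hl⟩ := (Nat.modEq_iff_dvd' h0).1 hj'
    exact ⟨j + a, l, by omega⟩

lemma IsSGroup.exists_pow {S : Finset ℕ} {G : Type*} [CommGroup G] (h : IsSGroup S G) (x : G) :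
    ∃ n, IsSNumber S n ∧ x ^ n = 1 := by
  have : x ∈ sTorsion S G := by rw [h]; trivial
  exact this

lemma isSGroup_sTorsion (S : Finset ℕ) (G : Type*) [CommGroup G] :
    IsSGroup S (sTorsion S G) := by
  refine eq_top_iff.2 ?_
  rintro ⟨x, n, hn, hx⟩ -
  exact ⟨n, hn, Subtype.ext hx⟩

lemma IsSGroup.of_surjective {S : Finset ℕ} {G H : Type*} [CommGroup G] [CommGroup H]
    (h : IsSGroup S G) (f : G →* H) (hf : Function.Surjective f) : IsSGroup S H := by
  refine eq_top_iff.2 fun y _ => ?_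
  obtain ⟨x, rfl⟩ := hf y
  obtain ⟨n, hn, hx⟩ := h.exists_pow x
  exact ⟨n, hn, by rw [← map_pow, hx, map_one]⟩

lemma IsSGroup.isSNumber_card {S : Finset ℕ} {G : Type*} [CommGroup G] [Finite G]
    (h : IsSGroup S G) : IsSNumber S (Nat.card G) := by
  refine ⟨Nat.card_pos.ne', fun p hp hpG => ?_⟩
  have := Fact.mk hp
  obtain ⟨x, hx⟩ := exists_prime_orderOf_dvd_card' p hpG
  obtain ⟨n, hn, hxn⟩ := h.exists_pow x
  exact hn.2 p hp (hx ▸ orderOf_dvd_of_pow_eq_one hxn)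

lemma isSGroup_of_card {S : Finset ℕ} {G : Type*} [CommGroup G]
    (h : IsSNumber S (Nat.card G)) : IsSGroup S G :=
  eq_top_iff.2 fun _ _ => ⟨_, h, pow_card_eq_one'⟩

lemma odd_of_isSNumber {S : Finset ℕ} (hS : ∀ p ∈ S, p ≠ 2) {n : ℕ} (h : IsSNumber S n) :
    Odd n := by
  rw [← Nat.not_even_iff_odd]
  intro he
  exact hS 2 (h.2 2 Nat.prime_two he.two_dvd) rfl

/-- The `S`-part and the prime-to-`S` part of an element of finite order. -/
lemma exists_sPart {S : Finset ℕ} {G : Type*} [CommGroup G] {x : G} {a b : ℕ}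
    (ha : IsSNumber S a) (hb0 : b ≠ 0) (hb : ∀ p ∈ S, b.Coprime p) (h : x ^ (a * b) = 1) :
    ∃ j : ℕ, (∃ l, b * j = 1 + a * l) ∧ (x ^ (b * j)) ^ a = 1 ∧
      (x * (x ^ (b * j))⁻¹) ^ b = 1 := by
  obtain ⟨j, l, hj⟩ := exists_mul_mod_one (ha.coprime hb) hb0
  refine ⟨j, ⟨l, hj⟩, ?_, ?_⟩
  · rw [← pow_mul, show b * j * a = a * b * j by ring, pow_mul, h, one_pow]
  · rw [hj, pow_add, pow_one, mul_inv_rev, mul_comm _ x⁻¹, mul_inv_cancel_left, inv_pow, ← pow_mul,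
      show a * l * b = a * b * l by ring, pow_mul, h, one_pow, inv_one]

/-- A subgroup `H` whose elements have roots up to torsion of order prime to `S`. -/
def AlmostDivisible (S : Finset ℕ) {G : Type*} [CommGroup G] (H : Subgroup G) : Prop :=
  ∀ x ∈ H, ∀ n : ℕ, n ≠ 0 → ∃ y ∈ H, ∃ k : ℕ, k ≠ 0 ∧ (∀ p ∈ S, k.Coprime p) ∧
    (y ^ n * x⁻¹) ^ k = 1

/-- Every element of `H` has roots of all orders in `H`. -/
def IsDiv {G : Type*} [CommGroup G] (H : Subgroup G) : Prop :=
  ∀ n : ℕ, n ≠ 0 → ∀ x ∈ H, ∃ y ∈ H, y ^ n = x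

lemma IsDiv.almostDivisible {G : Type*} [CommGroup G] {H : Subgroup G} (h : IsDiv H)
    (S : Finset ℕ) : AlmostDivisible S H := fun x hx n hn => by
  obtain ⟨y, hy, h⟩ := h n hn x hx
  exact ⟨y, hy, 1, one_ne_zero, fun p _ => Nat.coprime_one_left p, by simp [h]⟩

lemma IsDiv.map {G G' : Type*} [CommGroup G] [CommGroup G'] {H : Subgroup G} (h : IsDiv H)
    (f : G →* G') : IsDiv (H.map f) := by
  rintro n hn _ ⟨x, hx, rfl⟩
  obtain ⟨y, hy, rfl⟩ := h n hn x hx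
  exact ⟨f y, ⟨y, hy, rfl⟩, (map_pow f y n).symm⟩

lemma IsDiv.eq_bot {G : Type*} [CommGroup G] [Finite G] {H : Subgroup G} (h : IsDiv H) :
    H = ⊥ := by
  refine eq_bot_iff.2 fun x hx => ?_
  obtain ⟨y, -, rfl⟩ := h (Nat.card G) Nat.card_pos.ne' x hx
  rw [pow_card_eq_one']
  exact one_mem _

lemma divSub_eq_of_ker {G Q : Type*} [CommGroup G] [CommGroup Q] [Finite Q] (f : G →* Q)
    (h : IsDiv f.ker) : divSub G = f.ker := by
  refine le_antisymm (sSup_le fun D hD => ?_) (le_sSup h)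
  have := IsDiv.eq_bot (IsDiv.map (H := D) hD f)
  exact (Subgroup.map_eq_bot_iff D).1 this

lemma divSub_map {G H : Type*} [CommGroup G] [CommGroup H] (e : G ≃* H) :
    (divSub G).map (e : G →* H) = divSub H := by
  refine le_antisymm ?_ fun y hy => ?_
  · rw [Subgroup.map_le_iff_le_comap]
    refine sSup_le fun D hD => ?_
    rw [← Subgroup.map_le_iff_le_comap]
    exact le_sSup (IsDiv.map (H := D) hD _)
  · refine ⟨e.symm y, ?_, by simp⟩
    have : divSub H ≤ (divSub G).comap (e.symm : H →* G) := by
      refine sSup_le fun D hD => ?_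
      rw [← Subgroup.map_le_iff_le_comap]
      exact le_sSup (IsDiv.map (H := D) hD _)
    exact this hy

/-- The quotients by the maximal divisible subgroups of isomorphic groups. -/
def quotDivEquiv {G H : Type*} [CommGroup G] [CommGroup H] (e : G ≃* H) :
    G ⧸ divSub G ≃* H ⧸ divSub H :=
  QuotientGroup.congr _ _ e (divSub_map e)

lemma exists_mulEquiv_of_ker {A B C : Type*} [CommGroup A] [CommGroup B] [CommGroup C] (a : A →* B)
    (c : A →* C) (ha : Function.Surjective a) (hc : Function.Surjective c)
    (hac : ∀ x, c x = 1 ↔ a x = 1) : ∃ e : B ≃* C, ∀ x, e (a x) = c x := by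
  have hk : a.ker = c.ker := by ext x; exact (hac x).symm
  refine ⟨(quotientKerEquivOfSurjective a ha).symm.trans
    ((QuotientGroup.quotientMulEquivOfEq hk).trans
      (quotientKerEquivOfSurjective c hc)), fun x => ?_⟩
  have : (quotientKerEquivOfSurjective a ha).symm (a x) = (x : A ⧸ a.ker) := by
    rw [MulEquiv.symm_apply_eq]; rfl
  rw [MulEquiv.trans_apply, this]
  rfl

section Torsion

variable {S : Finset ℕ} (hS : ∀ p ∈ S, p.Prime) {G Q : Type*} [CommGroup G] [CommGroup Q]
  (f : G →* Q) (hf : Function.Surjective f) (hd : AlmostDivisible S f.ker)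

include hf hd in
lemma sTorsionMap_surjective : Function.Surjective (sTorsionMap S f) := by
  rintro ⟨q, n, hn, hq⟩
  obtain ⟨x, rfl⟩ := hf q
  obtain ⟨y, hy, k, hk0, hk, hyk⟩ := hd (x ^ n) (by rw [MonoidHom.mem_ker, map_pow, hq]) n hn.1
  have hz : (x * y⁻¹) ^ (n * k) = 1 := by
    rw [pow_mul, mul_pow, inv_pow, ← inv_inj, ← inv_pow, mul_inv_rev, inv_inv, hyk, inv_one]
  obtain ⟨j, ⟨l, hj⟩, h1, -⟩ := exists_sPart hn hk0 hk hz
  refine ⟨⟨_, n, hn, h1⟩, Subtype.ext ?_⟩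
  change f ((x * y⁻¹) ^ (k * j)) = f x
  rw [MonoidHom.mem_ker] at hy
  rw [map_pow, map_mul, map_inv, hy, inv_one, mul_one, hj, pow_add, pow_one, pow_mul, hq, one_pow,
    mul_one]

include hS hd in
lemma isDiv_ker_sTorsionMap : IsDiv (sTorsionMap S f).ker := by
  rintro N hN ⟨x, a, ha, hx⟩ hxf
  have hxf' : f x = 1 := congrArg Subtype.val hxf
  obtain ⟨y, hy, k, hk0, hk, hyk⟩ := hd x hxf' N hN
  obtain ⟨N1, N2, h1, h20, h2, rfl⟩ := exists_isSNumber_mul hS N hN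
  have hyN : y ^ (N1 * N2 * k) = x ^ k := by
    rw [mul_pow, inv_pow, ← pow_mul, mul_inv_eq_one] at hyk
    exact hyk
  have hz : y ^ ((N1 * a) * (N2 * k)) = 1 := by
    rw [show (N1 * a) * (N2 * k) = N1 * N2 * k * a by ring, pow_mul, hyN, ← pow_mul, mul_comm,
      pow_mul, hx, one_pow]
  obtain ⟨j, ⟨l, hj⟩, h3, -⟩ := exists_sPart (h1.mul ha) (mul_ne_zero h20 hk0)
    (fun p hp => (h2 p hp).mul_left (hk p hp)) hz
  refine ⟨⟨_, _, h1.mul ha, h3⟩, Subtype.ext ?_, Subtype.ext ?_⟩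
  · change f (y ^ _) = 1
    rw [map_pow, show f y = 1 from hy, one_pow]
  · change (y ^ (N2 * k * j)) ^ (N1 * N2) = x
    rw [← pow_mul, show N2 * k * j * (N1 * N2) = N1 * N2 * k * (N2 * j) by ring, pow_mul, hyN,
      ← pow_mul, show k * (N2 * j) = N2 * k * j by ring, hj, pow_add, pow_one,
      show N1 * a * l = a * (N1 * l) by ring, pow_mul, hx, one_pow, mul_one]

include hS hd in
lemma divSub_sTorsion [Finite Q] : divSub (sTorsion S G) = (sTorsionMap S f).ker :=
  divSub_eq_of_ker _ (isDiv_ker_sTorsionMap hS f hd)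

/-- `π⁰` of the `S^∞`-torsion subgroup. -/
def quotDivTorsion [Finite Q] : sTorsion S G ⧸ divSub (sTorsion S G) ≃* sTorsion S Q :=
  (QuotientGroup.quotientMulEquivOfEq (divSub_sTorsion hS f hd)).trans
    (quotientKerEquivOfSurjective _ (sTorsionMap_surjective f hf hd))

end Torsion

/-! ### Counting subgroups of free abelian groups -/

/-- Subgroups whose index is a product of primes in `S`. -/
abbrev SubS (S : Finset ℕ) (G : Type*) [AddCommGroup G] : Type _ :=
  {H : AddSubgroup G // IsSNumber S H.index}

/-- The subgroup of `G × ℤ` with intersection `H` with `G`, projection `dℤ` to `ℤ`, and containing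
`(c, d)`. -/
def extendSub {G : Type*} [AddCommGroup G] (H : AddSubgroup G) (d : ℕ) (c : G ⧸ H) :
    AddSubgroup (G × ℤ) where
  carrier := {x | ∃ j : ℤ, x.2 = d * j ∧ (x.1 : G ⧸ H) = j • c}
  zero_mem' := ⟨0, by simp⟩
  add_mem' := by
    rintro x y ⟨j, h1, h2⟩ ⟨j', h1', h2'⟩
    exact ⟨j + j', by simp [h1, h1', mul_add], by simp [h2, h2', add_smul]⟩
  neg_mem' := by
    rintro x ⟨j, h1, h2⟩
    exact ⟨-j, by simp [h1], by simp [h2]⟩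

lemma mem_extendSub {G : Type*} [AddCommGroup G] {H : AddSubgroup G} {d : ℕ} {c : G ⧸ H}
    {x : G × ℤ} : x ∈ extendSub H d c ↔ ∃ j : ℤ, x.2 = d * j ∧ (x.1 : G ⧸ H) = j • c := Iff.rfl

lemma index_extendSub {G : Type*} [AddCommGroup G] (H : AddSubgroup G) {d : ℕ} (hd : d ≠ 0)
    (c : G ⧸ H) : (extendSub H d c).index = H.index * d := by
  have hd' : (d : ℤ) ≠ 0 := by exact_mod_cast hd
  let L : AddSubgroup (G × ℤ) := (AddSubgroup.zmultiples (d : ℤ)).comap (AddMonoidHom.snd G ℤ)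
  have hL : L.index = d := by
    rw [AddSubgroup.index_comap_of_surjective _ (fun z => ⟨(0, z), rfl⟩)]
    simp
  have hle : extendSub H d c ≤ L := by
    rintro x ⟨j, h1, -⟩
    exact ⟨j, by simp [h1, mul_comm]⟩
  rw [← AddSubgroup.relIndex_mul_index hle, hL]
  congr 1
  have : (extendSub H d c).comap (AddMonoidHom.inl G ℤ) = H := by
    ext g
    rw [AddSubgroup.mem_comap, mem_extendSub]
    constructor
    · rintro ⟨j, h1, h2⟩
      have : j = 0 := by
        have h1 : (0 : ℤ) = d * j := h1
        rcases mul_eq_zero.1 h1.symm with h | h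
        · exact absurd h hd'
        · exact h
      rw [this, zero_smul] at h2
      exact (QuotientAddGroup.eq_zero_iff _).1 h2
    · intro hg
      exact ⟨0, by simp, by simpa using (QuotientAddGroup.eq_zero_iff g).2 hg⟩
  obtain ⟨c, rfl⟩ := QuotientAddGroup.mk_surjective c
  let f : G →+ L ⧸ (extendSub H d (c : G ⧸ H)).addSubgroupOf L :=
    (QuotientAddGroup.mk' _).comp ((AddMonoidHom.inl G ℤ).codRestrict L (fun g => ⟨0, by simp⟩))
  have hker : f.ker = H := by
    conv_rhs => rw [← this]
    ext g
    rw [AddMonoidHom.mem_ker]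
    exact (QuotientAddGroup.eq_zero_iff _)
  have hsurj : Function.Surjective f := by
    intro x
    obtain ⟨⟨⟨g, k⟩, j, hj⟩, rfl⟩ := QuotientAddGroup.mk_surjective x
    have hk : k = d * j := by
      have : j • (d : ℤ) = k := hj
      rw [← this, smul_eq_mul, mul_comm]
    refine ⟨g - j • c, ?_⟩
    refine (QuotientAddGroup.eq).2 ?_
    rw [AddSubgroup.mem_addSubgroupOf, mem_extendSub]
    refine ⟨j, ?_, ?_⟩
    · change -(0 : ℤ) + k = d * j
      simp [hk]
    · change ((-(g - j • c) + g : G) : G ⧸ H) = j • (c : G ⧸ H)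
      simp
  rw [AddSubgroup.relIndex, AddSubgroup.index, ← Nat.card_congr
    (QuotientAddGroup.quotientKerEquivOfSurjective f hsurj).toEquiv, hker]
  rfl

lemma extendSub_bijective (S : Finset ℕ) (G : Type*) [AddCommGroup G] :
    Function.Bijective (fun x : (Σ y : SubS S G × {d : ℕ // IsSNumber S d}, G ⧸ y.1.1) =>
      (⟨extendSub x.1.1.1 x.1.2.1 x.2, by
        rw [index_extendSub _ x.1.2.2.1]; exact x.1.1.2.mul x.1.2.2⟩ : SubS S (G × ℤ))) := by
  constructor
  · rintro ⟨⟨⟨H, hH⟩, ⟨d, hd⟩⟩, c⟩ ⟨⟨⟨H', hH'⟩, ⟨d', hd'⟩⟩, c'⟩ h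
    have h : extendSub H d c = extendSub H' d' c' := congrArg Subtype.val h
    have key : ∀ {H H' : AddSubgroup G} {d d' : ℕ} {c : G ⧸ H} {c' : G ⧸ H'}, d' ≠ 0 →
        extendSub H d c = extendSub H' d' c' → H ≤ H' ∧ d' ∣ d := by
      intro H H' d d' c c' hd' h
      constructor
      · intro g hg
        have : ((g, 0) : G × ℤ) ∈ extendSub H d c :=
          ⟨0, by simp, by simpa using (QuotientAddGroup.eq_zero_iff g).2 hg⟩
        rw [h] at this
        obtain ⟨j, h1, h2⟩ := this
        have h1 : (0 : ℤ) = d' * j := h1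
        rcases mul_eq_zero.1 h1.symm with h0 | h0
        · exact absurd (by exact_mod_cast h0) hd'
        · rw [h0, zero_smul] at h2
          exact (QuotientAddGroup.eq_zero_iff _).1 h2
      · obtain ⟨g, hg⟩ := QuotientAddGroup.mk_surjective c
        have : ((g, (d : ℤ)) : G × ℤ) ∈ extendSub H d c := ⟨1, by simp, by simp [hg]⟩
        rw [h] at this
        obtain ⟨j, h1, -⟩ := this
        have h1 : (d : ℤ) = d' * j := h1
        exact Int.natCast_dvd_natCast.1 ⟨j, h1⟩
    obtain ⟨h1, h2⟩ := key hd'.1 h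
    obtain ⟨h3, h4⟩ := key hd.1 h.symm
    obtain rfl : H = H' := le_antisymm h1 h3
    obtain rfl : d = d' := Nat.dvd_antisymm h4 h2
    have hc : c = c' := by
      obtain ⟨g, hg⟩ := QuotientAddGroup.mk_surjective c
      have : ((g, (d : ℤ)) : G × ℤ) ∈ extendSub H d c := ⟨1, by simp, by simp [hg]⟩
      rw [h] at this
      obtain ⟨j, h1, h2⟩ := this
      have h1 : (d : ℤ) = d * j := h1
      have hd0 : (d : ℤ) ≠ 0 := by exact_mod_cast hd.1
      have : j = 1 := by
        have : (d : ℤ) * j = d * 1 := by rw [← h1, mul_one]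
        exact mul_left_cancel₀ hd0 this
      rw [this, one_smul] at h2
      rw [← hg]
      exact h2
    rw [hc]
  · rintro ⟨K, hK⟩
    let H : AddSubgroup G := K.comap (AddMonoidHom.inl G ℤ)
    obtain ⟨a, ha⟩ := Int.subgroup_cyclic (K.map (AddMonoidHom.snd G ℤ))
    rw [← AddSubgroup.zmultiples_eq_closure, ← Int.zmultiples_natAbs] at ha
    set d := a.natAbs with hd
    have hmem : (d : ℤ) ∈ K.map (AddMonoidHom.snd G ℤ) := by
      rw [ha]; exact AddSubgroup.mem_zmultiples _
    obtain ⟨⟨g, k⟩, hgk, hk⟩ := hmem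
    have hk : k = d := hk
    subst hk
    have heq : extendSub H d (g : G ⧸ H) = K := by
      have hj : ∀ j : ℤ, ((j • g, (d : ℤ) * j) : G × ℤ) ∈ K := fun j => by
        have := K.zsmul_mem hgk j
        rwa [Prod.smul_mk, smul_eq_mul, mul_comm j] at this
      ext ⟨x, y⟩
      rw [mem_extendSub]
      constructor
      · rintro ⟨j, h1, h2⟩
        have h1 : y = d * j := h1
        have h2 : (x : G ⧸ H) = ((j • g : G) : G ⧸ H) := by simpa using h2
        have h3 : -(j • g) + x ∈ H := QuotientAddGroup.eq.1 h2.symm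
        have := K.add_mem (hj j) (show ((-(j • g) + x, 0) : G × ℤ) ∈ K from h3)
        simpa [h1] using this
      · intro hxy
        have : y ∈ K.map (AddMonoidHom.snd G ℤ) := ⟨_, hxy, rfl⟩
        rw [ha] at this
        obtain ⟨j, hy⟩ := this
        have hy : y = d * j := by rw [← hy]; simp [mul_comm]
        refine ⟨j, hy, ?_⟩
        have h3 : (x : G ⧸ H) = ((j • g : G) : G ⧸ H) := by
          refine (QuotientAddGroup.eq.2 ?_).symm
          have := K.add_mem (K.neg_mem (hj j)) hxy
          change ((-(j • g) + x, 0) : G × ℤ) ∈ K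
          simpa [hy] using this
        simpa using h3
    have hd0 : d ≠ 0 := by
      intro h0
      have h2 : K ≤ (⊥ : AddSubgroup ℤ).comap (AddMonoidHom.snd G ℤ) := by
        rintro ⟨x, y⟩ hxy
        rw [← heq] at hxy
        obtain ⟨j, hy, -⟩ := hxy
        change y = 0
        rw [show y = d * j from hy, h0]
        simp
      have h3 := AddSubgroup.index_dvd_of_le h2
      rw [AddSubgroup.index_comap_of_surjective _ (fun z => ⟨(0, z), rfl⟩)] at h3
      have : (⊥ : AddSubgroup ℤ).index = 0 := by
        rw [AddSubgroup.index_bot]; simp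
      rw [this, zero_dvd_iff] at h3
      exact hK.1 h3
    have hidx := index_extendSub H hd0 (g : G ⧸ H)
    rw [heq] at hidx
    rw [hidx] at hK
    exact ⟨⟨⟨⟨H, hK.of_dvd (dvd_mul_right _ _)⟩, ⟨d, hK.of_dvd (dvd_mul_left _ _)⟩⟩,
      (g : G ⧸ H)⟩, Subtype.ext heq⟩

open scoped ENNReal

/-- The Dirichlet series of the subgroups of `S`-index of `G`. -/
def zetaSub (S : Finset ℕ) (G : Type*) [AddCommGroup G] (s : ℕ) : ℝ≥0∞ :=
  ∑' H : SubS S G, ((H.1.index : ℝ≥0∞) ^ s)⁻¹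

/-- The Dirichlet series of the `S`-numbers. -/
def zetaS (S : Finset ℕ) (s : ℕ) : ℝ≥0∞ :=
  ∑' d : {d : ℕ // IsSNumber S d}, ((d.1 : ℝ≥0∞) ^ s)⁻¹

lemma zetaSub_prod_int (S : Finset ℕ) (G : Type*) [AddCommGroup G] (s : ℕ) :
    zetaSub S (G × ℤ) (s + 1) = zetaSub S G s * zetaS S (s + 1) := by
  unfold zetaSub zetaS
  rw [← (Equiv.ofBijective _ (extendSub_bijective S G)).tsum_eq]
  simp only [Equiv.ofBijective_apply]
  rw [ENNReal.tsum_sigma']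
  simp only []
  rw [ENNReal.tsum_prod', ← ENNReal.tsum_mul_right]
  refine tsum_congr fun H => ?_
  rw [← ENNReal.tsum_mul_left]
  refine tsum_congr fun d => ?_
  rw [tsum_congr (fun c : G ⧸ H.1 => by rw [index_extendSub _ d.2.1])]
  rw [ENNReal.tsum_const]
  have hH : (H.1.index : ℝ≥0∞) ≠ 0 := by exact_mod_cast H.2.1
  have hH' : (H.1.index : ℝ≥0∞) ≠ ⊤ := ENNReal.natCast_ne_top _
  have hd : (d.1 : ℝ≥0∞) ≠ 0 := by exact_mod_cast d.2.1
  have hcard : ((ENat.card (G ⧸ H.1) : ℕ∞) : ℝ≥0∞) = (H.1.index : ℝ≥0∞) := by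
    have : H.1.FiniteIndex := ⟨H.2.1⟩
    rw [ENat.card_eq_coe_natCard]
    rfl
  rw [hcard, Nat.cast_mul, mul_pow, ENNReal.mul_inv (Or.inl (pow_ne_zero _ hH))
    (Or.inl (ENNReal.pow_ne_top hH')), ← mul_assoc]
  congr 1
  rw [pow_succ, ENNReal.mul_inv (Or.inl (pow_ne_zero _ hH)) (Or.inl (ENNReal.pow_ne_top hH')),
    mul_comm _ ((H.1.index : ℝ≥0∞))⁻¹, ← mul_assoc, ENNReal.mul_inv_cancel hH hH', one_mul]

lemma zetaSub_congr (S : Finset ℕ) {G G' : Type*} [AddCommGroup G] [AddCommGroup G'] (e : G ≃+ G')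
    (s : ℕ) : zetaSub S G s = zetaSub S G' s := by
  unfold zetaSub
  let E : SubS S G' ≃ SubS S G :=
    { toFun := fun H => ⟨H.1.comap (e : G →+ G'), by
        rw [AddSubgroup.index_comap_of_surjective _ e.surjective]; exact H.2⟩
      invFun := fun H => ⟨H.1.comap (e.symm : G' →+ G), by
        rw [AddSubgroup.index_comap_of_surjective _ e.symm.surjective]; exact H.2⟩
      left_inv := fun H => Subtype.ext (by ext; simp)
      right_inv := fun H => Subtype.ext (by ext; simp) }
  rw [← E.tsum_eq]
  refine tsum_congr fun H => ?_
  change ((((H.1.comap (e : G →+ G')).index : ℕ) : ℝ≥0∞) ^ s)⁻¹ = _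
  rw [AddSubgroup.index_comap_of_surjective _ e.surjective]

lemma zetaSub_pi (S : Finset ℕ) (n u : ℕ) :
    zetaSub S (Fin n → ℤ) (u + n) = ∏ k ∈ Finset.range n, zetaS S (u + k + 1) := by
  induction n with
  | zero =>
    rw [Finset.prod_range_zero, zetaSub]
    have h : ∀ H : AddSubgroup (Fin 0 → ℤ), H = ⊤ := fun H =>
      eq_top_iff.2 fun x _ => by rw [Subsingleton.elim x 0]; exact H.zero_mem
    rw [tsum_eq_single ⟨⊤, by simpa using IsSNumber.one⟩ (fun H hH =>
      absurd (Subtype.ext (h H.1)) hH)]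
    simp
  | succ n ih =>
    let e : (Fin (n + 1) → ℤ) ≃+ (Fin n → ℤ) × ℤ :=
      { toFun := fun x => (fun i => x i.succ, x 0)
        invFun := fun y => Fin.cons y.2 y.1
        left_inv := fun x => by ext i; refine Fin.cases ?_ (fun j => ?_) i <;> simp
        right_inv := fun y => by simp
        map_add' := fun x y => rfl }
    rw [zetaSub_congr S e, ← add_assoc, zetaSub_prod_int, ih, Finset.prod_range_succ]

lemma zetaS_eq {S : Finset ℕ} (hS : ∀ p ∈ S, p.Prime) {s : ℕ} (hs : s ≠ 0) :
    zetaS S s = ENNReal.ofReal (∏ p ∈ S, (1 - ((p : ℝ) ^ s)⁻¹)⁻¹) := by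
  let f : ℕ →* ℝ :=
    { toFun := fun n => ((n : ℝ) ^ s)⁻¹
      map_one' := by simp
      map_mul' := fun a b => by push_cast; rw [mul_pow, mul_inv] }
  have hf : ∀ {p : ℕ}, p.Prime → ‖f p‖ < 1 := fun {p} hp => by
    change ‖((p : ℝ) ^ s)⁻¹‖ < 1
    have h1 : 1 < (p : ℝ) := by exact_mod_cast hp.one_lt
    have h2 : 1 < (p : ℝ) ^ s := one_lt_pow₀ h1 hs
    rw [Real.norm_of_nonneg (by positivity)]
    exact inv_lt_one_of_one_lt₀ h2
  obtain ⟨-, h2⟩ := EulerProduct.summable_and_hasSum_factoredNumbers_prod_filter_prime_geometric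
    hf S
  rw [Finset.filter_true_of_mem hS] at h2
  have h3 : ∏ p ∈ S, (1 - ((p : ℝ) ^ s)⁻¹)⁻¹ = ∑' m : Nat.factoredNumbers S, f m := h2.tsum_eq.symm
  have h4 : ∀ m : Nat.factoredNumbers S, 0 ≤ f m := fun m =>
    show (0 : ℝ) ≤ (((m : ℕ) : ℝ) ^ s)⁻¹ by positivity
  rw [h3, ENNReal.ofReal_tsum_of_nonneg h4 h2.summable, zetaS]
  let E : {d : ℕ // IsSNumber S d} ≃ Nat.factoredNumbers S := Equiv.subtypeEquivRight fun d => by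
    rw [Nat.factoredNumbers, IsSNumber]
    simp only [Set.mem_ofPred_eq, ne_eq, and_congr_right_iff]
    intro hd
    refine forall_congr' fun p => ?_
    rw [Nat.mem_primeFactorsList hd, and_imp]
  rw [← E.tsum_eq]
  refine tsum_congr fun d => ?_
  change _ = ENNReal.ofReal ((((d : ℕ) : ℝ) ^ s)⁻¹)
  have : (0 : ℝ) < (d : ℕ) := by exact_mod_cast Nat.pos_of_ne_zero d.2.1
  rw [ENNReal.ofReal_inv_of_pos (by positivity), ENNReal.ofReal_pow this.le,
    ENNReal.ofReal_natCast]

open scoped ENNReal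

/-! ### Isomorphism classes of finite abelian `S`-groups -/

/-- A finite abelian `S`-group. -/
structure SGrp (S : Finset ℕ) where
  carrier : Type
  [grp : CommGroup carrier]
  [fin : Finite carrier]
  sgrp : IsSGroup S carrier

attribute [instance] SGrp.grp SGrp.fin

instance SGrp.setoid (S : Finset ℕ) : Setoid (SGrp S) where
  r E E' := Nonempty (E.carrier ≃* E'.carrier)
  iseqv := ⟨fun _ => ⟨MulEquiv.refl _⟩, fun ⟨e⟩ => ⟨e.symm⟩, fun ⟨e⟩ ⟨e'⟩ => ⟨e.trans e'⟩⟩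

/-- Isomorphism classes of finite abelian `S`-groups. -/
abbrev SCls (S : Finset ℕ) : Type 1 := Quotient (SGrp.setoid S)

/-- A representative of a class. -/
abbrev SCls.rep {S : Finset ℕ} (c : SCls S) : Type := c.out.carrier

lemma SCls.mk_eq_iff {S : Finset ℕ} (E : SGrp S) (c : SCls S) :
    ⟦E⟧ = c ↔ Nonempty (E.carrier ≃* c.rep) := by
  conv_lhs => rw [← Quotient.out_eq c]
  exact Quotient.eq

/-- The class of `ℤⁿ/H`. -/
def quotCls {S : Finset ℕ} {n : ℕ} (H : SubS S (Fin n → ℤ)) : SCls S :=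
  Quotient.mk _
    { carrier := Multiplicative ((Fin n → ℤ) ⧸ H.1)
      fin := Nat.finite_of_card_ne_zero H.2.1
      sgrp := isSGroup_of_card H.2 }

lemma quotCls_eq_iff {S : Finset ℕ} {n : ℕ} (H : SubS S (Fin n → ℤ)) (c : SCls S) :
    quotCls H = c ↔ Nonempty (Multiplicative ((Fin n → ℤ) ⧸ H.1) ≃* c.rep) :=
  SCls.mk_eq_iff _ _

/-- Generating `n`-tuples. -/
abbrev GenTuple (n : ℕ) (E : Type*) [CommGroup E] : Type _ :=
  {v : Fin n → E // Subgroup.closure (Set.range v) = ⊤}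

/-- The homomorphism `ℤⁿ → E` attached to an `n`-tuple. -/
def tupleHom {n : ℕ} {E : Type*} [CommGroup E] (v : Fin n → E) : (Fin n → ℤ) →+ Additive E :=
  (Fintype.linearCombination ℤ (fun i => Additive.ofMul (v i))).toAddMonoidHom

lemma tupleHom_single {n : ℕ} {E : Type*} [CommGroup E] (v : Fin n → E) (i : Fin n) :
    tupleHom v (Pi.single i 1) = Additive.ofMul (v i) := by
  change Fintype.linearCombination ℤ _ (Pi.single i 1) = _
  rw [Fintype.linearCombination_apply_single, one_smul]

lemma eq_tupleHom {n : ℕ} {E : Type*} [CommGroup E] (f : (Fin n → ℤ) →+ Additive E) :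
    f = tupleHom (fun i => (f (Pi.single i 1)).toMul) := by
  refine AddMonoidHom.functions_ext _ _ _ fun i x => ?_
  have h : (Pi.single i x : Fin n → ℤ) = x • Pi.single i 1 := by
    rw [← Pi.single_smul, smul_eq_mul, mul_one]
  rw [h, map_zsmul, map_zsmul, tupleHom_single]
  rfl

lemma tupleHom_surjective {n : ℕ} {E : Type*} [CommGroup E] (v : GenTuple n E) :
    Function.Surjective (tupleHom v.1) := by
  have h : Subgroup.closure (Set.range v.1) ≤
      AddSubgroup.toSubgroup' (tupleHom v.1).range := by
    rw [Subgroup.closure_le]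
    rintro _ ⟨i, rfl⟩
    exact ⟨Pi.single i 1, tupleHom_single _ _⟩
  intro x
  have : x.toMul ∈ Subgroup.closure (Set.range v.1) := by rw [v.2]; trivial
  exact h this

lemma nonempty_genTuple_equiv (S : Finset ℕ) (n : ℕ) (c : SCls S) :
    Nonempty ({H : SubS S (Fin n → ℤ) // quotCls H = c} × (c.rep ≃* c.rep) ≃
      GenTuple n c.rep) := by
  have e1 : ∀ H : {H : SubS S (Fin n → ℤ) // quotCls H = c},
      Nonempty ((Multiplicative ((Fin n → ℤ) ⧸ H.1.1) ≃* c.rep) ≃ (c.rep ≃* c.rep)) := fun H => by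
    obtain ⟨e⟩ := (quotCls_eq_iff _ _).1 H.2
    exact ⟨⟨fun f => e.symm.trans f, fun f => e.trans f, fun f => by ext; simp,
      fun f => by ext; simp⟩⟩
  refine ⟨(Equiv.sigmaEquivProd _ _).symm.trans
    ((Equiv.sigmaCongrRight fun H => (e1 H).some).symm.trans ?_)⟩
  let v : (Σ H : {H : SubS S (Fin n → ℤ) // quotCls H = c},
      (Multiplicative ((Fin n → ℤ) ⧸ H.1.1) ≃* c.rep)) → Fin n → c.rep :=
    fun x i => x.2 (ofAdd (QuotientAddGroup.mk (Pi.single i 1)))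
  have hv : ∀ x y, tupleHom (v x) y =
      Additive.ofMul (x.2 (ofAdd (QuotientAddGroup.mk y))) := fun x y => by
    have := eq_tupleHom ((MulEquiv.toAdditiveRight x.2 :
      ((Fin n → ℤ) ⧸ x.1.1.1) ≃+ Additive c.rep).toAddMonoidHom.comp
      (QuotientAddGroup.mk' x.1.1.1))
    exact (DFunLike.congr_fun this y).symm
  refine Equiv.ofBijective (fun x => ⟨v x, ?_⟩) ⟨?_, ?_⟩
  · refine eq_top_iff.2 fun z _ => ?_
    have hs : Function.Surjective (QuotientAddGroup.mk : _ → (Fin n → ℤ) ⧸ x.1.1.1) :=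
      QuotientAddGroup.mk_surjective
    obtain ⟨y, hy⟩ := hs (toAdd (x.2.symm z))
    have h1 : tupleHom (v x) y = Additive.ofMul z := by
      rw [hv, hy]
      simp
    have h2 : tupleHom (v x) y ∈ (Subgroup.closure (Set.range (v x))).toAddSubgroup := by
      change Fintype.linearCombination ℤ _ y ∈ _
      rw [Fintype.linearCombination_apply]
      refine AddSubgroup.sum_mem _ fun i _ => AddSubgroup.zsmul_mem _ ?_ _
      exact Subgroup.subset_closure (k := Set.range (v x)) ⟨i, rfl⟩
    rw [h1] at h2
    exact h2
  · rintro ⟨⟨⟨H, hH⟩, hc⟩, e⟩ ⟨⟨⟨H', hH'⟩, hc'⟩, e'⟩ h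
    have h : v _ = v _ := congrArg Subtype.val h
    have h1 : ∀ y, e (ofAdd (QuotientAddGroup.mk y)) =
        e' (ofAdd (QuotientAddGroup.mk y)) := fun y => by
      have h2 := hv ⟨⟨⟨H, hH⟩, hc⟩, e⟩ y
      rw [h, hv] at h2
      exact (Additive.ofMul.injective h2).symm
    obtain rfl : H = H' := by
      ext y
      rw [← QuotientAddGroup.eq_zero_iff, ← QuotientAddGroup.eq_zero_iff (N := H')]
      have h3 := h1 y
      constructor
      · intro h4
        rw [h4, ofAdd_zero, map_one] at h3
        exact e'.map_eq_one_iff.1 h3.symm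
      · intro h4
        rw [h4, ofAdd_zero, map_one] at h3
        exact e.map_eq_one_iff.1 h3
    obtain rfl : e = e' := by
      ext x
      obtain ⟨y, hy⟩ := QuotientAddGroup.mk_surjective (toAdd x)
      have h3 := h1 y
      rw [hy] at h3
      exact h3
    rfl
  · intro w
    let e := QuotientAddGroup.quotientKerEquivOfSurjective _ (tupleHom_surjective w)
    have hcard : (tupleHom w.1).ker.index = Nat.card c.rep := Nat.card_congr e.toEquiv
    let H : SubS S (Fin n → ℤ) := ⟨(tupleHom w.1).ker, by
      rw [hcard]; exact c.out.sgrp.isSNumber_card⟩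
    let e' : Multiplicative ((Fin n → ℤ) ⧸ H.1) ≃* c.rep := AddEquiv.toMultiplicativeLeft e
    refine ⟨⟨⟨H, (quotCls_eq_iff _ _).2 ⟨e'⟩⟩, e'⟩, Subtype.ext ?_⟩
    funext i
    exact congrArg Additive.toMul (tupleHom_single w.1 i)

/-- The proportion of generating `n`-tuples. -/
def genDensity (n : ℕ) (E : Type*) [CommGroup E] : ℝ :=
  (Nat.card (GenTuple n E) : ℝ) / (Nat.card E : ℝ) ^ n

lemma card_pow_eq {n : ℕ} (E : Type*) [Finite E] : (Nat.card E : ℝ) ^ n = Nat.card (Fin n → E) := by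
  rw [Nat.card_fun, Nat.card_fin]
  push_cast
  rfl

lemma genDensity_le_succ (n : ℕ) (E : Type*) [CommGroup E] [Finite E] :
    genDensity n E ≤ genDensity (n + 1) E := by
  have h0 : (0 : ℝ) < Nat.card E := by exact_mod_cast Nat.card_pos
  unfold genDensity
  rw [div_le_div_iff₀ (by positivity) (by positivity), pow_succ, mul_comm _ (Nat.card E : ℝ),
    ← mul_assoc]
  refine mul_le_mul_of_nonneg_right ?_ (by positivity)
  rw [← Nat.cast_mul, ← Nat.card_prod]
  refine Nat.cast_le.2 (Nat.card_le_card_of_injective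
    (fun x : GenTuple n E × E => (⟨Fin.cons x.2 x.1.1, ?_⟩ : GenTuple (n + 1) E)) ?_)
  · refine eq_top_iff.2 ?_
    refine x.1.2.ge.trans (Subgroup.closure_mono ?_)
    rintro _ ⟨i, rfl⟩
    exact ⟨i.succ, by simp⟩
  · rintro ⟨x, a⟩ ⟨y, b⟩ h
    have h1 : (Fin.cons a x.1 : Fin (n + 1) → E) = Fin.cons b y.1 := congrArg Subtype.val h
    have := Fin.cons_injective2 h1
    exact Prod.ext (Subtype.ext this.2) this.1

lemma genDensity_le_one (n : ℕ) (E : Type*) [CommGroup E] [Finite E] : genDensity n E ≤ 1 := by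
  have h0 : (0 : ℝ) < Nat.card E := by exact_mod_cast Nat.card_pos
  unfold genDensity
  rw [div_le_one (by positivity), card_pow_eq]
  exact Nat.cast_le.2 (Nat.card_le_card_of_injective _ Subtype.val_injective)

lemma le_genDensity (n : ℕ) (E : Type*) [CommGroup E] [Finite E] :
    1 - Nat.card (Subgroup E) * (1 / 2) ^ n ≤ genDensity n E := by
  classical
  have h0 : (0 : ℝ) < Nat.card E := by exact_mod_cast Nat.card_pos
  unfold genDensity
  have h8 : (Nat.card E : ℝ) ^ n = Nat.card (GenTuple n E) +
      Nat.card {v : Fin n → E // Subgroup.closure (Set.range v) ≠ ⊤} := by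
    rw [card_pow_eq, ← Nat.cast_add, ← Nat.card_sum,
      Nat.card_congr (Equiv.sumCompl fun v : Fin n → E => Subgroup.closure (Set.range v) = ⊤)]
  rw [le_div_iff₀ (by positivity), sub_mul, one_mul, sub_le_iff_le_add]
  nth_rewrite 1 [h8]
  rw [add_le_add_iff_left]
  let M := {M : Subgroup E // M ≠ ⊤}
  have : Fintype M := Fintype.ofFinite M
  have h1 : Nat.card {v : Fin n → E // Subgroup.closure (Set.range v) ≠ ⊤} ≤
      Nat.card (Σ K : M, (Fin n → K.1)) := by
    refine Nat.card_le_card_of_injective (fun v => ⟨⟨_, v.2⟩, fun i =>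
      ⟨v.1 i, Subgroup.subset_closure ⟨i, rfl⟩⟩⟩) fun v w h => ?_
    have h2 : ∀ x y : (Σ K : M, (Fin n → K.1)), x = y →
        (fun i => (x.2 i : E)) = fun i => (y.2 i : E) := by rintro x _ rfl; rfl
    exact Subtype.ext (h2 _ _ h)
  refine (Nat.cast_le.2 h1).trans ?_
  rw [Nat.card_sigma, Nat.cast_sum]
  have h2 : ∀ K : M, (Nat.card (Fin n → K.1) : ℝ) ≤ (1 / 2) ^ n * (Nat.card E : ℝ) ^ n := by
    intro K
    rw [← card_pow_eq, ← mul_pow]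
    refine pow_le_pow_left₀ (by positivity) ?_ n
    have h3 : 1 < K.1.index := by
      have := K.1.index_ne_zero_of_finite
      have h4 : K.1.index ≠ 1 := fun h => K.2 (Subgroup.index_eq_one.1 h)
      omega
    have h5 : (Nat.card K.1 : ℝ) * K.1.index = Nat.card E := by
      exact_mod_cast K.1.card_mul_index
    have h6 : (2 : ℝ) ≤ K.1.index := by exact_mod_cast h3
    have h7 : (0 : ℝ) ≤ Nat.card K.1 := Nat.cast_nonneg _
    nlinarith
  refine (Finset.sum_le_sum fun K _ => h2 K).trans ?_
  rw [Finset.sum_const, nsmul_eq_mul, mul_assoc, Finset.card_univ, ← Nat.card_eq_fintype_card]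
  refine mul_le_mul_of_nonneg_right ?_ (by positivity)
  exact Nat.cast_le.2 (Nat.card_le_card_of_injective _ Subtype.val_injective)

lemma tendsto_genDensity (E : Type*) [CommGroup E] [Finite E] :
    Tendsto (fun n => genDensity n E) atTop (𝓝 1) := by
  refine tendsto_of_tendsto_of_tendsto_of_le_of_le ?_ tendsto_const_nhds
    (fun n => le_genDensity n E) (fun n => genDensity_le_one n E)
  have h := tendsto_pow_atTop_nhds_zero_of_lt_one (r := (1 / 2 : ℝ)) (by norm_num) (by norm_num)
  simpa using (h.const_mul (Nat.card (Subgroup E) : ℝ)).const_sub 1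

/-! ### The Cohen–Lenstra identity -/

instance (S : Finset ℕ) (c : SCls S) : Finite (c.rep ≃* c.rep) :=
  Finite.of_injective (fun e => (e : c.rep → c.rep)) DFunLike.coe_injective

lemma zetaSub_eq_tsum (S : Finset ℕ) (n u : ℕ) :
    zetaSub S (Fin n → ℤ) (u + n) = ∑' c : SCls S,
      ENNReal.ofReal (genDensity n c.rep) *
        ((Nat.card c.rep : ℝ≥0∞) ^ u * Nat.card (c.rep ≃* c.rep))⁻¹ := by
  rw [zetaSub, ← (Equiv.sigmaFiberEquiv (quotCls (S := S) (n := n))).tsum_eq, ENNReal.tsum_sigma']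
  refine tsum_congr fun c => ?_
  have hidx : ∀ H : {H : SubS S (Fin n → ℤ) // quotCls H = c}, H.1.1.index = Nat.card c.rep := by
    intro H
    obtain ⟨e⟩ := (quotCls_eq_iff _ _).1 H.2
    exact Nat.card_congr e.toEquiv
  simp only [Equiv.sigmaFiberEquiv_apply, hidx]
  rw [ENNReal.tsum_const]
  have hA : 0 < Nat.card (c.rep ≃* c.rep) := Nat.card_pos
  have hN : 0 < Nat.card c.rep := Nat.card_pos
  obtain ⟨e⟩ := nonempty_genTuple_equiv S n c
  have hfin : Finite {H : SubS S (Fin n → ℤ) // quotCls H = c} :=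
    have := Finite.of_injective _ e.injective
    Finite.of_surjective _ (Prod.fst_surjective (β := c.rep ≃* c.rep))
  have hcard := (Nat.card_congr e.symm).trans (Nat.card_prod _ _)
  rw [ENat.card_eq_coe_natCard, genDensity, hcard]
  have hA' : (Nat.card (c.rep ≃* c.rep) : ℝ≥0∞) ≠ 0 := by exact_mod_cast hA.ne'
  have hA'' : (Nat.card (c.rep ≃* c.rep) : ℝ≥0∞) ≠ ⊤ := ENNReal.natCast_ne_top _
  have hN' : (Nat.card c.rep : ℝ≥0∞) ≠ 0 := by exact_mod_cast hN.ne'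
  have hN'' : (Nat.card c.rep : ℝ≥0∞) ≠ ⊤ := ENNReal.natCast_ne_top _
  rw [ENNReal.ofReal_div_of_pos (by positivity), ENNReal.ofReal_natCast,
    ENNReal.ofReal_pow (by positivity), ENNReal.ofReal_natCast, pow_add,
    ENNReal.mul_inv (Or.inl (pow_ne_zero _ hN')) (Or.inl (ENNReal.pow_ne_top hN'')),
    ENNReal.mul_inv (Or.inr hA'') (Or.inr hA'), Nat.cast_mul, div_eq_mul_inv]
  generalize (Nat.card c.rep : ℝ≥0∞) ^ u = x
  generalize (Nat.card c.rep : ℝ≥0∞) ^ n = y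
  rw [show ∀ a b z w t : ℝ≥0∞, a * b * z * (w * t) = a * (w * z) * (b * t) by intros; ring,
    ENNReal.mul_inv_cancel hA' hA'', mul_one]
  rfl

lemma tsum_eq_of_tendsto {S : Finset ℕ} (hS : ∀ p ∈ S, p.Prime) (u : ℕ) {x : ℝ}
    (hx : Tendsto (fun n => ∏ k ∈ Finset.range n, ∏ p ∈ S, (1 - ((p : ℝ) ^ (k + (u + 1)))⁻¹)⁻¹)
      atTop (𝓝 x)) :
    ∑' c : SCls S, ((Nat.card c.rep : ℝ≥0∞) ^ u * Nat.card (c.rep ≃* c.rep))⁻¹ =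
      ENNReal.ofReal x := by
  let _ : MeasurableSpace (SCls S) := ⊤
  have h1 := MeasureTheory.lintegral_tendsto_of_tendsto_of_monotone
    (μ := (MeasureTheory.Measure.count : MeasureTheory.Measure (SCls S)))
    (f := fun n c => ENNReal.ofReal (genDensity n c.rep) *
        ((Nat.card c.rep : ℝ≥0∞) ^ u * Nat.card (c.rep ≃* c.rep))⁻¹)
    (F := fun c => ((Nat.card c.rep : ℝ≥0∞) ^ u * Nat.card (c.rep ≃* c.rep))⁻¹)
    (fun n => (measurable_from_top).aemeasurable)
    (Eventually.of_forall fun c => monotone_nat_of_le_succ fun n =>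
      mul_le_mul_left (ENNReal.ofReal_le_ofReal (genDensity_le_succ n c.rep)) _)
    (Eventually.of_forall fun c => by
      have h2 : Tendsto (fun n => ENNReal.ofReal (genDensity n c.rep)) atTop (𝓝 1) := by
        simpa using ENNReal.tendsto_ofReal (tendsto_genDensity c.rep)
      have h3 := ENNReal.Tendsto.mul_const (b := ((Nat.card c.rep : ℝ≥0∞) ^ u *
        Nat.card (c.rep ≃* c.rep))⁻¹) h2 (Or.inl one_ne_zero)
      rwa [one_mul] at h3)
  simp only [MeasureTheory.lintegral_count] at h1
  refine tendsto_nhds_unique h1 ?_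
  have h4 : ∀ n, (∑' c : SCls S, ENNReal.ofReal (genDensity n c.rep) *
        ((Nat.card c.rep : ℝ≥0∞) ^ u * Nat.card (c.rep ≃* c.rep))⁻¹) =
      ENNReal.ofReal (∏ k ∈ Finset.range n, ∏ p ∈ S, (1 - ((p : ℝ) ^ (k + (u + 1)))⁻¹)⁻¹) := by
    intro n
    rw [← zetaSub_eq_tsum, zetaSub_pi, ENNReal.ofReal_prod_of_nonneg]
    · refine Finset.prod_congr rfl fun k _ => ?_
      rw [zetaS_eq hS (by omega), show u + k + 1 = k + (u + 1) by ring]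
    · intro k _
      refine Finset.prod_nonneg fun p hp => inv_nonneg.2 (sub_nonneg.2 (inv_le_one_of_one_le₀ ?_))
      exact one_le_pow₀ (by exact_mod_cast (hS p hp).one_lt.le)
  simp only [h4]
  exact ENNReal.tendsto_ofReal hx

lemma tendsto_euler {S : Finset ℕ} (hS : ∀ p ∈ S, p.Prime) (u : ℕ) :
    Tendsto (fun n => ∏ k ∈ Finset.range n, ∏ p ∈ S, (1 - ((p : ℝ) ^ (k + (u + 1)))⁻¹)⁻¹)
      atTop (𝓝 (∏ p ∈ S, ∏' k : ℕ, (1 - ((p : ℝ) ^ (k + (u + 1)))⁻¹)⁻¹)) := by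
  simp only [Finset.prod_comm (s := Finset.range _)]
  refine tendsto_finsetProd _ fun p hp => ?_
  have hp2 : (2 : ℝ) ≤ p := by exact_mod_cast (hS p hp).two_le
  have hx : ∀ k : ℕ, ((p : ℝ) ^ (k + (u + 1)))⁻¹ ≤ (1 / 2) * (1 / 2) ^ k := fun k => by
    rw [← pow_succ', one_div, inv_pow]
    refine inv_anti₀ (by positivity) ?_
    calc (2 : ℝ) ^ (k + 1) ≤ p ^ (k + 1) := pow_le_pow_left₀ (by norm_num) hp2 _
      _ ≤ p ^ (k + (u + 1)) := pow_le_pow_right₀ (by linarith) (by omega)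
  have hx2 : ∀ k : ℕ, ((p : ℝ) ^ (k + (u + 1)))⁻¹ ≤ 1 / 2 := fun k =>
    (hx k).trans (mul_le_of_le_one_right (by norm_num) (pow_le_one₀ (by norm_num) (by norm_num)))
  have hx0 : ∀ k : ℕ, 0 ≤ ((p : ℝ) ^ (k + (u + 1)))⁻¹ := fun k => by positivity
  have hsum : Summable fun k : ℕ => (1 - ((p : ℝ) ^ (k + (u + 1)))⁻¹)⁻¹ - 1 := by
    refine Summable.of_nonneg_of_le (fun k => ?_) (fun k => ?_)
      (summable_geometric_of_lt_one (r := (1 / 2 : ℝ)) (by norm_num) (by norm_num))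
    · have := hx2 k; have := hx0 k
      rw [sub_nonneg]
      exact (one_le_inv₀ (by linarith)).2 (by linarith)
    · have h1 := hx2 k; have h2 := hx0 k; have h3 := hx k
      rw [sub_le_iff_le_add, inv_le_comm₀ (by linarith) (by positivity)]
      rw [inv_le_iff_one_le_mul₀ (by positivity)]
      have h4 : (0 : ℝ) ≤ (1 / 2) ^ k := by positivity
      nlinarith
  have := (Real.multipliable_one_add_of_summable hsum).hasProd.tendsto_prod_nat
  simpa using this

/-- The exponent of `#E` in the weight of `E`. -/
def QSign.exp : QSign → ℕ
  | .minus => 0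
  | .plus => 1

lemma clConst_eq (S : Finset ℕ) (s : QSign) :
    clConst S s = ∏ p ∈ S, ∏' k : ℕ, (1 - ((p : ℝ) ^ (k + (s.exp + 1)))⁻¹)⁻¹ := by
  cases s <;> rfl

lemma tsum_sCls {S : Finset ℕ} (hS : ∀ p ∈ S, p.Prime) (s : QSign) :
    ∑' c : SCls S, ((Nat.card c.rep : ℝ≥0∞) ^ s.exp * Nat.card (c.rep ≃* c.rep))⁻¹ =
      ENNReal.ofReal (clConst S s) := by
  rw [clConst_eq]
  exact tsum_eq_of_tendsto hS _ (tendsto_euler hS _)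

lemma clConst_pos {S : Finset ℕ} (hS : ∀ p ∈ S, p.Prime) (s : QSign) : 0 < clConst S s := by
  rw [← ENNReal.ofReal_pos, ← tsum_sCls hS s, pos_iff_ne_zero]
  intro h
  let E : SGrp S := { carrier := PUnit, sgrp := eq_top_iff.2 fun x _ => one_mem _ }
  have := ENNReal.tsum_eq_zero.1 h ⟦E⟧
  rw [ENNReal.inv_eq_zero] at this
  exact ENNReal.mul_ne_top (ENNReal.pow_ne_top (ENNReal.natCast_ne_top _))
    (ENNReal.natCast_ne_top _) this

lemma clMeasure_eq (S : Finset ℕ) (E : Type) [CommGroup E] (s : QSign) :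
    clMeasure S E s =
      (clConst S s)⁻¹ * ((Nat.card E : ℝ) ^ s.exp * Nat.card (E ≃* E))⁻¹ := by
  cases s
  · simp [clMeasure, QSign.exp, div_eq_mul_inv]
  · simp [clMeasure, QSign.exp, div_eq_mul_inv, mul_comm]

/-! ### The group `U_R(S^∞)` -/

section UGroup

variable {S : Finset ℕ} {R : Type} [CommRing R]

/-- The automorphism of `U_R(S^∞)` induced by a ring automorphism. -/
def usEquiv (S : Finset ℕ) {R : Type} [CommRing R] (ρ : R ≃+* R) : US S R ≃* US S R :=
  MonoidHom.toMulEquiv (usMap S (ρ : R →+* R)) (usMap S (ρ.symm : R →+* R))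
    (by
      ext u : 1
      rw [MonoidHom.comp_apply, ← usMap_comp]
      have : ((ρ.symm : R →+* R).comp (ρ : R →+* R)) = RingHom.id R := by ext; simp
      rw [this, usMap_id]; rfl)
    (by
      ext u : 1
      rw [MonoidHom.comp_apply, ← usMap_comp]
      have : ((ρ : R →+* R).comp (ρ.symm : R →+* R)) = RingHom.id R := by ext; simp
      rw [this, usMap_id]; rfl)

@[simp] lemma usEquiv_apply (ρ : R ≃+* R) (u : US S R) :
    usEquiv S ρ u = usMap S (ρ : R →+* R) u := rfl

/-- `Aut_ring(U_R(S^∞))`. -/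
def ringAut (S : Finset ℕ) (R : Type) [CommRing R] : Set (US S R ≃* US S R) :=
  {α | ∃ ρ : R ≃+* R, ∀ u, α u = usMap S (ρ : R →+* R) u}

lemma ringAut_refl : MulEquiv.refl _ ∈ ringAut S R := ⟨RingEquiv.refl R, fun u => (usMap_id S u).symm⟩

lemma ringAut_symm {α : US S R ≃* US S R} (h : α ∈ ringAut S R) : α.symm ∈ ringAut S R := by
  obtain ⟨ρ, hρ⟩ := h
  refine ⟨ρ.symm, fun u => α.injective ?_⟩
  rw [α.apply_symm_apply, hρ]
  exact ((usEquiv S ρ).apply_symm_apply u).symm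

lemma ringAut_trans {α β : US S R ≃* US S R} (h : α ∈ ringAut S R) (h' : β ∈ ringAut S R) :
    α.trans β ∈ ringAut S R := by
  obtain ⟨ρ, hρ⟩ := h
  obtain ⟨ρ', hρ'⟩ := h'
  refine ⟨ρ.trans ρ', fun u => ?_⟩
  rw [MulEquiv.trans_apply, hρ, hρ', ← usMap_comp]
  rfl

/-- The hypotheses on `(R, σ)` under which the classes of sequences are counted. -/
structure GoodRing (S : Finset ℕ) {R : Type} [CommRing R] (σ : R ≃+* R) : Prop where
  prime : ∀ p ∈ S, p.Prime
  odd : ∀ p ∈ S, p ≠ 2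
  finite : Finite (UR R)
  invol : ∀ u : US S R, usMap S (σ : R →+* R) (usMap S (σ : R →+* R) u) = u
  comm : ∀ (ρ : R ≃+* R) (u : US S R), usMap S (ρ : R →+* R) (usMap S (σ : R →+* R) u) =
    usMap S (σ : R →+* R) (usMap S (ρ : R →+* R) u)

/-- Square roots in groups of odd exponent. -/
lemma exists_sqrt_of_pow {G : Type*} [CommGroup G] {x : G} {n : ℕ} (hn : Odd n) (hx : x ^ n = 1) :
    ∃ k : ℕ, (x ^ k) ^ 2 = x := by
  obtain ⟨k, rfl⟩ := hn
  exact ⟨k + 1, by rw [← pow_mul, show (k + 1) * 2 = (2 * k + 1) + 1 by ring, pow_succ, hx, one_mul]⟩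

variable {σ : R ≃+* R}

lemma GoodRing.finiteU (hG : GoodRing S σ) : Finite (US S R) := by
  have := hG.finite
  infer_instance

lemma GoodRing.exists_sqrt (hG : GoodRing S σ) {G : Type*} [CommGroup G] (hGS : IsSGroup S G)
    (u : G) : ∃ k : ℕ, (u ^ k) ^ 2 = u := by
  obtain ⟨n, hn, hu⟩ := hGS.exists_pow u
  exact exists_sqrt_of_pow (odd_of_isSNumber hG.odd hn) hu

lemma GoodRing.eq_one_of_sq (hG : GoodRing S σ) {G : Type*} [CommGroup G] (hGS : IsSGroup S G)
    {u : G} (h : u ^ 2 = 1) : u = 1 := by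
  obtain ⟨k, hk⟩ := hG.exists_sqrt hGS u
  rw [← hk, ← pow_mul, mul_comm, pow_mul, h, one_pow]

/-- The subgroup `U_-`. -/
def uMinus (S : Finset ℕ) {R : Type} [CommRing R] (σ : R ≃+* R) : Subgroup (US S R) where
  carrier := UMinus S σ
  one_mem' := by change usMap S _ 1 = 1⁻¹; simp
  mul_mem' := by
    intro a b ha hb
    change usMap S _ _ = _
    rw [map_mul, mul_inv, show usMap S _ a = _ from ha, show usMap S _ b = _ from hb]
  inv_mem' := by
    intro a ha
    change usMap S _ _ = _
    rw [map_inv, show usMap S _ a = _ from ha]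

lemma mem_uMinus {u : US S R} : u ∈ uMinus S σ ↔ usMap S (σ : R →+* R) u = u⁻¹ := Iff.rfl

lemma GoodRing.ringAut_comm (hG : GoodRing S σ) {α : US S R ≃* US S R} (h : α ∈ ringAut S R)
    (u : US S R) : α (usMap S (σ : R →+* R) u) = usMap S (σ : R →+* R) (α u) := by
  obtain ⟨ρ, hρ⟩ := h
  rw [hρ, hρ, hG.comm]

lemma GoodRing.ringAut_mem (hG : GoodRing S σ) {α : US S R ≃* US S R} (h : α ∈ ringAut S R)
    {u : US S R} : α u ∈ uMinus S σ ↔ u ∈ uMinus S σ := by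
  rw [mem_uMinus, mem_uMinus, ← hG.ringAut_comm h, ← map_inv, α.injective.eq_iff]

end UGroup

namespace ThetaSeq

variable {S : Finset ℕ} {R : Type} [CommRing R] {σ : R ≃+* R} {Θ Θ' : ThetaSeq S R}

lemma IsIso.map_range {f : Θ.B ≃ₜ* Θ'.B} (h : IsIso Θ Θ' f) :
    Θ.i.range.map (f.toMulEquiv : Θ.B →* Θ'.B) = Θ'.i.range := by
  obtain ⟨-, ρ, hρ⟩ := h
  ext y
  constructor
  · rintro ⟨_, ⟨u, rfl⟩, rfl⟩
    exact ⟨_, (hρ u).symm⟩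
  · rintro ⟨u, rfl⟩
    refine ⟨_, ⟨(usEquiv S ρ).symm u, rfl⟩, ?_⟩
    refine (hρ _).trans (congrArg Θ'.i ?_)
    exact (usEquiv S ρ).apply_symm_apply u

lemma IsIso.mem_range {f : Θ.B ≃ₜ* Θ'.B} (h : IsIso Θ Θ' f) {b : Θ.B} :
    f b ∈ Θ'.i.range ↔ b ∈ Θ.i.range := by
  rw [← h.map_range]
  exact Subgroup.mem_map_iff_mem f.injective

lemma IsIso.isExt (hG : GoodRing S σ) {f : Θ.B ≃ₜ* Θ'.B} (h : IsIso Θ Θ' f) (hΘ : Θ.IsExt σ) :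
    Θ'.IsExt σ := by
  obtain ⟨h1, h2, h3, h4⟩ := hΘ
  have hf := h
  obtain ⟨h5, ρ, hρ⟩ := h
  have hf' : ∀ b, ∃ a, f a = b := f.surjective
  have hu' : ∀ u, ∃ v, usMap S (ρ : R →+* R) v = u := (usEquiv S ρ).surjective
  refine ⟨fun b => ?_, fun u => ?_, fun u v huv => ?_, fun b => ?_⟩
  · obtain ⟨a, rfl⟩ := hf' b
    rw [← h5, ← h5, h1]
  · obtain ⟨v, rfl⟩ := hu' u
    rw [← hρ, ← h5, h2, hρ, hG.comm]
  · obtain ⟨u, rfl⟩ := hu' u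
    obtain ⟨v, rfl⟩ := hu' v
    rw [← hρ, ← hρ] at huv
    rw [h3 (f.injective huv)]
  · obtain ⟨a, rfl⟩ := hf' b
    rw [← h5, ← map_mul]
    exact hf.mem_range.2 (h4 a)

/-- The isomorphism between the right hand terms. -/
def IsIso.cEquiv {f : Θ.B ≃ₜ* Θ'.B} (h : IsIso Θ Θ' f) : Θ.C ≃* Θ'.C :=
  QuotientGroup.congr _ _ f.toMulEquiv h.map_range

lemma equiv_out (Θ : ThetaSeq S R) : ∃ f, IsIso (⟦Θ⟧ : ThetaCls S R).out Θ f :=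
  Quotient.exact (Quotient.out_eq (⟦Θ⟧ : ThetaCls S R))

lemma IsIso.symm {f : Θ.B ≃ₜ* Θ'.B} (h : IsIso Θ Θ' f) : ∃ f', IsIso Θ' Θ f' :=
  (Setoid.symm (show Θ ≈ Θ' from ⟨f, h⟩))

/-- Isomorphic sequences have isomorphic torsion sequences. -/
lemma IsIso.tors {f : Θ.B ≃ₜ* Θ'.B} (h : IsIso Θ Θ' f) : ∃ f', IsIso Θ.tors Θ'.tors f' := by
  obtain ⟨h5, ρ, hρ⟩ := h
  have key : ∀ {G H : Type} [CommGroup G] [CommGroup H] (e : G ≃* H) (x : G), x ∈ sTorsion S G →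
      e x ∈ sTorsion S H := by
    rintro G H _ _ e x ⟨n, hn, hx⟩
    exact ⟨n, hn, by rw [← map_pow, hx, map_one]⟩
  let e : sTorsion S Θ.B ≃* sTorsion S Θ'.B :=
    { toFun := fun x => ⟨f x, key f.toMulEquiv x x.2⟩
      invFun := fun x => ⟨f.symm x, key f.symm.toMulEquiv x x.2⟩
      left_inv := fun x => Subtype.ext (f.symm_apply_apply _)
      right_inv := fun x => Subtype.ext (f.apply_symm_apply _)
      map_mul' := fun x y => Subtype.ext (map_mul f _ _) }
  let e' : Θ.tors.B ≃ₜ* Θ'.tors.B :=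
    { toMulEquiv := e
      continuous_toFun := by
        have : DiscreteTopology Θ.tors.B := ⟨rfl⟩
        exact continuous_of_discreteTopology
      continuous_invFun := by
        have : DiscreteTopology Θ'.tors.B := ⟨rfl⟩
        exact continuous_of_discreteTopology }
  exact ⟨e', fun b => Subtype.ext (h5 _), ρ, fun u => Subtype.ext (hρ u)⟩

lemma mk_tors_out (Θ : ThetaSeq S R) : torsCls (⟦Θ⟧ : ThetaCls S R) = ⟦Θ.tors⟧ := by
  obtain ⟨f, hf⟩ := equiv_out Θ
  exact Quotient.sound hf.tors

lemma mem_compEvent_iff (Θ : ThetaSeq S R) (E : Type) [CommGroup E] :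
    (⟦Θ⟧ : ThetaCls S R) ∈ compEvent S R E ↔ Nonempty ((Θ.C ⧸ divSub Θ.C) ≃* E) := by
  obtain ⟨f, hf⟩ := equiv_out Θ
  have e := quotDivEquiv hf.cEquiv
  exact ⟨fun ⟨x⟩ => ⟨e.symm.trans x⟩, fun ⟨x⟩ => ⟨e.trans x⟩⟩

lemma isSGroup_US : IsSGroup S (US S R) := isSGroup_sTorsion S _

lemma mem_sTorsion_of_mk {Θ : ThetaSeq S R} {b : Θ.B} (h : (b : Θ.C) ∈ sTorsion S Θ.C) :
    b ∈ sTorsion S Θ.B := by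
  obtain ⟨n, hn, hb⟩ := h
  have : b ^ n ∈ Θ.i.range := (eq_one_iff _).1 (by simpa using hb)
  obtain ⟨u, hu⟩ := this
  obtain ⟨k, hk, huk⟩ := isSGroup_US.exists_pow u
  exact ⟨n * k, hn.mul hk, by rw [pow_mul, ← hu, ← map_pow, huk, map_one]⟩

/-- The right hand term of the torsion sequence. -/
def torsCEquiv (Θ : ThetaSeq S R) : Θ.tors.C ≃* sTorsion S Θ.C := by
  let f : Θ.tors.B →* sTorsion S Θ.C := sTorsionMap S (mk' Θ.i.range)
  have hf : Function.Surjective f := by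
    rintro ⟨x, hx⟩
    obtain ⟨b, rfl⟩ := mk_surjective x
    exact ⟨⟨b, mem_sTorsion_of_mk hx⟩, rfl⟩
  have hk : Θ.tors.i.range = f.ker := by
    ext b
    rw [MonoidHom.mem_ker]
    constructor
    · rintro ⟨u, rfl⟩
      exact Subtype.ext ((eq_one_iff _).2 ⟨u, rfl⟩)
    · intro hb
      obtain ⟨u, hu⟩ := (eq_one_iff _).1 (congrArg Subtype.val hb)
      exact ⟨u, Subtype.ext hu⟩
  exact (QuotientGroup.quotientMulEquivOfEq hk).trans
    (quotientKerEquivOfSurjective f hf)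

/-- The value of `π⁰(C(S^∞))`, for a surjection of `C` to a finite group with almost
divisible kernel. -/
lemma mem_compEvent_tors_iff (hS : ∀ p ∈ S, p.Prime) (Θ : ThetaSeq S R) {Q : Type*} [CommGroup Q]
    [Finite Q] (f : Θ.C →* Q) (hf : Function.Surjective f) (hd : AlmostDivisible S f.ker)
    (E : Type) [CommGroup E] :
    (⟦Θ.tors⟧ : ThetaCls S R) ∈ compEvent S R E ↔ Nonempty (sTorsion S Q ≃* E) := by
  rw [mem_compEvent_iff]
  have e := (quotDivEquiv Θ.torsCEquiv).trans (quotDivTorsion hS f hf hd)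
  exact ⟨fun ⟨x⟩ => ⟨e.symm.trans x⟩, fun ⟨x⟩ => ⟨e.trans x⟩⟩

lemma exists_twist (Θ : ThetaSeq S R) (ρ : R ≃+* R) : ∃ (Θ' : ThetaSeq S R) (f : Θ.B ≃ₜ* Θ'.B),
    (∀ b, f (Θ.g b) = Θ'.g (f b)) ∧ ∀ u, f (Θ.i u) = Θ'.i (usMap S (ρ : R →+* R) u) :=
  ⟨{ Θ with i := Θ.i.comp (usMap S (ρ.symm : R →+* R)) }, ContinuousMulEquiv.refl Θ.B,
    fun _ => rfl, fun u => congrArg Θ.i ((usEquiv S ρ).symm_apply_apply u).symm⟩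

end ThetaSeq

/-! ### Extensions attached to a sequence -/

section Ext

variable {S : Finset ℕ} {R : Type} [CommRing R] {E : Type} [CommGroup E]

/-- `SameOrbit` on representatives. -/
def ExtData.Related (Y Y' : ExtData S R E) : Prop :=
  ∃ (f : Y.X ≃* Y'.X) (ρ : R ≃+* R) (β : E ≃* E),
    (∀ x, f (Y.g x) = Y'.g (f x)) ∧ (∀ u, f (Y.i u) = Y'.i (usMap S (ρ : R →+* R) u)) ∧
    ∀ x, Y'.p (f x) = β (Y.p x)

lemma ExtData.Related.trans {Y Y' Y'' : ExtData S R E} (h : Y.Related Y') (h' : Y'.Related Y'') :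
    Y.Related Y'' := by
  obtain ⟨f, ρ, β, h1, h2, h3⟩ := h
  obtain ⟨f', ρ', β', h1', h2', h3'⟩ := h'
  refine ⟨f.trans f', ρ.trans ρ', β.trans β', fun x => ?_, fun u => ?_, fun x => ?_⟩
  · simp [h1, h1']
  · rw [MulEquiv.trans_apply, h2, h2', ← usMap_comp]; rfl
  · simp [h3, h3']

lemma ExtData.Related.symm {Y Y' : ExtData S R E} (h : Y.Related Y') : Y'.Related Y := by
  obtain ⟨f, ρ, β, h1, h2, h3⟩ := h
  refine ⟨f.symm, ρ.symm, β.symm, fun x => ?_, fun u => ?_, fun x => ?_⟩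
  · apply f.injective; rw [h1]; simp
  · apply f.injective
    rw [h2]
    rw [f.apply_symm_apply]
    exact congrArg Y'.i ((usEquiv S ρ).apply_symm_apply u).symm
  · apply β.injective; rw [← h3]; simp

lemma ExtData.related_of_equiv {Y Y' : ExtData S R E} (h : Y ≈ Y') : Y.Related Y' := by
  obtain ⟨f, h1, h2, h3⟩ := h
  exact ⟨f, RingEquiv.refl R, MulEquiv.refl E, h1, fun u => (h2 u).trans
    (congrArg Y'.i (usMap_id S u).symm), h3⟩

lemma ExtData.related_refl (Y : ExtData S R E) : Y.Related Y :=
  ExtData.related_of_equiv (Setoid.refl Y)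

lemma ExtData.out_equiv (Y : ExtData S R E) : (⟦Y⟧ : ExtCls S R E).out ≈ Y :=
  Quotient.exact (Quotient.out_eq _)

lemma sameOrbit_mk_iff (Y Y' : ExtData S R E) :
    SameOrbit (⟦Y⟧ : ExtCls S R E) ⟦Y'⟧ ↔ Y.Related Y' := by
  have h1 := ExtData.related_of_equiv Y.out_equiv
  have h2 := ExtData.related_of_equiv Y'.out_equiv
  exact ⟨fun h => h1.symm.trans (ExtData.Related.trans h h2), fun h => h1.trans (h.trans h2.symm)⟩

lemma sameOrbit_refl (ε : ExtCls S R E) : SameOrbit ε ε := ε.out.related_refl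

lemma SameOrbit.symm {ε ε' : ExtCls S R E} (h : SameOrbit ε ε') : SameOrbit ε' ε :=
  ExtData.Related.symm h

lemma Realizes.related {Θ Θ' : ThetaSeq S R} {Y Y' : ExtData S R E} (h : Realizes Θ Y)
    (h' : Realizes Θ' Y') {f : Θ.B ≃ₜ* Θ'.B} (hf : ThetaSeq.IsIso Θ Θ' f) : Y.Related Y' := by
  obtain ⟨q, hq, hk, hg, hi, hp, hpk⟩ := h
  obtain ⟨q', hq', hk', hg', hi', hp', hpk'⟩ := h'
  have hdB : (divSub Θ.B).map (f.toMulEquiv : Θ.B →* Θ'.B) = divSub Θ'.B := divSub_map f.toMulEquiv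
  have hdC : (divSub Θ.C).map (hf.cEquiv : Θ.C →* Θ'.C) = divSub Θ'.C := divSub_map hf.cEquiv
  have h1 : ∀ b, q' (f b) = 1 ↔ q b = 1 := fun b => by
    rw [← MonoidHom.mem_ker, hk', ← hdB, ← MonoidHom.mem_ker, hk]
    exact Subgroup.mem_map_iff_mem f.injective
  have h2 : ∀ b, Y'.p (q' (f b)) = 1 ↔ Y.p (q b) = 1 := fun b => by
    change f b ∈ (Y'.p.comp q').ker ↔ b ∈ (Y.p.comp q).ker
    rw [hpk, hpk', ← hdC, Subgroup.mem_comap, Subgroup.mem_comap]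
    exact Subgroup.mem_map_iff_mem (f := (hf.cEquiv : Θ.C →* Θ'.C)) (x := (b : Θ.C))
      hf.cEquiv.injective
  obtain ⟨e, he⟩ := exists_mulEquiv_of_ker q (q'.comp f.toMulEquiv) hq (hq'.comp f.surjective) h1
  obtain ⟨β, hβ⟩ := exists_mulEquiv_of_ker (Y.p.comp q) ((Y'.p.comp q').comp f.toMulEquiv) (hp.comp hq)
    ((hp'.comp hq').comp f.surjective) h2
  obtain ⟨h5, ρ, hρ⟩ := hf
  refine ⟨e, ρ, β, fun x => ?_, fun u => ?_, fun x => ?_⟩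
  · obtain ⟨b, rfl⟩ := hq x
    rw [← hg, he, he]
    exact (congrArg q' (h5 b)).trans (hg' _)
  · rw [← hi, he]
    exact (congrArg q' (hρ u)).trans (hi' _)
  · obtain ⟨b, rfl⟩ := hq x
    rw [he]
    exact (hβ b).symm

lemma mem_extEvent_iff {Θ : ThetaSeq S R} {Y : ExtData S R E} (h : Realizes Θ Y)
    (ε : ExtCls S R E) : (⟦Θ⟧ : ThetaCls S R) ∈ extEvent ε ↔ SameOrbit ε ⟦Y⟧ := by
  constructor
  · rintro ⟨Θ', Y', hΘ, rfl, h'⟩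
    obtain ⟨f, hf⟩ := Quotient.exact hΘ
    rw [sameOrbit_mk_iff]
    exact h'.related h hf
  · intro hε
    obtain ⟨Y', rfl⟩ := Quotient.exists_rep ε
    rw [sameOrbit_mk_iff] at hε
    obtain ⟨f, ρ, β, h1, h2, h3⟩ := hε.symm
    obtain ⟨q, hq, hk, hg, hi, hp, hpk⟩ := h
    obtain ⟨Θ', k, hk1, hk2⟩ := Θ.exists_twist ρ
    have hk' : ThetaSeq.IsIso Θ Θ' k := ⟨hk1, ρ, hk2⟩
    have hdB : (divSub Θ.B).map (k.toMulEquiv : Θ.B →* Θ'.B) = divSub Θ'.B :=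
      divSub_map k.toMulEquiv
    have hdC : (divSub Θ.C).map (hk'.cEquiv : Θ.C →* Θ'.C) = divSub Θ'.C := divSub_map hk'.cEquiv
    have hks : ∀ b, ∃ a, k a = b := k.surjective
    let q' : Θ'.B →* Y'.X := ((f : Y.X →* Y'.X).comp q).comp (k.symm.toMulEquiv : Θ'.B →* Θ.B)
    have hq' : ∀ b, q' (k b) = f (q b) := fun b => congrArg (fun x => f (q x)) (k.symm_apply_apply b)
    refine ⟨Θ', Y', (Quotient.sound ⟨k, hk'⟩ : (⟦Θ⟧ : ThetaCls S R) = ⟦Θ'⟧).symm, rfl, q',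
      (f.surjective.comp hq).comp k.symm.surjective, ?_, fun b => ?_, fun u => ?_, ?_, ?_⟩
    · ext b
      obtain ⟨b, rfl⟩ := hks b
      rw [MonoidHom.mem_ker, hq', ← hdB, f.map_eq_one_iff, ← MonoidHom.mem_ker, hk]
      exact (Subgroup.mem_map_iff_mem k.injective).symm
    · obtain ⟨b, rfl⟩ := hks b
      rw [← hk1, hq', hq', hg, h1]
    · obtain ⟨u, rfl⟩ := (usEquiv S ρ).surjective u
      rw [usEquiv_apply, ← hk2, hq', hi, h2]
    · intro x
      obtain ⟨y, hy⟩ := hp (β.symm x)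
      exact ⟨f y, by rw [h3, hy]; simp⟩
    · ext b
      obtain ⟨b, rfl⟩ := hks b
      rw [MonoidHom.mem_ker, MonoidHom.comp_apply, hq', h3, β.map_eq_one_iff, ← MonoidHom.comp_apply,
        ← MonoidHom.mem_ker, hpk, ← hdC, Subgroup.mem_comap, Subgroup.mem_comap]
      exact (Subgroup.mem_map_iff_mem (f := (hk'.cEquiv : Θ.C →* Θ'.C)) (x := (b : Θ.C))
        hk'.cEquiv.injective).symm

/-- `π⁰(C) ≅ E` if the sequence realizes an extension of `E`. -/
lemma extEvent_subset (ε : ExtCls S R E) : extEvent ε ⊆ compEvent S R E := by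
  rintro c ⟨Θ, Y, rfl, -, q, hq, hk, hg, hi, hp, hpk⟩
  rw [ThetaSeq.mem_compEvent_iff]
  have h1 : Θ.i.range ≤ (Y.p.comp q).ker := by
    rw [hpk]
    intro b hb
    rw [Subgroup.mem_comap, show mk' Θ.i.range b = 1 from
      (eq_one_iff b).2 hb]
    exact one_mem _
  let f : Θ.C →* E := QuotientGroup.lift _ (Y.p.comp q) h1
  have hf : Function.Surjective f := fun x => by
    obtain ⟨b, hb⟩ := (hp.comp hq) x
    exact ⟨(b : Θ.C), hb⟩
  have hfk : divSub Θ.C = f.ker := by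
    ext x
    obtain ⟨b, rfl⟩ := mk_surjective x
    change b ∈ (divSub Θ.C).comap (mk' Θ.i.range) ↔ _
    rw [← hpk]
    rfl
  exact ⟨(QuotientGroup.quotientMulEquivOfEq hfk).trans
    (quotientKerEquivOfSurjective f hf)⟩

end Ext

lemma eq_one_of_divisible {T B : Type*} [CommGroup T] [CommGroup B]
    (hT : ∀ n : ℕ, n ≠ 0 → ∀ t : T, ∃ t', t' ^ n = t) (f : T →* B) (H : Subgroup B) [Finite H]
    (h : ∀ t, f t ∈ H) (t : T) : f t = 1 := by
  obtain ⟨t', rfl⟩ := hT (Nat.card H) Nat.card_pos.ne' t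
  have : (⟨f t', h t'⟩ : H) ^ Nat.card H = 1 := pow_card_eq_one'
  rw [map_pow]
  exact congrArg Subtype.val this

/-! ### Presentations of finite abelian groups -/

/-- The elements `e i` generate `E` with defining relations `e i ^ d i = 1`. -/
structure IsPres {ι : Type} [Fintype ι] {E : Type} [CommGroup E] (e : ι → E) (d : ι → ℕ) :
    Prop where
  ne_zero : ∀ i, d i ≠ 0
  rel : ∀ k : ι → ℤ, ∏ i, e i ^ k i = 1 ↔ ∀ i, (d i : ℤ) ∣ k i
  gen : ∀ x, ∃ k : ι → ℤ, ∏ i, e i ^ k i = x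

lemma exists_isPres (E : Type) [CommGroup E] [Finite E] :
    ∃ (ι : Type) (_ : Fintype ι) (e : ι → E) (d : ι → ℕ), IsPres e d ∧ Nat.card E = ∏ i, d i := by
  classical
  obtain ⟨ι, hι, n, hn, ⟨f⟩⟩ := CommGroup.equiv_prod_multiplicative_zmod_of_finite E
  have : ∀ i, NeZero (n i) := fun i => ⟨by have := hn i; omega⟩
  let a : (i : ι) → Multiplicative (ZMod (n i)) := fun i => ofAdd 1
  have key : ∀ k : ι → ℤ, f (∏ i, (f.symm (Pi.mulSingle i (a i))) ^ k i) =
      fun i => ofAdd ((k i : ℤ) : ZMod (n i)) := by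
    intro k
    rw [map_prod]
    simp only [map_zpow, MulEquiv.apply_symm_apply]
    funext j
    rw [Finset.prod_apply, Finset.prod_eq_single j]
    · simp only [Pi.pow_apply, Pi.mulSingle_eq_same, a]
      rw [← ofAdd_zsmul]
      simp
    · intro i _ hij
      simp [Pi.mulSingle_eq_of_ne hij.symm]
    · simp
  refine ⟨ι, hι, fun i => f.symm (Pi.mulSingle i (a i)), n, ⟨fun i => (this i).1, fun k => ?_,
    fun x => ?_⟩, ?_⟩
  · rw [← f.map_eq_one_iff, key]
    constructor
    · intro h i
      exact (ZMod.intCast_zmod_eq_zero_iff_dvd _ _).1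
        (ofAdd.injective ((congrFun h i).trans ofAdd_zero.symm))
    · intro h
      funext i
      rw [(ZMod.intCast_zmod_eq_zero_iff_dvd _ _).2 (h i)]
      rfl
  · choose k hk using fun i => ZMod.intCast_surjective (toAdd (f x i))
    refine ⟨k, f.injective ?_⟩
    rw [key]
    funext i
    rw [hk]
    rfl
  · rw [Nat.card_congr f.toEquiv, Nat.card_pi]
    refine Finset.prod_congr rfl fun i _ => ?_
    exact Nat.card_zmod (n i)

section IsPres

variable {ι : Type} [Fintype ι] {E : Type} [CommGroup E] {e : ι → E} {d : ι → ℕ}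

/-- The homomorphism `ℤ^ι → B` attached to `φ : ι → B`. -/
def powHom {B : Type*} [CommGroup B] (φ : ι → B) : (ι → Multiplicative ℤ) →* B where
  toFun k := ∏ i, φ i ^ (k i).toAdd
  map_one' := by simp
  map_mul' k l := by simp [zpow_add, Finset.prod_mul_distrib]

lemma powHom_apply {B : Type*} [CommGroup B] (φ : ι → B) (k : ι → Multiplicative ℤ) :
    powHom φ k = ∏ i, φ i ^ (k i).toAdd := rfl

lemma map_powHom {B B' : Type*} [CommGroup B] [CommGroup B'] (f : B →* B') (φ : ι → B)
    (k : ι → Multiplicative ℤ) : f (powHom φ k) = powHom (fun i => f (φ i)) k := by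
  simp [powHom_apply, map_prod]

lemma powHom_single [DecidableEq ι] {B : Type*} [CommGroup B] (φ : ι → B) (i : ι) (n : ℤ) :
    powHom φ (Pi.mulSingle i (ofAdd n)) = φ i ^ n := by
  rw [powHom_apply, Finset.prod_eq_single i]
  · simp
  · intro j _ hj
    simp [Pi.mulSingle_eq_of_ne hj]
  · simp

lemma IsPres.surjective (h : IsPres e d) : Function.Surjective (powHom e) := fun x => by
  obtain ⟨k, hk⟩ := h.gen x
  exact ⟨fun i => ofAdd (k i), hk⟩

lemma IsPres.powHom_eq_one (h : IsPres e d) (k : ι → Multiplicative ℤ) :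
    powHom e k = 1 ↔ ∃ l : ι → Multiplicative ℤ, ∀ i, k i = l i ^ d i := by
  rw [powHom_apply, h.rel]
  constructor
  · intro h
    choose l hl using h
    exact ⟨fun i => ofAdd (l i), fun i => toAdd.injective
      (by simp [hl])⟩
  · rintro ⟨l, hl⟩ i
    exact ⟨(l i).toAdd, by rw [hl]; simp⟩

lemma IsPres.pow_eq_one (h : IsPres e d) (i : ι) : e i ^ d i = 1 := by
  classical
  have := (h.powHom_eq_one (Pi.mulSingle i (ofAdd (d i : ℤ)))).2
    ⟨Pi.mulSingle i (ofAdd 1), fun j => ?_⟩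
  · rw [powHom_single] at this
    exact_mod_cast this
  · by_cases hj : j = i
    · subst hj; simp [← ofAdd_nsmul]
    · simp [Pi.mulSingle_eq_of_ne hj]

lemma IsPres.ext_equiv (h : IsPres e d) {Q : Type*} [CommGroup Q] {β β' : E ≃* Q}
    (hβ : ∀ i, β (e i) = β' (e i)) : β = β' := by
  ext x
  obtain ⟨k, rfl⟩ := h.surjective x
  have h1 := map_powHom (β : E →* Q) e k
  have h2 := map_powHom (β' : E →* Q) e k
  simp only [MonoidHom.coe_coe] at h1 h2
  rw [h1, h2]
  simp only [hβ]

end IsPres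

/-! ### Rigidifications of sequences -/

section Datum

variable {S : Finset ℕ} {R : Type} [CommRing R] {σ : R ≃+* R}
  {T : Type} [CommGroup T] [TopologicalSpace T]
  {ι : Type} [Fintype ι] {E : Type} [CommGroup E]

open ThetaSeq

/-- The subgroup of `B` generated by the image of `γ` and of `U_R(S^∞)`. -/
abbrev compOf (Θ : ThetaSeq S R) (γ : T →* Θ.B) : Subgroup Θ.B := γ.range ⊔ Θ.i.range

/-- A one-parameter subgroup of `B` that covers the identity component of `C`,
with period `z`. -/
def IsGen (z : T) (Θ : ThetaSeq S R) (γ : T →* Θ.B) : Prop :=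
  Continuous γ ∧ (∀ t, γ t ∈ Θ.i.range ↔ t ∈ zpowers z) ∧
    Finite (Θ.B ⧸ compOf Θ γ) ∧ IsSGroup S (Θ.B ⧸ compOf Θ γ)

/-- Lifts to `B` of the generators of `E`, for some identification of `E` with the group
of components. -/
def IsLift (e : ι → E) (d : ι → ℕ) (Θ : ThetaSeq S R) (γ : T →* Θ.B) (φ : ι → Θ.B) : Prop :=
  (∀ i, Θ.g (φ i) = (φ i)⁻¹ ∧ φ i ^ d i ∈ Θ.i.range) ∧
    ∃ β : E ≃* Θ.B ⧸ compOf Θ γ, ∀ i, β (e i) = (φ i : Θ.B ⧸ compOf Θ γ)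

/-- A rigidification of `Θ`. -/
abbrev Datum (z : T) (e : ι → E) (d : ι → ℕ) (Θ : ThetaSeq S R) : Type :=
  ringAut S R × (Σ γ : {γ : T →* Θ.B // IsGen z Θ γ}, {φ : ι → Θ.B // IsLift e d Θ γ.1 φ})

/-- The parameters that classify the rigidified sequences. -/
abbrev Param (S : Finset ℕ) {R : Type} [CommRing R] (σ : R ≃+* R) {T : Type} [CommGroup T] (z : T)
    (ι : Type) : Type :=
  {u : US S R // u ∈ uMinus S σ ∧ ∀ n : ℤ, z ^ n = 1 → u ^ n = 1} × (ι → uMinus S σ)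

/-- The datum `δ` has the parameter `p`. -/
def HasParam {z : T} {e : ι → E} {d : ι → ℕ} {Θ : ThetaSeq S R} (δ : Datum z e d Θ)
    (p : Param S σ z ι) : Prop :=
  Θ.i (δ.1.1 p.1.1) = δ.2.1.1 z ∧ ∀ i, Θ.i (δ.1.1 (p.2 i).1) = δ.2.2.1 i ^ d i

lemma IsGen.g_apply (hG : GoodRing S σ) (hT : ∀ n : ℕ, n ≠ 0 → ∀ t : T, ∃ t', t' ^ n = t)
    {z : T} {Θ : ThetaSeq S R} (hΘ : Θ.IsExt σ) (γ : T →* Θ.B) (t : T) :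
    Θ.g (γ t) = (γ t)⁻¹ := by
  have := hG.finiteU
  have : Finite Θ.i.range := Finite.of_surjective _ Θ.i.rangeRestrict_surjective
  have h := eq_one_of_divisible hT (γ * Θ.g.comp γ) Θ.i.range (fun t => hΘ.2.2.2 (γ t)) t
  exact eq_inv_of_mul_eq_one_right h

lemma g_mem_iff {Θ : ThetaSeq S R} (hΘ : Θ.IsExt σ) (u : US S R) :
    Θ.g (Θ.i u) = (Θ.i u)⁻¹ ↔ u ∈ uMinus S σ := by
  rw [hΘ.2.1, ← map_inv, hΘ.2.2.1.eq_iff]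
  rfl

lemma exists_hasParam (hG : GoodRing S σ) (hT : ∀ n : ℕ, n ≠ 0 → ∀ t : T, ∃ t', t' ^ n = t)
    {z : T} {e : ι → E} {d : ι → ℕ} {Θ : ThetaSeq S R} (hΘ : Θ.IsExt σ) (δ : Datum z e d Θ) :
    ∃! p : Param S σ z ι, HasParam δ p := by
  obtain ⟨⟨α, hα⟩, ⟨γ, hγ⟩, ⟨φ, hφ⟩⟩ := δ
  have h1 : γ z ∈ Θ.i.range := (hγ.2.1 z).2 (Subgroup.mem_zpowers z)
  obtain ⟨u, hu⟩ := h1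
  choose h hh using fun i => (hφ.1 i).2
  have hu' : α.symm u ∈ uMinus S σ := by
    rw [← hG.ringAut_mem hα, α.apply_symm_apply, ← g_mem_iff hΘ, hu]
    exact IsGen.g_apply (z := z) hG hT hΘ γ z
  have hz : ∀ n : ℤ, z ^ n = 1 → (α.symm u) ^ n = 1 := fun n hn => by
    rw [← map_zpow, EmbeddingLike.map_eq_one_iff]
    refine hΘ.2.2.1 ?_
    rw [map_zpow, hu, ← map_zpow, hn, map_one, map_one]
  have hh' : ∀ i, α.symm (h i) ∈ uMinus S σ := fun i => by
    rw [← hG.ringAut_mem hα, α.apply_symm_apply, ← g_mem_iff hΘ, hh, map_pow, (hφ.1 i).1, inv_pow]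
  refine ⟨⟨⟨α.symm u, hu', hz⟩, fun i => ⟨α.symm (h i), hh' i⟩⟩, ⟨?_, fun i => ?_⟩, ?_⟩
  · change Θ.i (α (α.symm u)) = γ z
    rw [α.apply_symm_apply, hu]
  · change Θ.i (α (α.symm (h i))) = _
    rw [α.apply_symm_apply, hh]
  · rintro ⟨⟨u', hu1, hu2⟩, h'⟩ ⟨h2, h3⟩
    refine Prod.ext (Subtype.ext ?_) (funext fun i => Subtype.ext ?_)
    · refine α.injective (hΘ.2.2.1 ?_)
      refine h2.trans ?_
      change γ z = Θ.i (α (α.symm u))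
      rw [α.apply_symm_apply, hu]
    · refine α.injective (hΘ.2.2.1 ?_)
      refine (h3 i).trans ?_
      change φ i ^ d i = Θ.i (α (α.symm (h i)))
      rw [α.apply_symm_apply, hh]

/-- The group that covers the middle terms of rigidified sequences. -/
abbrev CovGrp (S : Finset ℕ) (R : Type) [CommRing R] (T ι : Type) : Type :=
  US S R × T × (ι → Multiplicative ℤ)

/-- The covering map of a rigidified sequence. -/
def Datum.cov {z : T} {e : ι → E} {d : ι → ℕ} {Θ : ThetaSeq S R} (δ : Datum z e d Θ) :
    CovGrp S R T ι →* Θ.B :=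
  (Θ.i.comp (δ.1.1 : US S R →* US S R)).coprod (δ.2.1.1.coprod (powHom δ.2.2.1))

lemma Datum.cov_apply {z : T} {e : ι → E} {d : ι → ℕ} {Θ : ThetaSeq S R} (δ : Datum z e d Θ)
    (m : CovGrp S R T ι) :
    δ.cov m = Θ.i (δ.1.1 m.1) * (δ.2.1.1 m.2.1 * powHom δ.2.2.1 m.2.2) := rfl

lemma IsLift.powHom_mem {e : ι → E} {d : ι → ℕ} (hE : IsPres e d) {Θ : ThetaSeq S R}
    {γ : T →* Θ.B} {φ : ι → Θ.B} (h : IsLift e d Θ γ φ) (k : ι → Multiplicative ℤ) :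
    powHom φ k ∈ compOf Θ γ ↔ ∃ l : ι → Multiplicative ℤ, ∀ i, k i = l i ^ d i := by
  obtain ⟨-, β, hβ⟩ := h
  rw [← hE.powHom_eq_one, ← β.map_eq_one_iff]
  have h1 := map_powHom (β : E →* Θ.B ⧸ compOf Θ γ) e k
  have h2 := map_powHom (mk' (compOf Θ γ)) φ k
  simp only [MonoidHom.coe_coe, hβ] at h1
  rw [h1]
  rw [← eq_one_iff]
  exact (iff_of_eq (congrArg (· = 1) h2))

lemma Datum.cov_surjective {z : T} {e : ι → E} {d : ι → ℕ} (hE : IsPres e d) {Θ : ThetaSeq S R}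
    (δ : Datum z e d Θ) : Function.Surjective δ.cov := by
  obtain ⟨⟨α, hα⟩, ⟨γ, hγ⟩, ⟨φ, hφ⟩⟩ := δ
  intro b
  have hφ : IsLift e d Θ γ φ := hφ
  obtain ⟨hφ1, β, hβ⟩ := hφ
  obtain ⟨k, hk⟩ := hE.surjective (β.symm (b : Θ.B ⧸ compOf Θ γ))
  have h1 : ((powHom φ k : Θ.B) : Θ.B ⧸ compOf Θ γ) = b := by
    have h1 := map_powHom (β : E →* Θ.B ⧸ compOf Θ γ) e k
    have h2 := map_powHom (mk' (compOf Θ γ)) φ k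
    simp only [MonoidHom.coe_coe, hβ] at h1
    rw [hk, β.apply_symm_apply] at h1
    exact h2.trans h1.symm
  obtain ⟨_, ⟨t, rfl⟩, _, ⟨u, rfl⟩, h2⟩ := Subgroup.mem_sup.1 (QuotientGroup.eq.1 h1)
  refine ⟨(α.symm u, t, k), ?_⟩
  rw [Datum.cov_apply]
  change Θ.i (α (α.symm u)) * (γ t * powHom φ k) = b
  rw [α.apply_symm_apply, ← mul_assoc, mul_comm (Θ.i u), h2]
  simp

lemma Datum.cov_eq_one_iff {z : T} {e : ι → E} {d : ι → ℕ} (hE : IsPres e d) {Θ : ThetaSeq S R}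
    (hΘ : Θ.IsExt σ) (δ : Datum z e d Θ) {p : Param S σ z ι} (hp : HasParam δ p)
    (m : CovGrp S R T ι) :
    δ.cov m = 1 ↔ ∃ (n : ℤ) (l : ι → Multiplicative ℤ), m.2.1 = z ^ n ∧
      (∀ i, m.2.2 i = l i ^ d i) ∧ m.1 * (p.1.1 ^ n * powHom (fun i => (p.2 i).1) l) = 1 := by
  obtain ⟨v, t, k⟩ := m
  obtain ⟨⟨α, hα⟩, ⟨γ, hγ⟩, ⟨φ, hφ⟩⟩ := δ
  have hz : Θ.i (α p.1.1) = γ z := hp.1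
  have hd : ∀ i, Θ.i (α (p.2 i).1) = φ i ^ d i := hp.2
  rw [Datum.cov_apply]
  change Θ.i (α v) * (γ t * powHom φ k) = 1 ↔ ∃ (n : ℤ) (l : ι → Multiplicative ℤ), t = z ^ n ∧
      (∀ i, k i = l i ^ d i) ∧ v * (p.1.1 ^ n * powHom (fun i => (p.2 i).1) l) = 1
  have key : ∀ (n : ℤ) (l : ι → Multiplicative ℤ), t = z ^ n → (∀ i, k i = l i ^ d i) →
      Θ.i (α v) * (γ t * powHom φ k) =
        Θ.i (α (v * (p.1.1 ^ n * powHom (fun i => (p.2 i).1) l))) := by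
    intro n l ht hk
    have h1 : powHom φ k = Θ.i (α (powHom (fun i => (p.2 i).1) l)) := by
      have := map_powHom (Θ.i.comp (α : US S R →* US S R)) (fun i => (p.2 i).1) l
      refine Eq.trans ?_ this.symm
      rw [powHom_apply, powHom_apply]
      refine Finset.prod_congr rfl fun i _ => ?_
      change _ = (Θ.i (α (p.2 i).1)) ^ _
      rw [hd, hk, toAdd_pow, nsmul_eq_mul, zpow_mul, zpow_natCast]
    rw [h1, ht, map_zpow, ← hz]
    simp only [map_mul, map_zpow]
  constructor
  · intro h
    have h1 : powHom φ k ∈ compOf Θ γ := by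
      have : powHom φ k = (γ t)⁻¹ * Θ.i (α v)⁻¹ := by
        rw [map_inv, ← mul_inv, ← mul_eq_one_iff_eq_inv, ← h]
        simp only [mul_assoc, mul_comm, mul_left_comm]
      rw [this]
      exact Subgroup.mul_mem_sup (γ.range.inv_mem ⟨t, rfl⟩) ⟨_, rfl⟩
    obtain ⟨l, hl⟩ := (hφ.powHom_mem hE k).1 h1
    have h2 : t ∈ zpowers z := by
      rw [← hγ.2.1]
      have h3 : powHom φ k ∈ Θ.i.range := by
        rw [powHom_apply]
        refine Subgroup.prod_mem _ fun i _ => ?_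
        rw [hl, toAdd_pow, nsmul_eq_mul, zpow_mul, zpow_natCast]
        exact Subgroup.zpow_mem _ (hφ.1 i).2 _
      have h4 : γ t = (powHom φ k)⁻¹ * Θ.i (α v)⁻¹ := by
        rw [map_inv, ← mul_inv, ← mul_eq_one_iff_eq_inv, ← h]
        simp only [mul_comm, mul_left_comm]
      rw [h4]
      exact mul_mem (inv_mem h3) ⟨_, rfl⟩
    obtain ⟨n, hn⟩ := h2
    refine ⟨n, l, hn.symm, hl, ?_⟩
    rw [key n l hn.symm hl] at h
    exact α.map_eq_one_iff.1 (hΘ.2.2.1 (h.trans (map_one _).symm))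
  · rintro ⟨n, l, ht, hk, h⟩
    rw [key n l ht hk, h, map_one, map_one]

/-- The discrete topology on `U_R(S^∞)`. -/
abbrev usTop (S : Finset ℕ) (R : Type) [CommRing R] : TopologicalSpace (US S R) := ⊥

attribute [local instance] usTop

instance : DiscreteTopology (US S R) := ⟨rfl⟩

lemma Datum.isOpenQuotientMap [IsTopologicalGroup T] [SigmaCompactSpace T] (hG : GoodRing S σ)
    {z : T} {e : ι → E}
    {d : ι → ℕ} (hE : IsPres e d) {Θ : ThetaSeq S R} [CompactSpace Θ.B] [T2Space Θ.B]
    (δ : Datum z e d Θ) : IsOpenQuotientMap δ.cov := by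
  have := hG.finiteU
  have hc : Continuous δ.cov := by
    have h1 : Continuous (powHom δ.2.2.1) := continuous_of_discreteTopology
    have h2 : Continuous (Θ.i.comp (δ.1.1 : US S R →* US S R)) := continuous_of_discreteTopology
    have h3 := δ.2.1.2.1
    exact (h2.comp continuous_fst).mul ((h3.comp (continuous_fst.comp continuous_snd)).mul
      (h1.comp (continuous_snd.comp continuous_snd)))
  have : IsTopologicalGroup (US S R) := by
    exact { continuous_mul := continuous_of_discreteTopology
            continuous_inv := continuous_of_discreteTopology }
  refine ⟨δ.cov_surjective hE, hc, ?_⟩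
  have : SigmaCompactSpace (Multiplicative ℤ) :=
    SigmaCompactSpace.of_countable (Set.range fun x : Multiplicative ℤ => {x})
      (Set.countable_range _) (by rintro _ ⟨x, rfl⟩; exact isCompact_singleton)
      (by ext; simp)
  exact MonoidHom.isOpenMap_of_sigmaCompact δ.cov (δ.cov_surjective hE) hc

lemma exists_iso_of_hasParam [IsTopologicalGroup T] [SigmaCompactSpace T] (hG : GoodRing S σ)
    (hT : ∀ n : ℕ, n ≠ 0 → ∀ t : T, ∃ t', t' ^ n = t)
    {z : T} {e : ι → E} {d : ι → ℕ} (hE : IsPres e d) {Θ Θ' : ThetaSeq S R}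
    [CompactSpace Θ.B] [T2Space Θ.B] [CompactSpace Θ'.B] [T2Space Θ'.B]
    (hΘ : Θ.IsExt σ) (hΘ' : Θ'.IsExt σ) (δ : Datum z e d Θ) (δ' : Datum z e d Θ')
    {p : Param S σ z ι} (hp : HasParam δ p) (hp' : HasParam δ' p) :
    ∃ f : Θ.B ≃ₜ* Θ'.B, IsIso Θ Θ' f ∧ ∀ m, f (δ.cov m) = δ'.cov m := by
  obtain ⟨f, hf⟩ := exists_mulEquiv_of_ker δ.cov δ'.cov (δ.cov_surjective hE)
    (δ'.cov_surjective hE) (fun m => by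
      rw [δ.cov_eq_one_iff hE hΘ hp, δ'.cov_eq_one_iff hE hΘ' hp'])
  have h1 := δ.isOpenQuotientMap hG hE
  have h2 := δ'.isOpenQuotientMap hG hE
  let F : Θ.B ≃ₜ* Θ'.B :=
    { toMulEquiv := f
      continuous_toFun := by
        refine h1.isQuotientMap.continuous_iff.2 ?_
        convert h2.continuous using 1
        exact funext hf
      continuous_invFun := by
        refine h2.isQuotientMap.continuous_iff.2 ?_
        convert h1.continuous using 1
        exact funext fun m => by
          change f.symm (δ'.cov m) = _
          rw [← hf, f.symm_apply_apply] }
  have hg : ∀ {Θ : ThetaSeq S R} (hΘ : Θ.IsExt σ) (δ : Datum z e d Θ) (m : CovGrp S R T ι),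
      Θ.g (δ.cov m) = δ.cov (usMap S (σ : R →+* R) m.1, m.2.1⁻¹, m.2.2⁻¹) := by
    intro Θ hΘ δ m
    rw [Datum.cov_apply, Datum.cov_apply, map_mul, map_mul, hΘ.2.1, ← hG.ringAut_comm δ.1.2,
      IsGen.g_apply (z := z) hG hT hΘ, map_inv, map_inv]
    congr 2
    rw [map_powHom, powHom_apply, powHom_apply, ← Finset.prod_inv_distrib]
    refine Finset.prod_congr rfl fun i _ => ?_
    rw [(δ.2.2.2.1 i).1, inv_zpow]
  refine ⟨F, ⟨fun b => ?_, ?_⟩, hf⟩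
  · obtain ⟨m, rfl⟩ := δ.cov_surjective hE b
    change f _ = Θ'.g (f _)
    rw [hg hΘ δ, hf, hf, hg hΘ' δ']
  · obtain ⟨ρ, hρ⟩ := ringAut_trans (ringAut_symm δ.1.2) δ'.1.2
    refine ⟨ρ, fun u => ?_⟩
    have h3 := hf (δ.1.1.symm u, 1, 1)
    rw [Datum.cov_apply, Datum.cov_apply] at h3
    simp only [map_one, mul_one, MulEquiv.apply_symm_apply] at h3
    rw [← hρ]
    exact h3

/-- Transport of one-parameter subgroups. -/
lemma IsGen.map {z : T} {Θ Θ' : ThetaSeq S R} {f : Θ.B ≃ₜ* Θ'.B} (hf : IsIso Θ Θ' f)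
    {γ : T →* Θ.B} (hγ : IsGen z Θ γ) :
    ∃ k : Θ.B ⧸ compOf Θ γ ≃* Θ'.B ⧸ compOf Θ' ((f.toMulEquiv : Θ.B →* Θ'.B).comp γ),
      (∀ b : Θ.B, k b = (f b : Θ'.B)) ∧ IsGen z Θ' ((f.toMulEquiv : Θ.B →* Θ'.B).comp γ) := by
  have h1 : (compOf Θ γ).map (f.toMulEquiv : Θ.B →* Θ'.B) =
      compOf Θ' ((f.toMulEquiv : Θ.B →* Θ'.B).comp γ) := by
    rw [Subgroup.map_sup, hf.map_range, MonoidHom.map_range]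
  let k := QuotientGroup.congr _ _ f.toMulEquiv h1
  obtain ⟨h2, h3, h4, h5⟩ := hγ
  refine ⟨k, fun b => rfl, f.continuous.comp h2, fun t => ?_, ?_, h5.of_surjective (k : _ →* _)
    k.surjective⟩
  · rw [← h3]
    exact hf.mem_range
  · exact Finite.of_equiv _ k.toEquiv

lemma exists_datum_map {z : T} {e : ι → E} {d : ι → ℕ} {Θ Θ' : ThetaSeq S R}
    {f : Θ.B ≃ₜ* Θ'.B} (hf : IsIso Θ Θ' f) (δ : Datum z e d Θ) {p : Param S σ z ι}
    (hp : HasParam δ p) :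
    ∃ δ' : Datum z e d Θ', HasParam δ' p ∧ ∀ m, δ'.cov m = f (δ.cov m) := by
  obtain ⟨⟨α, hα⟩, ⟨γ, hγ⟩, ⟨φ, hφ⟩⟩ := δ
  have hff := hf
  obtain ⟨k, hk, hγ'⟩ := hγ.map hf
  obtain ⟨hg, ρ, hρ⟩ := hf
  have hα' : α.trans (usEquiv S ρ) ∈ ringAut S R := ringAut_trans hα ⟨ρ, fun u => rfl⟩
  have hφ' : IsLift e d Θ' ((f.toMulEquiv : Θ.B →* Θ'.B).comp γ) (fun i => f (φ i)) := by
    obtain ⟨h1, β, hβ⟩ := hφ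
    refine ⟨fun i => ⟨?_, ?_⟩, β.trans k, fun i => ?_⟩
    · rw [← hg, (h1 i).1, map_inv]
    · rw [← map_pow]
      exact hff.mem_range.2 (h1 i).2
    · rw [MulEquiv.trans_apply, hβ, hk]
  refine ⟨⟨⟨_, hα'⟩, ⟨_, hγ'⟩, ⟨_, hφ'⟩⟩, ⟨?_, fun i => ?_⟩, fun m => ?_⟩
  · change Θ'.i (usMap S (ρ : R →+* R) (α p.1.1)) = f (γ z)
    rw [← hρ]
    exact congrArg f hp.1
  · change Θ'.i (usMap S (ρ : R →+* R) (α (p.2 i).1)) = f (φ i) ^ d i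
    rw [← hρ, ← map_pow]
    exact congrArg f (hp.2 i)
  · rw [Datum.cov_apply, Datum.cov_apply, map_mul, map_mul]
    refine congrArg₂ (· * ·) (hρ _).symm (congrArg₂ (· * ·) rfl ?_)
    exact (map_powHom (f.toMulEquiv : Θ.B →* Θ'.B) φ m.2.2).symm

lemma Datum.ext_cov {z : T} {e : ι → E} {d : ι → ℕ} {Θ : ThetaSeq S R} (hΘ : Θ.IsExt σ)
    {δ δ' : Datum z e d Θ} (h : ∀ m, δ.cov m = δ'.cov m) : δ = δ' := by
  classical
  obtain ⟨⟨α, hα⟩, ⟨γ, hγ⟩, ⟨φ, hφ⟩⟩ := δ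
  obtain ⟨⟨α', hα'⟩, ⟨γ', hγ'⟩, ⟨φ', hφ'⟩⟩ := δ'
  simp only [Datum.cov_apply] at h
  obtain rfl : α = α' := by
    ext1 u
    have := h (u, 1, 1)
    simp only [map_one, mul_one] at this
    exact hΘ.2.2.1 this
  obtain rfl : γ = γ' := by
    ext t
    have := h (1, t, 1)
    simpa only [map_one, mul_one, one_mul] using this
  obtain rfl : φ = φ' := by
    funext i
    have := h (1, 1, Pi.mulSingle i (ofAdd 1))
    simpa only [map_one, one_mul, powHom_single, zpow_one] using this
  rfl

lemma nonempty_hasParam_equiv [IsTopologicalGroup T] [SigmaCompactSpace T] (hG : GoodRing S σ)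
    (hT : ∀ n : ℕ, n ≠ 0 → ∀ t : T, ∃ t', t' ^ n = t)
    {z : T} {e : ι → E} {d : ι → ℕ} (hE : IsPres e d) {Θ : ThetaSeq S R}
    [CompactSpace Θ.B] [T2Space Θ.B] (hΘ : Θ.IsExt σ) (δ : Datum z e d Θ)
    {p : Param S σ z ι} (hp : HasParam δ p) :
    Nonempty ({δ : Datum z e d Θ // HasParam δ p} ≃ {f : Θ.B ≃ₜ* Θ.B // IsIso Θ Θ f}) := by
  choose F hF hF' using fun f : {f : Θ.B ≃ₜ* Θ.B // IsIso Θ Θ f} => exists_datum_map f.2 δ hp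
  refine ⟨(Equiv.ofBijective (fun f => (⟨F f, hF f⟩ :
    {δ : Datum z e d Θ // HasParam δ p})) ⟨fun f f' h => ?_, ?_⟩).symm⟩
  · refine Subtype.ext (DFunLike.ext _ _ fun b => ?_)
    obtain ⟨m, rfl⟩ := δ.cov_surjective hE b
    rw [← hF', ← hF', show F f = F f' from congrArg Subtype.val h]
  · rintro ⟨δ', hδ'⟩
    obtain ⟨f, hf, hf'⟩ := exists_iso_of_hasParam hG hT hE hΘ hΘ δ δ' hp hδ'
    refine ⟨⟨f, hf⟩, Subtype.ext (Datum.ext_cov hΘ fun m => ?_)⟩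
    rw [hF', hf']

/-- Counting rigidifications by their parameters. -/
lemma card_datum [IsTopologicalGroup T] [SigmaCompactSpace T] (hG : GoodRing S σ)
    (hT : ∀ n : ℕ, n ≠ 0 → ∀ t : T, ∃ t', t' ^ n = t)
    {z : T} {e : ι → E} {d : ι → ℕ} (hE : IsPres e d) {Θ : ThetaSeq S R}
    [CompactSpace Θ.B] [T2Space Θ.B] (hΘ : Θ.IsExt σ) :
    Nat.card (Datum z e d Θ) =
      Nat.card {p : Param S σ z ι // ∃ δ : Datum z e d Θ, HasParam δ p} * Θ.autCard := by
  choose P hP hP' using fun δ : Datum z e d Θ => exists_hasParam hG hT hΘ δ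
  rw [autCard, ← Nat.card_prod]
  let Q := {p : Param S σ z ι // ∃ δ : Datum z e d Θ, HasParam δ p}
  have h1 : Datum z e d Θ ≃ Σ q : Q, {δ : Datum z e d Θ // HasParam δ q.1} :=
    { toFun := fun δ => ⟨⟨P δ, δ, hP δ⟩, δ, hP δ⟩
      invFun := fun x => x.2.1
      left_inv := fun δ => rfl
      right_inv := by
        rintro ⟨⟨q, hq⟩, δ, hδ⟩
        obtain rfl : q = P δ := hP' δ q hδ
        rfl }
  have h2 : ∀ q : Q, Nonempty ({δ : Datum z e d Θ // HasParam δ q.1} ≃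
      {f : Θ.B ≃ₜ* Θ.B // IsIso Θ Θ f}) := by
    rintro ⟨q, δ, hδ⟩
    exact nonempty_hasParam_equiv hG hT hE hΘ δ hδ
  exact Nat.card_congr (h1.trans ((Equiv.sigmaCongrRight fun q => (h2 q).some).trans
    (Equiv.sigmaEquivProd _ _)))

end Datum

section CountLifts

variable {S : Finset ℕ} {R : Type} [CommRing R] {σ : R ≃+* R}
  {T : Type} [CommGroup T] [TopologicalSpace T]
  {ι : Type} [Fintype ι] {E : Type} [CommGroup E]

open ThetaSeq

/-- The lifts to `B` of an element of the group of components on which the generator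
of `C₂` acts by inversion and whose `n`-th power comes from `U_R(S^∞)`. -/
abbrev LiftFibre (Θ : ThetaSeq S R) (γ : T →* Θ.B) (n : ℕ) (x : Θ.B ⧸ compOf Θ γ) : Type :=
  {b : Θ.B // (Θ.g b = b⁻¹ ∧ b ^ n ∈ Θ.i.range) ∧ x = (b : Θ.B ⧸ compOf Θ γ)}

lemma nonempty_liftFibre (hG : GoodRing S σ) (hT : ∀ n : ℕ, n ≠ 0 → ∀ t : T, ∃ t', t' ^ n = t)
    {Θ : ThetaSeq S R} (hΘ : Θ.IsExt σ) (γ : T →* Θ.B) {n : ℕ} (hn : n ≠ 0)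
    {x : Θ.B ⧸ compOf Θ γ} (hx : x ^ n = 1) : Nonempty (LiftFibre Θ γ n x) := by
  obtain ⟨b, rfl⟩ := mk_surjective x
  rw [← QuotientGroup.mk_pow, eq_one_iff] at hx
  obtain ⟨_, ⟨t, rfl⟩, _, ⟨u, rfl⟩, h⟩ := Subgroup.mem_sup.1 hx
  obtain ⟨t, rfl⟩ := hT n hn t
  let c := b * (γ t)⁻¹
  have hc : c ^ n = Θ.i u := by
    simp only [c, mul_pow, ← h, inv_pow, map_pow]
    exact mul_inv_cancel_comm _ _
  obtain ⟨v, hv⟩ := hΘ.2.2.2 c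
  obtain ⟨r, hr⟩ := hG.exists_sqrt isSGroup_US v
  obtain ⟨w, hw⟩ : ∃ w, w ^ 2 = v := ⟨v ^ r, hr⟩
  have hsv : usMap S (σ : R →+* R) v = v := by
    apply hΘ.2.2.1
    rw [← hΘ.2.1, hv, map_mul, hΘ.1, mul_comm]
  have hsw : usMap S (σ : R →+* R) w = w := by
    have : (usMap S (σ : R →+* R) w * w⁻¹) ^ 2 = 1 := by
      rw [mul_pow, ← map_pow, hw, hsv, inv_pow, hw, mul_inv_cancel]
    exact mul_inv_eq_one.1 (hG.eq_one_of_sq isSGroup_US this)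
  refine ⟨⟨c * (Θ.i w)⁻¹, ⟨?_, ?_⟩, ?_⟩⟩
  · rw [map_mul, map_inv, hΘ.2.1, hsw, mul_inv, inv_inv, mul_inv_eq_iff_eq_mul, mul_assoc,
      ← map_mul, ← sq, hw, hv]
    simp
  · rw [mul_pow, hc]
    exact mul_mem ⟨u, rfl⟩ (by rw [inv_pow]; exact inv_mem (Subgroup.pow_mem Θ.i.range ⟨w, rfl⟩ n))
  · refine QuotientGroup.eq.2 ?_
    have : b⁻¹ * (c * (Θ.i w)⁻¹) = (γ t)⁻¹ * (Θ.i w)⁻¹ := by simp [c, mul_assoc]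
    rw [this]
    exact Subgroup.mul_mem_sup (inv_mem ⟨t, rfl⟩) (inv_mem ⟨w, rfl⟩)

lemma nonempty_liftFibre_equiv (hG : GoodRing S σ)
    (hT : ∀ n : ℕ, n ≠ 0 → ∀ t : T, ∃ t', t' ^ n = t)
    {z : T} {Θ : ThetaSeq S R} (hΘ : Θ.IsExt σ) {γ : T →* Θ.B} (hγ : IsGen z Θ γ) {n : ℕ}
    (hn : n ≠ 0) {x : Θ.B ⧸ compOf Θ γ} (hx : x ^ n = 1) :
    Nonempty ({y : T ⧸ zpowers z // y ^ n = 1} × uMinus S σ ≃ LiftFibre Θ γ n x) := by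
  obtain ⟨b, ⟨hb1, hb2⟩, hb3⟩ := nonempty_liftFibre hG hT hΘ γ hn hx
  have hpow : ∀ t : T, γ t ^ n ∈ Θ.i.range ↔ (t : T ⧸ zpowers z) ^ n = 1 := fun t => by
    rw [← map_pow, hγ.2.1, ← QuotientGroup.mk_pow, eq_one_iff]
  have hout : ∀ y : T ⧸ zpowers z, ((y.out : T) : T ⧸ zpowers z) = y :=
    fun y => QuotientGroup.out_eq' y
  refine ⟨Equiv.ofBijective (fun y => ⟨b * (γ y.1.1.out * Θ.i y.2.1), ⟨?_, ?_⟩, ?_⟩) ⟨?_, ?_⟩⟩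
  · rw [map_mul, map_mul, hb1, IsGen.g_apply (z := z) hG hT hΘ, (g_mem_iff hΘ y.2.1).2 y.2.2,
      mul_inv, mul_inv]
  · rw [mul_pow, mul_pow]
    refine mul_mem hb2 (mul_mem ((hpow _).2 ?_) (Subgroup.pow_mem Θ.i.range ⟨_, rfl⟩ n))
    rw [hout, y.1.2]
  · rw [hb3]
    refine QuotientGroup.eq.2 ?_
    rw [inv_mul_cancel_left]
    exact Subgroup.mul_mem_sup ⟨_, rfl⟩ ⟨_, rfl⟩
  · rintro ⟨⟨y, hy⟩, ⟨u, hu⟩⟩ ⟨⟨y', hy'⟩, ⟨u', hu'⟩⟩ h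
    have h : γ y.out * Θ.i u = γ y'.out * Θ.i u' := mul_left_cancel (congrArg Subtype.val h)
    have h1 : γ (y.out⁻¹ * y'.out) = Θ.i (u * u'⁻¹) := by
      rw [map_mul, map_inv, map_mul, map_inv, inv_mul_eq_iff_eq_mul, ← mul_assoc, h,
        mul_inv_cancel_right]
    have h2 : y = y' := by
      rw [← hout y, ← hout y']
      exact QuotientGroup.eq.2 ((hγ.2.1 _).1 ⟨_, h1.symm⟩)
    subst h2
    have h3 : u = u' := hΘ.2.2.1 (mul_left_cancel h)
    subst h3
    rfl
  · rintro ⟨c, ⟨hc1, hc2⟩, hc3⟩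
    have h1 : b⁻¹ * c ∈ compOf Θ γ := QuotientGroup.eq.1 (hb3.symm.trans hc3)
    obtain ⟨_, ⟨t, rfl⟩, _, ⟨u, rfl⟩, h⟩ := Subgroup.mem_sup.1 h1
    have hu : u ∈ uMinus S σ := by
      rw [← g_mem_iff hΘ]
      have : Θ.i u = (γ t)⁻¹ * (b⁻¹ * c) := by rw [← h, inv_mul_cancel_left]
      rw [this, map_mul, map_mul, map_inv, map_inv, hb1, hc1, IsGen.g_apply (z := z) hG hT hΘ]
      simp [mul_comm]
    have ht : γ t ^ n ∈ Θ.i.range := by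
      have : γ t = b⁻¹ * c * (Θ.i u)⁻¹ := by rw [← h, mul_inv_cancel_right]
      rw [this, mul_pow, mul_pow, inv_pow, inv_pow]
      exact mul_mem (mul_mem (inv_mem hb2) hc2) (inv_mem (Subgroup.pow_mem Θ.i.range ⟨_, rfl⟩ n))
    obtain ⟨v, hv⟩ : γ ((t : T ⧸ zpowers z).out⁻¹ * t) ∈ Θ.i.range :=
      (hγ.2.1 _).2 (QuotientGroup.eq.1 (hout _))
    have hv' : v ∈ uMinus S σ := by
      rw [← g_mem_iff hΘ, hv]
      exact IsGen.g_apply (z := z) hG hT hΘ _ _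
    refine ⟨⟨⟨(t : T ⧸ zpowers z), (hpow t).1 ht⟩, ⟨v * u, mul_mem hv' hu⟩⟩,
      Subtype.ext ?_⟩
    change b * (γ (t : T ⧸ zpowers z).out * Θ.i (v * u)) = c
    rw [map_mul, hv, map_mul, map_inv, ← mul_assoc (γ _), mul_inv_cancel_left, h,
      mul_inv_cancel_left]

lemma nonempty_isLift_equiv (hG : GoodRing S σ)
    (hT : ∀ n : ℕ, n ≠ 0 → ∀ t : T, ∃ t', t' ^ n = t)
    {z : T} {e : ι → E} {d : ι → ℕ} (hE : IsPres e d) {Θ : ThetaSeq S R} (hΘ : Θ.IsExt σ)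
    {γ : T →* Θ.B} (hγ : IsGen z Θ γ) (k : E ≃* Θ.B ⧸ compOf Θ γ) :
    Nonempty ((E ≃* E) × (∀ i, {y : T ⧸ zpowers z // y ^ d i = 1} × uMinus S σ) ≃
      {φ : ι → Θ.B // IsLift e d Θ γ φ}) := by
  have h1 : ∀ (β : E ≃* Θ.B ⧸ compOf Θ γ) (i : ι), β (e i) ^ d i = 1 := fun β i => by
    rw [← map_pow, hE.pow_eq_one, map_one]
  have h2 := fun (β : E ≃* Θ.B ⧸ compOf Θ γ) (i : ι) =>
    nonempty_liftFibre_equiv hG hT hΘ hγ (hE.ne_zero i) (h1 β i)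
  have e1 : (E ≃* E) ≃ (E ≃* Θ.B ⧸ compOf Θ γ) :=
    { toFun := fun a => a.trans k
      invFun := fun b => b.trans k.symm
      left_inv := fun a => by ext; simp
      right_inv := fun b => by ext; simp }
  have e2 : (Σ β : E ≃* Θ.B ⧸ compOf Θ γ, ∀ i, LiftFibre Θ γ (d i) (β (e i))) ≃
      {φ : ι → Θ.B // IsLift e d Θ γ φ} := by
    refine Equiv.ofBijective (fun x => ⟨fun i => (x.2 i).1, fun i => (x.2 i).2.1, x.1,
      fun i => (x.2 i).2.2⟩) ⟨?_, ?_⟩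
    · rintro ⟨β, f⟩ ⟨β', f'⟩ h
      have h : ∀ i, (f i).1 = (f' i).1 := fun i => congrFun (congrArg Subtype.val h) i
      obtain rfl : β = β' := hE.ext_equiv fun i => by rw [(f i).2.2, (f' i).2.2, h]
      obtain rfl : f = f' := funext fun i => Subtype.ext (h i)
      rfl
    · rintro ⟨φ, h, β, hβ⟩
      exact ⟨⟨β, fun i => ⟨φ i, h i, hβ i⟩⟩, rfl⟩
  exact ⟨(Equiv.prodCongr e1 (Equiv.refl _)).trans ((Equiv.sigmaEquivProd _ _).symm.trans
    ((Equiv.sigmaCongrRight fun β => Equiv.piCongrRight fun i => (h2 β i).some).trans e2))⟩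

/-- The number of rigidifications of a sequence with group of components `E`. -/
lemma card_datum_eq (hG : GoodRing S σ)
    (hT : ∀ n : ℕ, n ≠ 0 → ∀ t : T, ∃ t', t' ^ n = t)
    {z : T} {e : ι → E} {d : ι → ℕ} (hE : IsPres e d) {Θ : ThetaSeq S R} (hΘ : Θ.IsExt σ)
    (hk : ∀ γ : T →* Θ.B, IsGen z Θ γ → Nonempty (E ≃* Θ.B ⧸ compOf Θ γ)) :
    Nat.card (Datum z e d Θ) = Nat.card (ringAut S R) * (Nat.card {γ : T →* Θ.B // IsGen z Θ γ} *
      (Nat.card (E ≃* E) * ((∏ i, Nat.card {y : T ⧸ zpowers z // y ^ d i = 1}) *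
        Nat.card (uMinus S σ) ^ Fintype.card ι))) := by
  rw [Nat.card_prod]
  congr 1
  rw [Nat.card_congr ((Equiv.sigmaCongrRight fun γ : {γ : T →* Θ.B // IsGen z Θ γ} =>
    (nonempty_isLift_equiv hG hT hE hΘ γ.2 (hk γ.1 γ.2).some).some.symm).trans
      (Equiv.sigmaEquivProd _ _)), Nat.card_prod, Nat.card_prod, Nat.card_pi]
  simp only [Nat.card_prod, Finset.prod_mul_distrib, Finset.prod_const, Finset.card_univ]

end CountLifts

/-! ### Sequences with given parameters -/

section Model

variable {S : Finset ℕ} {R : Type} [CommRing R] {σ : R ≃+* R}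
  {T : Type} [CommGroup T] [TopologicalSpace T]
  {ι : Type} [Fintype ι] {E : Type} [CommGroup E]

open ThetaSeq

attribute [local instance] usTop

instance : IsTopologicalGroup (US S R) where
  continuous_mul := continuous_of_discreteTopology
  continuous_inv := continuous_of_discreteTopology

/-- The relations between the generators of the middle term of a rigidified sequence. -/
def relSub {z : T} (d : ι → ℕ) (p : Param S σ z ι) : Subgroup (CovGrp S R T ι) where
  carrier := {m | ∃ (n : ℤ) (l : ι → Multiplicative ℤ), m.2.1 = z ^ n ∧
    (∀ i, m.2.2 i = l i ^ d i) ∧ m.1 * (p.1.1 ^ n * powHom (fun i => (p.2 i).1) l) = 1}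
  one_mem' := ⟨0, 1, by simp, by simp, by simp⟩
  mul_mem' := by
    rintro ⟨a, b, c⟩ ⟨a', b', c'⟩ ⟨n, l, h1, h2, h3⟩ ⟨n', l', h1', h2', h3'⟩
    refine ⟨n + n', l * l', ?_, fun i => ?_, ?_⟩
    · change b * b' = _
      rw [zpow_add]
      exact congrArg₂ (· * ·) h1 h1'
    · change c i * c' i = (l i * l' i) ^ d i
      rw [mul_pow]
      exact congrArg₂ (· * ·) (h2 i) (h2' i)
    · change a * a' * _ = 1
      rw [zpow_add, map_mul, mul_mul_mul_comm (p.1.1 ^ n), mul_mul_mul_comm a, h3, h3', one_mul]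
  inv_mem' := by
    rintro ⟨a, b, c⟩ ⟨n, l, h1, h2, h3⟩
    refine ⟨-n, l⁻¹, ?_, fun i => ?_, ?_⟩
    · change b⁻¹ = _
      rw [zpow_neg]
      exact congrArg _ h1
    · change (c i)⁻¹ = (l i)⁻¹ ^ d i
      rw [inv_pow]
      exact congrArg _ (h2 i)
    · change a⁻¹ * _ = 1
      rw [zpow_neg, map_inv, ← mul_inv, ← mul_inv, h3, inv_one]

lemma mem_relSub {z : T} {d : ι → ℕ} {p : Param S σ z ι} {m : CovGrp S R T ι} :
    m ∈ relSub d p ↔ ∃ (n : ℤ) (l : ι → Multiplicative ℤ), m.2.1 = z ^ n ∧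
    (∀ i, m.2.2 i = l i ^ d i) ∧ m.1 * (p.1.1 ^ n * powHom (fun i => (p.2 i).1) l) = 1 := Iff.rfl

/-- The action of the generator of `C₂` on the covering group. -/
def covG (S : Finset ℕ) (σ : R ≃+* R) (T ι : Type) [CommGroup T] :
    CovGrp S R T ι →* CovGrp S R T ι :=
  (usMap S (σ : R →+* R)).prodMap ((invMonoidHom : T →* T).prodMap invMonoidHom)

lemma covG_mem {z : T} {d : ι → ℕ} {p : Param S σ z ι} {m : CovGrp S R T ι}
    (hm : m ∈ relSub d p) : covG S σ T ι m ∈ relSub d p := by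
  obtain ⟨n, l, h1, h2, h3⟩ := hm
  refine ⟨-n, l⁻¹, ?_, fun i => ?_, ?_⟩
  · change (m.2.1)⁻¹ = _
    rw [h1, zpow_neg]
  · change (m.2.2 i)⁻¹ = (l i)⁻¹ ^ d i
    rw [h2, inv_pow]
  · change usMap S (σ : R →+* R) m.1 * _ = 1
    have h := congrArg (usMap S (σ : R →+* R)) h3
    rw [map_mul, map_mul, map_one, map_zpow, map_powHom, mem_uMinus.1 p.1.2.1] at h
    simp only [fun i => mem_uMinus.1 (p.2 i).2] at h
    refine Eq.trans ?_ h
    rw [zpow_neg, inv_zpow]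
    congr 2
    rw [powHom_apply, powHom_apply]
    refine Finset.prod_congr rfl fun i _ => ?_
    simp

variable [IsTopologicalGroup T]

/-- The sequence with the parameter `p`. -/
def model {z : T} (d : ι → ℕ) (p : Param S σ z ι) : ThetaSeq S R where
  B := CovGrp S R T ι ⧸ relSub d p
  g := QuotientGroup.map _ _ (covG S σ T ι) fun _ => covG_mem
  g_cont := by
    have h1 : Continuous (usMap S (σ : R →+* R)) := continuous_of_discreteTopology
    have h2 : Continuous (covG S σ T ι) :=
      h1.prodMap (continuous_inv.prodMap continuous_inv)
    exact (continuous_mk.comp h2).quotient_lift _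
  i := (mk' _).comp (MonoidHom.inl _ _)

lemma model_isExt (hG : GoodRing S σ) {z : T} {d : ι → ℕ} (hd : ∀ i, d i ≠ 0)
    (p : Param S σ z ι) : (model d p).IsExt σ := by
  refine ⟨?_, fun u => ?_, ?_, ?_⟩
  · rintro ⟨m⟩
    refine congrArg (QuotientGroup.mk : CovGrp S R T ι → _ ⧸ relSub d p) ?_
    exact Prod.ext (hG.invol _) (Prod.ext (inv_inv _) (inv_inv _))
  · refine congrArg (QuotientGroup.mk : CovGrp S R T ι → _ ⧸ relSub d p) ?_
    exact Prod.ext rfl (Prod.ext inv_one inv_one)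
  · rw [injective_iff_map_eq_one]
    intro u hu
    obtain ⟨n, l, h1, h2, h3⟩ := mem_relSub.1 ((eq_one_iff _).1 hu)
    have hl : l = 1 := funext fun i => by
      have h := congrArg toAdd (h2 i)
      simp only [toAdd_pow, nsmul_eq_mul] at h
      change (0 : ℤ) = _ at h
      exact toAdd.injective (by simpa [hd i] using h.symm)
    rw [hl, map_one, mul_one, p.1.2.2 n h1.symm, mul_one] at h3
    exact h3
  · rintro ⟨m⟩
    refine ⟨m.1 * usMap S (σ : R →+* R) m.1,
      congrArg (QuotientGroup.mk : CovGrp S R T ι → _ ⧸ relSub d p) ?_⟩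
    exact Prod.ext rfl (Prod.ext (mul_inv_cancel _).symm (mul_inv_cancel _).symm)

lemma model_t2 {z : T} (hz : ∀ A : Set T, A ⊆ zpowers z → IsClosed A) (d : ι → ℕ)
    (p : Param S σ z ι) : T2Space (model d p).B := by
  have : IsClosed (relSub d p : Set (CovGrp S R T ι)) := by
    rw [← isOpen_compl_iff, isOpen_iff_mem_nhds]
    rintro ⟨v, t, k⟩ hm
    have h1 : IsClosed {t : T | (v, t, k) ∈ relSub d p} := hz _ (by
      rintro t ⟨n, l, h, -⟩
      exact ⟨n, h.symm⟩)
    have h2 : {t : T | (v, t, k) ∈ relSub d p}ᶜ ∈ 𝓝 t := h1.isOpen_compl.mem_nhds hm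
    have h3 : ({v} ×ˢ ({t : T | (v, t, k) ∈ relSub d p}ᶜ ×ˢ {k}) : Set (CovGrp S R T ι)) ∈
        𝓝 (v, t, k) :=
      prod_mem_nhds (by simp [nhds_discrete]) (prod_mem_nhds h2 (by simp [nhds_discrete]))
    refine Filter.mem_of_superset h3 ?_
    rintro ⟨v', t', k'⟩ ⟨h4, h5, h6⟩
    obtain rfl : v' = v := h4
    obtain rfl : k' = k := h6
    exact h5
  change T2Space (CovGrp S R T ι ⧸ relSub d p)
  infer_instance

lemma model_compact (hG : GoodRing S σ) {z : T}
    (hz : ∃ K : Set T, IsCompact K ∧ ∀ t, ∃ n : ℤ, t * z ^ n ∈ K) {d : ι → ℕ}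
    (hd : ∀ i, d i ≠ 0) (p : Param S σ z ι) : CompactSpace (model d p).B := by
  obtain ⟨K, hK, hKz⟩ := hz
  have := hG.finiteU
  let L : Set (ι → Multiplicative ℤ) :=
    Set.pi Set.univ fun i => toAdd ⁻¹' Set.Ico (0 : ℤ) (d i)
  have hL : L.Finite := Set.Finite.pi fun i => (Set.finite_Ico _ _).preimage
    toAdd.injective.injOn
  have h1 : IsCompact ((Set.univ : Set (US S R)) ×ˢ (K ×ˢ L)) :=
    (Set.finite_univ.isCompact).prod (hK.prod hL.isCompact)
  have h2 := h1.image (continuous_mk (N := relSub d p))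
  refine ⟨?_⟩
  suffices h : QuotientGroup.mk '' (Set.univ ×ˢ K ×ˢ L) =
      (Set.univ : Set (CovGrp S R T ι ⧸ relSub d p)) from h ▸ h2
  rw [Set.eq_univ_iff_forall]
  rintro ⟨v, t, k⟩
  obtain ⟨n, hn⟩ := hKz t
  let l : ι → Multiplicative ℤ := fun i => ofAdd (-((k i).toAdd / d i))
  refine ⟨(v * (p.1.1 ^ n * powHom (fun i => (p.2 i).1) l)⁻¹, t * z ^ n, fun i => k i * l i ^ d i),
    ⟨Set.mem_univ _, hn, fun i _ => ?_⟩, ?_⟩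
  · have h0 : (0 : ℤ) < d i := by have := hd i; omega
    have : (k i * l i ^ d i).toAdd = (k i).toAdd % d i := by
      simp only [toAdd_mul, toAdd_pow, l, toAdd_ofAdd, nsmul_eq_mul, Int.emod_def]
      ring
    change (k i * l i ^ d i).toAdd ∈ Set.Ico (0 : ℤ) (d i)
    rw [this]
    exact ⟨Int.emod_nonneg _ h0.ne', Int.emod_lt_of_pos _ h0⟩
  · refine (QuotientGroup.eq.2 ?_).symm
    refine ⟨n, l, ?_, fun i => ?_, ?_⟩
    · exact inv_mul_cancel_left _ _
    · exact inv_mul_cancel_left _ _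
    · change v⁻¹ * (v * _) * _ = 1
      rw [inv_mul_cancel_left, inv_mul_cancel]

lemma model_datum {z : T} {e : ι → E} {d : ι → ℕ} [Finite E] (hES : IsSGroup S E)
    (hE : IsPres e d) (p : Param S σ z ι) :
    ∃ δ : Datum z e d (model d p), HasParam δ p := by
  classical
  let q : CovGrp S R T ι →* (model d p).B := mk' (relSub d p)
  have hq : ∀ m, q m = 1 ↔ m ∈ relSub d p := fun m => eq_one_iff _
  let γ : T →* (model d p).B := q.comp ((MonoidHom.inr _ _).comp (MonoidHom.inl _ _))
  let φ : ι → (model d p).B := fun i => q (1, 1, Pi.mulSingle i (ofAdd 1))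
  have hi : ∀ u, (model d p).i u = q (u, 1, 1) := fun u => rfl
  have hγ1 : ∀ t, γ t = q (1, t, 1) := fun t => rfl
  have hγu : ∀ t u, γ t = (model d p).i u ↔ (u⁻¹, t, 1) ∈ relSub d p := fun t u => by
    rw [hγ1, hi, ← hq, ← mul_inv_eq_one, ← map_inv, ← map_mul]
    simp
  have hγ2 : ∀ t, γ t ∈ (model d p).i.range ↔ t ∈ zpowers z := by
    intro t
    constructor
    · rintro ⟨u, hu⟩
      obtain ⟨n, l, h1, -⟩ := (hγu t u).1 hu.symm
      exact ⟨n, h1.symm⟩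
    · rintro ⟨n, rfl⟩
      refine ⟨p.1.1 ^ n, ((hγu _ _).2 ⟨n, 1, rfl, fun i => ?_, ?_⟩).symm⟩
      · exact (one_pow _).symm
      · rw [map_one, mul_one]
        exact inv_mul_cancel _
  have hker : ∀ m ∈ relSub d p, powHom e m.2.2 = 1 := by
    rintro m ⟨n, l, -, h, -⟩
    exact (hE.powHom_eq_one _).2 ⟨l, h⟩
  let π : (model d p).B →* E := QuotientGroup.lift (relSub d p)
    ((powHom e).comp ((MonoidHom.snd _ _).comp (MonoidHom.snd _ _))) hker
  have hπ : ∀ m, π (q m) = powHom e m.2.2 := fun m => rfl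
  have hπs : Function.Surjective π := fun x => by
    obtain ⟨k, hk⟩ := hE.surjective x
    exact ⟨q (1, 1, k), hk⟩
  have hπk : π.ker = compOf (model d p) γ := by
    apply le_antisymm
    · rintro ⟨v, t, k⟩ hb
      obtain ⟨l, hl⟩ := (hE.powHom_eq_one k).1 hb
      refine Subgroup.mem_sup.2 ⟨γ t, ⟨t, rfl⟩,
        (model d p).i (v * powHom (fun i => (p.2 i).1) l), ⟨_, rfl⟩, ?_⟩
      rw [hγ1, hi, ← map_mul]
      refine QuotientGroup.eq.2 ⟨0, l, ?_, fun i => ?_, ?_⟩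
      · change (t * 1)⁻¹ * t = _
        simp
      · change (1 * 1)⁻¹ * k i = _
        simp [hl]
      · change (1 * (v * _))⁻¹ * v * _ = 1
        rw [zpow_zero, one_mul, one_mul, mul_assoc, inv_mul_cancel]
    · refine sup_le ?_ ?_
      · rintro _ ⟨t, rfl⟩
        exact map_one (powHom e)
      · rintro _ ⟨u, rfl⟩
        exact map_one (powHom e)
  obtain ⟨κ, hκ⟩ := exists_mulEquiv_of_ker π (mk' (compOf (model d p) γ)) hπs
    (QuotientGroup.mk'_surjective _) fun b => by
      rw [QuotientGroup.mk'_apply, eq_one_iff, ← hπk]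
      rfl
  have hpow : ∀ i, φ i ^ d i = (model d p).i (p.2 i).1 := by
    intro i
    rw [hi, ← mul_inv_eq_one, ← map_pow, ← map_inv, ← map_mul, hq]
    refine ⟨0, Pi.mulSingle i (ofAdd 1), ?_, fun j => ?_, ?_⟩
    · simp
    · change Pi.mulSingle (M := fun _ => Multiplicative ℤ) i (ofAdd 1) j ^ d i *
        (1 : Multiplicative ℤ)⁻¹ = _
      rw [inv_one, mul_one]
      by_cases hj : j = i
      · rw [hj]
      · simp [Pi.mulSingle_eq_of_ne hj]
    · rw [powHom_single]
      simp
  have hγc : Continuous γ := by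
    have h : Continuous fun t : T => ((1, t, 1) : CovGrp S R T ι) :=
      continuous_const.prodMk (continuous_id.prodMk continuous_const)
    exact continuous_mk.comp h
  have hφg : ∀ i, (model d p).g (φ i) = (φ i)⁻¹ := by
    intro i
    refine Eq.trans (congrArg q ?_) (map_inv q _)
    exact Prod.ext ((map_one (usMap S (σ : R →+* R))).trans inv_one.symm) rfl
  have hφκ : ∀ i, κ (e i) = (φ i : (model d p).B ⧸ compOf (model d p) γ) := by
    intro i
    refine Eq.trans (congrArg κ ?_) (hκ (φ i))
    refine Eq.trans ?_ (hπ _).symm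
    exact ((powHom_single e i 1).trans (zpow_one _)).symm
  have hz : γ z = (model d p).i p.1.1 := by
    refine (hγu _ _).2 ⟨1, 1, (zpow_one z).symm, fun i => (one_pow _).symm, ?_⟩
    change p.1.1⁻¹ * _ = 1
    simp
  exact ⟨⟨⟨MulEquiv.refl _, ringAut_refl⟩, ⟨γ, hγc, hγ2, Finite.of_equiv _ κ.toEquiv,
    hES.of_surjective (κ : _ →* _) κ.surjective⟩, ⟨φ, fun i => ⟨hφg i, _, (hpow i).symm⟩, κ, hφκ⟩⟩,
    hz.symm, fun i => (hpow i).symm⟩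

end Model

open scoped ENNReal

section Measure

variable {S : Finset ℕ} {R : Type} [CommRing R] {σ : R ≃+* R}
  {T : Type} [CommGroup T] [TopologicalSpace T]
  {ι : Type} [Fintype ι] {E : Type} [CommGroup E]

open ThetaSeq

/-- `T` covers the identity components of the groups in `𝒢_cpt^±`, with period `z`. -/
structure IsPeriod (S : Finset ℕ) {R : Type} [CommRing R] (σ : R ≃+* R) (s : QSign) {T : Type}
    [CommGroup T] [TopologicalSpace T] (z : T) (N : ℕ) : Prop where
  div : ∀ n : ℕ, n ≠ 0 → ∀ t : T, ∃ t', t' ^ n = t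
  closed : ∀ A : Set T, A ⊆ zpowers z → IsClosed A
  cocompact : ∃ K : Set T, IsCompact K ∧ ∀ t, ∃ n : ℤ, t * z ^ n ∈ K
  card_tor : ∀ n : ℕ, n ≠ 0 → Nat.card {y : T ⧸ zpowers z // y ^ n = 1} = n ^ s.exp
  ne_zero : N ≠ 0
  card_gen : ∀ Θ : ThetaSeq S R, Θ.IsExt σ → CompactSpace Θ.B → T2Space Θ.B →
    ∀ γ, IsGen z Θ γ → Nat.card {γ : T →* Θ.B // IsGen z Θ γ} = N
  isCpt : ∀ Θ : ThetaSeq S R, Θ.IsCpt σ s ↔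
    Θ.IsExt σ ∧ CompactSpace Θ.B ∧ T2Space Θ.B ∧ ∃ γ : T →* Θ.B, IsGen z Θ γ

lemma mem_compEvent_iff_of_isGen (hS : ∀ p ∈ S, p.Prime)
    (hT : ∀ n : ℕ, n ≠ 0 → ∀ t : T, ∃ t', t' ^ n = t) {z : T} {Θ : ThetaSeq S R} {γ : T →* Θ.B}
    (hγ : IsGen z Θ γ) (E : Type) [CommGroup E] :
    torsCls (⟦Θ⟧ : ThetaCls S R) ∈ compEvent S R E ↔ Nonempty (E ≃* Θ.B ⧸ compOf Θ γ) := by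
  obtain ⟨-, -, hfin, hSG⟩ := hγ
  let f : Θ.C →* Θ.B ⧸ compOf Θ γ := QuotientGroup.map _ _ (MonoidHom.id _) le_sup_right
  have hf : Function.Surjective f := by
    rintro ⟨b⟩
    exact ⟨(b : Θ.C), rfl⟩
  have hk : f.ker = γ.range.map (mk' Θ.i.range) := by
    ext x
    obtain ⟨b, rfl⟩ := mk_surjective x
    constructor
    · intro h
      have h : b ∈ compOf Θ γ := (eq_one_iff b).1 h
      obtain ⟨c, hc, _, ⟨u, rfl⟩, rfl⟩ := Subgroup.mem_sup.1 h
      refine ⟨c, hc, QuotientGroup.eq.2 ?_⟩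
      rw [inv_mul_cancel_left]
      exact ⟨u, rfl⟩
    · rintro ⟨c, hc, hcb⟩
      rw [← hcb]
      exact (eq_one_iff c).2 (Subgroup.mem_sup_left hc)
  have hdiv : IsDiv γ.range := by
    rintro n hn _ ⟨t, rfl⟩
    obtain ⟨t', rfl⟩ := hT n hn t
    exact ⟨γ t', ⟨t', rfl⟩, (map_pow _ _ _).symm⟩
  have h := mem_compEvent_tors_iff hS Θ f hf (hk ▸ (hdiv.map (mk' Θ.i.range)).almostDivisible S) E
  rw [mk_tors_out, h]
  have e : sTorsion S (Θ.B ⧸ compOf Θ γ) ≃* Θ.B ⧸ compOf Θ γ :=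
    (MulEquiv.subgroupCongr (show sTorsion S (Θ.B ⧸ compOf Θ γ) = ⊤ from hSG)).trans
      Subgroup.topEquiv
  exact ⟨fun ⟨x⟩ => ⟨x.symm.trans e⟩, fun ⟨x⟩ => ⟨e.trans x.symm⟩⟩

variable {s : QSign} {z : T} {N : ℕ}

lemma IsPeriod.isCpt_of_isIso (hG : GoodRing S σ) (hP : IsPeriod S σ s z N) {Θ Θ' : ThetaSeq S R}
    {f : Θ.B ≃ₜ* Θ'.B} (hf : IsIso Θ Θ' f) (h : Θ.IsCpt σ s) : Θ'.IsCpt σ s := by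
  obtain ⟨h1, h2, h3, γ, hγ⟩ := (hP.isCpt Θ).1 h
  obtain ⟨k, -, hk⟩ := hγ.map hf
  exact (hP.isCpt Θ').2 ⟨hf.isExt hG h1, f.toHomeomorph.compactSpace, f.toHomeomorph.t2Space,
    _, hk⟩

lemma IsPeriod.out_isCpt (hG : GoodRing S σ) (hP : IsPeriod S σ s z N) {Θ : ThetaSeq S R}
    (h : Θ.IsCpt σ s) : (⟦Θ⟧ : ThetaCls S R).out.IsCpt σ s := by
  obtain ⟨f, hf⟩ := equiv_out Θ
  obtain ⟨f', hf'⟩ := hf.symm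
  exact hP.isCpt_of_isIso hG hf' h

variable [IsTopologicalGroup T]

lemma IsPeriod.model_isCpt (hG : GoodRing S σ) (hP : IsPeriod S σ s z N) {e : ι → E} {d : ι → ℕ}
    [Finite E] (hES : IsSGroup S E) (hE : IsPres e d) (p : Param S σ z ι) :
    (model d p).IsCpt σ s := by
  obtain ⟨δ, -⟩ := model_datum hES hE p
  exact (hP.isCpt _).2 ⟨model_isExt hG hE.ne_zero p, model_compact hG hP.cocompact hE.ne_zero p,
    model_t2 hP.closed d p, δ.2.1.1, δ.2.1.2⟩

variable [SigmaCompactSpace T]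

/-- The class of the sequence with the parameter `p`. -/
abbrev modelCls (d : ι → ℕ) (p : Param S σ z ι) : ThetaCls S R := ⟦model d p⟧

/-- The number of rigidifications of a sequence with `π⁰(C) ≅ E`. -/
def rigCount (S : Finset ℕ) {R : Type} [CommRing R] (σ : R ≃+* R) (s : QSign) (N : ℕ)
    (E : Type) [CommGroup E] (ι : Type) [Fintype ι] : ℕ :=
  Nat.card (ringAut S R) * (N * (Nat.card (E ≃* E) * (Nat.card E ^ s.exp *
        Nat.card (uMinus S σ) ^ Fintype.card ι)))

instance finite_ringAut [Finite (US S R)] : Finite (ringAut S R) := by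
  have : Finite (US S R ≃* US S R) := Finite.of_injective (fun f => (f : US S R → US S R))
    DFunLike.coe_injective
  infer_instance

lemma rigCount_ne_zero (hG : GoodRing S σ) (hN : N ≠ 0) [Finite E] :
    rigCount S σ s N E ι ≠ 0 := by
  have := hG.finiteU
  have : Nonempty (ringAut S R) := ⟨⟨_, ringAut_refl⟩⟩
  have : Finite (E ≃* E) := Finite.of_injective (fun f => (f : E → E)) DFunLike.coe_injective
  have h : ∀ (X : Type) [Finite X] [Nonempty X], Nat.card X ≠ 0 := fun X _ _ => Nat.card_pos.ne'
  exact mul_ne_zero (h _) (mul_ne_zero hN (mul_ne_zero (h _) (mul_ne_zero (pow_ne_zero _ (h _))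
    (pow_ne_zero _ (h _)))))

lemma hasParam_iff (hG : GoodRing S σ) (hP : IsPeriod S σ s z N) {e : ι → E} {d : ι → ℕ}
    [Finite E] (hES : IsSGroup S E) (hE : IsPres e d) {Θ : ThetaSeq S R} (hΘ : Θ.IsCpt σ s)
    (p : Param S σ z ι) :
    (∃ δ : Datum z e d Θ, HasParam δ p) ↔ modelCls d p = ⟦Θ⟧ := by
  obtain ⟨h1, h2, h3, -⟩ := (hP.isCpt _).1 hΘ
  obtain ⟨h1', h2', h3', -⟩ := (hP.isCpt _).1 (hP.model_isCpt hG hES hE p)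
  obtain ⟨δ', hδ'⟩ := model_datum hES hE p
  constructor
  · rintro ⟨δ, hδ⟩
    obtain ⟨f, hf, -⟩ := exists_iso_of_hasParam hG hP.div hE h1' h1 δ' δ hδ' hδ
    exact Quotient.sound ⟨f, hf⟩
  · intro h
    obtain ⟨f, hf⟩ : ∃ f, IsIso (model d p) Θ f := Quotient.exact h
    obtain ⟨δ, hδ, -⟩ := exists_datum_map hf δ' hδ'
    exact ⟨δ, hδ⟩

lemma rigCount_eq (hG : GoodRing S σ) (hP : IsPeriod S σ s z N) {e : ι → E} {d : ι → ℕ}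
    [Finite E] (hES : IsSGroup S E) (hE : IsPres e d) (hEd : Nat.card E = ∏ i, d i)
    {Θ : ThetaSeq S R} (hΘ : Θ.IsCpt σ s) (h : torsCls (⟦Θ⟧ : ThetaCls S R) ∈ compEvent S R E) :
    rigCount S σ s N E ι = Nat.card {p : Param S σ z ι // modelCls d p = ⟦Θ⟧} * Θ.autCard := by
  obtain ⟨h1, h2, h3, γ, hγ⟩ := (hP.isCpt _).1 hΘ
  have h4 := card_datum (z := z) hG hP.div hE h1
  rw [card_datum_eq hG hP.div hE h1 fun γ hγ => (mem_compEvent_iff_of_isGen hG.prime hP.div hγ E).1 h,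
    hP.card_gen Θ h1 h2 h3 γ hγ] at h4
  simp only [hasParam_iff hG hP hES hE hΘ] at h4
  rw [← h4, rigCount, hEd, ← Finset.prod_pow]
  simp only [fun i => hP.card_tor (d i) (hE.ne_zero i)]

/-- The weight of a set of classes. -/
def wt (σ : R ≃+* R) (s : QSign) (A : Set (ThetaCls S R)) : ℝ≥0∞ :=
  ∑' c : GCpt S σ s, A.indicator (fun c => (c.out.autCard : ℝ≥0∞)⁻¹) c.1

/-- The classes with `π⁰(C) ≅ E`, for compact sequences. -/
abbrev cptEvent (S : Finset ℕ) (R : Type) [CommRing R] (E : Type) [CommGroup E] :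
    Set (ThetaCls S R) := torsCls ⁻¹' compEvent S R E

lemma modelCls_mem (hG : GoodRing S σ) (hP : IsPeriod S σ s z N) {e : ι → E} {d : ι → ℕ}
    [Finite E] (hES : IsSGroup S E) (hE : IsPres e d) (p : Param S σ z ι) :
    modelCls d p ∈ cptEvent S R E := by
  obtain ⟨δ, -⟩ := model_datum hES hE p
  exact (mem_compEvent_iff_of_isGen hG.prime hP.div δ.2.1.2 E).2
    ⟨(δ.2.2.2.2).choose⟩

instance finite_param [Finite (US S R)] : Finite (Param S σ z ι) := inferInstance

lemma wt_inter (hG : GoodRing S σ) (hP : IsPeriod S σ s z N) {e : ι → E} {d : ι → ℕ}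
    [Finite E] (hES : IsSGroup S E) (hE : IsPres e d) (hEd : Nat.card E = ∏ i, d i)
    (A : Set (ThetaCls S R)) :
    wt σ s (A ∩ cptEvent S R E) =
      Nat.card {p : Param S σ z ι // modelCls d p ∈ A} / rigCount S σ s N E ι := by
  classical
  have := hG.finiteU
  have : Fintype (Param S σ z ι) := Fintype.ofFinite _
  have hW := rigCount_ne_zero (E := E) (ι := ι) (s := s) hG hP.ne_zero
  set W := rigCount S σ s N E ι with hWdef
  have h1 : ∀ c : GCpt S σ s, (A ∩ cptEvent S R E).indicator
      (fun c => (c.out.autCard : ℝ≥0∞)⁻¹) c.1 =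
      ∑ p : Param S σ z ι, if modelCls d p = c.1 ∧ c.1 ∈ A then (W : ℝ≥0∞)⁻¹ else 0 := by
    rintro ⟨c, hc⟩
    by_cases hcA : c ∈ A
    · simp only [hcA, and_true]
      rw [Finset.sum_ite, Finset.sum_const_zero, add_zero, Finset.sum_const, nsmul_eq_mul]
      by_cases hcE : c ∈ cptEvent S R E
      · rw [Set.indicator_of_mem (show c ∈ A ∩ cptEvent S R E from ⟨hcA, hcE⟩)]
        have h := rigCount_eq hG hP hES hE hEd hc (by rw [Quotient.out_eq]; exact hcE)
        rw [Quotient.out_eq, Nat.card_eq_fintype_card, Fintype.card_subtype, ← hWdef] at h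
        set n := (Finset.univ.filter fun p : Param S σ z ι => modelCls d p = c).card
        rw [h] at hW
        have hn : (n : ℝ≥0∞) ≠ 0 := by exact_mod_cast left_ne_zero_of_mul hW
        rw [h, Nat.cast_mul, ENNReal.mul_inv (Or.inl hn) (Or.inl (ENNReal.natCast_ne_top _)),
          ← mul_assoc, ENNReal.mul_inv_cancel hn (ENNReal.natCast_ne_top _), one_mul]
      · rw [Set.indicator_of_notMem (fun h => hcE h.2), Finset.filter_false_of_mem]
        · simp
        · rintro p - rfl
          exact hcE (modelCls_mem hG hP hES hE p)
    · rw [Set.indicator_of_notMem (fun h => hcA h.1)]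
      simp [hcA]
  rw [wt, tsum_congr h1, Summable.tsum_finsetSum fun _ _ => ENNReal.summable]
  have h2 : ∀ p : Param S σ z ι,
      ∑' c : GCpt S σ s, (if modelCls d p = c.1 ∧ c.1 ∈ A then (W : ℝ≥0∞)⁻¹ else 0) =
      if modelCls d p ∈ A then (W : ℝ≥0∞)⁻¹ else 0 := by
    intro p
    let c₀ : GCpt S σ s := ⟨modelCls d p, hP.out_isCpt hG (hP.model_isCpt hG hES hE p)⟩
    rw [tsum_eq_single c₀]
    · simp [c₀]
    · rintro c hc
      rw [if_neg]
      rintro ⟨h, -⟩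
      exact hc (Subtype.ext h.symm)
  rw [Finset.sum_congr rfl fun p _ => h2 p, Finset.sum_ite, Finset.sum_const_zero, add_zero,
    Finset.sum_const, nsmul_eq_mul, div_eq_mul_inv, Nat.card_eq_fintype_card, Fintype.card_subtype]

lemma exists_sCls (hG : GoodRing S σ) (hP : IsPeriod S σ s z N) (c : GCpt S σ s) :
    ∃! E : SCls S, c.1 ∈ cptEvent S R E.rep := by
  obtain ⟨h1, h2, h3, γ, hγ⟩ := (hP.isCpt _).1 c.2
  have hf := hγ.2.2.1
  have key : ∀ E : SCls S, c.1 ∈ cptEvent S R E.rep ↔ Nonempty (E.rep ≃* c.1.out.B ⧸ compOf _ γ) :=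
    fun E => by
      rw [← mem_compEvent_iff_of_isGen hG.prime hP.div hγ, Quotient.out_eq]
      rfl
  simp only [key]
  let E : SGrp S := { carrier := c.1.out.B ⧸ compOf _ γ, sgrp := hγ.2.2.2 }
  refine ⟨⟦E⟧, ?_, fun E' hE' => ?_⟩
  · obtain ⟨x⟩ := (SCls.mk_eq_iff E ⟦E⟧).1 rfl
    exact ⟨x.symm⟩
  · obtain ⟨x⟩ := hE'
    exact ((SCls.mk_eq_iff E E').2 ⟨x.symm⟩).symm

lemma wt_eq_tsum (hG : GoodRing S σ) (hP : IsPeriod S σ s z N) (A : Set (ThetaCls S R)) :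
    wt σ s A = ∑' E : SCls S, wt σ s (A ∩ cptEvent S R E.rep) := by
  simp only [wt]
  rw [ENNReal.tsum_comm]
  refine tsum_congr fun c => ?_
  obtain ⟨E, hE, hE'⟩ := exists_sCls hG hP c
  rw [tsum_eq_single E]
  · by_cases h : c.1 ∈ A
    · rw [Set.indicator_of_mem h,
        Set.indicator_of_mem (show c.1 ∈ A ∩ cptEvent S R E.rep from ⟨h, hE⟩)]
    · rw [Set.indicator_of_notMem h, Set.indicator_of_notMem fun h' => h h'.1]
  · intro E' hne
    rw [Set.indicator_of_notMem]
    exact fun h => hne (hE' E' h.2)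

/-- The total weight divided by the constant of the Cohen–Lenstra measure. -/
def wtConst (S : Finset ℕ) {R : Type} [CommRing R] (σ : R ≃+* R) {T : Type} [CommGroup T] (z : T)
    (N : ℕ) : ℝ≥0∞ :=
  (Nat.card {u : US S R // u ∈ uMinus S σ ∧ ∀ n : ℤ, z ^ n = 1 → u ^ n = 1} : ℝ≥0∞) /
    (Nat.card (ringAut S R) * N : ℕ)

lemma card_param : Nat.card (Param S σ z ι) =
    Nat.card {u : US S R // u ∈ uMinus S σ ∧ ∀ n : ℤ, z ^ n = 1 → u ^ n = 1} *
      Nat.card (uMinus S σ) ^ Fintype.card ι := by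
  rw [Nat.card_prod, Nat.card_pi]
  simp

instance nonempty_param : Nonempty (Param S σ z ι) :=
  ⟨⟨⟨1, one_mem _, fun n _ => one_zpow n⟩, 1⟩⟩

lemma wt_univ_inter (hG : GoodRing S σ) (hP : IsPeriod S σ s z N) [Finite E]
    (hES : IsSGroup S E) : wt σ s (Set.univ ∩ cptEvent S R E) =
      wtConst S σ z N * ((Nat.card E : ℝ≥0∞) ^ s.exp * Nat.card (E ≃* E))⁻¹ := by
  have := hG.finiteU
  obtain ⟨ι, _, e, d, hE, hEd⟩ := exists_isPres E
  have h0 : Nat.card (uMinus S σ) ≠ 0 := Nat.card_pos.ne'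
  have h1 : ((Nat.card (uMinus S σ) ^ Fintype.card ι : ℕ) : ℝ≥0∞) ≠ 0 := by
    exact_mod_cast pow_ne_zero _ h0
  have h2 : Nat.card {p : Param S σ z ι // modelCls d p ∈ Set.univ} = Nat.card (Param S σ z ι) :=
    Nat.card_congr (Equiv.subtypeUnivEquiv fun _ => Set.mem_univ _)
  have h3 : rigCount S σ s N E ι = Nat.card (ringAut S R) * N *
      (Nat.card E ^ s.exp * Nat.card (E ≃* E)) * Nat.card (uMinus S σ) ^ Fintype.card ι := by
    rw [rigCount]; ring
  have h4 := rigCount_ne_zero (E := E) (ι := ι) (s := s) hG hP.ne_zero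
  rw [h3] at h4
  rw [wt_inter hG hP hES hE hEd, h2, card_param, h3, Nat.cast_mul, Nat.cast_mul _ (_ ^ _),
    ENNReal.mul_div_mul_right _ _ h1 (ENNReal.natCast_ne_top _), wtConst, Nat.cast_mul _ (_ * _),
    div_eq_mul_inv, ENNReal.mul_inv, ← mul_assoc, div_eq_mul_inv, Nat.cast_mul (_ ^ _),
    Nat.cast_pow]
  · exact Or.inl (by exact_mod_cast left_ne_zero_of_mul (left_ne_zero_of_mul h4))
  · exact Or.inl (ENNReal.natCast_ne_top _)

lemma wt_univ (hG : GoodRing S σ) (hP : IsPeriod S σ s z N) :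
    wt σ s (Set.univ : Set (ThetaCls S R)) =
      wtConst S σ z N * ENNReal.ofReal (clConst S s) := by
  rw [wt_eq_tsum hG hP, ← tsum_sCls hG.prime, ← ENNReal.tsum_mul_left]
  exact tsum_congr fun E => wt_univ_inter hG hP E.out.sgrp

lemma wtConst_ne_zero (hG : GoodRing S σ) : wtConst S σ z N ≠ 0 := by
  have := hG.finiteU
  have : Nonempty {u : US S R // u ∈ uMinus S σ ∧ ∀ n : ℤ, z ^ n = 1 → u ^ n = 1} :=
    ⟨⟨1, one_mem _, fun n _ => one_zpow n⟩⟩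
  refine ENNReal.div_ne_zero.2 ⟨?_, ENNReal.natCast_ne_top _⟩
  exact_mod_cast Nat.card_pos.ne'

lemma wtConst_ne_top (hG : GoodRing S σ) (hN : N ≠ 0) : wtConst S σ z N ≠ ⊤ := by
  have := hG.finiteU
  have : Nonempty (ringAut S R) := ⟨⟨_, ringAut_refl⟩⟩
  refine ENNReal.div_ne_top (ENNReal.natCast_ne_top _) ?_
  exact_mod_cast mul_ne_zero Nat.card_pos.ne' hN

lemma wt_univ_ne_top (hG : GoodRing S σ) (hP : IsPeriod S σ s z N) :
    wt σ s (Set.univ : Set (ThetaCls S R)) ≠ ⊤ := by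
  rw [wt_univ hG hP]
  exact ENNReal.mul_ne_top (wtConst_ne_top hG hP.ne_zero) ENNReal.ofReal_ne_top

lemma wt_univ_ne_zero (hG : GoodRing S σ) (hP : IsPeriod S σ s z N) :
    wt σ s (Set.univ : Set (ThetaCls S R)) ≠ 0 := by
  rw [wt_univ hG hP]
  exact mul_ne_zero (wtConst_ne_zero hG) (ENNReal.ofReal_pos.2 (clConst_pos hG.prime s)).ne'

lemma autCard_inv_ne_top (hG : GoodRing S σ) (hP : IsPeriod S σ s z N) (c : GCpt S σ s) :
    (c.1.out.autCard : ℝ≥0∞)⁻¹ ≠ ⊤ := by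
  refine ne_top_of_le_ne_top (wt_univ_ne_top hG hP) ?_
  have := ENNReal.le_tsum (f := fun c : GCpt S σ s =>
    (Set.univ : Set (ThetaCls S R)).indicator (fun c => (c.out.autCard : ℝ≥0∞)⁻¹) c.1) c
  simpa [wt] using this

/-- The probability of a class, in `ℝ≥0∞`. -/
lemma probCpt_eq (hG : GoodRing S σ) (hP : IsPeriod S σ s z N) (c : GCpt S σ s) :
    probCpt σ s c = ((wt σ s (Set.univ : Set (ThetaCls S R)))⁻¹ *
      (c.1.out.autCard : ℝ≥0∞)⁻¹).toReal := by
  rw [ENNReal.toReal_mul, ENNReal.toReal_inv, ENNReal.toReal_inv, wt, ENNReal.tsum_toReal_eq]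
  · simp [probCpt]
  · intro c
    simpa using autCard_inv_ne_top hG hP c

lemma measCpt_eq (hG : GoodRing S σ) (hP : IsPeriod S σ s z N) (A : Set (ThetaCls S R)) :
    measCpt σ s A = ((wt σ s (Set.univ : Set (ThetaCls S R)))⁻¹ * wt σ s A).toReal := by
  have h1 := fun c => probCpt_eq hG hP c
  have h2 := wt_univ_ne_zero hG hP
  set M := wt σ s (Set.univ : Set (ThetaCls S R))
  rw [measCpt, wt, ← ENNReal.tsum_mul_left, ENNReal.tsum_toReal_eq]
  · refine tsum_congr fun c => ?_
    by_cases h : c.1 ∈ A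
    · rw [Set.indicator_of_mem h, Set.indicator_of_mem h, h1]
    · rw [Set.indicator_of_notMem h, Set.indicator_of_notMem h]
      simp
  · intro c
    refine ENNReal.mul_ne_top (ENNReal.inv_ne_top.2 h2) ?_
    by_cases h : c.1 ∈ A
    · rw [Set.indicator_of_mem h]
      exact autCard_inv_ne_top hG hP c
    · rw [Set.indicator_of_notMem h]
      exact ENNReal.zero_ne_top

/-- The measure of an event that lies over `E`. -/
lemma measCpt_inter (hG : GoodRing S σ) (hP : IsPeriod S σ s z N) {e : ι → E} {d : ι → ℕ}
    [Finite E] (hES : IsSGroup S E) (hE : IsPres e d) (hEd : Nat.card E = ∏ i, d i)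
    (A : Set (ThetaCls S R)) :
    measCpt σ s (A ∩ cptEvent S R E) = clMeasure S E s *
      ((Nat.card {p : Param S σ z ι // modelCls d p ∈ A} : ℝ) / Nat.card (Param S σ z ι)) := by
  have := hG.finiteU
  have h1 := wt_inter hG hP hES hE hEd Set.univ
  have h2 : Nat.card {p : Param S σ z ι // modelCls d p ∈ Set.univ} = Nat.card (Param S σ z ι) :=
    Nat.card_congr (Equiv.subtypeUnivEquiv fun _ => Set.mem_univ _)
  rw [wt_univ_inter hG hP hES, h2] at h1
  have h1 := congrArg ENNReal.toReal h1
  rw [measCpt_eq hG hP, wt_inter hG hP hES hE hEd, wt_univ hG hP, clMeasure_eq]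
  simp only [ENNReal.toReal_mul, ENNReal.toReal_inv, ENNReal.toReal_div, ENNReal.toReal_natCast,
    ENNReal.toReal_pow, ENNReal.toReal_ofReal (clConst_pos hG.prime s).le] at h1 ⊢
  have hW : (rigCount S σ s N E ι : ℝ) ≠ 0 := by exact_mod_cast rigCount_ne_zero hG hP.ne_zero
  have hPc : (Nat.card (Param S σ z ι) : ℝ) ≠ 0 := by exact_mod_cast Nat.card_pos.ne'
  have hc : (wtConst S σ z N).toReal ≠ 0 :=
    ENNReal.toReal_ne_zero.2 ⟨wtConst_ne_zero hG, wtConst_ne_top hG hP.ne_zero⟩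
  have hcl := (clConst_pos hG.prime s).ne'
  have h3 : ((Nat.card E : ℝ) ^ s.exp * Nat.card (E ≃* E))⁻¹ =
      (wtConst S σ z N).toReal⁻¹ * (Nat.card (Param S σ z ι) / rigCount S σ s N E ι) := by
    rw [← h1, inv_mul_cancel_left₀ hc]
  rw [h3]
  field_simp

lemma measCpt_cptEvent (hG : GoodRing S σ) (hP : IsPeriod S σ s z N) [Finite E]
    (hES : IsSGroup S E) : measCpt σ s (cptEvent S R E) = clMeasure S E s := by
  have := hG.finiteU
  obtain ⟨ι, _, e, d, hE, hEd⟩ := exists_isPres E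
  have h := measCpt_inter hG hP hES hE hEd Set.univ
  have h2 : Nat.card {p : Param S σ z ι // modelCls d p ∈ Set.univ} = Nat.card (Param S σ z ι) :=
    Nat.card_congr (Equiv.subtypeUnivEquiv fun _ => Set.mem_univ _)
  have hPc : (Nat.card (Param S σ z ι) : ℝ) ≠ 0 := by exact_mod_cast Nat.card_pos.ne'
  rwa [Set.univ_inter, h2, div_self hPc, mul_one] at h

/-- An event whose conditional probability does not depend on `E`. -/
lemma measCpt_of_ratio (hG : GoodRing S σ) (hP : IsPeriod S σ s z N) (A : Set (ThetaCls S R))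
    {r : ℝ} (hr : 0 ≤ r) (h : ∀ (E : Type) [CommGroup E] [Finite E], IsSGroup S E →
      measCpt σ s (A ∩ cptEvent S R E) = clMeasure S E s * r) :
    measCpt σ s A = r := by
  have key : wt σ s A = ENNReal.ofReal r * wt σ s (Set.univ : Set (ThetaCls S R)) := by
    rw [wt_eq_tsum hG hP A, wt_eq_tsum hG hP Set.univ, ← ENNReal.tsum_mul_left]
    refine tsum_congr fun E => ?_
    have hm := wt_univ_ne_zero hG hP
    have hm' := wt_univ_ne_top hG hP
    have hle : ∀ A : Set (ThetaCls S R), wt σ s A ≤ wt σ s Set.univ := fun A =>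
      ENNReal.tsum_le_tsum fun c => Set.indicator_le_indicator_of_subset (Set.subset_univ _)
        (fun _ => bot_le) _
    have h1 := h E.rep E.out.sgrp
    rw [← measCpt_cptEvent hG hP E.out.sgrp, ← Set.univ_inter (cptEvent S R E.rep),
      measCpt_eq hG hP, measCpt_eq hG hP, ENNReal.toReal_mul, ENNReal.toReal_mul, mul_assoc] at h1
    have h2 := mul_left_cancel₀ (ENNReal.toReal_ne_zero.2
      ⟨ENNReal.inv_ne_zero.2 hm', ENNReal.inv_ne_top.2 hm⟩) h1
    rw [Set.univ_inter] at h2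
    rw [← ENNReal.ofReal_toReal (ne_top_of_le_ne_top hm' (hle _)), h2,
      ENNReal.ofReal_mul ENNReal.toReal_nonneg, Set.univ_inter,
      ENNReal.ofReal_toReal (ne_top_of_le_ne_top hm' (hle _)), mul_comm]
  rw [measCpt_eq hG hP, key, mul_left_comm, ENNReal.inv_mul_cancel (wt_univ_ne_zero hG hP)
    (wt_univ_ne_top hG hP), mul_one, ENNReal.toReal_ofReal hr]

end Measure

/-! ### One-parameter subgroups -/

/-- The period of the universal covering of the circle. -/
abbrev unitPeriod : Multiplicative ℝ := ofAdd 1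

lemma mem_zpowers_unitPeriod {t : Multiplicative ℝ} :
    t ∈ zpowers unitPeriod ↔ ∃ n : ℤ, t.toAdd = n := by
  rw [Subgroup.mem_zpowers_iff]
  refine exists_congr fun n => ?_
  rw [← ofAdd_zsmul, ← toAdd.injective.eq_iff]
  simp [eq_comm]

instance : PathConnectedSpace (Multiplicative ℝ) := inferInstanceAs (PathConnectedSpace ℝ)
instance : SigmaCompactSpace (Multiplicative ℝ) := inferInstanceAs (SigmaCompactSpace ℝ)

/-- Continuous homomorphisms from `ℝ` lift through quotients by discrete subgroups. -/
lemma exists_lift_hom {G : Type*} [CommGroup G] [TopologicalSpace G] [IsTopologicalGroup G]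
    (H : Subgroup G) [DiscreteTopology H] (f : Multiplicative ℝ →* G ⧸ H) (hf : Continuous f) :
    ∃ γ : Multiplicative ℝ →* G, Continuous γ ∧ ∀ t, (γ t : G ⧸ H) = f t := by
  have cov := (Subgroup.isQuotientCoveringMap_of_comm H ⟨inferInstance⟩).isCoveringMap
  let f' : C(ℝ, G ⧸ H) := ⟨fun t => f (ofAdd t), hf.comp continuous_ofAdd⟩
  obtain ⟨F, ⟨hF0, hF⟩, -⟩ := cov.existsUnique_continuousMap_lifts f' 0 1 (by
    change ((1 : G) : G ⧸ H) = f 1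
    rw [map_one, QuotientGroup.mk_one])
  have hF' : ∀ t, (F t : G ⧸ H) = f (ofAdd t) := fun t => congrFun hF t
  have hc : Continuous fun x : ℝ × ℝ => F (x.1 + x.2) * (F x.1 * F x.2)⁻¹ := by fun_prop
  have hm : ∀ x : ℝ × ℝ, F (x.1 + x.2) * (F x.1 * F x.2)⁻¹ ∈ H := fun x => by
    rw [← eq_one_iff, QuotientGroup.mk_mul, QuotientGroup.mk_inv,
      QuotientGroup.mk_mul, hF', hF', hF', ofAdd_add, map_mul, mul_inv_cancel]
  have hadd : ∀ s t, F (s + t) = F s * F t := fun s t => by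
    have h1 : F (s + t) * (F s * F t)⁻¹ = F (0 + 0) * (F 0 * F 0)⁻¹ :=
      isPreconnected_univ.constant_of_mapsTo (T := (H : Set G)) ⟨inferInstance⟩ hc.continuousOn
        (fun x _ => hm x) (Set.mem_univ (s, t)) (Set.mem_univ (0, 0))
    rw [add_zero, hF0, mul_one, inv_one, mul_one] at h1
    exact mul_inv_eq_one.1 h1
  exact ⟨{ toFun := fun t => F t.toAdd, map_one' := hF0, map_mul' := fun s t => hadd _ _ },
    F.continuous.comp continuous_toAdd, fun t => hF' _⟩

lemma rangeRestrict_eq_one {G H : Type*} [Group G] [Group H] (f : G →* H) (x : G) :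
    f.rangeRestrict x = 1 ↔ f x = 1 := by
  rw [Subtype.ext_iff]
  rfl

/-- A covering of a circle by `ℝ` is unique up to sign. -/
lemma eq_or_eq_inv_of_isOpenMap {Q : Type*} [CommGroup Q] [TopologicalSpace Q]
    [IsTopologicalGroup Q] {γ₀ γ₁ : Multiplicative ℝ →* Q} (h₀ : Continuous γ₀)
    (h₁ : Continuous γ₁) (hk₀ : ∀ t, γ₀ t = 1 ↔ t ∈ zpowers unitPeriod)
    (hk₁ : ∀ t, γ₁ t = 1 ↔ t ∈ zpowers unitPeriod) (ho : IsOpenMap γ₀) :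
    γ₁ = γ₀ ∨ γ₁ = γ₀⁻¹ := by
  have hHo : IsOpen (γ₀.range : Set Q) := by
    rw [MonoidHom.coe_range]
    exact ho.isOpen_range
  have hmem : ∀ t, γ₁ t ∈ γ₀.range := by
    have h1 : IsOpen ((γ₀.range.comap γ₁ : Subgroup (Multiplicative ℝ)) : Set (Multiplicative ℝ)) :=
      hHo.preimage h₁
    have h2 := IsClopen.eq_univ ⟨Subgroup.isClosed_of_isOpen _ h1, h1⟩ ⟨1, one_mem _⟩
    intro t
    exact Set.eq_univ_iff_forall.1 h2 t
  obtain ⟨e, he⟩ := exists_mulEquiv_of_ker γ₀.rangeRestrict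
    (mk' (zpowers unitPeriod)) γ₀.rangeRestrict_surjective
    (QuotientGroup.mk'_surjective _) fun t => by
      rw [QuotientGroup.mk'_apply, eq_one_iff, ← hk₀, rangeRestrict_eq_one]
  have hq : IsOpenQuotientMap γ₀.rangeRestrict :=
    ⟨γ₀.rangeRestrict_surjective, h₀.subtype_mk _, ho.subtype_mk _⟩
  have hec : Continuous e := by
    rw [hq.isQuotientMap.continuous_iff]
    exact (continuous_mk (N := zpowers unitPeriod)).congr
      fun t => (he t).symm
  have hdisc : DiscreteTopology (zpowers unitPeriod) := by
    have : DiscreteTopology (AddSubgroup.zmultiples (1 : ℝ)) := inferInstance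
    exact this
  obtain ⟨F, hFc, hF⟩ := exists_lift_hom (zpowers unitPeriod)
    ((e : γ₀.range →* _).comp (γ₁.codRestrict γ₀.range hmem)) (hec.comp (h₁.subtype_mk _))
  have hF1 : ∀ t, γ₀ (F t) = γ₁ t := fun t => by
    have h1 : e (γ₀.rangeRestrict (F t)) = e (γ₁.codRestrict γ₀.range hmem t) :=
      (he (F t)).trans (hF t)
    exact congrArg Subtype.val (e.injective h1)
  let A : ℝ →+ ℝ :=
    { toFun := fun t => (F (ofAdd t)).toAdd
      map_zero' := by simp
      map_add' := fun s t => by simp }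
  have hAc : Continuous A := continuous_toAdd.comp (hFc.comp continuous_ofAdd)
  have hA : ∀ t, A t = t * A 1 := fun t => by
    have := map_real_smul A hAc t 1
    rwa [smul_eq_mul, mul_one, smul_eq_mul] at this
  have hFA : ∀ t : ℝ, F (ofAdd t) = ofAdd (t * A 1) :=
    fun t => congrArg ofAdd (hA t)
  have h1 : ∀ t : ℝ, (∃ n : ℤ, t * A 1 = n) ↔ ∃ n : ℤ, t = n := fun t => by
    have h2 := hk₁ (ofAdd t)
    rw [← hF1, hFA, hk₀, mem_zpowers_unitPeriod, mem_zpowers_unitPeriod] at h2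
    exact h2
  have hA0 : A 1 ≠ 0 := fun h0 => by
    obtain ⟨n, hn⟩ := (h1 (1 / 2)).1 ⟨0, by simp [h0]⟩
    have h2 : ((1 : ℤ) : ℝ) = ((2 * n : ℤ) : ℝ) := by push_cast; linarith
    have := Int.cast_injective h2
    omega
  obtain ⟨a, ha⟩ := (h1 1).2 ⟨1, by simp⟩
  obtain ⟨b, hb⟩ := (h1 (A 1)⁻¹).1 ⟨1, by simp [hA0]⟩
  rw [one_mul] at ha
  have hab : a * b = 1 := by
    have : ((a * b : ℤ) : ℝ) = ((1 : ℤ) : ℝ) := by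
      push_cast
      rw [← ha, ← hb, mul_inv_cancel₀ hA0]
    exact Int.cast_injective this
  rcases Int.eq_one_or_neg_one_of_mul_eq_one hab with rfl | rfl
  · left
    refine MonoidHom.ext fun t => ?_
    rw [← hF1]
    congr 1
    have := hFA t.toAdd
    rwa [ha, Int.cast_one, mul_one] at this
  · right
    refine MonoidHom.ext fun t => ?_
    rw [← hF1, MonoidHom.inv_apply, ← map_inv]
    congr 1
    have := hFA t.toAdd
    rwa [ha, Int.cast_neg, Int.cast_one, mul_neg_one] at this

/-- The covering of the circle by `ℝ`. -/
def circleHom : Multiplicative ℝ →* Circle where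
  toFun t := Circle.exp (2 * Real.pi * t.toAdd)
  map_one' := by simp
  map_mul' s t := by simp [mul_add, Circle.exp_add]

lemma circleHom_eq_one (t : Multiplicative ℝ) :
    circleHom t = 1 ↔ t ∈ zpowers unitPeriod := by
  rw [mem_zpowers_unitPeriod]
  change Circle.exp (2 * Real.pi * t.toAdd) = 1 ↔ _
  rw [Circle.exp_eq_one]
  refine exists_congr fun n => ?_
  rw [mul_comm, mul_left_inj' (by positivity)]

lemma circleHom_continuous : Continuous circleHom := by
  have : Continuous fun t : ℝ => Circle.exp (2 * Real.pi * t) := by fun_prop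
  exact this

lemma circleHom_surjective : Function.Surjective circleHom := fun x => by
  obtain ⟨r, rfl⟩ := Circle.exp_surjective x
  refine ⟨ofAdd (r / (2 * Real.pi)), ?_⟩
  change Circle.exp (2 * Real.pi * (r / (2 * Real.pi))) = _
  rw [mul_div_cancel₀ _ (by positivity)]

lemma circleHom_isOpenQuotientMap : IsOpenQuotientMap circleHom :=
  ⟨circleHom_surjective, circleHom_continuous,
    MonoidHom.isOpenMap_of_sigmaCompact _ circleHom_surjective circleHom_continuous⟩

lemma card_circle_torsion {n : ℕ} (hn : n ≠ 0) :
    Nat.card {y : Multiplicative ℝ ⧸ zpowers unitPeriod // y ^ n = 1} = n := by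
  have hn' : (n : ℝ) ≠ 0 := by exact_mod_cast hn
  have hmk : ∀ s t : ℝ, ((ofAdd s : Multiplicative ℝ) :
      Multiplicative ℝ ⧸ zpowers unitPeriod) = (ofAdd t : Multiplicative ℝ) ↔
      ∃ k : ℤ, t = s + k := fun s t => by
    rw [QuotientGroup.eq, mem_zpowers_unitPeriod]
    refine exists_congr fun k => ?_
    simp only [toAdd_mul, toAdd_inv, toAdd_ofAdd]
    constructor <;> intro h <;> linarith
  have hpow : ∀ t : ℝ, ((ofAdd t : Multiplicative ℝ) :
      Multiplicative ℝ ⧸ zpowers unitPeriod) ^ n = 1 ↔ ∃ k : ℤ, n * t = k := fun t => by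
    rw [← QuotientGroup.mk_pow, eq_one_iff, mem_zpowers_unitPeriod]
    simp
  rw [Nat.card_congr (Equiv.ofBijective (fun k : Fin n =>
    (⟨((ofAdd ((k : ℕ) / n : ℝ) : Multiplicative ℝ) :
      Multiplicative ℝ ⧸ zpowers unitPeriod), (hpow _).2 ⟨(k : ℕ), by
        rw [mul_div_cancel₀ _ hn']; simp⟩⟩ :
      {y : Multiplicative ℝ ⧸ zpowers unitPeriod // y ^ n = 1})) ⟨?_, ?_⟩).symm, Nat.card_fin]
  · intro k l h
    obtain ⟨j, hj⟩ := (hmk _ _).1 (congrArg Subtype.val h)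
    have h1 : ((l : ℕ) : ℤ) = (k : ℕ) + n * j := by
      have : (((l : ℕ) : ℤ) : ℝ) = (((k : ℕ) + n * j : ℤ) : ℝ) := by
        push_cast
        field_simp at hj
        exact hj
      exact Int.cast_injective this
    have h2 : ((l : ℕ) : ℤ) % n = ((k : ℕ) : ℤ) % n := by rw [h1, Int.add_mul_emod_self_left]
    rw [Int.emod_eq_of_lt (by omega) (by exact_mod_cast l.2),
      Int.emod_eq_of_lt (by omega) (by exact_mod_cast k.2)] at h2
    exact Fin.ext (by exact_mod_cast h2.symm)
  · rintro ⟨⟨t⟩, ht⟩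
    obtain ⟨j, hj⟩ := (hpow (toAdd t)).1 ht
    have h0 : (0 : ℤ) < n := by omega
    have hlt := Int.emod_lt_of_pos j h0
    have hnn := Int.emod_nonneg j h0.ne'
    refine ⟨⟨(j % n).toNat, by omega⟩, Subtype.ext ((hmk _ t.toAdd).2 ⟨j / n, ?_⟩)⟩
    have h3 : (((j % n).toNat : ℕ) : ℝ) = (j : ℝ) - n * (j / n : ℤ) := by
      have h4 : (((j % n).toNat : ℕ) : ℤ) = j - n * (j / n) := by
        rw [Int.toNat_of_nonneg hnn, Int.emod_def]
      exact_mod_cast congrArg (Int.cast : ℤ → ℝ) h4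
    rw [h3, ← hj]
    field_simp
    ring

section Period

variable {S : Finset ℕ} {R : Type} [CommRing R] {σ : R ≃+* R}

open ThetaSeq

/-- The image of `γ` in `C`. -/
abbrev ThetaSeq.barHom (Θ : ThetaSeq S R) {T : Type} [CommGroup T] (γ : T →* Θ.B) : T →* Θ.C :=
  (mk' Θ.i.range).comp γ

lemma exists_compQuot_equiv {T : Type} [CommGroup T] (Θ : ThetaSeq S R) (γ : T →* Θ.B) :
    Nonempty (Θ.B ⧸ compOf Θ γ ≃* Θ.C ⧸ (Θ.barHom γ).range) := by
  obtain ⟨e, -⟩ := exists_mulEquiv_of_ker (mk' (compOf Θ γ))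
    ((mk' (Θ.barHom γ).range).comp (mk' Θ.i.range))
    (QuotientGroup.mk'_surjective _)
    ((QuotientGroup.mk'_surjective _).comp (QuotientGroup.mk'_surjective _)) fun b => by
      rw [MonoidHom.comp_apply, QuotientGroup.mk'_apply, QuotientGroup.mk'_apply,
        eq_one_iff, QuotientGroup.mk'_apply, eq_one_iff]
      constructor
      · rintro ⟨t, ht⟩
        have : (γ t)⁻¹ * b ∈ Θ.i.range := QuotientGroup.eq.1 ht
        have h2 := Subgroup.mul_mem_sup (show γ t ∈ γ.range from ⟨t, rfl⟩) this
        rwa [mul_inv_cancel_left] at h2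
      · intro hb
        obtain ⟨_, ⟨t, rfl⟩, _, ⟨u, rfl⟩, rfl⟩ := Subgroup.mem_sup.1 hb
        refine ⟨t, QuotientGroup.eq.2 ?_⟩
        rw [inv_mul_cancel_left]
        exact ⟨u, rfl⟩
  exact ⟨e⟩

lemma barHom_eq_one {T : Type} [CommGroup T] (Θ : ThetaSeq S R) (γ : T →* Θ.B) (t : T) :
    Θ.barHom γ t = 1 ↔ γ t ∈ Θ.i.range := eq_one_iff _

lemma multReal_div (n : ℕ) (hn : n ≠ 0) (t : Multiplicative ℝ) : ∃ t', t' ^ n = t := by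
  have hn' : (n : ℝ) ≠ 0 := by exact_mod_cast hn
  refine ⟨ofAdd (t.toAdd / n), toAdd.injective ?_⟩
  simp only [toAdd_pow, toAdd_ofAdd, nsmul_eq_mul]
  field_simp

/-- The one-parameter subgroup is unique up to sign. -/
lemma gen_unique [Finite (US S R)] {Θ : ThetaSeq S R} {γ₀ γ₁ : Multiplicative ℝ →* Θ.B}
    (h₀ : Continuous γ₀) (h₁ : Continuous γ₁)
    (hk₀ : ∀ t, γ₀ t ∈ Θ.i.range ↔ t ∈ zpowers unitPeriod)
    (hk₁ : ∀ t, γ₁ t ∈ Θ.i.range ↔ t ∈ zpowers unitPeriod)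
    (ho : IsOpenMap (Θ.barHom γ₀)) : γ₁ = γ₀ ∨ γ₁ = γ₀⁻¹ := by
  have : Finite Θ.i.range := Finite.of_surjective _ Θ.i.rangeRestrict_surjective
  have hmk := continuous_mk (N := Θ.i.range)
  have key : ∀ γ : Multiplicative ℝ →* Θ.B, Θ.barHom γ₁ = Θ.barHom γ → γ₁ = γ := fun γ h => by
    ext t
    refine (div_eq_one.1 ?_ : γ₁ t = γ t)
    refine eq_one_of_divisible multReal_div (γ₁ / γ) Θ.i.range (fun t => ?_) t
    rw [← eq_one_iff, MonoidHom.div_apply, QuotientGroup.mk_div, div_eq_one]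
    exact DFunLike.congr_fun h t
  rcases eq_or_eq_inv_of_isOpenMap (hmk.comp h₀) (hmk.comp h₁)
    (fun t => (barHom_eq_one Θ γ₀ t).trans (hk₀ t))
    (fun t => (barHom_eq_one Θ γ₁ t).trans (hk₁ t)) ho with h | h
  · exact Or.inl (key _ h)
  · refine Or.inr (key _ (h.trans ?_))
    ext t
    rfl

lemma barHom_range_isCompact {Θ : ThetaSeq S R} {γ : Multiplicative ℝ →* Θ.B}
    (hγ : IsGen unitPeriod Θ γ) : IsCompact ((Θ.barHom γ).range : Set Θ.C) := by
  have hc : Continuous fun t : ℝ => Θ.barHom γ (ofAdd t) :=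
    continuous_mk.comp (hγ.1.comp continuous_ofAdd)
  convert (isCompact_Icc (a := (0 : ℝ)) (b := 1)).image hc
  ext x
  constructor
  · rintro ⟨t, rfl⟩
    refine ⟨Int.fract t.toAdd, ⟨Int.fract_nonneg _, (Int.fract_lt_one _).le⟩, ?_⟩
    refine (eq_of_div_eq_one ?_).symm
    rw [← map_div, barHom_eq_one, hγ.2.1, mem_zpowers_unitPeriod]
    exact ⟨⌊t.toAdd⌋, Int.self_sub_fract _⟩
  · rintro ⟨t, -, rfl⟩
    exact ⟨_, rfl⟩

lemma t2_C [Finite (US S R)] (Θ : ThetaSeq S R) [T2Space Θ.B] : T2Space Θ.C := by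
  have : Finite Θ.i.range := Finite.of_surjective _ Θ.i.rangeRestrict_surjective
  have : IsClosed (Θ.i.range : Set Θ.B) := (Set.toFinite _).isClosed
  infer_instance

lemma barHom_isOpen [Finite (US S R)] {Θ : ThetaSeq S R} [T2Space Θ.B]
    {γ : Multiplicative ℝ →* Θ.B} (hγ : IsGen unitPeriod Θ γ) :
    IsOpen ((Θ.barHom γ).range : Set Θ.C) := by
  have := t2_C Θ
  obtain ⟨e⟩ := exists_compQuot_equiv Θ γ
  have := hγ.2.2.1
  have : Finite (Θ.C ⧸ (Θ.barHom γ).range) := Finite.of_equiv _ e.toEquiv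
  have := Subgroup.finiteIndex_of_finite_quotient (H := (Θ.barHom γ).range)
  exact Subgroup.isOpen_of_isClosed_of_finiteIndex _ (barHom_range_isCompact hγ).isClosed

lemma barHom_rangeRestrict_isOpenQuotientMap [Finite (US S R)] {Θ : ThetaSeq S R} [T2Space Θ.B]
    {γ : Multiplicative ℝ →* Θ.B} (hγ : IsGen unitPeriod Θ γ) :
    IsOpenQuotientMap (Θ.barHom γ).rangeRestrict := by
  have := t2_C Θ
  have : CompactSpace (Θ.barHom γ).range := isCompact_iff_compactSpace.1 (barHom_range_isCompact hγ)
  have hc : Continuous (Θ.barHom γ).rangeRestrict :=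
    (continuous_mk.comp hγ.1).subtype_mk _
  exact ⟨MonoidHom.rangeRestrict_surjective _, hc,
    MonoidHom.isOpenMap_of_sigmaCompact _ (MonoidHom.rangeRestrict_surjective _) hc⟩

lemma barHom_isOpenMap [Finite (US S R)] {Θ : ThetaSeq S R} [T2Space Θ.B]
    {γ : Multiplicative ℝ →* Θ.B} (hγ : IsGen unitPeriod Θ γ) : IsOpenMap (Θ.barHom γ) :=
  (barHom_isOpen hγ).isOpenMap_subtype_val.comp
    (barHom_rangeRestrict_isOpenQuotientMap hγ).isOpenMap

lemma isCptGroup_of_isGen [Finite (US S R)] {Θ : ThetaSeq S R} [CompactSpace Θ.B] [T2Space Θ.B]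
    {γ : Multiplicative ℝ →* Θ.B} (hγ : IsGen unitPeriod Θ γ) : IsCptGroup S .plus Θ.C := by
  have := t2_C Θ
  have hc : Continuous (Θ.barHom γ) := continuous_mk.comp hγ.1
  have hD : (Θ.barHom γ).range = Subgroup.connectedComponentOfOne Θ.C := by
    apply le_antisymm
    · have h1 : IsPreconnected ((Θ.barHom γ).range : Set Θ.C) := by
        rw [MonoidHom.coe_range]
        exact isPreconnected_range hc
      exact h1.subset_connectedComponent (one_mem _)
    · have h2 : IsClopen ((Θ.barHom γ).range : Set Θ.C) :=
        ⟨(barHom_range_isCompact hγ).isClosed, barHom_isOpen hγ⟩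
      exact h2.connectedComponent_subset (one_mem _)
  obtain ⟨e, he⟩ := exists_mulEquiv_of_ker (Θ.barHom γ).rangeRestrict circleHom
    (MonoidHom.rangeRestrict_surjective _) circleHom_surjective fun t => by
      rw [circleHom_eq_one, ← hγ.2.1, ← barHom_eq_one, rangeRestrict_eq_one]
  have h1 := barHom_rangeRestrict_isOpenQuotientMap hγ
  let k : (Θ.barHom γ).range ≃ₜ* Circle :=
    { toMulEquiv := e
      continuous_toFun := h1.isQuotientMap.continuous_iff.2
        (circleHom_continuous.congr fun t => (he t).symm)
      continuous_invFun := circleHom_isOpenQuotientMap.isQuotientMap.continuous_iff.2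
        (h1.continuous.congr fun t => by
          change _ = e.symm (circleHom t)
          rw [← he, e.symm_apply_apply]) }
  obtain ⟨e'⟩ := exists_compQuot_equiv Θ γ
  have hfin := hγ.2.2.1
  have h3 : Finite (Θ.C ⧸ (Θ.barHom γ).range) := Finite.of_equiv _ e'.toEquiv
  have h4 : IsSGroup S (Θ.C ⧸ (Θ.barHom γ).range) :=
    hγ.2.2.2.of_surjective (e' : _ →* _) e'.surjective
  refine ⟨inferInstance, inferInstance, ?_⟩
  change Nonempty (Subgroup.connectedComponentOfOne Θ.C ≃ₜ* Circle) ∧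
      Finite (Θ.C ⧸ Subgroup.connectedComponentOfOne Θ.C) ∧
      IsSGroup S (Θ.C ⧸ Subgroup.connectedComponentOfOne Θ.C)
  rw [← hD]
  exact ⟨⟨k⟩, h3, h4⟩

lemma exists_isGen_of_isCptGroup [Finite (US S R)] {Θ : ThetaSeq S R} [T2Space Θ.B]
    (h : IsCptGroup S .plus Θ.C) : ∃ γ : Multiplicative ℝ →* Θ.B, IsGen unitPeriod Θ γ := by
  obtain ⟨-, -, ⟨k⟩, h1, h2⟩ := h
  have : Finite Θ.i.range := Finite.of_surjective _ Θ.i.rangeRestrict_surjective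
  let f : Multiplicative ℝ →* Θ.C := (Subgroup.subtype _).comp
    ((k.symm.toMulEquiv : Circle →* Subgroup.connectedComponentOfOne Θ.C).comp circleHom)
  have hf : Continuous f :=
    continuous_subtype_val.comp (k.symm.continuous.comp circleHom_continuous)
  obtain ⟨γ, hγ, hγf⟩ := exists_lift_hom Θ.i.range f hf
  have hb : Θ.barHom γ = f := by
    ext t
    exact hγf t
  have hr : (Θ.barHom γ).range = Subgroup.connectedComponentOfOne Θ.C := by
    rw [hb]
    ext x
    constructor
    · rintro ⟨t, rfl⟩
      exact Subtype.prop _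
    · intro hx
      obtain ⟨t, ht⟩ := circleHom_surjective (k ⟨x, hx⟩)
      refine ⟨t, ?_⟩
      change ((k.symm (circleHom t) : Subgroup.connectedComponentOfOne Θ.C) : Θ.C) = x
      rw [ht, k.symm_apply_apply]
  obtain ⟨e⟩ := exists_compQuot_equiv Θ γ
  rw [← hr] at h1 h2
  refine ⟨γ, hγ, fun t => ?_, Finite.of_equiv _ e.symm.toEquiv,
    h2.of_surjective (e.symm : _ →* _) e.symm.surjective⟩
  rw [← barHom_eq_one, hb, ← circleHom_eq_one]
  change ((k.symm (circleHom t) : Subgroup.connectedComponentOfOne Θ.C) : Θ.C) = 1 ↔ _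
  rw [OneMemClass.coe_eq_one, map_eq_one_iff _ k.symm.injective]

lemma isPeriod_plus (hG : GoodRing S σ) : IsPeriod S σ .plus unitPeriod 2 where
  div := multReal_div
  closed A hA := by
    have h1 : A = toAdd ⁻¹' ((Int.cast : ℤ → ℝ) ''
        {n | ofAdd (n : ℝ) ∈ A}) := by
      ext t
      constructor
      · intro ht
        obtain ⟨n, hn⟩ := mem_zpowers_unitPeriod.1 (hA ht)
        refine ⟨n, ?_, hn.symm⟩
        change ofAdd (n : ℝ) ∈ A
        rw [← hn]
        exact ht
      · rintro ⟨n, hn, hnt⟩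
        change ofAdd (n : ℝ) ∈ A at hn
        rw [hnt] at hn
        exact hn
    rw [h1]
    exact (Int.isClosedEmbedding_coe_real.isClosedMap _ (isClosed_discrete _)).preimage
      continuous_toAdd
  cocompact := by
    refine ⟨ofAdd '' Set.Icc (0 : ℝ) 1, isCompact_Icc.image continuous_ofAdd,
      fun t => ⟨-⌊t.toAdd⌋, Int.fract t.toAdd, ⟨Int.fract_nonneg _, (Int.fract_lt_one _).le⟩, ?_⟩⟩
    apply toAdd.injective
    simp [← Int.self_sub_floor, sub_eq_add_neg]
  card_tor n hn := by rw [card_circle_torsion hn]; simp [QSign.exp]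
  ne_zero := two_ne_zero
  card_gen Θ hΘ h1 h2 γ hγ := by
    have := hG.finiteU
    have hinv : IsGen unitPeriod Θ γ⁻¹ := by
      have hr : compOf Θ γ⁻¹ = compOf Θ γ := by
        have : (γ⁻¹).range = γ.range := by
          ext x
          constructor
          · rintro ⟨t, rfl⟩
            exact ⟨t⁻¹, map_inv γ t⟩
          · rintro ⟨t, rfl⟩
            exact ⟨t⁻¹, by rw [MonoidHom.inv_apply, map_inv, inv_inv]⟩
        rw [compOf, this]
      refine ⟨hγ.1.inv, fun t => ?_, ?_, ?_⟩
      · rw [MonoidHom.inv_apply, inv_mem_iff, hγ.2.1]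
      · rw [hr]; exact hγ.2.2.1
      · rw [hr]; exact hγ.2.2.2
    rw [Nat.card_eq_two_iff]
    refine ⟨⟨γ, hγ⟩, ⟨γ⁻¹, hinv⟩, fun h => ?_, ?_⟩
    · have h3 : γ = γ⁻¹ := congrArg Subtype.val h
      have h4 := DFunLike.congr_fun h3 (ofAdd (1 / 4))
      rw [MonoidHom.inv_apply, eq_inv_iff_mul_eq_one, ← map_mul, ← ofAdd_add] at h4
      obtain ⟨n, hn⟩ := mem_zpowers_unitPeriod.1 ((hγ.2.1 _).1 (h4 ▸ one_mem _))
      have h2 : ((1 : ℤ) : ℝ) = ((2 * n : ℤ) : ℝ) := by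
        push_cast
        rw [← hn, toAdd_ofAdd]
        norm_num
      have := Int.cast_injective h2
      omega
    · rw [Set.eq_univ_iff_forall]
      rintro ⟨γ', hγ'⟩
      rcases gen_unique hγ.1 hγ'.1 hγ.2.1 hγ'.2.1 (barHom_isOpenMap hγ) with h | h
      · exact Or.inl (Subtype.ext h)
      · exact Or.inr (Subtype.ext h)
  isCpt Θ := by
    have := hG.finiteU
    constructor
    · rintro ⟨h1, h2, h3, h4⟩
      exact ⟨h1, h2, h3, exists_isGen_of_isCptGroup h4⟩
    · rintro ⟨h1, h2, h3, γ, hγ⟩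
      exact ⟨h1, h2, h3, isCptGroup_of_isGen hγ⟩

instance : IsTopologicalGroup PUnit.{1} where
  continuous_mul := continuous_of_discreteTopology
  continuous_inv := continuous_of_discreteTopology

lemma isPeriod_minus (hG : GoodRing S σ) : IsPeriod S σ .minus PUnit.unit.{1} 1 where
  div n hn t := ⟨t, rfl⟩
  closed A hA := isClosed_discrete A
  cocompact := ⟨Set.univ, isCompact_univ, fun t => ⟨0, Set.mem_univ _⟩⟩
  card_tor n hn := by
    have h : Subsingleton (PUnit.{1} ⧸ zpowers PUnit.unit.{1}) := by
      constructor
      rintro ⟨x⟩ ⟨y⟩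
      rfl
    rw [Nat.card_eq_one_iff_unique.2 ⟨inferInstance, ⟨⟨1, one_pow n⟩⟩⟩]
    rfl
  ne_zero := one_ne_zero
  card_gen Θ hΘ h1 h2 γ hγ := by
    have : Subsingleton (PUnit.{1} →* Θ.B) := ⟨fun f g => MonoidHom.ext fun x =>
      (map_one f).trans (map_one g).symm⟩
    exact Nat.card_eq_one_iff_unique.2 ⟨inferInstance, ⟨⟨γ, hγ⟩⟩⟩
  isCpt Θ := by
    have := hG.finiteU
    have hr : ∀ γ : PUnit.{1} →* Θ.B, compOf Θ γ = Θ.i.range := fun γ => by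
      refine sup_eq_right.2 ?_
      rintro _ ⟨⟨⟩, rfl⟩
      exact (map_one γ) ▸ one_mem _
    constructor
    · rintro ⟨h1, h2, h3, -, -, h4, h5⟩
      refine ⟨h1, h2, h3, 1, continuous_const, fun t => ?_, ?_, ?_⟩
      · exact ⟨fun _ => ⟨0, rfl⟩, fun _ => one_mem _⟩
      · rw [hr]; exact h4
      · rw [hr]; exact h5
    · rintro ⟨h1, h2, h3, γ, -, -, h4, h5⟩
      rw [hr] at h4 h5
      exact ⟨h1, h2, h3, inferInstance, t2_C Θ, h4, h5⟩

end Period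

open scoped ENNReal

section Disc

variable {S : Finset ℕ} {R : Type} [CommRing R] {σ : R ≃+* R} {s : QSign}
  {T : Type} [CommGroup T] [TopologicalSpace T] [IsTopologicalGroup T] [SigmaCompactSpace T]
  {z : T} {N : ℕ}

open ThetaSeq

lemma tors_isDisc {Θ : ThetaSeq S R} (h : Θ.IsCpt σ s) : Θ.tors.IsDisc σ s := by
  obtain ⟨⟨h1, h2, h3, h4⟩, -, -, h5⟩ := h
  refine ⟨⟨fun b => Subtype.ext (h1 b.1), fun u => Subtype.ext (h2 u), fun u v h => ?_, fun b => ?_⟩,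
    ⟨rfl⟩, Θ.C, inferInstance, inferInstance, inferInstance, h5, ⟨Θ.torsCEquiv⟩⟩
  · exact h3 (congrArg Subtype.val h)
  · obtain ⟨u, hu⟩ := h4 b.1
    exact ⟨u, Subtype.ext hu⟩

lemma isDisc_of_isIso (hG : GoodRing S σ) {Θ Θ' : ThetaSeq S R} {f : Θ.B ≃ₜ* Θ'.B}
    (hf : IsIso Θ Θ' f) (h : Θ.IsDisc σ s) : Θ'.IsDisc σ s := by
  obtain ⟨h1, h2, C', i1, i2, i3, h3, ⟨e⟩⟩ := h
  exact ⟨hf.isExt hG h1, f.toHomeomorph.discreteTopology, C', i1, i2, i3, h3,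
    ⟨hf.cEquiv.symm.trans e⟩⟩

/-- The map `Θ ↦ Θ(S^∞)` on classes. -/
def torsGCpt (hG : GoodRing S σ) (c : GCpt S σ s) : GDisc S σ s :=
  ⟨torsCls c.1, by
    obtain ⟨f, hf⟩ := equiv_out c.1.out.tors
    obtain ⟨f', hf'⟩ := hf.symm
    exact isDisc_of_isIso hG hf' (tors_isDisc c.2)⟩

/-- `ℙ^±` is the pushforward of `ℙ_cpt^±`. -/
lemma measDisc_eq (hG : GoodRing S σ) (hP : IsPeriod S σ s z N) (A : Set (ThetaCls S R)) :
    measDisc σ s A = measCpt σ s (torsCls ⁻¹' A) := by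
  classical
  let w : GCpt S σ s → ℝ≥0∞ := fun c =>
    (wt σ s (Set.univ : Set (ThetaCls S R)))⁻¹ * (c.1.out.autCard : ℝ≥0∞)⁻¹
  have hw : ∀ c, probCpt σ s c = (w c).toReal := probCpt_eq hG hP
  have hwt : ∑' c, w c = 1 := by
    rw [ENNReal.tsum_mul_left]
    have : ∑' c : GCpt S σ s, (c.1.out.autCard : ℝ≥0∞)⁻¹ =
        wt σ s (Set.univ : Set (ThetaCls S R)) := by simp [wt]
    rw [this]
    exact ENNReal.inv_mul_cancel (wt_univ_ne_zero hG hP) (wt_univ_ne_top hG hP)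
  have hle : ∀ f : GCpt S σ s → ℝ≥0∞, (∀ c, f c ≤ w c) → ∑' c, f c ≠ ⊤ := fun f hf =>
    ne_top_of_le_ne_top ENNReal.one_ne_top (hwt ▸ ENNReal.tsum_le_tsum hf)
  have hwtop : ∀ c, w c ≠ ⊤ := fun c =>
    ne_top_of_le_ne_top ENNReal.one_ne_top (hwt ▸ ENNReal.le_tsum c)
  have h1 : ∀ d : GDisc S σ s, probDisc σ s d =
      (∑' c : GCpt S σ s, if torsCls c.1 = d.1 then w c else 0).toReal := by
    intro d
    rw [probDisc, ENNReal.tsum_toReal_eq]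
    · refine tsum_congr fun c => ?_
      split_ifs <;> simp [hw]
    · intro c
      split_ifs
      · exact hwtop c
      · exact ENNReal.zero_ne_top
  have h2 : measDisc σ s A = (∑' d : GDisc S σ s, ∑' c : GCpt S σ s,
      if torsCls c.1 = d.1 ∧ d.1 ∈ A then w c else 0).toReal := by
    rw [measDisc, ENNReal.tsum_toReal_eq]
    · refine tsum_congr fun d => ?_
      by_cases h : d.1 ∈ A
      · rw [Set.indicator_of_mem h, h1]
        simp [h]
      · rw [Set.indicator_of_notMem h]
        simp [h]
    · intro d
      refine hle _ fun c => ?_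
      split_ifs
      · exact le_rfl
      · exact bot_le
  rw [h2, ENNReal.tsum_comm, ENNReal.tsum_toReal_eq, measCpt]
  · refine tsum_congr fun c => ?_
    rw [tsum_eq_single (torsGCpt hG c)]
    · by_cases h : torsCls c.1 ∈ A
      · rw [Set.indicator_of_mem (show c.1 ∈ torsCls ⁻¹' A from h), if_pos ⟨rfl, h⟩, hw]
      · rw [Set.indicator_of_notMem (show c.1 ∉ torsCls ⁻¹' A from h), if_neg fun h' => h h'.2, ENNReal.toReal_zero]
    · intro d hd
      rw [if_neg]
      exact fun h => hd (Subtype.ext h.1.symm)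
  · intro c
    rw [tsum_eq_single (torsGCpt hG c)]
    · split_ifs
      · exact hwtop c
      · exact ENNReal.zero_ne_top
    · intro d hd
      rw [if_neg]
      exact fun h => hd (Subtype.ext h.1.symm)

lemma expCpt_ind (A : Set (ThetaCls S R)) : expCpt σ s (ind A) = (measCpt σ s A : ℂ) := by
  rw [expCpt, measCpt, Complex.ofReal_tsum]
  refine tsum_congr fun c => ?_
  by_cases h : c.1 ∈ A
  · simp [ind, Set.indicator_of_mem h]
  · simp [ind, Set.indicator_of_notMem h]

lemma expDisc_ind (A : Set (ThetaCls S R)) : expDisc σ s (ind A) = (measDisc σ s A : ℂ) := by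
  rw [expDisc, measDisc, Complex.ofReal_tsum]
  refine tsum_congr fun c => ?_
  by_cases h : c.1 ∈ A
  · simp [ind, Set.indicator_of_mem h]
  · simp [ind, Set.indicator_of_notMem h]

end Disc

section UnitEvent

variable {S : Finset ℕ} {R : Type} [CommRing R] {σ : R ≃+* R}

open ThetaSeq

lemma uOrbit_symm (hG : GoodRing S σ) {u v : US S R} (h : u ∈ uOrbit σ v) : v ∈ uOrbit σ u := by
  obtain ⟨ρ, -, rfl⟩ := h
  exact ⟨ρ.symm, fun w => hG.comm ρ.symm w, ((usEquiv S ρ).symm_apply_apply v).symm⟩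

lemma uOrbit_subset (hG : GoodRing S σ) {u : US S R} (hu : u ∈ UMinus S σ) :
    uOrbit σ u ⊆ UMinus S σ := by
  rintro _ ⟨ρ, h, rfl⟩
  change usMap S (σ : R →+* R) _ = _
  rw [← h, show usMap S (σ : R →+* R) u = u⁻¹ from hu, map_inv]

/-- The unit event of a sequence with a given one-parameter subgroup. -/
lemma mem_unitEvent_iff (hG : GoodRing S σ) {Θ : ThetaSeq S R} (hΘ : Θ.IsExt σ)
    {γ : Multiplicative ℝ →* Θ.B} (hγ : Continuous γ)
    (hk : ∀ t, γ t ∈ Θ.i.range ↔ t ∈ zpowers unitPeriod)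
    (ho : IsOpenMap (Θ.barHom γ)) {v : US S R} (hv : Θ.i v = γ unitPeriod) (u : US S R) :
    (⟦Θ⟧ : ThetaCls S R) ∈ unitEvent u ↔ u ∈ uOrbit σ v := by
  have := hG.finiteU
  have hvm : v ∈ UMinus S σ := by
    refine (g_mem_iff hΘ v).1 ?_
    rw [hv]
    exact IsGen.g_apply (z := unitPeriod) hG multReal_div hΘ γ _
  constructor
  · rintro ⟨Θ', h, γ', h1, h2, h3⟩
    obtain ⟨f, hf⟩ : ∃ f, IsIso Θ' Θ f := Quotient.exact h
    have hff := hf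
    obtain ⟨-, ρ, hρ⟩ := hf
    have h4 : Θ.i (usMap S (ρ : R →+* R) u) = (f.toMulEquiv : Θ'.B →* Θ.B).comp γ' unitPeriod := by
      rw [← hρ, ← h3]
      rfl
    have h5 := gen_unique (γ₁ := (f.toMulEquiv : Θ'.B →* Θ.B).comp γ') hγ (f.continuous.comp h1) hk
      (fun t => by
        rw [mem_zpowers_unitPeriod]
        exact hff.mem_range.trans (h2 t.toAdd)) ho
    have h6 : usMap S (ρ : R →+* R) u = v ∨ usMap S (ρ : R →+* R) u = v⁻¹ := by
      rcases h5 with h5 | h5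
      · exact Or.inl (hΘ.2.2.1 (by rw [h4, h5, hv]))
      · exact Or.inr (hΘ.2.2.1 (by rw [h4, h5, map_inv, hv, MonoidHom.inv_apply]))
    apply uOrbit_symm hG
    rcases h6 with h6 | h6
    · exact ⟨ρ, fun w => hG.comm ρ w, h6.symm⟩
    · refine ⟨ρ.trans σ, fun w => hG.comm _ w, ?_⟩
      have h7 : usMap S ((ρ.trans σ : R ≃+* R) : R →+* R) u =
          usMap S (σ : R →+* R) (usMap S (ρ : R →+* R) u) :=
        usMap_comp S (ρ : R →+* R) (σ : R →+* R) u
      have h8 : usMap S (σ : R →+* R) v = v⁻¹ := hvm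
      rw [h7, h6, map_inv, h8, inv_inv]
  · rintro ⟨ρ, -, rfl⟩
    obtain ⟨Θ', f, hf⟩ := exists_twist Θ ρ
    have hff : IsIso Θ Θ' f := ⟨hf.1, ρ, hf.2⟩
    refine ⟨Θ', Quotient.sound hff.symm, (f.toMulEquiv : Θ.B →* Θ'.B).comp γ, ?_, fun t => ?_, ?_⟩
    · exact f.continuous.comp hγ
    · have := (hff.mem_range (b := γ (ofAdd t))).trans (hk _)
      rw [mem_zpowers_unitPeriod] at this
      exact this
    · rw [← hf.2, hv]
      rfl

variable {ι : Type} [Fintype ι] {E : Type} [CommGroup E] [Finite E]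

lemma modelCls_mem_unitEvent (hG : GoodRing S σ) {e : ι → E} {d : ι → ℕ} (hES : IsSGroup S E)
    (hE : IsPres e d) (p : Param S σ unitPeriod ι) (u : US S R) :
    modelCls d p ∈ unitEvent u ↔ p.1.1 ∈ uOrbit σ u := by
  have := hG.finiteU
  have hP := isPeriod_plus hG
  obtain ⟨δ, hδ⟩ := model_datum hES hE p
  obtain ⟨h1, h2, h3, -⟩ := (hP.isCpt _).1 (hP.model_isCpt hG hES hE p)
  rw [mem_unitEvent_iff (v := δ.1.1 p.1.1) hG h1 δ.2.1.2.1 δ.2.1.2.2.1 (barHom_isOpenMap δ.2.1.2)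
    hδ.1]
  obtain ⟨ρ, hρ⟩ := δ.1.2
  rw [hρ]
  constructor
  · intro h
    apply uOrbit_symm hG
    obtain ⟨ρ', -, rfl⟩ := h
    exact ⟨ρ.trans ρ', fun w => hG.comm _ w, (usMap_comp S _ _ _).symm⟩
  · rintro ⟨ρ', -, h⟩
    rw [h]
    refine uOrbit_symm hG ⟨ρ'.trans ρ, fun w => hG.comm _ w, (usMap_comp S _ _ _).symm⟩

lemma zpow_unitPeriod (u : US S R) (n : ℤ) (h : unitPeriod ^ n = 1) : u ^ n = 1 := by
  have h1 := congrArg toAdd h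
  rw [← ofAdd_zsmul] at h1
  have h2 : (n : ℝ) = 0 := by simpa using h1
  rw [Int.cast_eq_zero.1 h2, zpow_zero]

/-- The parameters for the real case. -/
def paramPlus (S : Finset ℕ) {R : Type} [CommRing R] (σ : R ≃+* R) (ι : Type) :
    Param S σ unitPeriod ι ≃ uMinus S σ × (ι → uMinus S σ) :=
  Equiv.prodCongr (Equiv.subtypeEquivRight fun u =>
    ⟨fun h => h.1, fun h => ⟨h, zpow_unitPeriod u⟩⟩) (Equiv.refl _)

lemma measCpt_unitEvent_inter (hG : GoodRing S σ) (hES : IsSGroup S E) {u : US S R}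
    (hu : u ∈ UMinus S σ) :
    measCpt σ .plus (unitEvent u ∩ cptEvent S R E) = clMeasure S E .plus *
      (((uOrbit σ u).ncard : ℝ) / ((UMinus S σ).ncard : ℝ)) := by
  have := hG.finiteU
  obtain ⟨ι, _, e, d, hE, hEd⟩ := exists_isPres E
  rw [measCpt_inter hG (isPeriod_plus hG) hES hE hEd]
  congr 1
  have h1 : Nat.card {p : Param S σ unitPeriod ι // modelCls d p ∈ unitEvent u} =
      (uOrbit σ u).ncard * Nat.card (ι → uMinus S σ) := by
    rw [← Nat.card_coe_set_eq, ← Nat.card_prod]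
    refine Nat.card_congr ?_
    exact
      { toFun := fun p => ⟨⟨p.1.1.1, (modelCls_mem_unitEvent hG hES hE p.1 u).1 p.2⟩, p.1.2⟩
        invFun := fun x => ⟨⟨⟨x.1.1, uOrbit_subset hG hu x.1.2, zpow_unitPeriod _⟩, x.2⟩,
          (modelCls_mem_unitEvent hG hES hE _ u).2 x.1.2⟩
        left_inv := fun p => rfl
        right_inv := fun x => rfl }
  have h2 : Nat.card (Param S σ unitPeriod ι) =
      (UMinus S σ).ncard * Nat.card (ι → uMinus S σ) := by
    rw [Nat.card_congr (paramPlus S σ ι), Nat.card_prod, ← Nat.card_coe_set_eq]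
    rfl
  rw [h1, h2]
  push_cast
  refine mul_div_mul_right _ _ ?_
  exact_mod_cast (Nat.card_pos (α := ι → uMinus S σ)).ne'

lemma measCpt_unitEvent (hG : GoodRing S σ) {u : US S R} (hu : u ∈ UMinus S σ) :
    measCpt σ .plus (unitEvent u) = ((uOrbit σ u).ncard : ℝ) / ((UMinus S σ).ncard : ℝ) :=
  measCpt_of_ratio hG (isPeriod_plus hG) _ (by positivity) fun E _ _ hE =>
    measCpt_unitEvent_inter hG hE hu

lemma measDisc_compEvent (hG : GoodRing S σ) (s : QSign) (hES : IsSGroup S E) :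
    measDisc σ s (compEvent S R E) = clMeasure S E s := by
  cases s
  · rw [measDisc_eq hG (isPeriod_minus hG)]
    exact measCpt_cptEvent hG (isPeriod_minus hG) hES
  · rw [measDisc_eq hG (isPeriod_plus hG)]
    exact measCpt_cptEvent hG (isPeriod_plus hG) hES

end UnitEvent

open ThetaSeq

section ExtCount

variable {S : Finset ℕ} {R : Type} [CommRing R] {σ : R ≃+* R}
  {ι : Type} [Fintype ι] {E : Type} [CommGroup E] {e : ι → E} {d : ι → ℕ}

/-- The relations of the extension with parameter `h`. -/
def relExt (d : ι → ℕ) (V : Subgroup (US S R)) (h : ι → uMinus S σ) :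
    Subgroup (US S R × (ι → Multiplicative ℤ)) where
  carrier := {m | ∃ l : ι → Multiplicative ℤ, (∀ i, m.2 i = l i ^ d i) ∧
    m.1 * powHom (fun i => (h i).1) l ∈ V}
  one_mem' := ⟨1, by simp, by simp⟩
  mul_mem' := by
    rintro ⟨a, c⟩ ⟨a', c'⟩ ⟨l, h2, h3⟩ ⟨l', h2', h3'⟩
    refine ⟨l * l', fun i => ?_, ?_⟩
    · change c i * c' i = (l i * l' i) ^ d i
      rw [mul_pow]
      exact congrArg₂ (· * ·) (h2 i) (h2' i)
    · change a * a' * _ ∈ V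
      rw [map_mul, mul_mul_mul_comm]
      exact mul_mem h3 h3'
  inv_mem' := by
    rintro ⟨a, c⟩ ⟨l, h2, h3⟩
    refine ⟨l⁻¹, fun i => ?_, ?_⟩
    · change (c i)⁻¹ = (l i)⁻¹ ^ d i
      rw [inv_pow]
      exact congrArg _ (h2 i)
    · change a⁻¹ * _ ∈ V
      rw [map_inv, ← mul_inv]
      exact inv_mem h3

lemma usMap_of_mem_uMinus {u : US S R} (hu : u ∈ uMinus S σ) : usMap S (σ : R →+* R) u = u⁻¹ := hu

lemma powHom_mem_uMinus (h : ι → uMinus S σ) (l : ι → Multiplicative ℤ) :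
    powHom (fun i => (h i).1) l ∈ uMinus S σ :=
  Subgroup.prod_mem _ fun i _ => Subgroup.zpow_mem _ (h i).2 _

/-- The extension with parameter `h`. -/
def extModel (hE : IsPres e d) {V : Subgroup (US S R)} (hV : V ≤ uMinus S σ)
    (h : ι → uMinus S σ) : ExtData S R E where
  X := (US S R × (ι → Multiplicative ℤ)) ⧸ relExt d V h
  g := QuotientGroup.map _ _ ((usMap S (σ : R →+* R)).prodMap invMonoidHom) (by
    rintro ⟨v, k⟩ ⟨l, h1, h2⟩
    refine ⟨l⁻¹, fun i => ?_, ?_⟩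
    · change (k i)⁻¹ = (l i)⁻¹ ^ d i
      rw [inv_pow]
      exact congrArg _ (h1 i)
    · change usMap S (σ : R →+* R) v * _ ∈ V
      have h3 := hV h2
      have h4 := usMap_of_mem_uMinus h3
      rw [map_mul, usMap_of_mem_uMinus (powHom_mem_uMinus h l)] at h4
      rw [map_inv, h4]
      exact inv_mem h2)
  i := (mk' _).comp (MonoidHom.inl _ _)
  p := QuotientGroup.lift _ ((powHom e).comp (MonoidHom.snd _ _)) (by
    rintro ⟨v, k⟩ ⟨l, h1, -⟩
    exact (hE.powHom_eq_one k).2 ⟨l, h1⟩)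

lemma mem_relExt {V : Subgroup (US S R)} {h : ι → uMinus S σ}
    {m : US S R × (ι → Multiplicative ℤ)} : m ∈ relExt d V h ↔
      ∃ l : ι → Multiplicative ℤ, (∀ i, m.2 i = l i ^ d i) ∧
        m.1 * powHom (fun i => (h i).1) l ∈ V := Iff.rfl

lemma extModel_i_ker (hE : IsPres e d) {V : Subgroup (US S R)} (hV : V ≤ uMinus S σ)
    (h : ι → uMinus S σ) : (extModel hE hV h).i.ker = V := by
  ext v
  rw [MonoidHom.mem_ker]
  change mk' (relExt d V h) (v, 1) = 1 ↔ _
  rw [QuotientGroup.mk'_apply, eq_one_iff, mem_relExt]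
  constructor
  · rintro ⟨l, h1, h2⟩
    have hl : l = 1 := funext fun i => by
      have h := congrArg toAdd (h1 i)
      simp only [toAdd_pow, nsmul_eq_mul] at h
      change (0 : ℤ) = _ at h
      exact toAdd.injective (by simpa [hE.ne_zero i] using h.symm)
    simpa [hl] using h2
  · intro hv
    exact ⟨1, fun i => (one_pow _).symm, by simpa using hv⟩

lemma extModel_isExt (hG : GoodRing S σ) (hE : IsPres e d) {V : Subgroup (US S R)}
    (hV : V ≤ uMinus S σ) (h : ι → uMinus S σ) : (extModel hE hV h).IsExt σ V := by
  have hmk : ∀ a b : US S R × (ι → Multiplicative ℤ), a = b →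
    ((a : (US S R × (ι → Multiplicative ℤ)) ⧸ relExt d V h)) = b := fun a b h => h ▸ rfl
  refine ⟨?_, fun u => ?_, ?_, extModel_i_ker hE hV h, ?_, fun x => ?_⟩
  · rintro ⟨m⟩
    exact hmk _ _ (Prod.ext (hG.invol _) (inv_inv _))
  · exact hmk _ _ (Prod.ext rfl inv_one)
  · rintro ⟨m⟩
    exact map_inv (powHom e) m.2
  · apply le_antisymm
    · rintro ⟨v, k⟩ hk
      obtain ⟨l, hl⟩ := (hE.powHom_eq_one k).1 hk
      refine ⟨v * powHom (fun i => (h i).1) l, QuotientGroup.eq.2 ⟨l, fun i => ?_, ?_⟩⟩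
      · change (1 : Multiplicative ℤ)⁻¹ * k i = _
        rw [inv_one, one_mul, hl]
      · change (v * _)⁻¹ * v * _ ∈ V
        rw [mul_assoc, inv_mul_cancel]
        exact one_mem _
    · rintro _ ⟨u, rfl⟩
      exact map_one (powHom e)
  · obtain ⟨k, hk⟩ := hE.surjective x
    exact ⟨mk' (relExt d V h) (1, k), hk⟩

/-- Lifts of the generators of `E` to an extension, with given powers. -/
def ExtLifts (e : ι → E) (d : ι → ℕ) (Y : ExtData S R E) (h : ι → uMinus S σ) (x : ι → Y.X) :
    Prop :=
  ∀ i, Y.p (x i) = e i ∧ Y.g (x i) = (x i)⁻¹ ∧ x i ^ d i = Y.i (h i).1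

/-- The lifts of the generators to the extension with parameter `h`. -/
def extGen [DecidableEq ι] (hE : IsPres e d) {V : Subgroup (US S R)}
    (hV : V ≤ uMinus S σ) (h : ι → uMinus S σ) (i : ι) : (extModel hE hV h).X :=
  mk' (relExt d V h) (1, Pi.mulSingle i (ofAdd 1))

lemma extModel_lifts [DecidableEq ι] (hE : IsPres e d) {V : Subgroup (US S R)}
    (hV : V ≤ uMinus S σ) (h : ι → uMinus S σ) :
    ExtLifts e d (extModel hE hV h) h (extGen hE hV h) := by
  intro i
  refine ⟨(powHom_single e i 1).trans (zpow_one _), ?_, ?_⟩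
  · refine Eq.trans (congrArg (mk' (relExt d V h)) ?_) (map_inv _ _)
    exact Prod.ext ((map_one (usMap S (σ : R →+* R))).trans inv_one.symm) rfl
  · refine (QuotientGroup.eq.2 ?_).symm
    refine ⟨Pi.mulSingle i (ofAdd 1), fun j => ?_, ?_⟩
    · change (1 : Multiplicative ℤ)⁻¹ *
        Pi.mulSingle (M := fun _ => Multiplicative ℤ) i (ofAdd 1) j ^ d i = _
      rw [inv_one, one_mul]
      by_cases hj : j = i
      · rw [hj]
      · simp [Pi.mulSingle_eq_of_ne hj]
    · rw [powHom_single, zpow_one]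
      change (h i).1⁻¹ * 1 ^ d i * (h i).1 ∈ V
      rw [one_pow, mul_one, inv_mul_cancel]
      exact one_mem _

lemma extModel_equiv (hE : IsPres e d) {V : Subgroup (US S R)}
    (hV : V ≤ uMinus S σ) (h : ι → uMinus S σ) {Y : ExtData S R E} (hY : Y.IsExt σ V)
    {x : ι → Y.X} (hx : ExtLifts e d Y h x) : extModel hE hV h ≈ Y := by
  obtain ⟨h1, h2, h3, h4, h5, h6⟩ := hY
  let c : US S R × (ι → Multiplicative ℤ) →* Y.X := Y.i.coprod (powHom x)
  have hc : ∀ m, c m = Y.i m.1 * powHom x m.2 := fun m => rfl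
  have hpx : ∀ k, Y.p (powHom x k) = powHom e k := fun k => by
    rw [map_powHom]
    simp only [fun i => (hx i).1]
  have hpi : ∀ u, Y.p (Y.i u) = 1 := fun u => by
    rw [← MonoidHom.mem_ker, h5]
    exact ⟨u, rfl⟩
  have hcs : Function.Surjective c := by
    intro y
    obtain ⟨k, hk⟩ := hE.surjective (Y.p y)
    have : y * (powHom x k)⁻¹ ∈ Y.p.ker := by
      rw [MonoidHom.mem_ker, map_mul, map_inv, hpx, hk, mul_inv_cancel]
    rw [h5] at this
    obtain ⟨u, hu⟩ := this
    exact ⟨(u, k), by rw [hc, hu, inv_mul_cancel_right]⟩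
  have hxl : ∀ k l : ι → Multiplicative ℤ, (∀ i, k i = l i ^ d i) →
      powHom x k = Y.i (powHom (fun i => (h i).1) l) := fun k l hkl => by
    rw [map_powHom, powHom_apply, powHom_apply]
    refine Finset.prod_congr rfl fun i _ => ?_
    rw [hkl, toAdd_pow, nsmul_eq_mul, zpow_mul, zpow_natCast, (hx i).2.2]
  obtain ⟨f, hf⟩ := exists_mulEquiv_of_ker (mk' (relExt d V h)) c
    (QuotientGroup.mk'_surjective _) hcs fun m => by
      rw [QuotientGroup.mk'_apply, eq_one_iff, mem_relExt]
      constructor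
      · intro hm
        have h7 := congrArg Y.p hm
        rw [hc, map_mul, hpi, one_mul, hpx, map_one] at h7
        obtain ⟨l, hl⟩ := (hE.powHom_eq_one _).1 h7
        refine ⟨l, hl, ?_⟩
        rw [hc, hxl _ _ hl, ← map_mul, ← MonoidHom.mem_ker, h4] at hm
        exact hm
      · rintro ⟨l, hl, hm⟩
        rw [hc, hxl _ _ hl, ← map_mul, ← MonoidHom.mem_ker, h4]
        exact hm
  refine ⟨f, ?_, fun u => ?_, ?_⟩
  · rintro ⟨m⟩
    refine (hf _).trans (Eq.trans ?_ (congrArg Y.g (hf m)).symm)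
    change Y.i (usMap S (σ : R →+* R) m.1) * powHom x m.2⁻¹ = Y.g (Y.i m.1 * powHom x m.2)
    rw [map_mul, h2, map_inv, map_powHom, powHom_apply, powHom_apply, ← Finset.prod_inv_distrib]
    simp only [fun i => (hx i).2.1, inv_zpow]
  · refine (hf (u, 1)).trans ?_
    change Y.i u * powHom x 1 = _
    rw [map_one, mul_one]
  · rintro ⟨m⟩
    refine (congrArg Y.p (hf m)).trans ?_
    change Y.p (Y.i m.1 * powHom x m.2) = powHom e m.2
    rw [map_mul, hpi, one_mul, hpx]

/-- An element of the image of `U_R(S^∞)` that is inverted comes from `U_-`. -/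
lemma exists_uMinus_of_inv (hG : GoodRing S σ) {X : Type} [CommGroup X] {g : X →* X}
    {i : US S R →* X} (hgi : ∀ u, g (i u) = i (usMap S (σ : R →+* R) u)) {w : US S R}
    (hw : g (i w) = (i w)⁻¹) : ∃ v ∈ uMinus S σ, i v = i w := by
  obtain ⟨k, hk⟩ := hG.exists_sqrt isSGroup_US (w * (usMap S (σ : R →+* R) w)⁻¹)
  refine ⟨(w * (usMap S (σ : R →+* R) w)⁻¹) ^ k, pow_mem ?_ k, ?_⟩
  · rw [mem_uMinus, map_mul, map_inv, hG.invol, mul_inv, inv_inv, mul_comm]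
  · have h1 : i (((w * (usMap S (σ : R →+* R) w)⁻¹) ^ k) * w⁻¹) ^ 2 = 1 := by
      rw [← map_pow, mul_pow, hk, map_mul, map_mul, map_inv, ← hgi, hw, inv_inv, map_pow, map_inv,
        ← sq, inv_pow, mul_inv_cancel]
    obtain ⟨n, hn, hun⟩ := isSGroup_US.exists_pow (((w * (usMap S (σ : R →+* R) w)⁻¹) ^ k) * w⁻¹)
    obtain ⟨j, hj⟩ := exists_sqrt_of_pow (odd_of_isSNumber hG.odd hn)
      (show i (((w * (usMap S (σ : R →+* R) w)⁻¹) ^ k) * w⁻¹) ^ n = 1 by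
        rw [← map_pow, hun, map_one])
    rw [← pow_mul, mul_comm j 2, pow_mul, h1, one_pow, map_mul, map_inv] at hj
    exact (mul_inv_eq_one.1 hj.symm)

lemma exists_extLifts (hG : GoodRing S σ) (hE : IsPres e d) {V : Subgroup (US S R)}
    {Y : ExtData S R E} (hY : Y.IsExt σ V) :
    ∃ (h : ι → uMinus S σ) (x : ι → Y.X), ExtLifts e d Y h x := by
  obtain ⟨h1, h2, h3, h4, h5, h6⟩ := hY
  have hpi : ∀ u, Y.p (Y.i u) = 1 := fun u => by
    rw [← MonoidHom.mem_ker, h5]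
    exact ⟨u, rfl⟩
  have key : ∀ i, ∃ (h : uMinus S σ) (x : Y.X), Y.p x = e i ∧ Y.g x = x⁻¹ ∧ x ^ d i = Y.i h.1 := by
    intro i
    obtain ⟨y, hy⟩ := h6 (e i)
    obtain ⟨v, hv⟩ : y * Y.g y ∈ Y.i.range := by
      rw [← h5, MonoidHom.mem_ker, map_mul, h3, mul_inv_cancel]
    obtain ⟨k, hk⟩ := hG.exists_sqrt isSGroup_US v
    have h7 : Y.g (Y.i v) = Y.i v := by rw [hv, map_mul, h1, mul_comm]
    have h8 : Y.g (Y.i (v ^ k)) = Y.i (v ^ k) := by rw [map_pow, map_pow, h7]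
    let x := y * (Y.i (v ^ k))⁻¹
    have hx1 : Y.p x = e i := by rw [map_mul, map_inv, hpi, hy, inv_one, mul_one]
    have hx2 : Y.g x = x⁻¹ := by
      refine eq_inv_of_mul_eq_one_right ?_
      rw [map_mul, map_inv, h8, mul_mul_mul_comm, ← hv, ← mul_inv, ← map_mul, ← sq, hk,
        mul_inv_cancel]
    obtain ⟨w, hw⟩ : x ^ d i ∈ Y.i.range := by
      rw [← h5, MonoidHom.mem_ker, map_pow, hx1, hE.pow_eq_one]
    obtain ⟨u, hu, hu'⟩ := exists_uMinus_of_inv hG h2 (w := w) (by rw [hw, map_pow, hx2, inv_pow])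
    exact ⟨⟨u, hu⟩, x, hx1, hx2, by rw [hu', hw]⟩
  choose h x hx using key
  exact ⟨h, x, hx⟩

/-- The parameters of the trivial extension. -/
def trivParam (d : ι → ℕ) (V : Subgroup (US S R)) (σ : R ≃+* R) : Set (ι → uMinus S σ) :=
  {h | ∃ φ : ι → uMinus S σ, ∀ i, (h i * (φ i ^ d i)⁻¹).1 ∈ V}

lemma extModel_eq_iff (hG : GoodRing S σ) (hE : IsPres e d) {V : Subgroup (US S R)}
    (hV : V ≤ uMinus S σ) (h h' : ι → uMinus S σ) :
    (⟦extModel hE hV h⟧ : ExtCls S R E) = ⟦extModel hE hV h'⟧ ↔ h * h'⁻¹ ∈ trivParam d V σ := by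
  classical
  have hY := extModel_isExt hG hE hV h
  have hY' := extModel_isExt hG hE hV h'
  have hl := extModel_lifts hE hV h
  have hl' := extModel_lifts hE hV h'
  set a : ι → (extModel hE hV h).X := extGen hE hV h
  set a' : ι → (extModel hE hV h').X := extGen hE hV h'
  obtain ⟨h1, h2, h3, h4, h5, h6⟩ := hY'
  constructor
  · intro heq
    obtain ⟨f, hf1, hf2, hf3⟩ := Quotient.exact heq
    have key : ∀ i, ∃ φ : uMinus S σ, (extModel hE hV h').i φ.1 = f (a i) * (a' i)⁻¹ := by
      intro i
      obtain ⟨w, hw⟩ : f (a i) * (a' i)⁻¹ ∈ (extModel hE hV h').i.range := by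
        rw [← h5, MonoidHom.mem_ker, map_mul, map_inv, hf3, (hl i).1, (hl' i).1, mul_inv_cancel]
      obtain ⟨v, hv, hv'⟩ := exists_uMinus_of_inv hG h2 (w := w) (by
        rw [hw, map_mul, map_inv, ← hf1, (hl i).2.1, (hl' i).2.1, map_inv, mul_inv])
      exact ⟨⟨v, hv⟩, by rw [hv', hw]⟩
    choose φ hφ using key
    refine ⟨φ, fun i => ?_⟩
    rw [← h4, MonoidHom.mem_ker]
    change (extModel hE hV h').i ((h i).1 * (h' i).1⁻¹ * ((φ i).1 ^ d i)⁻¹) = 1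
    rw [map_mul, map_mul, map_inv, map_inv, map_pow, hφ, mul_pow, inv_pow, ← hf2, ← (hl i).2.2,
      ← (hl' i).2.2, ← map_pow]
    simp
  · rintro ⟨φ, hφ⟩
    refine Quotient.sound (extModel_equiv hE hV h ⟨h1, h2, h3, h4, h5, h6⟩
      (x := fun i => (extModel hE hV h').i (φ i).1 * a' i) fun i => ⟨?_, ?_, ?_⟩)
    · have : (extModel hE hV h').p ((extModel hE hV h').i (φ i).1) = 1 := by
        rw [← MonoidHom.mem_ker, h5]
        exact ⟨_, rfl⟩
      rw [map_mul, this, one_mul, (hl' i).1]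
    · rw [map_mul, h2, usMap_of_mem_uMinus (φ i).2, map_inv, (hl' i).2.1, mul_inv]
    · have h7 := hφ i
      rw [← h4, MonoidHom.mem_ker] at h7
      change (extModel hE hV h').i ((h i).1 * (h' i).1⁻¹ * ((φ i).1 ^ d i)⁻¹) = 1 at h7
      rw [map_mul, map_mul, map_inv, map_inv, mul_inv_eq_one, mul_inv_eq_iff_eq_mul] at h7
      rw [mul_pow, (hl' i).2.2, h7, map_pow]

lemma isExt_congr {V : Subgroup (US S R)} {Y Y' : ExtData S R E} (h : Y ≈ Y')
    (hY : Y.IsExt σ V) : Y'.IsExt σ V := by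
  obtain ⟨f, hf1, hf2, hf3⟩ := h
  obtain ⟨h1, h2, h3, h4, h5, h6⟩ := hY
  have hs : ∀ y, ∃ x, f x = y := f.surjective
  refine ⟨fun y => ?_, fun u => ?_, fun y => ?_, ?_, ?_, fun x => ?_⟩
  · obtain ⟨x, rfl⟩ := hs y
    rw [← hf1, ← hf1, h1]
  · rw [← hf2, ← hf1, h2, hf2]
  · obtain ⟨x, rfl⟩ := hs y
    rw [← hf1, hf3, hf3, h3]
  · rw [← h4]
    ext u
    rw [MonoidHom.mem_ker, MonoidHom.mem_ker, ← hf2, EmbeddingLike.map_eq_one_iff]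
  · ext y
    obtain ⟨x, rfl⟩ := hs y
    rw [MonoidHom.mem_ker, hf3, ← MonoidHom.mem_ker, h5]
    constructor
    · rintro ⟨u, rfl⟩
      exact ⟨u, (hf2 u).symm⟩
    · rintro ⟨u, hu⟩
      rw [← hf2] at hu
      exact ⟨u, f.injective hu⟩
  · obtain ⟨y, hy⟩ := h6 x
    exact ⟨f y, (hf3 y).trans hy⟩

lemma mk_mem_extSet_iff {V : Subgroup (US S R)} {Y : ExtData S R E} :
    (⟦Y⟧ : ExtCls S R E) ∈ extSet E σ V ↔ Y.IsExt σ V :=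
  ⟨fun h => isExt_congr (Y.out_equiv) h, fun h => isExt_congr (Setoid.symm Y.out_equiv) h⟩

/-- All extensions occur equally often among those with parameters. -/
lemma nonempty_fibre_equiv (hG : GoodRing S σ) (hE : IsPres e d) {V : Subgroup (US S R)}
    (hV : V ≤ uMinus S σ) {ε : ExtCls S R E} (hε : ε ∈ extSet E σ V) :
    Nonempty ({h // (⟦extModel hE hV h⟧ : ExtCls S R E) = ε} ≃ trivParam d V σ) := by
  obtain ⟨h₀, x, hx⟩ := exists_extLifts hG hE hε
  have h0 : (⟦extModel hE hV h₀⟧ : ExtCls S R E) = ε := by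
    rw [← Quotient.out_eq ε]
    exact Quotient.sound (extModel_equiv hE hV h₀ hε hx)
  subst h0
  exact ⟨{ toFun := fun h => ⟨h.1 * h₀⁻¹, (extModel_eq_iff hG hE hV h.1 h₀).1 h.2⟩
           invFun := fun h => ⟨h.1 * h₀, (extModel_eq_iff hG hE hV _ h₀).2 (by
            rw [mul_inv_cancel_right]; exact h.2)⟩
           left_inv := fun h => Subtype.ext (inv_mul_cancel_right _ _)
           right_inv := fun h => Subtype.ext (mul_inv_cancel_right _ _) }⟩

lemma card_extModel_mem (hG : GoodRing S σ) (hE : IsPres e d) {V : Subgroup (US S R)}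
    (hV : V ≤ uMinus S σ) (B : Set (ExtCls S R E)) :
    Nat.card {h // (⟦extModel hE hV h⟧ : ExtCls S R E) ∈ B} =
      (B ∩ extSet E σ V).ncard * Nat.card (trivParam d V σ) := by
  rw [← Nat.card_coe_set_eq, ← Nat.card_prod]
  refine Nat.card_congr (Equiv.trans ?_ (((Equiv.sigmaCongrRight fun ε :
    (B ∩ extSet E σ V : Set (ExtCls S R E)) =>
    (nonempty_fibre_equiv hG hE hV ε.2.2).some)).trans (Equiv.sigmaEquivProd _ _)))
  exact
    { toFun := fun h => ⟨⟨⟦extModel hE hV h.1⟧, h.2,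
        mk_mem_extSet_iff.2 (extModel_isExt hG hE hV h.1)⟩, h.1, rfl⟩
      invFun := fun x => ⟨x.2.1, by rw [x.2.2]; exact x.1.2.1⟩
      left_inv := fun h => rfl
      right_inv := by
        rintro ⟨⟨ε, h1, h2⟩, h, hh⟩
        have hh' : (⟦extModel hE hV h⟧ : ExtCls S R E) = ε := hh
        subst hh'
        rfl }

lemma card_extSet (hG : GoodRing S σ) (hE : IsPres e d) {V : Subgroup (US S R)}
    (hV : V ≤ uMinus S σ) :
    Nat.card (ι → uMinus S σ) = (extSet E σ V).ncard * Nat.card (trivParam d V σ) := by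
  have := card_extModel_mem hG hE hV Set.univ
  rw [Set.univ_inter] at this
  rw [← this]
  exact Nat.card_congr (Equiv.subtypeUnivEquiv fun _ => Set.mem_univ _).symm

/-- Related extensions have the same number of trivial parameters. -/
lemma card_trivParam_eq (hG : GoodRing S σ) (d : ι → ℕ) {V V' : Subgroup (US S R)}
    {ε ε' : ExtCls S R E} (hε : ε ∈ extSet E σ V) (hε' : ε' ∈ extSet E σ V')
    (h : SameOrbit ε ε') : Nonempty (trivParam d V σ ≃ trivParam d V' σ) := by
  obtain ⟨f, ρ, β, -, hf, -⟩ := h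
  have hV : ∀ u, usMap S (ρ : R →+* R) u ∈ V' ↔ u ∈ V := fun u => by
    rw [← hε.2.2.2.1, ← hε'.2.2.2.1, MonoidHom.mem_ker, MonoidHom.mem_ker, ← hf,
      EmbeddingLike.map_eq_one_iff]
  have hm : ∀ u, usEquiv S ρ u ∈ uMinus S σ ↔ u ∈ uMinus S σ := fun u =>
    hG.ringAut_mem ⟨ρ, fun u => rfl⟩
  let r : uMinus S σ ≃ uMinus S σ := (usEquiv S ρ).toEquiv.subtypeEquiv fun u => (hm u).symm
  have hr : ∀ (h φ : uMinus S σ) (n : ℕ), (r h * (r φ ^ n)⁻¹).1 =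
      usMap S (ρ : R →+* R) (h * (φ ^ n)⁻¹).1 := fun h φ n => by
    change usMap S (ρ : R →+* R) h.1 * (usMap S (ρ : R →+* R) φ.1 ^ n)⁻¹ =
      usMap S (ρ : R →+* R) (h.1 * (φ.1 ^ n)⁻¹)
    rw [map_mul, map_inv, map_pow]
  refine ⟨(Equiv.piCongrRight fun _ => r).subtypeEquiv fun h => ?_⟩
  constructor
  · rintro ⟨φ, hφ⟩
    refine ⟨fun i => r (φ i), fun i => ?_⟩
    change (r (h i) * (r (φ i) ^ d i)⁻¹).1 ∈ V'
    rw [hr, hV]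
    exact hφ i
  · rintro ⟨φ, hφ⟩
    refine ⟨fun i => r.symm (φ i), fun i => ?_⟩
    rw [← hV, ← hr, r.apply_symm_apply]
    exact hφ i

end ExtCount

section Realize

variable {S : Finset ℕ} {R : Type} [CommRing R] {σ : R ≃+* R} {E : Type} [CommGroup E]

/-- A criterion for `Realizes`. -/
lemma realizes_of_isDiv [Finite E] {Θ : ThetaSeq S R} {Y : ExtData S R E} [Finite Y.X]
    (q : Θ.B →* Y.X) (hq : Function.Surjective q) (hk : IsDiv q.ker)
    (hg : ∀ b, q (Θ.g b) = Y.g (q b)) (hi : ∀ u, q (Θ.i u) = Y.i u)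
    (hp : Function.Surjective Y.p) (hpi : Y.p.ker = Y.i.range) : Realizes Θ Y := by
  refine ⟨q, hq, (divSub_eq_of_ker q hk).symm, hg, hi, hp, ?_⟩
  have hpi' : ∀ u, Y.p (Y.i u) = 1 := fun u => by
    rw [← MonoidHom.mem_ker, hpi]
    exact ⟨u, rfl⟩
  let ψ : Θ.C →* E := QuotientGroup.lift _ (Y.p.comp q) (by
    rintro _ ⟨u, rfl⟩
    change Y.p (q (Θ.i u)) = 1
    rw [hi, hpi'])
  have hψ : ∀ b : Θ.B, ψ (b : Θ.C) = Y.p (q b) := fun b => rfl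
  have hψk : ψ.ker = q.ker.map (mk' Θ.i.range) := by
    ext x
    obtain ⟨b, rfl⟩ := mk_surjective x
    rw [MonoidHom.mem_ker, hψ, ← MonoidHom.mem_ker, hpi]
    constructor
    · rintro ⟨u, hu⟩
      refine ⟨b * (Θ.i u)⁻¹, ?_, QuotientGroup.eq.2 ?_⟩
      · change q _ = 1
        rw [map_mul, map_inv, hi, hu, mul_inv_cancel]
      · rw [mul_inv, inv_inv, inv_mul_cancel_comm]
        exact ⟨u, rfl⟩
    · rintro ⟨c, hc, hcb⟩
      obtain ⟨u, hu⟩ := QuotientGroup.eq.1 hcb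
      refine ⟨u, ?_⟩
      rw [← hi, hu, map_mul, map_inv, show q c = 1 from hc, inv_one, one_mul]
  have h := divSub_eq_of_ker ψ (hψk ▸ hk.map _)
  rw [h]
  ext b
  rfl

variable {T : Type} [CommGroup T] [TopologicalSpace T] [IsTopologicalGroup T] {z : T}
  {ι : Type} [Fintype ι] {e : ι → E} {d : ι → ℕ}

lemma zpowers_le_uMinus (p : Param S σ z ι) : zpowers p.1.1 ≤ uMinus S σ := by
  rw [Subgroup.zpowers_le]
  exact p.1.2.1

lemma extModel_finite (hG : GoodRing S σ) [Finite E] (hE : IsPres e d) {V : Subgroup (US S R)}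
    (hV : V ≤ uMinus S σ) (h : ι → uMinus S σ) : Finite (extModel hE hV h).X := by
  have := hG.finiteU
  obtain ⟨-, -, -, -, h5, h6⟩ := extModel_isExt hG hE hV h
  have h1 : Finite (extModel hE hV h).p.ker := by
    rw [h5]
    exact Finite.of_surjective _ (extModel hE hV h).i.rangeRestrict_surjective
  have h2 : Finite ((extModel hE hV h).X ⧸ (extModel hE hV h).p.ker) := Finite.of_equiv _
    (quotientKerEquivOfSurjective _ h6).symm.toEquiv
  exact Finite.of_subgroup_quotient (extModel hE hV h).p.ker

lemma extModel_isSGroup (hG : GoodRing S σ) (hES : IsSGroup S E) (hE : IsPres e d)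
    {V : Subgroup (US S R)} (hV : V ≤ uMinus S σ) (h : ι → uMinus S σ) :
    IsSGroup S (extModel hE hV h).X := by
  obtain ⟨-, -, -, -, h5, h6⟩ := extModel_isExt hG hE hV h
  refine eq_top_iff.2 fun x _ => ?_
  obtain ⟨n, hn, hx⟩ := hES.exists_pow ((extModel hE hV h).p x)
  rw [← map_pow, ← MonoidHom.mem_ker, h5] at hx
  obtain ⟨u, hu⟩ := hx
  obtain ⟨k, hk, huk⟩ := isSGroup_US.exists_pow u
  exact ⟨n * k, hn.mul hk, by rw [pow_mul, ← hu, ← map_pow, huk, map_one]⟩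

lemma realizes_model (hG : GoodRing S σ) [Finite E] (hES : IsSGroup S E) (hE : IsPres e d)
    (hT : ∀ n : ℕ, n ≠ 0 → ∀ t : T, ∃ t', t' ^ n = t) (p : Param S σ z ι) :
    Realizes (model d p).tors (extModel hE (zpowers_le_uMinus p) p.2) := by
  set Y := extModel hE (zpowers_le_uMinus p) p.2 with hYdef
  have hfin : Finite Y.X := extModel_finite hG hE _ _
  have hYS : IsSGroup S Y.X := extModel_isSGroup hG hES hE _ _
  obtain ⟨-, -, -, -, h5, h6⟩ := extModel_isExt hG hE (zpowers_le_uMinus p) p.2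
  let q : (model d p).B →* Y.X := QuotientGroup.map (relSub d p)
    (relExt d (zpowers p.1.1) p.2)
    ((MonoidHom.fst _ _).prod ((MonoidHom.snd _ _).comp (MonoidHom.snd _ _))) (by
      rintro ⟨v, t, k⟩ ⟨n, l, h1, h2, h3⟩
      refine ⟨l, h2, ?_⟩
      change v * powHom _ l ∈ _
      refine ⟨-n, ?_⟩
      change p.1.1 ^ (-n) = _
      rw [zpow_neg]
      exact inv_eq_of_mul_eq_one_right ((mul_left_comm _ _ _).trans h3))
  have hq : Function.Surjective q := by
    rintro ⟨v, k⟩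
    exact ⟨mk' (relSub d p) (v, 1, k), rfl⟩
  have hqd : IsDiv q.ker := by
    rintro n hn ⟨v, t, k⟩ hb
    obtain ⟨l, h1, j, h2⟩ := (eq_one_iff _).1 hb
    change p.1.1 ^ j = v * powHom _ l at h2
    obtain ⟨t', ht'⟩ := hT n hn (t * z ^ j)
    refine ⟨mk' (relSub d p) (1, t', 1), ?_, QuotientGroup.eq.2
      (show (_ : CovGrp S R T ι) ∈ relSub d p from ⟨-j, l, ?_, fun i => ?_, ?_⟩)⟩
    · exact (eq_one_iff _).2 ⟨1, fun i => (one_pow _).symm, by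
        change 1 * powHom _ 1 ∈ _
        rw [map_one, mul_one]
        exact one_mem _⟩
    · change (t' ^ n)⁻¹ * t = _
      rw [ht', mul_inv, zpow_neg, inv_mul_cancel_comm]
    · change (1 ^ n)⁻¹ * k i = _
      rw [one_pow, inv_one, one_mul]
      exact h1 i
    · change (1 ^ n)⁻¹ * v * _ = 1
      rw [one_pow, inv_one, one_mul, mul_left_comm, ← h2, zpow_neg, inv_mul_cancel]
  let q' : (model d p).tors.B →* Y.X := q.comp (sTorsion S (model d p).B).subtype
  have e' : sTorsion S Y.X ≃* Y.X :=
    (MulEquiv.subgroupCongr (show sTorsion S Y.X = ⊤ from hYS)).trans Subgroup.topEquiv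
  have hq' : Function.Surjective q' := fun y => by
    obtain ⟨b, hb⟩ := sTorsionMap_surjective (S := S) q hq (hqd.almostDivisible S)
      ⟨y, hYS.symm ▸ Subgroup.mem_top y⟩
    exact ⟨b, congrArg Subtype.val hb⟩
  have hk : q'.ker = (sTorsionMap S q).ker := by
    ext b
    refine Iff.trans MonoidHom.mem_ker (Iff.trans ?_ (MonoidHom.mem_ker (f := sTorsionMap S q)).symm)
    exact (Subtype.ext_iff (a1 := sTorsionMap S q b) (a2 := 1)).symm
  refine realizes_of_isDiv q' hq' ?_ ?_ (fun u => rfl) h6 h5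
  · rw [hk]
    exact isDiv_ker_sTorsionMap hG.prime q (hqd.almostDivisible S)
  · rintro ⟨⟨m⟩, hm⟩
    rfl

end Realize

open ThetaSeq

section ExtMeasure

variable {S : Finset ℕ} {R : Type} [CommRing R] {σ : R ≃+* R}
  {T : Type} [CommGroup T] [TopologicalSpace T] [IsTopologicalGroup T] {z : T} {N : ℕ}
  {ι : Type} [Fintype ι] {E : Type} [CommGroup E] {e : ι → E} {d : ι → ℕ}

/-- The class of the extension with parameter `p`. -/
def extModelCls (hE : IsPres e d) (p : Param S σ z ι) : ExtCls S R E :=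
  ⟦extModel hE (zpowers_le_uMinus p) p.2⟧

lemma measDisc_extEvent (hG : GoodRing S σ) {s : QSign} [SigmaCompactSpace T]
    (hP : IsPeriod S σ s z N) [Finite E]
    (hES : IsSGroup S E) (hE : IsPres e d) (hEd : Nat.card E = ∏ i, d i) (ε : ExtCls S R E) :
    measDisc σ s (extEvent ε) = clMeasure S E s *
      ((Nat.card {p : Param S σ z ι // SameOrbit ε (extModelCls hE p)} : ℝ) /
        Nat.card (Param S σ z ι)) := by
  have h1 : torsCls ⁻¹' (extEvent ε : Set (ThetaCls S R)) =
      torsCls ⁻¹' extEvent ε ∩ cptEvent S R E :=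
    (Set.inter_eq_left.2 (Set.preimage_mono (extEvent_subset ε))).symm
  rw [measDisc_eq hG hP, h1, measCpt_inter hG hP hES hE hEd]
  have h2 : ∀ p : Param S σ z ι, modelCls d p ∈ torsCls ⁻¹' (extEvent ε : Set (ThetaCls S R)) ↔
      SameOrbit ε (extModelCls hE p) := fun p => by
    rw [Set.mem_preimage, modelCls, mk_tors_out]
    exact mem_extEvent_iff (realizes_model hG hES hE hP.div p) ε
  rw [Nat.card_congr (Equiv.subtypeEquivRight h2)]

/-- The pairs `(u, ε')`, where `ε'` is in the orbit of `ε` and the period is mapped to `u`. -/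
def orbitPairs (σ : R ≃+* R) (z : T) (ε : ExtCls S R E) : Set (US S R × ExtCls S R E) :=
  {x | (x.1 ∈ uMinus S σ ∧ ∀ n : ℤ, z ^ n = 1 → x.1 ^ n = 1) ∧
    x.2 ∈ extSet E σ (zpowers x.1) ∧ SameOrbit ε x.2}

lemma card_sameOrbit (hG : GoodRing S σ) (hE : IsPres e d) {V : Subgroup (US S R)}
    {ε : ExtCls S R E} (hε : ε ∈ extSet E σ V) :
    Nat.card {p : Param S σ z ι // SameOrbit ε (extModelCls hE p)} =
      (orbitPairs σ z ε).ncard * Nat.card (trivParam d V σ) := by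
  rw [← Nat.card_coe_set_eq, ← Nat.card_prod]
  have hV : ∀ x : orbitPairs σ z ε, zpowers x.1.1 ≤ uMinus S σ := fun x => by
    rw [Subgroup.zpowers_le]
    exact x.2.1.1
  have e1 : ∀ x : orbitPairs σ z ε,
      {h // (⟦extModel hE (hV x) h⟧ : ExtCls S R E) = x.1.2} ≃ trivParam d V σ := fun x =>
    ((nonempty_fibre_equiv hG hE (hV x) x.2.2.1).some).trans
      (card_trivParam_eq hG d hε x.2.2.1 x.2.2.2).some.symm
  refine Nat.card_congr (Equiv.trans ?_ ((Equiv.sigmaCongrRight e1).trans (Equiv.sigmaEquivProd _ _)))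
  exact
    { toFun := fun p => ⟨⟨(p.1.1.1, extModelCls hE p.1), p.1.1.2,
        mk_mem_extSet_iff.2 (extModel_isExt hG hE _ _), p.2⟩, p.1.2, rfl⟩
      invFun := fun x => ⟨(⟨x.1.1.1, x.1.2.1⟩, x.2.1), by
        have h := x.1.2.2.2
        rw [← x.2.2] at h
        exact h⟩
      left_inv := fun p => rfl
      right_inv := by
        rintro ⟨⟨⟨u, ε'⟩, h1, h2, h3⟩, h, hh⟩
        have h1' : u ∈ uMinus S σ := h1.1
        have hh' : (⟦extModel hE (Subgroup.zpowers_le.2 h1') h⟧ : ExtCls S R E) = ε' := hh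
        subst hh'
        rfl }

lemma clMeasure_ne_zero (hS : ∀ p ∈ S, p.Prime) [Finite E] (s : QSign) :
    clMeasure S E s ≠ 0 := by
  have h1 := (inv_pos.2 (clConst_pos hS s)).ne'
  have h2 : (Nat.card (E ≃* E) : ℝ) ≠ 0 := by
    have : Finite (E ≃* E) := Finite.of_injective _ DFunLike.coe_injective
    exact_mod_cast Nat.card_pos.ne'
  have h3 : (Nat.card E : ℝ) ≠ 0 := by exact_mod_cast Nat.card_pos.ne'
  cases s
  · exact div_ne_zero h1 h2
  · exact div_ne_zero h1 (mul_ne_zero h2 h3)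

lemma card_trivParam_ne_zero (hG : GoodRing S σ) (V : Subgroup (US S R)) :
    Nat.card (trivParam d V σ) ≠ 0 := by
  have := hG.finiteU
  have : Nonempty (trivParam d V σ) := ⟨⟨1, 1, fun i => by simp⟩⟩
  exact Nat.card_pos.ne'

lemma measDisc_extEvent_div_plus (hG : GoodRing S σ) [Finite E] (hES : IsSGroup S E)
    {u : US S R} (hu : u ∈ UMinus S σ) {ε : ExtCls S R E}
    (hε : ε ∈ extSet E σ (zpowers u)) :
    measDisc σ .plus (extEvent ε) / measDisc σ .plus (compEvent S R E) =
      (Set.ncard {x : US S R × ExtCls S R E | x.1 ∈ UMinus S σ ∧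
          x.2 ∈ extSet E σ (zpowers x.1) ∧ SameOrbit ε x.2} : ℝ) /
        (((UMinus S σ).ncard : ℝ) * ((extSet E σ (zpowers u)).ncard : ℝ)) := by
  have := hG.finiteU
  obtain ⟨ι, _, e, d, hE, hEd⟩ := exists_isPres E
  rw [measDisc_extEvent hG (isPeriod_plus hG) hES hE hEd, measDisc_compEvent hG _ hES,
    mul_div_cancel_left₀ _ (clMeasure_ne_zero hG.prime _), card_sameOrbit hG hE hε,
    Nat.card_congr (paramPlus S σ ι), Nat.card_prod,
    card_extSet hG hE (Subgroup.zpowers_le.2 hu : _ ≤ uMinus S σ), ← mul_assoc]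
  have h1 : (orbitPairs σ unitPeriod ε : Set (US S R × ExtCls S R E)) =
      {x | x.1 ∈ UMinus S σ ∧ x.2 ∈ extSet E σ (zpowers x.1) ∧ SameOrbit ε x.2} :=
    Set.ext fun x => and_congr_left fun _ => ⟨fun h => h.1, fun h => ⟨h, zpow_unitPeriod _⟩⟩
  have h2 : Nat.card (uMinus S σ) = (UMinus S σ).ncard := Nat.card_coe_set_eq _
  rw [h1, h2]
  push_cast
  refine mul_div_mul_right _ _ ?_
  exact_mod_cast card_trivParam_ne_zero hG _

lemma measDisc_extEvent_div_minus (hG : GoodRing S σ) [Finite E] (hES : IsSGroup S E)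
    {ε : ExtCls S R E} (hε : ε ∈ extSet E σ (⊥ : Subgroup (US S R))) :
    measDisc σ .minus (extEvent ε) / measDisc σ .minus (compEvent S R E) =
      (Set.ncard {ε' ∈ extSet E σ (⊥ : Subgroup (US S R)) | SameOrbit ε ε'} : ℝ) /
        ((extSet E σ (⊥ : Subgroup (US S R))).ncard : ℝ) := by
  have := hG.finiteU
  obtain ⟨ι, _, e, d, hE, hEd⟩ := exists_isPres E
  rw [measDisc_extEvent hG (isPeriod_minus hG) hES hE hEd, measDisc_compEvent hG _ hES,
    mul_div_cancel_left₀ _ (clMeasure_ne_zero hG.prime _), card_sameOrbit hG hE hε]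
  have h0 : ∀ u : US S R, (u ∈ uMinus S σ ∧ ∀ n : ℤ, PUnit.unit.{1} ^ n = 1 → u ^ n = 1) ↔
      u = 1 := fun u => by
    constructor
    · intro h
      simpa using h.2 1 rfl
    · rintro rfl
      exact ⟨one_mem _, fun n _ => one_zpow n⟩
  have h1 : (orbitPairs σ PUnit.unit.{1} ε : Set (US S R × ExtCls S R E)) =
      (fun ε' => (1, ε')) '' {ε' ∈ extSet E σ (⊥ : Subgroup (US S R)) | SameOrbit ε ε'} := by
    ext ⟨u, ε'⟩
    rw [orbitPairs, Set.mem_setOf_eq, h0]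
    constructor
    · rintro ⟨h, h2, h3⟩
      change u = 1 at h
      subst h
      rw [Subgroup.zpowers_one_eq_bot] at h2
      exact ⟨ε', ⟨h2, h3⟩, rfl⟩
    · rintro ⟨ε'', ⟨h2, h3⟩, h⟩
      obtain ⟨rfl, rfl⟩ := Prod.mk.inj h
      refine ⟨rfl, ?_, h3⟩
      rw [Subgroup.zpowers_one_eq_bot]
      exact h2
  have h2 : Nat.card (Param S σ PUnit.unit.{1} ι) = Nat.card (ι → uMinus S σ) := by
    have h3 : Nat.card {u : US S R // u ∈ uMinus S σ ∧
        ∀ n : ℤ, PUnit.unit.{1} ^ n = 1 → u ^ n = 1} = 1 := by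
      rw [Nat.card_congr (Equiv.subtypeEquivRight h0)]
      exact Nat.card_unique
    rw [Param, Nat.card_prod, h3, one_mul]
  rw [h1, Set.ncard_image_of_injective _ (Prod.mk_right_injective _), h2,
    card_extSet hG hE (bot_le : (⊥ : Subgroup (US S R)) ≤ uMinus S σ)]
  push_cast
  refine mul_div_mul_right _ _ ?_
  exact_mod_cast card_trivParam_ne_zero hG _

end ExtMeasure

/-! ### Quadratic algebras -/

section Quadratic

variable {K A : Type*} [Field K] [CommRing A] [Algebra K A] [IsReduced A]

/-- A reduced quadratic algebra with a non-trivial automorphism is generated by a square root. -/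
lemma exists_sqrt_generator (h2 : (2 : K) ≠ 0) (hA : Module.finrank K A = 2) {τ : A ≃ₐ[K] A}
    (hτ : τ ≠ AlgEquiv.refl) : ∃ (y : A) (b : K), b ≠ 0 ∧ y ^ 2 = algebraMap K A b ∧ τ y = -y ∧
      (∀ x, ∃ α β : K, x = algebraMap K A α + algebraMap K A β * y) ∧
      ∀ α β : K, algebraMap K A α + algebraMap K A β * y = 0 → α = 0 ∧ β = 0 := by
  obtain ⟨x, hx⟩ : ∃ x, τ x ≠ x := by
    by_contra! h
    exact hτ (AlgEquiv.ext h)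
  have : Nontrivial A := ⟨⟨_, _, hx⟩⟩
  have hfix : ∀ a : K, τ (algebraMap K A a) = algebraMap K A a := τ.commutes
  have hind : ∀ (w : A), τ w ≠ w → ∀ α β : K, algebraMap K A α + algebraMap K A β * w = 0 →
      α = 0 ∧ β = 0 := by
    intro w hw α β h
    have hβ : β = 0 := by
      by_contra hβ
      apply hw
      have : w = algebraMap K A (-α / β) := by
        have h3 : algebraMap K A β * algebraMap K A β⁻¹ = 1 := by
          rw [← map_mul, mul_inv_cancel₀ hβ, map_one]
        rw [div_eq_mul_inv, map_mul, map_neg]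
        linear_combination (-w) * h3 + algebraMap K A β⁻¹ * h
      rw [this, hfix]
    subst hβ
    simpa using h
  have hgen : ∀ w, τ w ≠ w → ∀ x, ∃ α β : K, x = algebraMap K A α + algebraMap K A β * w := by
    intro w hw x
    have hl : LinearIndependent K ![1, w] := by
      rw [LinearIndependent.pair_iff]
      intro s t h
      refine hind w hw s t ?_
      rw [← h, Algebra.smul_def, Algebra.smul_def, mul_one]
    have hsp := hl.span_eq_top_of_card_eq_finrank (by simp [hA])
    have hx : x ∈ Submodule.span K (Set.range ![1, w]) := hsp ▸ Submodule.mem_top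
    rw [Matrix.range_cons, Matrix.range_cons, Matrix.range_empty, Set.union_empty,
      Set.singleton_union, Submodule.mem_span_pair] at hx
    obtain ⟨a, b, h⟩ := hx
    exact ⟨a, b, by rw [← h, Algebra.smul_def, Algebra.smul_def, mul_one]⟩
  obtain ⟨c, d, hcd⟩ := hgen x hx (x ^ 2)
  set y := x - algebraMap K A (d / 2) with hy
  have hd : algebraMap K A d = 2 * algebraMap K A (d / 2) := by
    rw [← map_ofNat (algebraMap K A) 2, ← map_mul, mul_div_cancel₀ _ h2]
  have hy2 : y ^ 2 = algebraMap K A (c + (d / 2) ^ 2) := by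
    rw [map_add, map_pow, hy]
    linear_combination hcd + x * hd
  have hτy : τ y ≠ y := fun h => hx (by
    rw [hy, map_sub, hfix] at h
    exact sub_left_injective h)
  have hb : c + (d / 2) ^ 2 ≠ 0 := fun h => hτy (by
    rw [h, map_zero] at hy2
    rw [pow_eq_zero_iff two_ne_zero |>.1 hy2, map_zero])
  refine ⟨y, _, hb, hy2, ?_, hgen y hτy, hind y hτy⟩
  set b := c + (d / 2) ^ 2
  obtain ⟨α, β, h⟩ := hgen y hτy (τ y)
  have h1 : (τ y) ^ 2 = algebraMap K A b := by rw [← map_pow, hy2, hfix]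
  obtain ⟨h3, h4⟩ := hind y hτy (α ^ 2 + β ^ 2 * b - b) (2 * α * β) (by
    simp only [map_add, map_sub, map_mul, map_pow, map_ofNat]
    rw [h] at h1
    linear_combination h1 - (algebraMap K A β) ^ 2 * hy2)
  have hβ : β ≠ 0 := by
    rintro rfl
    apply hτy
    have h5 : τ y = algebraMap K A α := by rw [h, map_zero, zero_mul, add_zero]
    have h6 : y = algebraMap K A α := τ.injective (by rw [h5, hfix])
    rw [h5, ← h6]
  have hα : α = 0 := by simpa [h2, hβ] using h4
  subst hα
  have h7 : (β - 1) * (β + 1) = 0 := by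
    apply mul_right_cancel₀ hb
    linear_combination h3
  rcases mul_eq_zero.1 h7 with h8 | h8
  · exact absurd (by rw [h, sub_eq_zero.1 h8, map_zero, map_one, zero_add, one_mul]) hτy
  · rw [h, eq_neg_of_add_eq_zero_left h8]
    simp

lemma invol_of_quadratic (h2 : (2 : K) ≠ 0) (hA : Module.finrank K A = 2) {τ : A ≃ₐ[K] A}
    (hτ : τ ≠ AlgEquiv.refl) (x : A) : τ (τ x) = x ∧
      (∃ t : K, x + τ x = algebraMap K A t) ∧ ∃ n : K, x * τ x = algebraMap K A n := by
  obtain ⟨y, b, -, hy2, hy, hgen, -⟩ := exists_sqrt_generator h2 hA hτ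
  obtain ⟨α, β, rfl⟩ := hgen x
  simp only [map_add, map_mul, τ.commutes, hy, map_neg]
  refine ⟨by ring, ⟨2 * α, ?_⟩, ⟨α ^ 2 - β ^ 2 * b, ?_⟩⟩
  · rw [map_mul, map_ofNat]
    ring
  · simp only [map_sub, map_mul, map_pow]
    linear_combination (-(algebraMap K A β) ^ 2) * hy2

end Quadratic

/-! ### Rings of integers of étale algebras of degree two -/

section Local

variable {p : ℕ} [Fact p.Prime] {A : Type*} [CommRing A] [Algebra ℚ_[p] A] [Algebra ℤ_[p] A]
  [IsScalarTower ℤ_[p] ℚ_[p] A]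

lemma exists_padicInt_of_isIntegral [Nontrivial A] {a : ℚ_[p]}
    (h : IsIntegral ℤ_[p] (algebraMap ℚ_[p] A a)) : ∃ c : ℤ_[p], (c : ℚ_[p]) = a := by
  rw [isIntegral_algebraMap_iff (algebraMap ℚ_[p] A).injective] at h
  exact IsIntegrallyClosed.isIntegral_iff.1 h

variable [IsReduced A]

lemma isIntegral_algEquiv (τ : A ≃ₐ[ℚ_[p]] A) {x : A} (hx : IsIntegral ℤ_[p] x) :
    IsIntegral ℤ_[p] (τ x) :=
  hx.map ((τ.restrictScalars ℤ_[p] : A ≃ₐ[ℤ_[p]] A) : A →ₐ[ℤ_[p]] A)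

/-- The structure of the ring of integers. -/
lemma exists_integral_generator (hA : Module.finrank ℚ_[p] A = 2) {τ : A ≃ₐ[ℚ_[p]] A}
    (hτ : τ ≠ AlgEquiv.refl) :
    (∀ x : A, IsIntegral ℤ_[p] x → (∃ t : ℤ_[p], x + τ x = algebraMap ℤ_[p] A t) ∧
      ∃ n : ℤ_[p], x * τ x = algebraMap ℤ_[p] A n) ∧
    ∃ ω : A, IsIntegral ℤ_[p] ω ∧
      (∀ x : A, IsIntegral ℤ_[p] x → ∃ a k : ℤ_[p],
        x = algebraMap ℤ_[p] A a + algebraMap ℤ_[p] A k * ω) ∧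
      ∀ a k : ℤ_[p], algebraMap ℤ_[p] A a + algebraMap ℤ_[p] A k * ω = 0 → a = 0 ∧ k = 0 := by
  have : Nontrivial A := by
    by_contra h
    rw [not_nontrivial_iff_subsingleton] at h
    rw [Module.finrank_zero_of_subsingleton] at hA
    omega
  have h2 : (2 : ℚ_[p]) ≠ 0 := two_ne_zero
  have hmap : ∀ c : ℤ_[p], algebraMap ℤ_[p] A c = algebraMap ℚ_[p] A (c : ℚ_[p]) := fun c =>
    IsScalarTower.algebraMap_apply ℤ_[p] ℚ_[p] A c
  have htn : ∀ x : A, IsIntegral ℤ_[p] x → (∃ t : ℤ_[p], x + τ x = algebraMap ℤ_[p] A t) ∧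
      ∃ n : ℤ_[p], x * τ x = algebraMap ℤ_[p] A n := by
    intro x hx
    obtain ⟨-, ⟨t, ht⟩, ⟨n, hn⟩⟩ := invol_of_quadratic h2 hA hτ x
    obtain ⟨t', rfl⟩ := exists_padicInt_of_isIntegral (A := A)
      (ht ▸ hx.add (isIntegral_algEquiv τ hx))
    obtain ⟨n', rfl⟩ := exists_padicInt_of_isIntegral (A := A)
      (hn ▸ hx.mul (isIntegral_algEquiv τ hx))
    exact ⟨⟨t', by rw [ht, hmap]⟩, ⟨n', by rw [hn, hmap]⟩⟩
  refine ⟨htn, ?_⟩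
  obtain ⟨y, b, hb, hy2, hy, hgen, hind⟩ := exists_sqrt_generator h2 hA hτ
  -- the coefficients of `y`, multiplied by `2 * b`, are integral up to a fixed denominator
  obtain ⟨N, hN⟩ : ∃ N : ℕ, ‖(p : ℚ_[p]) ^ N * (2 * b)‖ ^ 2 * ‖(4 * b)⁻¹‖ ≤ 1 ∧
      ‖((p : ℚ_[p]) ^ N) ^ 2 * b‖ ≤ 1 := by
    have hlim : Tendsto (fun N : ℕ => ‖(p : ℚ_[p])‖ ^ N) atTop (𝓝 0) :=
      tendsto_pow_atTop_nhds_zero_of_lt_one (norm_nonneg _) Padic.norm_p_lt_one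
    have h3 : Tendsto (fun N : ℕ => ‖(p : ℚ_[p]) ^ N * (2 * b)‖ ^ 2 * ‖(4 * b)⁻¹‖) atTop (𝓝 0) := by
      simp only [norm_mul, norm_pow]
      simpa using ((hlim.mul_const (‖(2 : ℚ_[p])‖ * ‖b‖)).pow 2).mul_const ‖(4 * b)⁻¹‖
    have h4 : Tendsto (fun N : ℕ => ‖((p : ℚ_[p]) ^ N) ^ 2 * b‖) atTop (𝓝 0) := by
      simp only [norm_mul, norm_pow]
      simpa using (hlim.pow 2).mul_const ‖b‖
    obtain ⟨N, h5, h6⟩ := ((h3.eventually (gt_mem_nhds one_pos)).and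
      (h4.eventually (gt_mem_nhds one_pos))).exists
    exact ⟨N, h5.le, h6.le⟩
  set D : ℚ_[p] := (p : ℚ_[p]) ^ N * (2 * b) with hD
  have hp0 : (p : ℚ_[p]) ^ N ≠ 0 := pow_ne_zero _ (Nat.cast_ne_zero.2 (Fact.out : p.Prime).ne_zero)
  have hD0 : D ≠ 0 := mul_ne_zero hp0 (mul_ne_zero h2 hb)
  have hcoef : ∀ α β : ℚ_[p], IsIntegral ℤ_[p] (algebraMap ℚ_[p] A α + algebraMap ℚ_[p] A β * y) →
      ∃ c : ℤ_[p], (c : ℚ_[p]) = D * β := by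
    intro α β h
    obtain ⟨⟨t, ht⟩, ⟨n, hn⟩⟩ := htn _ h
    simp only [map_add, map_mul, τ.commutes, hy] at ht hn
    rw [hmap] at ht hn
    have h3 : (t : ℚ_[p]) = 2 * α := by
      apply (algebraMap ℚ_[p] A).injective
      rw [← ht, map_mul, map_ofNat]
      ring
    have h4 : (n : ℚ_[p]) = α ^ 2 - β ^ 2 * b := by
      apply (algebraMap ℚ_[p] A).injective
      rw [← hn]
      simp only [map_sub, map_mul, map_pow]
      linear_combination (-(algebraMap ℚ_[p] A β) ^ 2) * hy2
    have h5 : β ^ 2 = ((t ^ 2 - 4 * n : ℤ_[p]) : ℚ_[p]) * (4 * b)⁻¹ := by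
      have h40 : (4 : ℚ_[p]) ≠ 0 := by norm_num
      have h41 : ((t ^ 2 - 4 * n : ℤ_[p]) : ℚ_[p]) = (t : ℚ_[p]) ^ 2 - 4 * n := by
        push_cast
        rfl
      rw [h41, h3, h4, eq_mul_inv_iff_mul_eq₀ (mul_ne_zero h40 hb)]
      ring
    have h6 : ‖D * β‖ ^ 2 ≤ 1 := by
      have h7 : ‖D * β‖ ^ 2 = ‖D‖ ^ 2 *
          (‖((t ^ 2 - 4 * n : ℤ_[p]) : ℚ_[p])‖ * ‖(4 * b)⁻¹‖) := by
        rw [norm_mul D, mul_pow, ← norm_pow β, h5, norm_mul _ (4 * b)⁻¹]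
      rw [h7]
      calc ‖D‖ ^ 2 * (‖((t ^ 2 - 4 * n : ℤ_[p]) : ℚ_[p])‖ * ‖(4 * b)⁻¹‖)
          = (‖D‖ ^ 2 * ‖(4 * b)⁻¹‖) * ‖((t ^ 2 - 4 * n : ℤ_[p]) : ℚ_[p])‖ := by ring
        _ ≤ 1 * 1 := mul_le_mul hN.1 (PadicInt.norm_le_one _) (norm_nonneg _) zero_le_one
        _ = 1 := one_mul 1
    exact ⟨⟨D * β, by simpa using (sq_le_one_iff₀ (norm_nonneg _)).1 h6⟩, rfl⟩
  let I : Ideal ℤ_[p] :=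
    { carrier := {c | ∃ α β : ℚ_[p], IsIntegral ℤ_[p]
        (algebraMap ℚ_[p] A α + algebraMap ℚ_[p] A β * y) ∧ (c : ℚ_[p]) = D * β}
      add_mem' := by
        rintro c c' ⟨α, β, h, h'⟩ ⟨α', β', k, k'⟩
        refine ⟨α + α', β + β', ?_, ?_⟩
        · convert h.add k using 1
          simp only [map_add]
          ring
        · push_cast
          rw [h', k']
          ring
      zero_mem' := ⟨0, 0, by simpa using isIntegral_zero, by simp⟩
      smul_mem' := by
        rintro e c ⟨α, β, h, h'⟩
        refine ⟨e * α, e * β, ?_, ?_⟩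
        · convert (isIntegral_algebraMap (R := ℤ_[p]) (A := A) (x := e)).mul h using 1
          rw [hmap]
          simp only [map_mul]
          ring
        · change ((e * c : ℤ_[p]) : ℚ_[p]) = _
          push_cast
          rw [h']
          ring }
  obtain ⟨g, hg⟩ := (IsPrincipalIdealRing.principal I).principal
  obtain ⟨α₀, β₀, hint, hg0⟩ : g ∈ I := hg ▸ Submodule.mem_span_singleton_self g
  have hβ0 : β₀ ≠ 0 := by
    rintro rfl
    have hg1 : g = 0 := by
      rw [mul_zero] at hg0
      exact Subtype.ext hg0
    have hyI : IsIntegral ℤ_[p] (algebraMap ℚ_[p] A 0 + algebraMap ℚ_[p] A ((p : ℚ_[p]) ^ N) * y) := by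
      rw [map_zero, zero_add]
      refine IsIntegral.of_pow (n := 2) two_pos ?_
      rw [mul_pow, hy2, ← map_pow, ← map_mul]
      obtain ⟨c, hc⟩ : ∃ c : ℤ_[p], (c : ℚ_[p]) = ((p : ℚ_[p]) ^ N) ^ 2 * b := ⟨⟨_, hN.2⟩, rfl⟩
      rw [← hc, ← hmap]
      exact isIntegral_algebraMap
    obtain ⟨c, hc⟩ := hcoef _ _ hyI
    have hcI : c ∈ I := ⟨_, _, hyI, hc⟩
    rw [hg, hg1, Submodule.span_zero_singleton, Submodule.mem_bot] at hcI
    rw [hcI] at hc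
    exact mul_ne_zero hD0 hp0 (by rw [← hc]; rfl)
  refine ⟨_, hint, fun x hx => ?_, fun a k h => ?_⟩
  · obtain ⟨α, β, rfl⟩ := hgen x
    obtain ⟨c, hc⟩ := hcoef α β hx
    have hcI : c ∈ I := ⟨α, β, hx, hc⟩
    rw [hg, Submodule.mem_span_singleton] at hcI
    obtain ⟨k, rfl⟩ := hcI
    have hk : β = (k : ℚ_[p]) * β₀ := by
      apply mul_left_cancel₀ hD0
      rw [← hc, smul_eq_mul, PadicInt.coe_mul, hg0]
      ring
    have hk' : algebraMap ℚ_[p] A β = algebraMap ℚ_[p] A k * algebraMap ℚ_[p] A β₀ := by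
      rw [hk, map_mul]
    obtain ⟨a, ha⟩ := exists_padicInt_of_isIntegral (A := A) (a := α - (k : ℚ_[p]) * α₀) (by
      convert hx.sub ((isIntegral_algebraMap (R := ℤ_[p]) (A := A) (x := k)).mul hint) using 1
      rw [hmap, hk']
      simp only [map_sub, map_mul]
      ring)
    refine ⟨a, k, ?_⟩
    rw [hmap, hmap, ha, hk']
    simp only [map_sub, map_mul]
    ring
  · rw [hmap, hmap] at h
    obtain ⟨h3, h4⟩ := hind (a + k * α₀) (k * β₀) (by
      simp only [map_add, map_mul]
      linear_combination h)
    have hk : (k : ℚ_[p]) = 0 := by simpa [hβ0] using h4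
    rw [hk, zero_mul, add_zero] at h3
    exact ⟨Subtype.ext h3, Subtype.ext hk⟩

end Local

/-- `R` is a free quadratic algebra over `ℤ/m` with conjugation `σ`. -/
structure QuadRing (m : ℕ) {R : Type} [CommRing R] (σ : R ≃+* R) : Prop where
  cast : (m : R) = 0
  gen : ∃ ω : R, (∀ x, ∃ a b : ℤ, x = a + b * ω) ∧
    ∀ a b : ℤ, (a : R) + b * ω = 0 → (m : ℤ) ∣ a ∧ (m : ℤ) ∣ b
  invol : ∀ x, σ (σ x) = x
  trace : ∀ x, ∃ t : ℤ, x + σ x = t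
  norm : ∀ x, ∃ n : ℤ, x * σ x = n

section CRT

variable {m : ℕ}

lemma natCast_dvd_prime_pow (hm : m ≠ 0) (p : m.primeFactors) :
    (m : ℤ_[(p : ℕ)]) ∣ (p : ℤ_[(p : ℕ)]) ^ m.factorization p := by
  have hp := Nat.prime_of_mem_primeFactors p.2
  have h1 : (m : ℤ_[(p : ℕ)]) = (p : ℤ_[(p : ℕ)]) ^ m.factorization p *
      ((m / p ^ m.factorization p : ℕ) : ℤ_[(p : ℕ)]) := by
    exact_mod_cast congrArg (Nat.cast (R := ℤ_[(p : ℕ)])) (Nat.ordProj_mul_ordCompl_eq_self m p).symm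
  have h2 : IsUnit ((m / p ^ m.factorization p : ℕ) : ℤ_[(p : ℕ)]) := by
    rw [PadicInt.isUnit_iff, ← not_lt.trans (PadicInt.norm_le_one _).ge_iff_eq]
    intro h
    have h3 : ‖((m / p ^ m.factorization p : ℕ) : ℤ_[(p : ℕ)])‖ < 1 := h
    have h4 := (PadicInt.norm_int_lt_one_iff_dvd ((m / p ^ m.factorization p : ℕ) : ℤ)).1
      (by exact_mod_cast h3)
    exact Nat.not_dvd_ordCompl hp hm (by exact_mod_cast h4)
  rw [h1]
  exact (h2.dvd_mul_right.1 dvd_rfl).trans dvd_rfl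

lemma exists_int_approx (hm : m ≠ 0) (c : ∀ p : m.primeFactors, ℤ_[(p : ℕ)]) :
    ∃ N : ℤ, ∀ p : m.primeFactors, ∃ e : ℤ_[(p : ℕ)], c p = N + m * e := by
  obtain ⟨k, hk⟩ := Nat.chineseRemainderOfFinset
    (fun p : m.primeFactors => (c p).appr (m.factorization p))
    (fun p : m.primeFactors => (p : ℕ) ^ m.factorization p) Finset.univ
    (fun p _ => pow_ne_zero _ (Nat.prime_of_mem_primeFactors p.2).ne_zero) (fun p _ q _ hpq =>
      Nat.Coprime.pow _ _ ((Nat.coprime_primes (Nat.prime_of_mem_primeFactors p.2)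
        (Nat.prime_of_mem_primeFactors q.2)).2 fun h => hpq (Subtype.ext h)))
  refine ⟨k, fun p => ?_⟩
  have h1 := Ideal.mem_span_singleton.1 ((c p).appr_spec (m.factorization p))
  have h2 : (p : ℤ_[(p : ℕ)]) ^ m.factorization p ∣
      (((c p).appr (m.factorization p) : ℤ) - (k : ℤ) : ℤ) := by
    rw [PadicInt.pow_p_dvd_int_iff]
    exact_mod_cast (Nat.modEq_iff_dvd.1 (hk p (Finset.mem_univ _)))
  obtain ⟨e, he⟩ := (natCast_dvd_prime_pow hm p).trans (dvd_add h1 h2)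
  refine ⟨e, ?_⟩
  rw [← he]
  push_cast
  ring

lemma int_dvd_of_forall (hm : m ≠ 0) (k : ℤ)
    (h : ∀ p : m.primeFactors, (m : ℤ_[(p : ℕ)]) ∣ (k : ℤ_[(p : ℕ)])) : (m : ℤ) ∣ k := by
  rw [Int.natCast_dvd, Nat.dvd_iff_prime_pow_dvd_dvd]
  intro p j hp hj
  rcases j.eq_zero_or_pos with rfl | hj0
  · simp
  have hpm : p ∈ m.primeFactors := Nat.mem_primeFactors.2 ⟨hp, (dvd_pow_self p hj0.ne').trans hj, hm⟩
  have := Fact.mk hp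
  have h1 : (p : ℤ_[p]) ^ j ∣ (m : ℤ_[p]) := by exact_mod_cast (Nat.cast_dvd_cast hj)
  have h2 := (PadicInt.pow_p_dvd_int_iff j k).1 (h1.trans (h ⟨p, hpm⟩))
  rw [← Int.natCast_dvd]
  exact_mod_cast h2

end CRT

namespace LocalData

variable {m : ℕ} (D : LocalData m)

instance (p : m.primeFactors) : IsReduced (D.A p) :=
  Algebra.FormallyUnramified.isReduced_of_field ℚ_[(p : ℕ)] (D.A p)

lemma mk_intCast (a : ℤ) : Ideal.Quotient.mk (Ideal.span {(m : D.OA)}) a = a := map_intCast _ a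

lemma quadRing (hm : m ≠ 0) : QuadRing m D.σ := by
  have hloc := fun p : m.primeFactors => exists_integral_generator (D.finrank_eq p) (D.τ_ne p)
  choose htn ω hω hgen hind using hloc
  have hmk : ∀ x y : D.OA, (∀ p : m.primeFactors, ∃ e : integralClosure ℤ_[(p : ℕ)] (D.A p), x p = y p + m * e) →
      Ideal.Quotient.mk (Ideal.span {(m : D.OA)}) x = Ideal.Quotient.mk _ y := by
    intro x y h
    choose e he using h
    rw [Ideal.Quotient.mk_eq_mk_iff_sub_mem, Ideal.mem_span_singleton]
    refine ⟨e, funext fun p => ?_⟩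
    change x p - y p = m * e p
    rw [he p, add_sub_cancel_left]
  have hconst : ∀ (x : D.OA) (c : ∀ p : m.primeFactors, ℤ_[(p : ℕ)]),
      (∀ p : m.primeFactors, x p = algebraMap ℤ_[(p : ℕ)] (integralClosure ℤ_[(p : ℕ)] (D.A p)) (c p)) →
      ∃ N : ℤ, Ideal.Quotient.mk (Ideal.span {(m : D.OA)}) x = N := by
    intro x c h
    obtain ⟨N, hN⟩ := exists_int_approx hm c
    choose e he using hN
    refine ⟨N, ?_⟩
    rw [← D.mk_intCast]
    refine hmk _ _ fun p => ⟨algebraMap _ _ (e p), ?_⟩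
    rw [h, he, map_add, map_mul, map_intCast, map_natCast]
    rfl
  refine ⟨?_, ?_, ?_, ?_, ?_⟩
  · have h : Ideal.Quotient.mk (Ideal.span {(m : D.OA)}) (m : D.OA) = 0 :=
      Ideal.Quotient.eq_zero_iff_mem.2 (Ideal.mem_span_singleton_self _)
    rwa [map_natCast] at h
  · let w : D.OA := fun p => ⟨ω p, hω p⟩
    refine ⟨Ideal.Quotient.mk _ w, fun x => ?_, fun a b h => ?_⟩
    · obtain ⟨x, rfl⟩ := Ideal.Quotient.mk_surjective x
      choose a b hab using fun p => hgen p (x p) (x p).2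
      obtain ⟨a', ha⟩ := exists_int_approx hm a
      obtain ⟨b', hb⟩ := exists_int_approx hm b
      choose c hc using ha
      choose d hd using hb
      refine ⟨a', b', ?_⟩
      rw [← D.mk_intCast, ← D.mk_intCast, ← map_mul, ← map_add]
      refine hmk _ _ fun p => ⟨algebraMap _ _ (c p) + algebraMap _ _ (d p) * w p, ?_⟩
      apply Subtype.ext
      rw [hab p, hc, hd]
      simp only [map_add, map_mul, map_intCast, map_natCast]
      change _ = ((a' : D.A p) + b' * ω p) + m * (algebraMap _ _ (c p) + algebraMap _ _ (d p) * ω p)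
      ring
    · rw [← D.mk_intCast, ← D.mk_intCast, ← map_mul, ← map_add, Ideal.Quotient.eq_zero_iff_mem,
        Ideal.mem_span_singleton] at h
      obtain ⟨e, he⟩ := h
      have key : ∀ p : m.primeFactors, (m : ℤ_[(p : ℕ)]) ∣ (a : ℤ_[(p : ℕ)]) ∧
          (m : ℤ_[(p : ℕ)]) ∣ (b : ℤ_[(p : ℕ)]) := by
        intro p
        obtain ⟨c, d, hcd⟩ := hgen p (e p) (e p).2
        have h1 : ((a : D.A p) + b * ω p) = m * (e p : D.A p) :=
          congrArg (fun x : D.OA => (x p : D.A p)) he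
        obtain ⟨h2, h3⟩ := hind p (a - m * c) (b - m * d) (by
          simp only [map_sub, map_mul, map_intCast, map_natCast]
          rw [hcd] at h1
          linear_combination h1)
        exact ⟨⟨c, sub_eq_zero.1 h2⟩, ⟨d, sub_eq_zero.1 h3⟩⟩
      exact ⟨int_dvd_of_forall hm a fun p => (key p).1, int_dvd_of_forall hm b fun p => (key p).2⟩
  · intro x
    obtain ⟨x, rfl⟩ := Ideal.Quotient.mk_surjective x
    refine congrArg (Ideal.Quotient.mk (Ideal.span {(m : D.OA)})) (funext fun p => Subtype.ext ?_)
    exact (invol_of_quadratic two_ne_zero (D.finrank_eq p) (D.τ_ne p) _).1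
  · intro x
    obtain ⟨x, rfl⟩ := Ideal.Quotient.mk_surjective x
    choose t ht using fun p => (htn p (x p) (x p).2).1
    exact hconst (x + D.τO x) t fun p => Subtype.ext (ht p)
  · intro x
    obtain ⟨x, rfl⟩ := Ideal.Quotient.mk_surjective x
    choose t ht using fun p => (htn p (x p) (x p).2).2
    exact hconst (x * D.τO x) t fun p => Subtype.ext (ht p)

end LocalData

namespace QuadRing

variable {m : ℕ} {R : Type} [CommRing R] {σ : R ≃+* R}

lemma exists_fin_surjective (h : QuadRing m σ) (hm : m ≠ 0) :
    ∃ f : Fin m × Fin m → R, Function.Surjective f := by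
  obtain ⟨ω, hω, -⟩ := h.gen
  have hmod : ∀ a : ℤ, ∃ i : Fin m, ((i : ℕ) : R) = a := by
    intro a
    have h0 := Int.emod_nonneg a (Int.natCast_ne_zero.2 hm)
    have h1 := Int.emod_lt_of_pos a (Int.natCast_pos.2 (Nat.pos_of_ne_zero hm))
    refine ⟨⟨(a % m).toNat, by omega⟩, ?_⟩
    have h2 : (((a % m).toNat : ℕ) : R) = ((a % m : ℤ) : R) := by
      rw [← Int.cast_natCast, Int.toNat_of_nonneg h0]
    change (((a % m).toNat : ℕ) : R) = a
    rw [h2]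
    conv_rhs => rw [← Int.mul_ediv_add_emod a m]
    push_cast
    rw [h.cast, zero_mul, zero_add]
  refine ⟨fun x => ((x.1 : ℕ) : R) + ((x.2 : ℕ) : R) * ω, fun x => ?_⟩
  obtain ⟨a, b, rfl⟩ := hω x
  obtain ⟨i, hi⟩ := hmod a
  obtain ⟨j, hj⟩ := hmod b
  exact ⟨(i, j), by rw [← hi, ← hj]⟩

lemma finite (h : QuadRing m σ) (hm : m ≠ 0) : Finite R :=
  let ⟨_, hf⟩ := h.exists_fin_surjective hm
  Finite.of_surjective _ hf

lemma card_le (h : QuadRing m σ) (hm : m ≠ 0) : Nat.card R ≤ m ^ 2 := by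
  obtain ⟨f, hf⟩ := h.exists_fin_surjective hm
  refine (Nat.card_le_card_of_surjective f hf).trans ?_
  simp [sq]

/-- The idempotents of the odd part and of the `2`-part. -/
lemma exists_idempotents (h : QuadRing m σ) (hm : m ≠ 0) : ∃ (k m' : ℕ) (e n : ℤ), Odd m' ∧
    m = 2 ^ k * m' ∧ (e : R) + n = 1 ∧ (e : R) * n = 0 ∧ (m' : R) * e = 0 ∧ (m' : ℤ) ∣ n ∧
      (2 : R) ^ k * n = 0 := by
  obtain ⟨k, m', hm', hmk⟩ := Nat.exists_eq_two_pow_mul_odd hm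
  have hc : IsCoprime ((2 : ℤ) ^ k) m' := by
    apply IsCoprime.pow_left
    exact_mod_cast Nat.isCoprime_iff_coprime.2 (Nat.coprime_two_left.2 hm')
  obtain ⟨u, v, huv⟩ := hc
  have h0 : (2 : R) ^ k * m' = 0 := by
    rw [← h.cast, hmk]
    push_cast
    rfl
  refine ⟨k, m', u * 2 ^ k, v * m', hm', hmk, ?_, ?_, ?_, dvd_mul_left _ _, ?_⟩
  · exact_mod_cast congrArg (Int.cast (R := R)) huv
  · push_cast
    linear_combination u * v * h0
  · push_cast
    linear_combination u * h0
  · push_cast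
    linear_combination v * h0

variable {k m' : ℕ} {e n : ℤ}

lemma eq_of_parts (hen : (e : R) + n = 1) {x y : R} (h1 : e * x = e * y) (h2 : n * x = n * y) :
    x = y := by
  linear_combination h1 + h2 - (x - y) * hen

lemma odd_part_cancel (hm' : Odd m') (hme : (m' : R) * e = 0) (j : ℕ) {x : R}
    (hx : 2 ^ j * (e * x) = 0) : (e : R) * x = 0 := by
  have hc : IsCoprime ((2 : ℤ) ^ j) m' := by
    apply IsCoprime.pow_left
    exact_mod_cast Nat.isCoprime_iff_coprime.2 (Nat.coprime_two_left.2 hm')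
  obtain ⟨u, v, huv⟩ := hc
  have h1 : (u : R) * 2 ^ j + v * m' = 1 := by exact_mod_cast congrArg (Int.cast (R := R)) huv
  linear_combination (-(e * x)) * h1 + u * hx + v * x * hme

/-- On the odd part, all ring automorphisms commute with the conjugation. -/
lemma comm_odd_part (h : QuadRing m σ) (hm' : Odd m') (hmk : m = 2 ^ k * m')
    (hme : (m' : R) * e = 0) (ρ : R ≃+* R) (x : R) : (e : R) * ρ (σ x) = e * σ (ρ x) := by
  obtain ⟨ω, hω, hind⟩ := h.gen
  obtain ⟨t, ht⟩ := h.trace ω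
  obtain ⟨α, β, hρ⟩ := hω (ρ ω)
  have hσ : σ ω = t - ω := by linear_combination ht
  obtain ⟨N, hN⟩ := h.norm (2 * ω - t)
  rw [map_sub, map_mul, map_ofNat, map_intCast, hσ] at hN
  set A : ℤ := 4 * α + 2 * β * t - 2 * t with hA
  have h1 : ρ ((2 * ω - t) ^ 2) = -N := by
    rw [← map_intCast ρ N, ← map_neg, ← hN]
    congr 1
    ring
  have h2 : (A : R) ^ 2 + 4 * β ^ 2 * (2 * ω - t) ^ 2 + 4 * A * β * (2 * ω - t) = -4 * N := by
    have h3 : 2 * ρ (2 * ω - t) = A + 2 * β * (2 * ω - t) := by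
      rw [map_sub, map_mul, map_ofNat, map_intCast, hρ, hA]
      push_cast
      ring
    rw [map_pow] at h1
    linear_combination 4 * h1 - (2 * ρ (2 * ω - t) + (A + 2 * β * (2 * ω - t))) * h3
  have h4 := (hind (A ^ 2 - 4 * β ^ 2 * N - 4 * A * β * t + 4 * N) (8 * A * β) (by
    push_cast
    linear_combination h2 + 4 * (β : R) ^ 2 * hN)).2
  obtain ⟨c, d, hcd⟩ := hω (ρ.symm ω)
  have h5 := (hind (c + d * α) (d * β - 1) (by
    have := congrArg ρ hcd
    rw [ρ.apply_symm_apply, map_add, map_mul, map_intCast, map_intCast, hρ] at this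
    push_cast
    linear_combination -this)).2
  have hm'm : (m' : ℤ) ∣ m := ⟨2 ^ k, by rw [hmk]; push_cast; ring⟩
  have h6 : (m' : ℤ) ∣ 8 * A := by
    have h7 : 8 * A = d * (8 * A * β) - 8 * A * (d * β - 1) := by ring
    rw [h7]
    exact dvd_sub ((hm'm.trans h4).mul_left d) ((hm'm.trans h5).mul_left (8 * A))
  have h7 : (e : R) * (8 * A) = 0 := by
    obtain ⟨f, hf⟩ := h6
    have : (8 : R) * A = m' * f := by exact_mod_cast congrArg (Int.cast (R := R)) hf
    rw [this]
    linear_combination f * hme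
  obtain ⟨a, b, rfl⟩ := hω x
  have h8 : (e : R) * (ρ (σ (a + b * ω)) - σ (ρ (a + b * ω))) = 0 := by
    refine odd_part_cancel hm' hme 4 ?_
    simp only [map_add, map_mul, map_intCast, hσ, map_sub, hρ]
    have h9 : (A : R) = 4 * α + 2 * β * t - 2 * t := by
      rw [hA]
      push_cast
      ring
    linear_combination (-b) * h7 + 8 * e * b * h9
  linear_combination h8

/-- Units of odd order. -/
def OddUnit (u : Rˣ) : Prop := ∃ j : ℕ, Odd j ∧ u ^ j = 1

lemma OddUnit.mul {u v : Rˣ} (hu : OddUnit u) (hv : OddUnit v) : OddUnit (u * v) := by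
  obtain ⟨i, hi, hu⟩ := hu
  obtain ⟨j, hj, hv⟩ := hv
  exact ⟨i * j, hi.mul hj, by rw [mul_pow, pow_mul, hu, one_pow, mul_comm i, pow_mul, hv, one_pow,
    one_mul]⟩

lemma OddUnit.inv {u : Rˣ} (hu : OddUnit u) : OddUnit u⁻¹ := by
  obtain ⟨i, hi, hu⟩ := hu
  exact ⟨i, hi, by rw [inv_pow, hu, inv_one]⟩

lemma OddUnit.map {u : Rˣ} (hu : OddUnit u) (ρ : R ≃+* R) :
    OddUnit (Units.map (ρ : R →* R) u) := by
  obtain ⟨i, hi, hu⟩ := hu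
  exact ⟨i, hi, by rw [← map_pow, hu, map_one]⟩

/-- Odd order units are inverted by the conjugation on the `2`-part. -/
lemma norm_oddUnit (h : QuadRing m σ) (hmk : m = 2 ^ k * m') (hn : (m' : ℤ) ∣ n)
    {u : Rˣ} (hu : OddUnit u) : (n : R) * (u * σ u) = n := by
  obtain ⟨N, hN⟩ := h.norm u
  obtain ⟨j, hj, huj⟩ := hu
  obtain ⟨ω, -, hind⟩ := h.gen
  have h1 : ((N : R)) ^ j = 1 := by
    have h2 : (u : R) ^ j = 1 := by rw [← Units.val_pow_eq_pow_val, huj, Units.val_one]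
    rw [← hN, mul_pow, ← map_pow, h2, map_one, one_mul]
  have h2 : (m : ℤ) ∣ N ^ j - 1 := (hind (N ^ j - 1) 0 (by
    push_cast
    rw [h1]
    ring)).1
  have h3 : (2 : ℤ) ^ k ∣ N - 1 := by
    rcases k.eq_zero_or_pos with rfl | hk
    · simp
    have h4 : (2 : ℤ) ^ k ∣ N ^ j - 1 := dvd_trans ⟨m', by rw [hmk]; push_cast; rfl⟩ h2
    have hNodd : Odd N := by
      have h5 : Odd (N ^ j) := by
        obtain ⟨c, hc⟩ := (dvd_pow_self (2 : ℤ) hk.ne').trans h4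
        exact ⟨c, by linarith⟩
      exact (Int.odd_pow.1 h5).resolve_right (by
        rintro rfl
        simp at hj)
    have h6 : Odd (∑ i ∈ Finset.range j, N ^ i) := by
      rw [Int.odd_iff, Finset.sum_int_mod]
      simp only [fun i => Int.odd_iff.1 (hNodd.pow (n := i))]
      simp only [Finset.sum_const, Finset.card_range, nsmul_eq_mul, mul_one]
      exact_mod_cast Nat.odd_iff.1 hj
    have h7 : (N - 1) * (∑ i ∈ Finset.range j, N ^ i) = N ^ j - 1 := by
      rw [mul_comm, geom_sum_mul]
    rw [← h7] at h4
    refine IsCoprime.dvd_of_dvd_mul_right (IsCoprime.pow_left ?_) h4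
    exact Int.isCoprime_iff_gcd_eq_one.2 (Int.isCoprime_iff_gcd_eq_one.1 (by
      obtain ⟨c, hc⟩ := h6
      exact ⟨-c, 1, by rw [hc]; ring⟩))
  obtain ⟨f, hf⟩ := h3
  obtain ⟨g, hg⟩ := hn
  have h8 : (n : R) * (N - 1) = 0 := by
    have h9 : n * (N - 1) = (m : ℤ) * (f * g) := by
      rw [hf, hg, hmk]
      push_cast
      ring
    have h10 := congrArg (Int.cast (R := R)) h9
    push_cast at h10
    rw [h10, h.cast, zero_mul]
  rw [hN]
  linear_combination h8

lemma conj_oddUnit (h : QuadRing m σ) (hmk : m = 2 ^ k * m') (hn : (m' : ℤ) ∣ n)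
    {u : Rˣ} (hu : OddUnit u) : (n : R) * σ u = n * (u⁻¹ : Rˣ) := by
  have h1 := h.norm_oddUnit hmk hn hu
  have h2 : (u : R) * (u⁻¹ : Rˣ) = 1 := u.mul_inv
  linear_combination (u⁻¹ : Rˣ) * h1 - n * σ u * h2

lemma comm_oddUnit (h : QuadRing m σ) (hm : m ≠ 0) (ρ : R ≃+* R) {u : Rˣ} (hu : OddUnit u) :
    ρ (σ u) = σ (ρ u) := by
  obtain ⟨k, m', e, n, hm', hmk, hen, -, hme, hn, -⟩ := h.exists_idempotents hm
  refine eq_of_parts hen (h.comm_odd_part hm' hmk hme ρ u) ?_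
  have h1 := congrArg ρ (h.conj_oddUnit hmk hn hu)
  have h2 := h.conj_oddUnit hmk hn (hu.map ρ)
  rw [map_mul, map_mul, map_intCast] at h1
  rw [h1]
  exact h2.symm

/-- The units that are trivial on the `2`-part. -/
def oddKer (R : Type) [CommRing R] (n : ℤ) : Subgroup Rˣ where
  carrier := {u | (n : R) * u = n}
  one_mem' := by simp
  mul_mem' := by
    intro u v hu hv
    change (n : R) * u = n at hu
    change (n : R) * v = n at hv
    change (n : R) * (u * v : Rˣ) = n
    rw [Units.val_mul, ← mul_assoc, hu, hv]
  inv_mem' := by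
    intro u hu
    change (n : R) * u = n at hu
    change (n : R) * (u⁻¹ : Rˣ) = n
    have h2 : (u : R) * (u⁻¹ : Rˣ) = 1 := u.mul_inv
    linear_combination (-(u⁻¹ : Rˣ) : R) * hu + n * h2

lemma mem_oddKer {u : Rˣ} : u ∈ oddKer R n ↔ (n : R) * u = n := Iff.rfl

lemma mem_oddKer_of_pow {u : Rˣ} {i j : ℕ} (hij : i.Coprime j) (h1 : u ^ i ∈ oddKer R n)
    (h2 : u ^ j ∈ oddKer R n) : u ∈ oddKer R n := by
  rw [← eq_one_iff] at h1 h2 ⊢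
  have h3 : (u : Rˣ ⧸ oddKer R n) ^ Nat.gcd i j = 1 := pow_gcd_eq_one.2 ⟨h1, h2⟩
  rwa [hij, pow_one] at h3

lemma mem_oddKer_of_two (h2n : (2 : R) ^ k * n = 0) {u : Rˣ} (hu : OddUnit u) {y : R}
    (hy : (n : R) * u = n * (1 + 2 * y)) : u ∈ oddKer R n := by
  obtain ⟨j, hj, huj⟩ := hu
  refine mem_oddKer_of_pow (i := 2 ^ k) (j := j) ?_ ?_ (huj ▸ one_mem _)
  · exact (Nat.coprime_two_left.2 hj).pow_left k
  have key : ∀ i : ℕ, ∃ z : R, (n : R) * (u : R) ^ 2 ^ i = n * (1 + 2 ^ (i + 1) * z) := by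
    intro i
    induction i with
    | zero => exact ⟨y, by simpa using hy⟩
    | succ i ih =>
      obtain ⟨z, hz⟩ := ih
      refine ⟨z + 2 ^ i * z ^ 2, ?_⟩
      rw [pow_succ 2 i, pow_mul]
      linear_combination ((u : R) ^ 2 ^ i + (1 + 2 ^ (i + 1) * z)) * hz
  obtain ⟨z, hz⟩ := key k
  rw [mem_oddKer, Units.val_pow_eq_pow_val, hz]
  linear_combination 2 * z * h2n

/-- There are at most three units of odd order on the `2`-part. -/
lemma oddUnit_trichotomy (h : QuadRing m σ) (hen : (e : R) + n = 1) (h0 : (e : R) * n = 0)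
    (h2n : (2 : R) ^ k * n = 0) {u v : Rˣ} (hu : OddUnit u) (hv : OddUnit v)
    (hun : u ∉ oddKer R n) : v ∈ oddKer R n ∨ v * u⁻¹ ∈ oddKer R n ∨ v * u ∈ oddKer R n := by
  classical
  let I : Ideal R := Ideal.span {2, (e : R)}
  let π : R →+* R ⧸ I := Ideal.Quotient.mk I
  have hπ : ∀ w : Rˣ, OddUnit w → π w = 1 → w ∈ oddKer R n := by
    intro w hw h1
    rw [← map_one π, Ideal.Quotient.mk_eq_mk_iff_sub_mem, Ideal.mem_span_pair] at h1
    obtain ⟨a, b, hab⟩ := h1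
    refine mem_oddKer_of_two h2n hw (y := a) ?_
    linear_combination (-n : R) * hab + b * h0
  have hπ2 : ∀ w w' : Rˣ, OddUnit w → OddUnit w' → π w = π w' → w * w'⁻¹ ∈ oddKer R n := by
    intro w w' hw hw' h1
    refine hπ _ (hw.mul hw'.inv) ?_
    rw [Units.val_mul, map_mul, h1, ← map_mul, Units.mul_inv, map_one]
  obtain ⟨hcard, hfin⟩ : Nat.card (R ⧸ I) ≤ 4 ∧ Finite (R ⧸ I) := by
    obtain ⟨ω, hω, -⟩ := h.gen
    have h2 : π 2 = 0 := Ideal.Quotient.eq_zero_iff_mem.2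
      (Ideal.subset_span (Set.mem_insert _ _))
    have hmod : ∀ a : ℤ, ∃ i : Bool, (if i then (1 : R ⧸ I) else 0) = π a := by
      intro a
      rcases Int.even_or_odd' a with ⟨c, rfl | rfl⟩
      · exact ⟨false, by push_cast; rw [map_mul, h2, zero_mul]⟩
      · exact ⟨true, by push_cast; rw [map_add, map_mul, h2, zero_mul, map_one, zero_add]; rfl⟩
    have hs : Function.Surjective fun x : Bool × Bool =>
        (if x.1 then (1 : R ⧸ I) else 0) + (if x.2 then (1 : R ⧸ I) else 0) * π ω := by
      intro x
      obtain ⟨x, rfl⟩ := Ideal.Quotient.mk_surjective x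
      obtain ⟨a, b, rfl⟩ := hω x
      obtain ⟨i, hi⟩ := hmod a
      obtain ⟨j, hj⟩ := hmod b
      refine ⟨(i, j), ?_⟩
      change _ = π (a + b * ω)
      rw [map_add, map_mul, ← hi, ← hj]
    exact ⟨(Nat.card_le_card_of_surjective _ hs).trans (by simp), Finite.of_surjective _ hs⟩
  by_contra! hcon
  obtain ⟨hv1, hv2, hv3⟩ := hcon
  have hnt : Nontrivial (R ⧸ I) := by
    by_contra hn
    rw [not_nontrivial_iff_subsingleton] at hn
    exact hun (hπ u hu (Subsingleton.elim _ _))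
  have hne : ∀ w : Rˣ, π w ≠ 0 := fun w => (w.isUnit.map π).ne_zero
  have h1 : π u ≠ 1 := fun h1 => hun (hπ u hu h1)
  have h2 : π (u⁻¹ : Rˣ) ≠ 1 := fun h1 => hun (by simpa using inv_mem (hπ _ hu.inv h1))
  have h3 : π v ≠ 1 := fun h1 => hv1 (hπ v hv h1)
  have h4 : π v ≠ π u := fun h1 => hv2 (hπ2 v u hv hu h1)
  have h5 : π v ≠ π (u⁻¹ : Rˣ) := fun h1 => hv3 (by simpa using hπ2 v u⁻¹ hv hu.inv h1)
  have h6 : π u ≠ π (u⁻¹ : Rˣ) := fun h1 => hun (by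
    have h7 := hπ2 u u⁻¹ hu hu.inv h1
    rw [inv_inv, ← sq] at h7
    obtain ⟨j, hj, huj⟩ := hu
    exact mem_oddKer_of_pow (Nat.coprime_two_left.2 hj) h7 (huj ▸ one_mem _))
  have := Fintype.ofFinite (R ⧸ I)
  have h7 := Finset.card_le_univ ({0, 1, π u, π (u⁻¹ : Rˣ), π v} : Finset (R ⧸ I))
  rw [Finset.card_insert_of_notMem, Finset.card_insert_of_notMem, Finset.card_insert_of_notMem,
    Finset.card_pair h5.symm, ← Nat.card_eq_fintype_card] at h7
  · omega
  · simp [h6, h4.symm]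
  · simp [h1.symm, h2.symm, h3.symm]
  · simp [(hne _).symm]

/-- Every ring automorphism agrees on odd order units with one that commutes with the
conjugation. -/
lemma exists_comm_ringAut (h : QuadRing m σ) (hm : m ≠ 0) (ρ : R ≃+* R) :
    ∃ ρ' : R ≃+* R, (∀ x, ρ' (σ x) = σ (ρ' x)) ∧ ∀ u : Rˣ, OddUnit u → ρ' u = ρ u := by
  obtain ⟨k, m', e, n, hm', hmk, hen, h0, hme, hn, h2n⟩ := h.exists_idempotents hm
  have := h.finite hm
  have hee : (e : R) * e = e := by linear_combination (e : R) * hen - h0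
  have hnn : (n : R) * n = n := by linear_combination (n : R) * hen - h0
  obtain ⟨κ, hκσ, hκ⟩ : ∃ κ : R ≃+* R, (∀ x, κ (σ x) = σ (κ x)) ∧
      ∀ u : Rˣ, OddUnit u → (n : R) * κ u = n * ρ u := by
    by_cases hρ : ∀ u : Rˣ, OddUnit u → (n : R) * ρ u = n * u
    · exact ⟨RingEquiv.refl R, fun _ => rfl, fun u hu => (hρ u hu).symm⟩
    · push Not at hρ
      obtain ⟨u, hu, hρu⟩ := hρ
      refine ⟨σ, fun _ => rfl, fun v hv => ?_⟩
      set r : Rˣ →* Rˣ := Units.map (ρ : R →* R) with hr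
      have hrv : ∀ w : Rˣ, ((r w : Rˣ) : R) = ρ w := fun w => rfl
      have hker : ∀ w : Rˣ, r w ∈ oddKer R n ↔ w ∈ oddKer R n := fun w => by
        rw [mem_oddKer, mem_oddKer, hrv]
        conv_lhs => rw [← map_intCast ρ n, ← map_mul, ρ.injective.eq_iff]
      have hun : u ∉ oddKer R n := fun hun => hρu (by
        rw [← hrv, mem_oddKer.1 hun, mem_oddKer.1 ((hker u).2 hun)])
      have heq : ∀ w w' : Rˣ, w * w'⁻¹ ∈ oddKer R n → (n : R) * w = n * w' := fun w w' hw => by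
        rw [mem_oddKer, Units.val_mul] at hw
        have h2 : ((w'⁻¹ : Rˣ) : R) * w' = 1 := w'.inv_mul
        linear_combination (w' : R) * hw - n * w * h2
      have heq' : ∀ w w' : Rˣ, (n : R) * w = n * w' → w * w'⁻¹ ∈ oddKer R n := fun w w' hw => by
        rw [mem_oddKer, Units.val_mul]
        have h2 : (w' : R) * (w'⁻¹ : Rˣ) = 1 := w'.mul_inv
        linear_combination ((w'⁻¹ : Rˣ) : R) * hw + n * h2
      have hru : r u * u ∈ oddKer R n := by
        rcases h.oddUnit_trichotomy hen h0 h2n hu (hu.map ρ) hun with h1 | h1 | h1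
        · exact absurd ((hker u).1 h1) hun
        · exact absurd (heq _ _ h1) hρu
        · exact h1
      have key : r v * v ∈ oddKer R n := by
        rcases h.oddUnit_trichotomy hen h0 h2n hu hv hun with h1 | h1 | h1
        · exact mul_mem ((hker v).2 h1) h1
        · have h2 := mul_mem (mul_mem ((hker _).2 h1) h1) hru
          rwa [map_mul, map_inv, mul_mul_mul_comm, inv_mul_cancel_right, inv_mul_cancel_right] at h2
        · have h2 := mul_mem (mul_mem ((hker _).2 h1) h1) (inv_mem hru)
          rwa [map_mul, mul_mul_mul_comm, mul_inv_cancel_right] at h2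
      rw [h.conj_oddUnit hmk hn hv, ← hrv]
      exact (heq _ _ (by simpa using key)).symm
  let f : R →+* R :=
    { toFun := fun x => e * ρ x + n * κ x
      map_one' := by rw [map_one, map_one, mul_one, mul_one, hen]
      map_zero' := by simp
      map_add' := fun x y => by
        rw [map_add, map_add]
        ring
      map_mul' := fun x y => by
        rw [map_mul, map_mul]
        linear_combination (-(ρ x * ρ y)) * hee - κ x * κ y * hnn -
          (ρ x * κ y + κ x * ρ y) * h0 }
  have hf : ∀ x, f x = e * ρ x + n * κ x := fun x => rfl
  have hinj : Function.Injective f := by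
    rw [injective_iff_map_eq_zero]
    intro x hx
    rw [hf] at hx
    refine eq_of_parts hen ?_ ?_
    · rw [mul_zero]
      apply ρ.injective
      rw [map_mul, map_intCast, map_zero]
      linear_combination (e : R) * hx - ρ x * hee - κ x * h0
    · rw [mul_zero]
      apply κ.injective
      rw [map_mul, map_intCast, map_zero]
      linear_combination (n : R) * hx - κ x * hnn - ρ x * h0
  refine ⟨RingEquiv.ofBijective f (Finite.injective_iff_bijective.1 hinj), fun x => ?_,
    fun u hu => ?_⟩
  · change f (σ x) = σ (f x)
    rw [hf, hf, map_add, map_mul, map_mul, map_intCast, map_intCast, hκσ,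
      h.comm_odd_part hm' hmk hme]
  · change f u = ρ u
    rw [hf, hκ u hu]
    linear_combination ρ u * hen

variable {S : Finset ℕ}

lemma exists_oddUnit (hS : ∀ p ∈ S, p.Prime ∧ p ≠ 2) (w : US S R) :
    ∃ u : Rˣ, OddUnit u ∧ (w : UR R) = (u : UR R) := by
  obtain ⟨⟨u⟩, j, hj, hu⟩ := w
  have hodd : Odd j := odd_of_isSNumber (fun p hp => (hS p hp).2) hj
  have h1 : u ^ j ∈ zpowers (-1 : Rˣ) := (eq_one_iff _).1 hu
  obtain ⟨i, hi⟩ := h1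
  change (-1 : Rˣ) ^ i = u ^ j at hi
  rcases Int.even_or_odd i with h2 | h2
  · rw [h2.neg_one_zpow] at hi
    exact ⟨u, ⟨j, hodd, hi.symm⟩, rfl⟩
  · rw [h2.neg_one_zpow] at hi
    refine ⟨-u, ⟨j, hodd, by rw [hodd.neg_pow, ← hi, neg_neg]⟩, ?_⟩
    refine QuotientGroup.eq.2 ⟨1, ?_⟩
    change (-1 : Rˣ) ^ (1 : ℤ) = u⁻¹ * -u
    simp

lemma usMap_congr (hS : ∀ p ∈ S, p.Prime ∧ p ≠ 2) {f f' : R →+* R}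
    (hf : ∀ u : Rˣ, OddUnit u → f u = f' u) (w : US S R) : usMap S f w = usMap S f' w := by
  obtain ⟨u, hu, hw⟩ := exists_oddUnit hS w
  apply Subtype.ext
  change urMap f w = urMap f' w
  rw [hw]
  exact congrArg QuotientGroup.mk (Units.ext (hf u hu))

lemma goodRing (h : QuadRing m σ) (hm : m ≠ 0) (hS : ∀ p ∈ S, p.Prime ∧ p ≠ 2) :
    GoodRing S σ where
  prime p hp := (hS p hp).1
  odd p hp := (hS p hp).2
  finite := by
    have := h.finite hm
    infer_instance
  invol u := by
    rw [← usMap_comp]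
    exact (usMap_congr hS (f' := RingHom.id R) (fun u _ => h.invol u) u).trans (usMap_id S u)
  comm ρ u := by
    rw [← usMap_comp, ← usMap_comp]
    exact usMap_congr hS (fun u hu => h.comm_oddUnit hm ρ hu) u

lemma exists_comm (h : QuadRing m σ) (hm : m ≠ 0) (hS : ∀ p ∈ S, p.Prime ∧ p ≠ 2)
    (ρ : R ≃+* R) : ∃ ρ' : R ≃+* R, (∀ x, ρ' (σ x) = σ (ρ' x)) ∧
      ∀ u : US S R, usMap S (ρ' : R →+* R) u = usMap S (ρ : R →+* R) u := by
  obtain ⟨ρ', h1, h2⟩ := h.exists_comm_ringAut hm ρ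
  exact ⟨ρ', h1, fun u => usMap_congr hS h2 u⟩

end QuadRing

/-! ### Ray class groups and Arakelov ray class groups -/

section Arith

variable {F : Type} [Field F] [NumberField F] {m : ℕ}

/-- The class of an ideal in the ray class group. -/
def rayMk (F : Type) [Field F] [NumberField F] (m : ℕ) : idSub F m →* RayCl F m :=
  mk' (((ray F m).map (prId F)).subgroupOf (idSub F m))

/-- The class in the Arakelov ray class group. -/
def picMk (F : Type) [Field F] [NumberField F] (m : ℕ) : araDiv F m →* Pic F m :=
  mk' (((ray F m).map (prIdReal F)).subgroupOf (araDiv F m))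

lemma rayMk_surjective : Function.Surjective (rayMk F m) := QuotientGroup.mk'_surjective _

lemma picMk_surjective : Function.Surjective (picMk F m) := QuotientGroup.mk'_surjective _

lemma rayMk_eq_one {x : idSub F m} : rayMk F m x = 1 ↔ ∃ β ∈ ray F m, prId F β = x :=
  eq_one_iff x

lemma val_prId (α : Fˣ) : (Units.val (prId F α) : FractionalIdeal (𝓞 F)⁰ F) =
    FractionalIdeal.spanSingleton (𝓞 F)⁰ (α : F) := coe_toPrincipalIdeal α

lemma exists_mem_coprime {b : Ideal (𝓞 F)} (hb0 : b ≠ ⊥)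
    (hb : IsCoprime b (Ideal.span {(m : 𝓞 F)})) : ∃ d ∈ b, d ≠ 0 ∧ IsCoprime d (m : 𝓞 F) := by
  obtain ⟨i, hi, j, hj, hij⟩ := Ideal.isCoprime_iff_exists.1 hb
  obtain ⟨c, rfl⟩ := Ideal.mem_span_singleton.1 hj
  by_cases h0 : i = 0
  · obtain ⟨d, hd, hd0⟩ := Submodule.exists_mem_ne_zero_of_ne_bot hb0
    exact ⟨d, hd, hd0, 0, c, by linear_combination hij - h0⟩
  · exact ⟨i, hi, h0, 1, c, by linear_combination hij⟩

lemma idSub_rep {I : FracId F} (hI : I ∈ idSub F m) : ∃ a b : Ideal (𝓞 F), b ≠ ⊥ ∧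
    IsCoprime a (Ideal.span {(m : 𝓞 F)}) ∧ IsCoprime b (Ideal.span {(m : 𝓞 F)}) ∧
    (Units.val I : FractionalIdeal (𝓞 F)⁰ F) * b = a := by
  obtain ⟨a, b, ha, hb, h⟩ := hI
  by_cases hb0 : b = ⊥
  · have htop : ∀ c : Ideal (𝓞 F), IsCoprime c (Ideal.span {(m : 𝓞 F)}) := fun c => by
      rw [hb0, Ideal.isCoprime_iff_sup_eq, bot_sup_eq] at hb
      rw [Ideal.isCoprime_iff_sup_eq, hb, sup_top_eq]
    refine ⟨(Units.val I : FractionalIdeal (𝓞 F)⁰ F).num,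
      Ideal.span {((Units.val I : FractionalIdeal (𝓞 F)⁰ F).den : 𝓞 F)}, ?_, htop _, htop _, ?_⟩
    · rw [Ne, Ideal.span_singleton_eq_bot]
      exact nonZeroDivisors.ne_zero (Units.val I : FractionalIdeal (𝓞 F)⁰ F).den.2
    · rw [FractionalIdeal.coeIdeal_span_singleton, mul_comm]
      exact FractionalIdeal.den_mul_self_eq_num' (𝓞 F)⁰ F _
  · exact ⟨a, b, hb0, ha, hb, h⟩

lemma exists_prId_of_mk_eq_one {I : FracId F} (hI : ClassGroup.mk F I = 1) :
    ∃ β : Fˣ, prId F β = I := by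
  obtain ⟨⟨β, hβ⟩⟩ := ClassGroup.mk_eq_one_iff.1 hI
  have h1 : FractionalIdeal.spanSingleton (𝓞 F)⁰ β = Units.val I :=
    FractionalIdeal.coeToSubmodule_injective
      ((FractionalIdeal.coe_spanSingleton _ _).trans hβ.symm)
  have h2 : β ≠ 0 := by
    rintro rfl
    rw [FractionalIdeal.spanSingleton_zero] at h1
    exact Units.ne_zero I h1.symm
  exact ⟨Units.mk0 β h2, Units.ext (by rw [val_prId]; exact h1)⟩

lemma rayClToCl_rayMk (x : idSub F m) : rayClToCl F m (rayMk F m x) = ClassGroup.mk F x.1 := rfl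

lemma prId_copUnit_mem (α : copInt F m) : prId F (copUnit m α) ∈ idSub F m := (prIdReal_mem m α).1

lemma picToRayCl_picCls (α : copInt F m) :
    picToRayCl F m (picCls m α) = rayMk F m ⟨prId F (copUnit m α), prId_copUnit_mem α⟩ := rfl

/-- The residue class of an integer that is coprime to `m`. -/
def resCls (α : copInt F m) : (𝓞 F ⧸ Ideal.span {(m : 𝓞 F)})ˣ := (isCoprime_iff_isUnit.1 α.2.2).unit

lemma resToPic_resCls (α : copInt F m) : resToPic m (resCls α) = picCls m α :=
  resToPic_eq m _ α rfl

lemma rayClToCl_resToPic (a : (𝓞 F ⧸ Ideal.span {(m : 𝓞 F)})ˣ) :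
    rayClToCl F m (picToRayCl F m (resToPic m a)) = 1 := by
  obtain ⟨α, hα⟩ := exists_lift m a
  rw [resToPic_eq m a α hα, picToRayCl_picCls, rayClToCl_rayMk]
  refine ClassGroup.mk_eq_one_iff.2 ?_
  change ((Units.val (prId F (copUnit m α)) : FractionalIdeal (𝓞 F)⁰ F) : Submodule (𝓞 F) F).IsPrincipal
  rw [val_prId]
  exact ⟨⟨_, FractionalIdeal.coe_spanSingleton _ _⟩⟩

/-- A principal ideal that is coprime to `m` is generated by a quotient of integers that are
coprime to `m`. -/
lemma exists_quotient_of_mem_idSub {β : Fˣ} (hβ : prId F β ∈ idSub F m) :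
    ∃ c d : copInt F m, β * copUnit m d = copUnit m c := by
  obtain ⟨a, b, hb0, ha, hb, h⟩ := idSub_rep hβ
  obtain ⟨d, hdb, hd0, hdm⟩ := exists_mem_coprime hb0 hb
  rw [val_prId] at h
  obtain ⟨b', hb'⟩ := Ideal.dvd_iff_le.2 ((Ideal.span_singleton_le_iff_mem b).2 hdb)
  have h1 : FractionalIdeal.spanSingleton (𝓞 F)⁰ ((β : F) * algebraMap (𝓞 F) F d) =
      ((a * b' : Ideal (𝓞 F)) : FractionalIdeal (𝓞 F)⁰ F) := by
    rw [← FractionalIdeal.spanSingleton_mul_spanSingleton,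
      ← FractionalIdeal.coeIdeal_span_singleton, hb', FractionalIdeal.coeIdeal_mul,
      FractionalIdeal.coeIdeal_mul, ← h, mul_assoc]
  have h2 : (β : F) * algebraMap (𝓞 F) F d ∈
      ((a * b' : Ideal (𝓞 F)) : FractionalIdeal (𝓞 F)⁰ F) := by
    rw [← h1]
    exact FractionalIdeal.mem_spanSingleton_self _ _
  obtain ⟨c, -, hc⟩ := (FractionalIdeal.mem_coeIdeal _).1 h2
  rw [← hc, ← FractionalIdeal.coeIdeal_span_singleton, FractionalIdeal.coeIdeal_inj] at h1
  have hb'c : IsCoprime b' (Ideal.span {(m : 𝓞 F)}) := by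
    have h3 : IsCoprime (Ideal.span {d}) (Ideal.span {(m : 𝓞 F)}) :=
      (Ideal.isCoprime_span_singleton_iff _ _).2 hdm
    rw [hb'] at h3
    exact h3.of_mul_left_right
  have hcm : IsCoprime c (m : 𝓞 F) := by
    rw [← Ideal.isCoprime_span_singleton_iff, h1]
    exact ha.mul_left hb'c
  have hc0 : c ≠ 0 := by
    rintro rfl
    rw [map_zero] at hc
    exact mul_ne_zero β.ne_zero (by simpa using hd0) hc.symm
  exact ⟨⟨c, hc0, hcm⟩, ⟨d, hd0, hdm⟩, Units.ext hc.symm⟩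

/-- Exactness of the ray class sequence at the ray class group. -/
lemma exists_resToPic_of_rayClToCl_eq_one {x : RayCl F m} (hx : rayClToCl F m x = 1) :
    ∃ a, picToRayCl F m (resToPic m a) = x := by
  obtain ⟨⟨I, hI⟩, rfl⟩ := rayMk_surjective x
  obtain ⟨β, rfl⟩ := exists_prId_of_mk_eq_one hx
  obtain ⟨c, d, hcd⟩ := exists_quotient_of_mem_idSub hI
  refine ⟨resCls c * (resCls d)⁻¹, ?_⟩
  rw [map_mul, map_inv, resToPic_resCls, resToPic_resCls, map_mul, map_inv, picToRayCl_picCls,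
    picToRayCl_picCls, mul_inv_eq_iff_eq_mul, ← map_mul]
  refine congrArg _ (Subtype.ext ?_)
  change prId F (copUnit m c) = prId F β * prId F (copUnit m d)
  rw [← map_mul, hcd]

lemma rayClToCl_surjective (hm : m ≠ 0) : Function.Surjective (rayClToCl F m) := by
  intro x
  have hm0 : Ideal.span {(m : 𝓞 F)} ≠ 0 := by
    rw [Ne, Ideal.zero_eq_bot, Ideal.span_singleton_eq_bot]
    exact_mod_cast hm
  obtain ⟨a, ha, ham, hax⟩ : ∃ (a : Ideal (𝓞 F)) (ha : a ∈ (Ideal (𝓞 F))⁰),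
      IsCoprime a (Ideal.span {(m : 𝓞 F)}) ∧ ClassGroup.mk0 ⟨a, ha⟩ = x := by
    obtain ⟨⟨J, hJ⟩, hJx⟩ := ClassGroup.mk0_surjective x⁻¹
    have hJ0 : J ≠ 0 := nonZeroDivisors.ne_zero hJ
    obtain ⟨α, hα⟩ := IsDedekindDomain.exists_sup_span_eq
      (Ideal.mul_le_left : J * Ideal.span {(m : 𝓞 F)} ≤ J) (mul_ne_zero hJ0 hm0)
    obtain ⟨a, ha⟩ := Ideal.dvd_iff_le.2 (le_sup_right.trans hα.le)
    have ham : IsCoprime a (Ideal.span {(m : 𝓞 F)}) := by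
      rw [Ideal.isCoprime_iff_add, add_comm]
      apply mul_left_cancel₀ hJ0
      rw [mul_add, ← ha, mul_one]
      exact hα
    by_cases ha0 : a = 0
    · obtain ⟨⟨a', ha'⟩, hax⟩ := ClassGroup.mk0_surjective x
      refine ⟨a', ha', ?_, hax⟩
      rw [Ideal.isCoprime_iff_add, ha0, zero_add] at ham
      rw [ham]
      exact isCoprime_one_right
    · refine ⟨a, mem_nonZeroDivisors_of_ne_zero ha0, ham, ?_⟩
      rw [← inv_inv x, ← hJx, eq_comm, inv_eq_iff_mul_eq_one, ← map_mul]
      refine (ClassGroup.mk0_eq_one_iff _).2 ?_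
      change (J * a).IsPrincipal
      rw [← ha]
      exact ⟨⟨α, rfl⟩⟩
  refine ⟨rayMk F m ⟨FractionalIdeal.mk0 F ⟨a, ha⟩, a, 1, ham, isCoprime_one_left, ?_⟩, ?_⟩
  · change (a : FractionalIdeal (𝓞 F)⁰ F) * ((1 : Ideal (𝓞 F)) : FractionalIdeal (𝓞 F)⁰ F) = a
    rw [Ideal.one_eq_top, FractionalIdeal.coeIdeal_top, mul_one]
  · exact (ClassGroup.mk_mk0 F ⟨a, ha⟩).trans hax

lemma picToRayCl_surjective : Function.Surjective (picToRayCl F m) := by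
  intro x
  obtain ⟨⟨I, hI⟩, rfl⟩ := rayMk_surjective x
  set N : ℝ := ((FractionalIdeal.absNorm (Units.val I : FractionalIdeal (𝓞 F)⁰ F) : ℚ) : ℝ) with hN
  have hN0 : 0 < N := by
    rw [hN]
    have h1 : 0 ≤ FractionalIdeal.absNorm (Units.val I : FractionalIdeal (𝓞 F)⁰ F) :=
      FractionalIdeal.absNorm_nonneg _
    have h2 : FractionalIdeal.absNorm (Units.val I : FractionalIdeal (𝓞 F)⁰ F) ≠ 0 := by
      rw [Ne, FractionalIdeal.absNorm_eq_zero_iff]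
      exact Units.ne_zero I
    exact_mod_cast lt_of_le_of_ne h1 h2.symm
  have ht := Real.rpow_pos_of_pos hN0 ((Module.finrank ℚ F : ℝ)⁻¹)
  refine ⟨picMk F m ⟨(I, fun _ => Units.mk0 _ ht.ne'), hI, fun _ => ht, ?_⟩, rfl⟩
  change N = ∏ v : InfinitePlace F, (N ^ ((Module.finrank ℚ F : ℝ)⁻¹)) ^ v.mult
  rw [Finset.prod_pow_eq_pow_sum, InfinitePlace.sum_mult_eq,
    Real.rpow_inv_natCast_pow hN0.le Module.finrank_pos.ne']

/-- The elements of norm one in `∏_v ℝ_{>0}`. -/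
def archSub (F : Type) [Field F] [NumberField F] : Subgroup (InfinitePlace F → ℝˣ) where
  carrier := {y | (∀ v, 0 < (y v : ℝ)) ∧ ∏ v : InfinitePlace F, (y v : ℝ) ^ v.mult = 1}
  one_mem' := ⟨fun v => by simp, by simp⟩
  mul_mem' := by
    rintro x y ⟨h, h'⟩ ⟨k, k'⟩
    refine ⟨fun v => by simpa using mul_pos (h v) (k v), ?_⟩
    simp only [Pi.mul_apply, Units.val_mul, mul_pow, Finset.prod_mul_distrib, h', k', mul_one]
  inv_mem' := by
    rintro x ⟨h, h'⟩
    refine ⟨fun v => by simpa using h v, ?_⟩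
    simp only [Pi.inv_apply, Units.val_inv_eq_inv_val, inv_pow, Finset.prod_inv_distrib, h', inv_one]

/-- The inclusion of the norm one group. -/
def archIncl (F : Type) [Field F] [NumberField F] (m : ℕ) : archSub F →* araDiv F m :=
  ((MonoidHom.inr (FracId F) (InfinitePlace F → ℝˣ)).comp (archSub F).subtype).codRestrict _ fun y =>
    ⟨one_mem _, y.2.1, by
      change ((FractionalIdeal.absNorm ((1 : (FractionalIdeal (𝓞 F)⁰ F)ˣ) :
        FractionalIdeal (𝓞 F)⁰ F) : ℚ) : ℝ) = _
      rw [Units.val_one, map_one, Rat.cast_one]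
      exact y.2.2.symm⟩

/-- The map from the norm one group to the Arakelov ray class group. -/
def archToPic (F : Type) [Field F] [NumberField F] (m : ℕ) : archSub F →* Pic F m :=
  (picMk F m).comp (archIncl F m)

lemma picToRayCl_archToPic (y : archSub F) : picToRayCl F m (archToPic F m y) = 1 :=
  map_one (rayMk F m)

lemma archToPic_range : (archToPic F m).range = (picToRayCl F m).ker := by
  apply le_antisymm
  · rintro _ ⟨y, rfl⟩
    exact picToRayCl_archToPic y
  · intro x hx
    obtain ⟨⟨⟨I, y⟩, h1, h2, h3⟩, rfl⟩ := picMk_surjective x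
    obtain ⟨β, hβ, hβI⟩ := rayMk_eq_one.1 hx
    change prId F β = I at hβI
    subst hβI
    have hy : ∀ v, ((y v * ((prIdReal F β).2 v)⁻¹ : ℝˣ) : ℝ) = y v * (v (β : F))⁻¹ := fun v => by
      rw [Units.val_mul, Units.val_inv_eq_inv_val]
      rfl
    refine ⟨⟨y * ((prIdReal F β).2)⁻¹, fun v => ?_, ?_⟩, ?_⟩
    · change 0 < ((y v * ((prIdReal F β).2 v)⁻¹ : ℝˣ) : ℝ)
      rw [hy]
      exact mul_pos (h2 v) (inv_pos.2 (InfinitePlace.pos_iff.2 β.ne_zero))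
    · change ∏ v : InfinitePlace F, ((y v * ((prIdReal F β).2 v)⁻¹ : ℝˣ) : ℝ) ^ v.mult = 1
      simp only [hy, mul_pow, inv_pow, Finset.prod_mul_distrib, Finset.prod_inv_distrib]
      change ((FractionalIdeal.absNorm (Units.val (prId F β)) : ℚ) : ℝ) =
        ∏ v : InfinitePlace F, (y v : ℝ) ^ v.mult at h3
      rw [← h3, InfinitePlace.prod_eq_abs_norm, val_prId, FractionalIdeal.absNorm_span_singleton]
      refine mul_inv_cancel₀ ?_
      simp
    · refine QuotientGroup.eq.2 ⟨β, hβ, ?_⟩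
      refine Prod.ext ?_ (funext fun v => ?_)
      · change prId F β = 1⁻¹ * prId F β
        rw [inv_one, one_mul]
      · change (prIdReal F β).2 v = (y v * ((prIdReal F β).2 v)⁻¹)⁻¹ * y v
        rw [mul_inv, inv_inv, inv_mul_cancel_comm]

lemma archSub_div {n : ℕ} (hn : n ≠ 0) (y : archSub F) : ∃ z : archSub F, z ^ n = y := by
  have hz : ∀ v, 0 < (y.1 v : ℝ) ^ ((n : ℝ)⁻¹) := fun v => Real.rpow_pos_of_pos (y.2.1 v) _
  have hzn : ∀ v, ((y.1 v : ℝ) ^ ((n : ℝ)⁻¹)) ^ n = y.1 v := fun v =>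
    Real.rpow_inv_natCast_pow (y.2.1 v).le hn
  refine ⟨⟨fun v => Units.mk0 _ (hz v).ne', hz, ?_⟩, Subtype.ext (funext fun v => Units.ext (hzn v))⟩
  change ∏ v : InfinitePlace F, ((y.1 v : ℝ) ^ ((n : ℝ)⁻¹)) ^ v.mult = 1
  have h1 : 0 ≤ ∏ v : InfinitePlace F, ((y.1 v : ℝ) ^ ((n : ℝ)⁻¹)) ^ v.mult :=
    Finset.prod_nonneg fun v _ => pow_nonneg (hz v).le _
  refine (pow_eq_one_iff_of_nonneg h1 hn).1 ?_
  rw [← Finset.prod_pow]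
  simp only [pow_right_comm _ (InfinitePlace.mult _) n, hzn]
  exact y.2.2

lemma isDiv_ker_picToRayCl : IsDiv (picToRayCl F m).ker := by
  intro n hn x hx
  rw [← archToPic_range] at hx
  obtain ⟨y, rfl⟩ := hx
  obtain ⟨z, rfl⟩ := archSub_div hn y
  exact ⟨archToPic F m z, picToRayCl_archToPic z, (map_pow _ _ _).symm⟩

/-- The residue class of a unit of `𝓞_F`. -/
def unitRes (m : ℕ) : (𝓞 F)ˣ →* (𝓞 F ⧸ Ideal.span {(m : 𝓞 F)})ˣ :=
  Units.map (Ideal.Quotient.mk (Ideal.span {(m : 𝓞 F)})).toMonoidHom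

lemma prId_unit (ε : (𝓞 F)ˣ) : prId F (Units.map (algebraMap (𝓞 F) F : 𝓞 F →* F) ε) = 1 := by
  apply Units.ext
  rw [val_prId]
  change FractionalIdeal.spanSingleton (𝓞 F)⁰ (algebraMap (𝓞 F) F ε) = _
  rw [← FractionalIdeal.coeIdeal_span_singleton, Ideal.span_singleton_eq_top.2 ε.isUnit]
  exact FractionalIdeal.coeIdeal_top _

lemma exists_unit_of_prId_eq_one {α : Fˣ} (h : prId F α = 1) :
    ∃ ε : (𝓞 F)ˣ, algebraMap (𝓞 F) F ε = α := by
  have key : ∀ β : Fˣ, prId F β = 1 → ∃ x : 𝓞 F, algebraMap (𝓞 F) F x = β := by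
    intro β hβ
    have h1 : (β : F) ∈ FractionalIdeal.spanSingleton (𝓞 F)⁰ (β : F) :=
      FractionalIdeal.mem_spanSingleton_self _ _
    rw [← val_prId, hβ] at h1
    exact (FractionalIdeal.mem_one_iff _).1 h1
  obtain ⟨x, hx⟩ := key α h
  obtain ⟨y, hy⟩ := key α⁻¹ (by rw [map_inv, h, inv_one])
  have hxy : x * y = 1 := by
    apply RingOfIntegers.coe_injective
    rw [map_mul, hx, hy, map_one, Units.mul_inv]
  exact ⟨⟨x, y, hxy, by rw [mul_comm, hxy]⟩, hx⟩

lemma archToPic_eq_resToPic_iff (y : archSub F) (a : (𝓞 F ⧸ Ideal.span {(m : 𝓞 F)})ˣ) :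
    archToPic F m y = resToPic m a ↔
      ∃ ε : (𝓞 F)ˣ, (∀ v : InfinitePlace F, (y.1 v : ℝ) = v (algebraMap (𝓞 F) F ε)) ∧
        unitRes m ε = a := by
  constructor
  · intro h
    obtain ⟨α, hα⟩ := exists_lift m a
    rw [resToPic_eq m a α hα] at h
    obtain ⟨β, ⟨b₁, b₂, hb0, hbm, hb12, hb⟩, hβ⟩ := QuotientGroup.eq.1 h
    have h1 : prId F β = 1⁻¹ * prId F (copUnit m α) := congrArg Prod.fst hβ
    have h2 : (prIdReal F β).2 = y.1⁻¹ * (prIdReal F (copUnit m α)).2 := congrArg Prod.snd hβ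
    obtain ⟨ε, hε⟩ := exists_unit_of_prId_eq_one (α := copUnit m α * β⁻¹) (by
      rw [map_mul, map_inv, h1, inv_one, one_mul, mul_inv_cancel])
    refine ⟨ε, fun v => ?_, Units.ext ?_⟩
    · have h3 := congrArg Units.val (congrFun h2 v)
      change v (β : F) = ((y.1 v)⁻¹ : ℝˣ) * v (copUnit m α : F) at h3
      rw [hε, Units.val_mul, map_mul, Units.val_inv_eq_inv_val, map_inv₀, h3,
        Units.val_inv_eq_inv_val, mul_inv, inv_inv]
      have h4 : v (copUnit m α : F) ≠ 0 := (InfinitePlace.pos_iff.2 (Units.ne_zero _)).ne'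
      field_simp
    · have h3 : (ε : 𝓞 F) * b₁ = α * b₂ := by
        apply RingOfIntegers.coe_injective
        rw [map_mul, map_mul, ← hb, hε, Units.val_mul]
        change (copUnit m α : F) * _ * _ = (copUnit m α : F) * _
        rw [mul_assoc, ← mul_assoc _ (β : F), Units.inv_mul, one_mul]
      have h4 : Ideal.Quotient.mk (Ideal.span {(m : 𝓞 F)}) b₁ = Ideal.Quotient.mk _ b₂ := by
        rwa [Ideal.Quotient.mk_eq_mk_iff_sub_mem, Ideal.mem_span_singleton]
      have h5 := congrArg (Ideal.Quotient.mk (Ideal.span {(m : 𝓞 F)})) h3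
      rw [map_mul, map_mul, h4, hα] at h5
      exact (isCoprime_iff_isUnit.1 hbm).mul_left_injective h5
  · rintro ⟨ε, h1, rfl⟩
    have hε : (ε : 𝓞 F) ∈ copInt F m := ⟨ε.ne_zero, isCoprime_iff_isUnit.2 (ε.isUnit.map _)⟩
    rw [resToPic_eq m (unitRes m ε) ⟨ε, hε⟩ rfl]
    refine congrArg (picMk F m) (Subtype.ext (Prod.ext ?_ (funext fun v => Units.ext (h1 v))))
    have h2 : copUnit m ⟨(ε : 𝓞 F), hε⟩ = Units.map (algebraMap (𝓞 F) F : 𝓞 F →* F) ε :=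
      Units.ext rfl
    change 1 = prId F (copUnit m ⟨(ε : 𝓞 F), hε⟩)
    rw [h2, prId_unit]

lemma picToRayCl_resToPic_eq_one_iff (a : (𝓞 F ⧸ Ideal.span {(m : 𝓞 F)})ˣ) :
    picToRayCl F m (resToPic m a) = 1 ↔ ∃ ε : (𝓞 F)ˣ, unitRes m ε = a := by
  constructor
  · intro h
    have h1 : resToPic m a ∈ (picToRayCl F m).ker := h
    rw [← archToPic_range] at h1
    obtain ⟨y, hy⟩ := h1
    obtain ⟨ε, -, hε⟩ := (archToPic_eq_resToPic_iff y a).1 hy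
    exact ⟨ε, hε⟩
  · rintro ⟨ε, rfl⟩
    have hε : (ε : 𝓞 F) ∈ copInt F m := ⟨ε.ne_zero, isCoprime_iff_isUnit.2 (ε.isUnit.map _)⟩
    rw [resToPic_eq m (unitRes m ε) ⟨ε, hε⟩ rfl, picToRayCl_picCls, ← map_one (rayMk F m)]
    have h2 : copUnit m ⟨(ε : 𝓞 F), hε⟩ = Units.map (algebraMap (𝓞 F) F : 𝓞 F →* F) ε :=
      Units.ext rfl
    exact congrArg _ (Subtype.ext ((congrArg (prId F) h2).trans (prId_unit ε)))

lemma picToRayCl_gPic (g : F ≃ₐ[ℚ] F) (x : Pic F m) :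
    picToRayCl F m (gPic g m x) = gRayCl g m (picToRayCl F m x) := by
  obtain ⟨x⟩ := x
  rfl

end Arith

section SPart

variable {S : Finset ℕ} {G H : Type*} [CommGroup G] [CommGroup H]

lemma exists_sTorsion_mul_primeToS (hS : ∀ p ∈ S, p.Prime) [Finite G] (x : G) :
    ∃ a ∈ sTorsion S G, ∃ b ∈ primeToS S G, a * b = x := by
  obtain ⟨N1, N2, h1, h20, h2, hN⟩ := exists_isSNumber_mul hS (Nat.card G) Nat.card_pos.ne'
  have hx : x ^ (N1 * N2) = 1 := by rw [← hN, pow_card_eq_one']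
  have hc : N1.Coprime N2 := Nat.coprime_of_dvd fun p hp hpn hpk =>
    hp.one_lt.ne' (Nat.dvd_one.1 ((h2 p (h1.2 p hp hpn)) ▸ Nat.dvd_gcd hpk dvd_rfl))
  have hb := Nat.gcd_eq_gcd_ab N1 N2
  rw [hc] at hb
  refine ⟨(x ^ N2) ^ N1.gcdB N2, (sTorsion S G).zpow_mem ⟨N1, h1, by rw [← pow_mul, mul_comm, hx]⟩ _,
    (x ^ N1) ^ N1.gcdA N2, (primeToS S G).zpow_mem ⟨N2, h20, h2, by rw [← pow_mul, hx]⟩ _, ?_⟩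
  rw [← zpow_natCast, ← zpow_natCast, ← zpow_mul, ← zpow_mul, ← zpow_add, add_comm, ← hb]
  simp

lemma eq_one_of_mem_sTorsion_primeToS {x : G} (h : x ∈ sTorsion S G)
    (h' : x ∈ primeToS S G) : x = 1 := by
  obtain ⟨n, hn, hx⟩ := h
  obtain ⟨k, hk0, hk, hxk⟩ := h'
  have hc : n.Coprime k := Nat.coprime_of_dvd fun p hp hpn hpk =>
    hp.one_lt.ne' (Nat.dvd_one.1 ((hk p (hn.2 p hp hpn)) ▸ Nat.dvd_gcd hpk dvd_rfl))
  have := pow_gcd_eq_one.2 ⟨hx, hxk⟩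
  rwa [hc, pow_one] at this

lemma map_mem_sTorsion (f : G →* H) {x : G} (h : x ∈ sTorsion S G) : f x ∈ sTorsion S H := by
  obtain ⟨n, hn, hx⟩ := h
  exact ⟨n, hn, by rw [← map_pow, hx, map_one]⟩

lemma map_mem_primeToS (f : G →* H) {x : G} (h : x ∈ primeToS S G) : f x ∈ primeToS S H := by
  obtain ⟨n, hn, hn', hx⟩ := h
  exact ⟨n, hn, hn', by rw [← map_pow, hx, map_one]⟩

lemma exists_sTorsion_lift (hS : ∀ p ∈ S, p.Prime) [Finite G] (f : G →* H) {y : H}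
    (hy : y ∈ sTorsion S H) (hyf : y ∈ f.range) : ∃ x ∈ sTorsion S G, f x = y := by
  obtain ⟨x, rfl⟩ := hyf
  obtain ⟨a, ha, b, hb, rfl⟩ := exists_sTorsion_mul_primeToS hS x
  refine ⟨a, ha, ?_⟩
  have h1 : f b = 1 := by
    refine eq_one_of_mem_sTorsion_primeToS ?_ (map_mem_primeToS f hb)
    have := mul_mem (inv_mem (map_mem_sTorsion f ha)) hy
    rwa [map_mul, inv_mul_cancel_left] at this
  rw [map_mul, h1, mul_one]

end SPart

namespace QuadField

variable (F : QuadField) {m : ℕ}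

lemma g_invol (x : F.K) : F.g (F.g x) = x :=
  (invol_of_quadratic two_ne_zero F.finrank_eq F.g_ne x).1

lemma int_of_rat {x : 𝓞 F.K} {t : ℚ} (h : algebraMap (𝓞 F.K) F.K x = algebraMap ℚ F.K t) :
    ∃ n : ℤ, x = n := by
  have h1 : IsIntegral ℤ (algebraMap ℚ F.K t) := h ▸ x.2
  rw [isIntegral_algebraMap_iff (algebraMap ℚ F.K).injective] at h1
  obtain ⟨n, hn⟩ := IsIntegrallyClosed.isIntegral_iff.1 h1
  refine ⟨n, RingOfIntegers.coe_injective ?_⟩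
  rw [h, ← hn]
  simp

lemma exists_trace (x : 𝓞 F.K) : ∃ t : ℤ, x + gInt F.g x = t := by
  obtain ⟨-, ⟨t, ht⟩, -⟩ := invol_of_quadratic two_ne_zero F.finrank_eq F.g_ne
    (algebraMap (𝓞 F.K) F.K x)
  exact F.int_of_rat (t := t) (by rw [map_add, coe_gInt, ht])

lemma exists_norm (x : 𝓞 F.K) : ∃ n : ℤ, x * gInt F.g x = n := by
  obtain ⟨-, -, ⟨t, ht⟩⟩ := invol_of_quadratic two_ne_zero F.finrank_eq F.g_ne
    (algebraMap (𝓞 F.K) F.K x)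
  exact F.int_of_rat (t := t) (by rw [map_mul, coe_gInt, ht])

lemma gInt_invol (x : 𝓞 F.K) : gInt F.g (gInt F.g x) = x :=
  RingOfIntegers.coe_injective (F.g_invol _)

/-- The product of an ideal and its conjugate is generated by a rational integer. -/
lemma exists_mul_conj (a : Ideal (𝓞 F.K)) (ha : a ≠ ⊥) : ∃ n : ℕ, n ≠ 0 ∧
    a * a.map ((gInt F.g : 𝓞 F.K ≃+* 𝓞 F.K) : 𝓞 F.K →+* 𝓞 F.K) = Ideal.span {(n : 𝓞 F.K)} := by
  set a' := a.map ((gInt F.g : 𝓞 F.K ≃+* 𝓞 F.K) : 𝓞 F.K →+* 𝓞 F.K) with ha'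
  have hga : ∀ x ∈ a, gInt F.g x ∈ a' := fun x hx => Ideal.mem_map_of_mem _ hx
  let J : Ideal ℤ := (a * a').comap (algebraMap ℤ (𝓞 F.K))
  obtain ⟨n, hn⟩ := (IsPrincipalIdealRing.principal J).principal
  have hJ : ∀ k : ℤ, k ∈ J ↔ n ∣ k := fun k => by
    rw [hn]
    exact Ideal.mem_span_singleton
  have hnJ : (n : 𝓞 F.K) ∈ a * a' := (hJ n).2 dvd_rfl
  have hn0 : n ≠ 0 := by
    rintro rfl
    obtain ⟨x, hx, hx0⟩ := Submodule.exists_mem_ne_zero_of_ne_bot ha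
    obtain ⟨k, hk⟩ := F.exists_norm x
    have h1 : k ∈ J := by
      change (k : 𝓞 F.K) ∈ a * a'
      rw [← hk]
      exact Ideal.mul_mem_mul hx (hga x hx)
    rw [hJ, zero_dvd_iff] at h1
    rw [h1, Int.cast_zero, mul_eq_zero] at hk
    exact hk.elim hx0 fun h => hx0 (by simpa using h)
  have key : ∀ x ∈ a, ∀ y ∈ a, (n : 𝓞 F.K) ∣ x * gInt F.g y := by
    intro x hx y hy
    obtain ⟨t, ht⟩ := F.exists_trace (x * gInt F.g y)
    obtain ⟨k, hk⟩ := F.exists_norm x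
    obtain ⟨l, hl⟩ := F.exists_norm y
    rw [map_mul, gInt_invol] at ht
    have h1 : t ∈ J := by
      change (t : 𝓞 F.K) ∈ a * a'
      rw [← ht, mul_comm (gInt F.g x)]
      exact add_mem (Ideal.mul_mem_mul hx (hga y hy)) (Ideal.mul_mem_mul hy (hga x hx))
    have h2 : k ∈ J := by
      change (k : 𝓞 F.K) ∈ a * a'
      rw [← hk]
      exact Ideal.mul_mem_mul hx (hga x hx)
    have h3 : l ∈ J := by
      change (l : 𝓞 F.K) ∈ a * a'
      rw [← hl]
      exact Ideal.mul_mem_mul hy (hga y hy)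
    obtain ⟨t', rfl⟩ := (hJ t).1 h1
    obtain ⟨k', rfl⟩ := (hJ k).1 h2
    obtain ⟨l', rfl⟩ := (hJ l).1 h3
    have hnF : (n : F.K) ≠ 0 := Int.cast_ne_zero.2 hn0
    set z : F.K := algebraMap (𝓞 F.K) F.K (x * gInt F.g y) / n with hz
    have hzint : IsIntegral ℤ z := by
      refine ⟨Polynomial.X ^ 2 - Polynomial.C t' * Polynomial.X + Polynomial.C k' * Polynomial.C l', ?_, ?_⟩
      · monicity!
      · have h4 : (algebraMap (𝓞 F.K) F.K (x * gInt F.g y)) ^ 2 -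
            n * t' * algebraMap (𝓞 F.K) F.K (x * gInt F.g y) + n * n * k' * l' = 0 := by
          have h5 : (x * gInt F.g y) ^ 2 - n * t' * (x * gInt F.g y) + n * n * k' * l' = 0 := by
            push_cast at ht hk hl
            linear_combination (x * gInt F.g y) * ht - (y * gInt F.g y) * hk - n * k' * hl
          have := congrArg (algebraMap (𝓞 F.K) F.K) h5
          simpa using this
        simp only [Polynomial.eval₂_add, Polynomial.eval₂_sub, Polynomial.eval₂_mul,
          Polynomial.eval₂_pow, Polynomial.eval₂_X, Polynomial.eval₂_C]
        simp only [eq_intCast]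
        have h6 : algebraMap (𝓞 F.K) F.K (x * gInt F.g y) = n * z := by
          rw [hz, mul_div_cancel₀ _ hnF]
        rw [h6] at h4
        refine mul_left_cancel₀ (pow_ne_zero 2 hnF) ?_
        linear_combination h4
    refine ⟨⟨z, hzint⟩, RingOfIntegers.coe_injective ?_⟩
    rw [map_mul (algebraMap (𝓞 F.K) F.K) (n : 𝓞 F.K) ⟨z, hzint⟩, map_intCast]
    change _ = (n : F.K) * z
    rw [hz, mul_div_cancel₀ _ hnF]
  refine ⟨n.natAbs, Int.natAbs_ne_zero.2 hn0, ?_⟩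
  have h1 : Ideal.span {((n.natAbs : ℕ) : 𝓞 F.K)} = Ideal.span {(n : 𝓞 F.K)} := by
    rcases Int.natAbs_eq n with h | h
    · conv_rhs => rw [h]
      rw [Int.cast_natCast]
    · conv_rhs => rw [h]
      rw [Int.cast_neg, Int.cast_natCast, Ideal.span_singleton_neg]
  rw [h1]
  apply le_antisymm
  · rw [ha', Ideal.map, Ideal.mul_le]
    intro x hx y hy
    refine Submodule.span_induction (p := fun y _ => x * y ∈ Ideal.span {(n : 𝓞 F.K)}) ?_ ?_ ?_ ?_ hy
    · rintro _ ⟨y, hy, rfl⟩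
      exact Ideal.mem_span_singleton.2 (key x hx y hy)
    · simp
    · intro y z _ _ h h'
      rw [mul_add]
      exact add_mem h h'
    · intro c y _ h
      rw [smul_eq_mul, mul_left_comm]
      exact Ideal.mul_mem_left _ _ h
  · rw [Ideal.span_singleton_le_iff_mem]
    exact hnJ

lemma gFrac_invol (I : FractionalIdeal (𝓞 F.K)⁰ F.K) : gFrac F.g (gFrac F.g I) = I := by
  have hmap : ∀ a : Ideal (𝓞 F.K), gFrac F.g (gFrac F.g (a : FractionalIdeal (𝓞 F.K)⁰ F.K)) = a := by
    intro a
    rw [gFrac_coeIdeal, gFrac_coeIdeal, Ideal.map_map]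
    have : ((gInt F.g : 𝓞 F.K ≃+* 𝓞 F.K) : 𝓞 F.K →+* 𝓞 F.K).comp
        ((gInt F.g : 𝓞 F.K ≃+* 𝓞 F.K) : 𝓞 F.K →+* 𝓞 F.K) = RingHom.id _ :=
      RingHom.ext F.gInt_invol
    rw [this, Ideal.map_id]
  have h := FractionalIdeal.den_mul_self_eq_num' (𝓞 F.K)⁰ F.K I
  have h2 := congrArg (fun J => gFrac F.g (gFrac F.g J)) h
  simp only [map_mul] at h2
  rw [hmap, ← h, gFrac_span, gFrac_span, F.g_invol] at h2
  refine mul_left_cancel₀ ?_ h2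
  rw [Ne, FractionalIdeal.spanSingleton_eq_zero_iff]
  simp [nonZeroDivisors.ne_zero I.den.2]

lemma gId_invol (I : FracId F.K) : gId F.g (gId F.g I) = I := Units.ext (F.gFrac_invol _)

lemma gRayCl_invol (x : RayCl F.K m) : gRayCl F.g m (gRayCl F.g m x) = x := by
  obtain ⟨x, rfl⟩ := rayMk_surjective x
  exact congrArg (rayMk F.K m) (Subtype.ext (F.gId_invol _))

lemma comap_comap (v : InfinitePlace F.K) :
    (v.comap (F.g : F.K →+* F.K)).comap (F.g : F.K →+* F.K) = v := by
  rw [← InfinitePlace.comap_comp]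
  convert InfinitePlace.comap_id v
  exact RingHom.ext F.g_invol

lemma gPic_invol (x : Pic F.K m) : gPic F.g m (gPic F.g m x) = x := by
  obtain ⟨x, rfl⟩ := picMk_surjective x
  refine congrArg (picMk F.K m) (Subtype.ext (Prod.ext (F.gId_invol _) (funext fun v => ?_)))
  change x.1.2 _ = x.1.2 v
  rw [F.comap_comap]

/-- A fractional ideal coprime to `m`, times its conjugate, is generated by a quotient of
positive integers. -/
lemma exists_mul_gId {I : FracId F.K} (hI : I ∈ idSub F.K m) :
    ∃ β : F.Kˣ, prId F.K β = I * gId F.g I ∧ ∃ t : ℚ, 0 < t ∧ (β : F.K) = algebraMap ℚ F.K t := by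
  obtain ⟨a, b, hb0, -, -, h⟩ := idSub_rep hI
  have ha0 : a ≠ ⊥ := by
    rintro rfl
    rw [FractionalIdeal.coeIdeal_bot, mul_eq_zero] at h
    exact h.elim (Units.ne_zero I) (FractionalIdeal.coeIdeal_ne_zero.2 hb0)
  obtain ⟨k, hk0, hk⟩ := F.exists_mul_conj a ha0
  obtain ⟨l, hl0, hl⟩ := F.exists_mul_conj b hb0
  have hkK : (k : F.K) ≠ 0 := Nat.cast_ne_zero.2 hk0
  have hlK : (l : F.K) ≠ 0 := Nat.cast_ne_zero.2 hl0
  refine ⟨Units.mk0 ((k : F.K) / l) (div_ne_zero hkK hlK), ?_, (k : ℚ) / l, ?_, ?_⟩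
  · apply Units.ext
    rw [val_prId]
    change FractionalIdeal.spanSingleton (𝓞 F.K)⁰ ((k : F.K) / l) =
      (Units.val I : FractionalIdeal (𝓞 F.K)⁰ F.K) * gFrac F.g (Units.val I)
    have h2 := congrArg (gFrac F.g) h
    rw [map_mul, gFrac_coeIdeal, gFrac_coeIdeal] at h2
    have h3 := congrArg (fun J : Ideal (𝓞 F.K) => (J : FractionalIdeal (𝓞 F.K)⁰ F.K)) hk
    have h4 := congrArg (fun J : Ideal (𝓞 F.K) => (J : FractionalIdeal (𝓞 F.K)⁰ F.K)) hl
    simp only [FractionalIdeal.coeIdeal_mul, FractionalIdeal.coeIdeal_span_singleton,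
      map_natCast] at h3 h4
    rw [← h, ← h2, mul_mul_mul_comm, h4] at h3
    have hl' : FractionalIdeal.spanSingleton (𝓞 F.K)⁰ (l : F.K) ≠ 0 := by
      rwa [Ne, FractionalIdeal.spanSingleton_eq_zero_iff]
    refine mul_right_cancel₀ hl' ?_
    rw [h3, FractionalIdeal.spanSingleton_mul_spanSingleton, div_mul_cancel₀ _ hlK]
  · positivity
  · simp

lemma rayClToCl_gRayCl (x : RayCl F.K m) :
    rayClToCl F.K m (gRayCl F.g m x) = (rayClToCl F.K m x)⁻¹ := by
  rw [eq_inv_iff_mul_eq_one, mul_comm, ← map_mul]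
  obtain ⟨⟨I, hI⟩, rfl⟩ := rayMk_surjective x
  obtain ⟨β, hβ, -⟩ := F.exists_mul_gId hI
  change ClassGroup.mk F.K (I * gId F.g I) = 1
  refine ClassGroup.mk_eq_one_iff.2 ?_
  rw [← hβ]
  change ((Units.val (prId F.K β) : FractionalIdeal (𝓞 F.K)⁰ F.K) :
    Submodule (𝓞 F.K) F.K).IsPrincipal
  rw [val_prId]
  exact ⟨⟨_, FractionalIdeal.coe_spanSingleton _ _⟩⟩

end QuadField

namespace FieldPair

variable {S : Finset ℕ} {s : QSign} {m : ℕ} {R : Type} [CommRing R] {σ : R ≃+* R}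
  (q : FieldPair s m R σ)

/-- The isomorphism of unit groups induced by `r`. -/
def resUnits : (𝓞 q.F.K ⧸ Ideal.span {(m : 𝓞 q.F.K)})ˣ →* Rˣ :=
  (Units.mapEquiv q.r.symm.toMulEquiv).toMonoidHom

/-- The class in `U_R` of a unit of `𝓞_F / m`. -/
def resToUR : (𝓞 q.F.K ⧸ Ideal.span {(m : 𝓞 q.F.K)})ˣ →* UR R :=
  MonoidHom.comp (mk' (zpowers (-1 : Rˣ))) q.resUnits

lemma toPic_mk (a : Rˣ) : q.toPic (QuotientGroup.mk a) = resToPic m (Units.map (q.r : R →* _) a) :=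
  rfl

lemma toPic_resToUR (a : (𝓞 q.F.K ⧸ Ideal.span {(m : 𝓞 q.F.K)})ˣ) :
    q.toPic (q.resToUR a) = resToPic m a := by
  have h : Units.map (q.r : R →* _) (q.resUnits a) = a := Units.ext (q.r.apply_symm_apply _)
  exact (q.toPic_mk _).trans (congrArg (resToPic m) h)

lemma exists_resToUR (w : UR R) : ∃ a, q.resToUR a = w := by
  obtain ⟨w, rfl⟩ := mk_surjective w
  refine ⟨Units.map (q.r : R →* _) w, congrArg QuotientGroup.mk (Units.ext ?_)⟩
  exact q.r.symm_apply_apply _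

/-- The map `U_R → Cl_F(m)`. -/
abbrev toRayCl : UR R →* RayCl q.F.K m := (picToRayCl q.F.K m).comp q.toPic

lemma rayClToCl_toRayCl (w : UR R) : rayClToCl q.F.K m (q.toRayCl w) = 1 := by
  obtain ⟨a, rfl⟩ := q.exists_resToUR w
  rw [MonoidHom.comp_apply, toPic_resToUR, rayClToCl_resToPic]

lemma toRayCl_range : q.toRayCl.range = (rayClToCl q.F.K m).ker := by
  ext x
  constructor
  · rintro ⟨w, rfl⟩
    exact q.rayClToCl_toRayCl w
  · intro hx
    obtain ⟨a, rfl⟩ := exists_resToPic_of_rayClToCl_eq_one hx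
    exact ⟨q.resToUR a, by rw [MonoidHom.comp_apply, toPic_resToUR]⟩

lemma finite_rayCl (hG : GoodRing S σ) : Finite (RayCl q.F.K m) := by
  have := hG.finite
  have h1 : Finite (rayClToCl q.F.K m).ker := by
    rw [← toRayCl_range]
    exact Finite.of_surjective _ q.toRayCl.rangeRestrict_surjective
  have h2 : Finite (RayCl q.F.K m ⧸ (rayClToCl q.F.K m).ker) :=
    Finite.of_injective _ (QuotientGroup.kerLift_injective (rayClToCl q.F.K m))
  exact Finite.of_subgroup_quotient (rayClToCl q.F.K m).ker

lemma exists_toPic_mul_archToPic {b : Pic q.F.K m}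
    (hb : rayClToCl q.F.K m (picToRayCl q.F.K m b) = 1) :
    ∃ w y, q.toPic w * archToPic q.F.K m y = b := by
  have h1 : picToRayCl q.F.K m b ∈ q.toRayCl.range := by rwa [toRayCl_range]
  obtain ⟨w, hw⟩ := h1
  have h2 : (q.toPic w)⁻¹ * b ∈ (picToRayCl q.F.K m).ker := by
    rw [MonoidHom.mem_ker, map_mul, map_inv, ← hw]
    exact inv_mul_cancel _
  rw [← archToPic_range] at h2
  obtain ⟨y, hy⟩ := h2
  exact ⟨w, y, by rw [hy, mul_inv_cancel_left]⟩

lemma toPic_eq_archToPic_iff (w : UR R) (y : archSub q.F.K) :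
    q.toPic w = archToPic q.F.K m y ↔ ∃ ε : (𝓞 q.F.K)ˣ,
      (∀ v : InfinitePlace q.F.K, (y.1 v : ℝ) = v (algebraMap (𝓞 q.F.K) q.F.K ε)) ∧
      q.resToUR (unitRes m ε) = w := by
  constructor
  · intro h
    obtain ⟨a, rfl⟩ := q.exists_resToUR w
    rw [toPic_resToUR, eq_comm, archToPic_eq_resToPic_iff] at h
    obtain ⟨ε, hε, rfl⟩ := h
    exact ⟨ε, hε, rfl⟩
  · rintro ⟨ε, hε, rfl⟩
    rw [toPic_resToUR, eq_comm, archToPic_eq_resToPic_iff]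
    exact ⟨ε, hε, rfl⟩

lemma toRayCl_eq_one_iff (w : UR R) : q.toRayCl w = 1 ↔ ∃ ε, q.resToUR (unitRes m ε) = w := by
  constructor
  · intro h
    obtain ⟨a, rfl⟩ := q.exists_resToUR w
    rw [MonoidHom.comp_apply, toPic_resToUR, picToRayCl_resToPic_eq_one_iff] at h
    obtain ⟨ε, rfl⟩ := h
    exact ⟨ε, rfl⟩
  · rintro ⟨ε, rfl⟩
    rw [MonoidHom.comp_apply, toPic_resToUR, picToRayCl_resToPic_eq_one_iff]
    exact ⟨ε, rfl⟩

lemma araTorsCls_mem_compEvent_iff (hG : GoodRing S σ) (hm : m ≠ 0) (E : Type) [CommGroup E] :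
    q.araTorsCls S ∈ compEvent S R E ↔ Nonempty (q.F.ClS S ≃* E) := by
  have := hG.finite
  let f : (q.araSeq S).C →* ClassGroup (𝓞 q.F.K) :=
    QuotientGroup.lift _ ((rayClToCl q.F.K m).comp (picToRayCl q.F.K m)) (by
      rintro _ ⟨u, rfl⟩
      exact q.rayClToCl_toRayCl u.1)
  refine ThetaSeq.mem_compEvent_tors_iff hG.prime (q.araSeq S) f ?_ ?_ E
  · intro x
    obtain ⟨x, rfl⟩ := rayClToCl_surjective (m := m) hm x
    obtain ⟨x, rfl⟩ := picToRayCl_surjective x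
    exact ⟨QuotientGroup.mk x, rfl⟩
  · intro x hx n hn
    obtain ⟨b, rfl⟩ := mk_surjective x
    obtain ⟨w, y, rfl⟩ := q.exists_toPic_mul_archToPic (b := b) hx
    obtain ⟨a, ha, c, ⟨k, hk0, hk, hc⟩, rfl⟩ := exists_sTorsion_mul_primeToS hG.prime w
    obtain ⟨z, rfl⟩ := archSub_div hn y
    let π : Pic q.F.K m →* (q.araSeq S).C := mk' (q.araSeq S).i.range
    have h1 : π (q.toPic a) = 1 := (eq_one_iff _).2 ⟨(⟨a, ha⟩ : US S R), rfl⟩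
    refine ⟨π (archToPic q.F.K m z), ?_, k, hk0, hk, ?_⟩
    · change rayClToCl q.F.K m (picToRayCl q.F.K m (archToPic q.F.K m z)) = 1
      rw [picToRayCl_archToPic, map_one]
    · change (π (archToPic q.F.K m z) ^ n *
        (π (q.toPic (a * c) * archToPic q.F.K m (z ^ n)))⁻¹) ^ k = 1
      rw [map_mul, map_mul, map_mul, h1, one_mul, map_pow, map_pow, mul_inv, mul_left_comm,
        mul_inv_cancel, mul_one, inv_pow, ← map_pow, ← map_pow, hc, map_one, map_one, inv_one]

/-- The exact sequence `𝒮_F^fin(m)(S^∞)`. -/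
def finData {E : Type} [CommGroup E] (ι : q.F.ClS S ≃* E) : ExtData S R E where
  X := sTorsion S (RayCl q.F.K m)
  g := sTorsionMap S (gRayCl q.F.g m)
  i := sTorsionMap S q.toRayCl
  p := (ι : q.F.ClS S →* E).comp (sTorsionMap S (rayClToCl q.F.K m))

lemma exists_sTorsionMap_toRayCl (hG : GoodRing S σ) (x : sTorsion S (RayCl q.F.K m))
    (hx : rayClToCl q.F.K m x = 1) : ∃ u : US S R, sTorsionMap S q.toRayCl u = x := by
  have := hG.finite
  have h2 : x.1 ∈ q.toRayCl.range := by
    rw [toRayCl_range]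
    exact hx
  obtain ⟨w, hw, hwx⟩ := exists_sTorsion_lift (G := UR R) hG.prime q.toRayCl x.2 h2
  exact ⟨⟨w, hw⟩, Subtype.ext hwx⟩

lemma finData_ker {E : Type} [CommGroup E] (hG : GoodRing S σ) (ι : q.F.ClS S ≃* E) :
    (q.finData ι).p.ker = (q.finData ι).i.range := by
  have key : ∀ x : sTorsion S (RayCl q.F.K m), ι (sTorsionMap S (rayClToCl q.F.K m) x) = 1 ↔
      ∃ u : US S R, sTorsionMap S q.toRayCl u = x := by
    intro x
    rw [map_eq_one_iff ι ι.injective]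
    constructor
    · exact fun hx => q.exists_sTorsionMap_toRayCl hG x (congrArg Subtype.val hx)
    · rintro ⟨u, rfl⟩
      exact Subtype.ext (q.rayClToCl_toRayCl u.1)
  exact Subgroup.ext key

lemma finData_surjective {E : Type} [CommGroup E] (hG : GoodRing S σ) (hm : m ≠ 0)
    (ι : q.F.ClS S ≃* E) : Function.Surjective (q.finData ι).p := by
  have := q.finite_rayCl hG
  intro e
  obtain ⟨x, rfl⟩ := ι.surjective e
  obtain ⟨z, hz, hzx⟩ := exists_sTorsion_lift hG.prime (rayClToCl q.F.K m) x.2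
    (rayClToCl_surjective hm x.1)
  exact ⟨⟨z, hz⟩, congrArg ι (Subtype.ext hzx)⟩

lemma finCls_mem_extSet {E : Type} [CommGroup E] (hG : GoodRing S σ) (hm : m ≠ 0)
    (ι : q.F.ClS S ≃* E) : q.finCls ι ∈ extSet E σ (q.unitKer S) := by
  refine (mk_mem_extSet_iff (Y := q.finData ι)).2 ⟨fun x => Subtype.ext (q.F.gRayCl_invol x.1),
    fun u => Subtype.ext ?_, fun x => ?_, rfl, q.finData_ker hG ι, q.finData_surjective hG hm ι⟩
  · change gRayCl q.F.g m (picToRayCl q.F.K m (q.toPic u.1)) = _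
    rw [← picToRayCl_gPic, gPic_toPic]
    rfl
  · change ι _ = (ι _)⁻¹
    rw [← map_inv]
    exact congrArg ι (Subtype.ext (q.F.rayClToCl_gRayCl x.1))

lemma araTorsCls_mem_extEvent_iff {E : Type} [CommGroup E] (hG : GoodRing S σ) (hm : m ≠ 0)
    (ι : q.F.ClS S ≃* E) (ε : ExtCls S R E) :
    q.araTorsCls S ∈ extEvent ε ↔ SameOrbit ε (q.finCls ι) := by
  have := q.finite_rayCl hG
  have : Finite (q.finData ι).X := inferInstanceAs (Finite (sTorsion S (RayCl q.F.K m)))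
  have : Finite E := Finite.of_equiv _ ι.toEquiv
  have hd := (isDiv_ker_picToRayCl (F := q.F.K) (m := m)).almostDivisible S
  refine mem_extEvent_iff (Y := q.finData ι) (realizes_of_isDiv (Θ := (q.araSeq S).tors)
    (sTorsionMap S (picToRayCl q.F.K m)) (sTorsionMap_surjective _ picToRayCl_surjective hd)
    (isDiv_ker_sTorsionMap hG.prime _ hd) (fun b => Subtype.ext (picToRayCl_gPic _ _))
    (fun u => rfl) (q.finData_surjective hG hm ι) (q.finData_ker hG ι)) ε

end FieldPair

namespace QuadField

variable (F : QuadField)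

lemma embedding_eq (φ ψ : F.K →+* ℂ) : ψ = φ ∨ ψ = φ.comp (F.g : F.K →+* F.K) := by
  obtain ⟨y, b, -, hy2, hy, hgen, -⟩ := exists_sqrt_generator two_ne_zero F.finrank_eq F.g_ne
  have hext : ∀ χ : F.K →+* ℂ, χ y = ψ y → ψ = χ := fun χ h => by
    ext x
    obtain ⟨α, β, rfl⟩ := hgen x
    simp [h]
  have h : (φ y - ψ y) * (φ y + ψ y) = 0 := by
    have h1 := congrArg φ hy2
    have h2 := congrArg ψ hy2
    simp only [map_pow, eq_ratCast, map_ratCast] at h1 h2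
    linear_combination h1 - h2
  rcases mul_eq_zero.1 h with h | h
  · exact Or.inl (hext φ (sub_eq_zero.1 h))
  · refine Or.inr (hext _ ?_)
    change φ (F.g y) = _
    rw [hy, map_neg]
    linear_combination -h

lemma comp_g_ne (φ : F.K →+* ℂ) : φ.comp (F.g : F.K →+* F.K) ≠ φ := fun h =>
  F.g_ne (AlgEquiv.ext fun x => φ.injective (RingHom.congr_fun h x))

lemma conj_embedding (hF : IsTotallyComplex F.K) (φ : F.K →+* ℂ) (x : F.K) :
    (starRingEnd ℂ) (φ x) = φ (F.g x) := by
  rcases F.embedding_eq φ (ComplexEmbedding.conjugate φ) with h | h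
  · exact absurd h (InfinitePlace.isComplex_mk_iff.1 (hF.isComplex _))
  · exact RingHom.congr_fun h x

lemma eq_one_or_eq_neg_one (hF : IsTotallyComplex F.K) (hE : ¬ F.Exceptional) (ε : (𝓞 F.K)ˣ) :
    ε = 1 ∨ ε = -1 := by
  obtain ⟨φ⟩ : Nonempty (F.K →+* ℂ) := inferInstance
  obtain ⟨t, ht⟩ := F.exists_trace ε
  obtain ⟨n, hn⟩ := F.exists_norm ε
  set e : F.K := algebraMap (𝓞 F.K) F.K ε with he
  have ht' : e + F.g e = t := by
    rw [← map_intCast (algebraMap (𝓞 F.K) F.K), ← ht, map_add, coe_gInt]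
  have hn' : e * F.g e = n := by
    rw [← map_intCast (algebraMap (𝓞 F.K) F.K), ← hn, map_mul, coe_gInt]
  have hnu : IsUnit n := by
    have h1 : IsUnit ((n : ℤ) : 𝓞 F.K) := by
      rw [← hn]
      exact ε.isUnit.mul (ε.isUnit.map (gInt F.g))
    obtain ⟨c, hc⟩ := h1.exists_right_inv
    obtain ⟨k, hk⟩ := F.int_of_rat (x := c) (t := (n : ℚ)⁻¹) (by
      have h2 := congrArg (algebraMap (𝓞 F.K) F.K) hc
      rw [map_mul, map_intCast, map_one] at h2
      rw [map_inv₀, map_intCast]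
      exact eq_inv_of_mul_eq_one_right h2)
    rw [hk] at hc
    exact IsUnit.of_mul_eq_one k (by exact_mod_cast hc)
  have h1 : Complex.normSq (φ e) = n := by
    have := congrArg φ hn'
    rw [map_mul, ← F.conj_embedding hF, Complex.mul_conj, map_intCast] at this
    exact_mod_cast this
  have h2 : 2 * (φ e).re = t := by
    have := congrArg φ ht'
    rw [map_add, ← F.conj_embedding hF, Complex.add_conj, map_intCast] at this
    exact_mod_cast this
  have hn1 : n = 1 := by
    rcases Int.isUnit_iff.1 hnu with h | h
    · exact h
    · have := Complex.normSq_nonneg (φ e)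
      rw [h1, h] at this
      norm_num at this
  rw [hn1, Complex.normSq_apply, Int.cast_one] at h1
  have h3 : (t : ℝ) ^ 2 ≤ 4 := by
    rw [← h2]
    nlinarith [mul_self_nonneg (φ e).im]
  have h4 : t ^ 2 ≤ 4 := by exact_mod_cast h3
  have h5 : -2 ≤ t := by nlinarith
  have h6 : t ≤ 2 := by nlinarith
  have hq : e ^ 2 - t * e + 1 = 0 := by
    rw [hn1, Int.cast_one] at hn'
    linear_combination (-hn') + e * ht'
  have hval : ∀ c : 𝓞 F.K, (e - algebraMap (𝓞 F.K) F.K c) ^ 2 = 0 → (ε : 𝓞 F.K) = c := fun c hc =>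
    RingOfIntegers.coe_injective (sub_eq_zero.1 (pow_eq_zero_iff two_ne_zero |>.1 hc))
  interval_cases t
  · refine Or.inr (Units.ext (hval (-1) ?_))
    push_cast at hq
    rw [map_neg, map_one]
    linear_combination hq
  · exact absurd ⟨e, Or.inr (by push_cast at hq; linear_combination hq)⟩ hE
  · exact absurd ⟨e, Or.inl (by push_cast at hq; linear_combination hq)⟩ hE
  · exact absurd ⟨-e, Or.inr (by push_cast at hq; linear_combination hq)⟩ hE
  · refine Or.inl (Units.ext (hval 1 ?_))
    push_cast at hq
    rw [map_one]
    linear_combination hq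

lemma not_exceptional_of_real (hF : IsTotallyReal F.K) : ¬ F.Exceptional := by
  rintro ⟨z, hz⟩
  obtain ⟨φ⟩ : Nonempty (F.K →+* ℂ) := inferInstance
  have hφ : ComplexEmbedding.IsReal φ := InfinitePlace.isReal_mk_iff.1 (hF.isReal _)
  set x : ℝ := hφ.embedding z
  rcases hz with h | h
  · have := congrArg hφ.embedding h
    simp only [map_add, map_pow, map_one, map_zero] at this
    nlinarith [sq_nonneg x]
  · have := congrArg hφ.embedding h
    simp only [map_add, map_pow, map_one, map_zero] at this
    nlinarith [sq_nonneg (x + 1 / 2)]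

end QuadField

lemma FieldPair.unitKer_minus {S : Finset ℕ} {m : ℕ} {R : Type} [CommRing R] {σ : R ≃+* R}
    (q : FieldPair .minus m R σ) (hE : ¬ q.F.Exceptional) : q.unitKer S = ⊥ := by
  refine eq_bot_iff.2 fun u hu => Subtype.ext ?_
  obtain ⟨ε, hε⟩ := (q.toRayCl_eq_one_iff u.1).1 (congrArg Subtype.val hu)
  rw [← hε]
  rcases q.F.eq_one_or_eq_neg_one q.hasSign hE ε with rfl | rfl
  · simp
  · refine (eq_one_iff _).2 (Subgroup.mem_zpowers_iff.2 ⟨1, Units.ext ?_⟩)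
    rw [zpow_one]
    change _ = q.r.symm (Ideal.Quotient.mk _ (-1))
    simp

/-- The exponential function as a map from `ℝ` to `ℝˣ`. -/
def expUnit : Multiplicative ℝ →* ℝˣ where
  toFun t := Units.mk0 (Real.exp t.toAdd) (Real.exp_ne_zero _)
  map_one' := Units.ext Real.exp_zero
  map_mul' _ _ := Units.ext (Real.exp_add _ _)

lemma continuous_expUnit : Continuous expUnit := by
  refine Units.continuous_iff.2 ⟨Real.continuous_exp.comp continuous_toAdd, ?_⟩
  have : Continuous fun t : Multiplicative ℝ => Real.exp (-t.toAdd) :=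
    Real.continuous_exp.comp continuous_toAdd.neg
  refine this.congr fun t => ?_
  rw [Real.exp_neg]
  rfl

namespace QuadField

variable (F : QuadField) {m : ℕ}

lemma exists_places (hF : IsTotallyReal F.K) : ∃ v v' : InfinitePlace F.K, v ≠ v' ∧
    (∀ w, w = v ∨ w = v') ∧ v.comap (F.g : F.K →+* F.K) = v' ∧
    v'.comap (F.g : F.K →+* F.K) = v := by
  obtain ⟨φ⟩ : Nonempty (F.K →+* ℂ) := inferInstance
  refine ⟨InfinitePlace.mk φ, InfinitePlace.mk (φ.comp (F.g : F.K →+* F.K)), fun h => ?_,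
    fun w => ?_, rfl, F.comap_comap (InfinitePlace.mk φ)⟩
  · have hφ : ComplexEmbedding.conjugate φ = φ := InfinitePlace.isReal_mk_iff.1 (hF.isReal _)
    rcases InfinitePlace.mk_eq_iff.1 h with h | h
    · exact F.comp_g_ne φ h.symm
    · exact F.comp_g_ne φ (h.symm.trans hφ)
  · rcases F.embedding_eq φ w.embedding with h | h
    · exact Or.inl (by rw [← h, InfinitePlace.mk_embedding])
    · exact Or.inr (by rw [← h, InfinitePlace.mk_embedding])

lemma prod_places (hF : IsTotallyReal F.K) {v v' : InfinitePlace F.K} (hv : v ≠ v')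
    (h : ∀ w, w = v ∨ w = v') (f : InfinitePlace F.K → ℝ) : ∏ w, f w ^ w.mult = f v * f v' := by
  classical
  have huniv : (Finset.univ : Finset (InfinitePlace F.K)) = {v, v'} := by
    ext w
    simpa using h w
  rw [huniv, Finset.prod_pair hv, IsTotallyReal.mult_eq, IsTotallyReal.mult_eq, pow_one, pow_one]

lemma real_eq_one_or (hF : IsTotallyReal F.K) {ε : (𝓞 F.K)ˣ}
    (h : ∀ v : InfinitePlace F.K, v (algebraMap (𝓞 F.K) F.K ε) = 1) : ε = 1 ∨ ε = -1 := by
  obtain ⟨φ⟩ : Nonempty (F.K →+* ℂ) := inferInstance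
  have hφ : ComplexEmbedding.IsReal φ := InfinitePlace.isReal_mk_iff.1 (hF.isReal _)
  set x : ℝ := hφ.embedding (algebraMap (𝓞 F.K) F.K ε)
  have hx : |x| = 1 := by
    have h1 : ‖φ (algebraMap (𝓞 F.K) F.K ε)‖ = 1 := h (InfinitePlace.mk φ)
    rwa [← hφ.coe_embedding_apply, Complex.norm_real] at h1
  have hinj : Function.Injective fun e : (𝓞 F.K)ˣ => hφ.embedding (algebraMap (𝓞 F.K) F.K e) :=
    fun a b hab => Units.ext (RingOfIntegers.coe_injective (hφ.embedding.injective hab))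
  rcases (abs_eq zero_le_one).1 hx with h1 | h1
  · exact Or.inl (hinj (by simpa using h1))
  · exact Or.inr (hinj (by simpa using h1))

lemma place_zpow (v : InfinitePlace F.K) {η ε : (𝓞 F.K)ˣ} {n : ℤ} (h : ε = η ^ n ∨ ε = -η ^ n) :
    v (algebraMap (𝓞 F.K) F.K ε) = v (algebraMap (𝓞 F.K) F.K η) ^ n := by
  have h1 : v (algebraMap (𝓞 F.K) F.K (η ^ n : (𝓞 F.K)ˣ)) = v (algebraMap (𝓞 F.K) F.K η) ^ n := by
    rw [NumberField.Units.coe_zpow, map_zpow₀]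
  rcases h with rfl | rfl
  · exact h1
  · rw [← h1, Units.val_neg, map_neg]
    exact v.1.map_neg _

lemma exists_place_ne_one (hF : IsTotallyReal F.K) {η : (𝓞 F.K)ˣ} (hη : F.IsFundUnit η) :
    ∃ v : InfinitePlace F.K, v (algebraMap (𝓞 F.K) F.K η) ≠ 1 := by
  classical
  by_contra! h
  have htop : Units.torsion F.K = ⊤ := by
    refine eq_top_iff.2 fun ε _ => (Units.mem_torsion F.K).2 fun w => ?_
    obtain ⟨n, h1⟩ := hη ε
    rw [F.place_zpow w h1, h w, one_zpow]
  obtain ⟨v, v', hv, hw, -⟩ := F.exists_places hF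
  have h3 : 2 ≤ Fintype.card (InfinitePlace F.K) := by
    have := Finset.card_pair hv
    rw [← this]
    exact Finset.card_le_univ _
  have h4 : 0 < Units.rank F.K := Nat.sub_pos_of_lt h3
  refine (Units.basisUnitLattice F.K).ne_zero ⟨0, h4⟩ (Subtype.ext ?_)
  rw [← Units.logEmbedding_fundSystem]
  exact Units.dirichletUnitTheorem.logEmbedding_eq_zero_iff.2 (htop ▸ Subgroup.mem_top _)

lemma absNorm_prId (α : F.Kˣ) : ((FractionalIdeal.absNorm
    (Units.val (prId F.K α) : FractionalIdeal (𝓞 F.K)⁰ F.K) : ℚ) : ℝ) =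
      ∏ v : InfinitePlace F.K, (v (α : F.K)) ^ v.mult := by
  rw [val_prId, FractionalIdeal.absNorm_span_singleton, InfinitePlace.prod_eq_abs_norm]

lemma prod_place_unit (ε : (𝓞 F.K)ˣ) :
    ∏ v : InfinitePlace F.K, (v (algebraMap (𝓞 F.K) F.K ε)) ^ v.mult = 1 := by
  have := F.absNorm_prId (Units.map (algebraMap (𝓞 F.K) F.K : 𝓞 F.K →* F.K) ε)
  rw [prId_unit] at this
  refine this.symm.trans ?_
  change ((FractionalIdeal.absNorm ((1 : (FractionalIdeal (𝓞 F.K)⁰ F.K)ˣ) :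
    FractionalIdeal (𝓞 F.K)⁰ F.K) : ℚ) : ℝ) = 1
  simp

/-- The group of elements of norm one is a line, with the fundamental unit as period. -/
lemma exists_archGen (hF : IsTotallyReal F.K) {η : (𝓞 F.K)ˣ} (hη : F.IsFundUnit η) (m : ℕ) :
    ∃ γ : Multiplicative ℝ →* archSub F.K, Function.Surjective γ ∧
      Continuous ((archIncl F.K m).comp γ) ∧ IsOpenMap ((archIncl F.K m).comp γ) ∧
      (∀ t, (∃ ε : (𝓞 F.K)ˣ, ∀ w : InfinitePlace F.K,
        ((γ t).1 w : ℝ) = w (algebraMap (𝓞 F.K) F.K ε)) ↔ t ∈ zpowers unitPeriod) ∧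
      ∀ w : InfinitePlace F.K, ((γ unitPeriod).1 w : ℝ) = w (algebraMap (𝓞 F.K) F.K η) := by
  classical
  obtain ⟨v, v', hv, hw, -⟩ := F.exists_places hF
  have hpos : ∀ (ε : (𝓞 F.K)ˣ) (w : InfinitePlace F.K), 0 < w (algebraMap (𝓞 F.K) F.K ε) :=
    fun ε w => InfinitePlace.pos_iff.2 (by simp)
  have hmul : ∀ ε : (𝓞 F.K)ˣ,
      v (algebraMap (𝓞 F.K) F.K ε) * v' (algebraMap (𝓞 F.K) F.K ε) = 1 := fun ε => by
    rw [← F.prod_places hF hv hw (fun w => w (algebraMap (𝓞 F.K) F.K ε)), prod_place_unit]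
  set L : ℝ := Real.log (v (algebraMap (𝓞 F.K) F.K η)) with hL
  have hLexp : Real.exp L = v (algebraMap (𝓞 F.K) F.K η) := Real.exp_log (hpos η v)
  have hexp : ∀ (ε : (𝓞 F.K)ˣ) (t : ℝ), Real.exp t = v (algebraMap (𝓞 F.K) F.K ε) →
      Real.exp (-t) = v' (algebraMap (𝓞 F.K) F.K ε) := fun ε t h => by
    rw [Real.exp_neg, h]
    exact inv_eq_of_mul_eq_one_right (hmul ε)
  have hL0 : L ≠ 0 := by
    intro h0
    have h1 : v (algebraMap (𝓞 F.K) F.K η) = 1 := by rw [← hLexp, h0, Real.exp_zero]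
    obtain ⟨w, hw1⟩ := F.exists_place_ne_one hF hη
    have h2 := hmul η
    rcases hw w with rfl | rfl
    · exact hw1 h1
    · rw [h1, one_mul] at h2
      exact hw1 h2
  let sc : ℝ → (Multiplicative ℝ →* Multiplicative ℝ) := fun c =>
    AddMonoidHom.toMultiplicative (AddMonoidHom.mulLeft c)
  have hscc : ∀ c, Continuous (sc c) := fun c =>
    (continuous_const.mul continuous_id : Continuous fun t : ℝ => c * t)
  let γ₀ : Multiplicative ℝ →* (InfinitePlace F.K → ℝˣ) :=
    MonoidHom.pi fun w => expUnit.comp (sc (if w = v then L else -L))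
  have hγv : ∀ t, (γ₀ t v : ℝ) = Real.exp (L * t.toAdd) := fun t => by
    change Real.exp ((if v = v then L else -L) * t.toAdd) = _
    rw [if_pos rfl]
  have hγv' : ∀ t, (γ₀ t v' : ℝ) = Real.exp (-(L * t.toAdd)) := fun t => by
    change Real.exp ((if v' = v then L else -L) * t.toAdd) = _
    rw [if_neg hv.symm, neg_mul]
  have hc₀ : Continuous γ₀ := continuous_pi fun w => continuous_expUnit.comp (hscc _)
  let γ : Multiplicative ℝ →* archSub F.K := γ₀.codRestrict _ fun t => ⟨fun w => Real.exp_pos _, by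
    rw [F.prod_places hF hv hw (fun w => (γ₀ t w : ℝ)), hγv, hγv', ← Real.exp_add, add_neg_cancel,
      Real.exp_zero]⟩
  have hunit : ∀ (t : Multiplicative ℝ) (ε : (𝓞 F.K)ˣ), (∀ w : InfinitePlace F.K,
      ((γ t).1 w : ℝ) = w (algebraMap (𝓞 F.K) F.K ε)) ↔
        Real.exp (L * t.toAdd) = v (algebraMap (𝓞 F.K) F.K ε) := fun t ε => by
    constructor
    · exact fun h => (hγv t).symm.trans (h v)
    · intro h w
      rcases hw w with rfl | rfl
      · exact (hγv t).trans h
      · exact (hγv' t).trans (hexp ε _ h)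
  have hsurj : ∀ y : archSub F.K, γ (ofAdd (Real.log (y.1 v) / L)) = y := fun y => by
    have h1 : Real.exp (L * (Real.log (y.1 v) / L)) = (y.1 v : ℝ) := by
      rw [mul_div_cancel₀ _ hL0, Real.exp_log (y.2.1 v)]
    refine Subtype.ext (funext fun w => Units.ext ?_)
    rcases hw w with rfl | rfl
    · exact (hγv _).trans h1
    · refine (hγv' _).trans ?_
      rw [Real.exp_neg]
      change (Real.exp (L * (Real.log (y.1 v) / L)))⁻¹ = _
      rw [h1]
      refine inv_eq_of_mul_eq_one_right ?_
      rw [← F.prod_places hF hv hw (fun w => (y.1 w : ℝ)), y.2.2]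
  refine ⟨γ, fun y => ⟨_, hsurj y⟩, ?_, ?_, fun t => ?_, ?_⟩
  · exact Continuous.subtype_mk (continuous_const.prodMk hc₀) _
  · intro U hU
    have hpc : Continuous fun x : araDiv F.K m => ((x.1.2 v : ℝˣ) : ℝ) :=
      Units.continuous_val.comp ((continuous_apply v).comp (continuous_snd.comp continuous_subtype_val))
    have hlc : Continuous fun x : araDiv F.K m =>
        (ofAdd (Real.log (x.1.2 v : ℝ) / L)) :=
      continuous_ofAdd.comp ((hpc.log fun x => (x.2.2.1 v).ne').div_const L)
    have h1 : IsOpen {x : araDiv F.K m | x.1.1 = 1} :=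
      (isOpen_discrete ({1} : Set (FracId F.K))).preimage (continuous_fst.comp continuous_subtype_val)
    convert h1.inter (hU.preimage hlc) using 1
    ext x
    constructor
    · rintro ⟨t, ht, rfl⟩
      refine ⟨rfl, ?_⟩
      change ofAdd (Real.log (γ₀ t v : ℝ) / L) ∈ U
      rwa [hγv, Real.log_exp, mul_div_cancel_left₀ _ hL0]
    · rintro ⟨hx1, hxU⟩
      have hx1' : x.1.1 = 1 := hx1
      refine ⟨_, hxU, Subtype.ext (Prod.ext hx1.symm ?_)⟩
      exact congrArg Subtype.val (hsurj ⟨x.1.2, x.2.2.1, by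
        rw [← x.2.2.2, hx1']
        change ((FractionalIdeal.absNorm ((1 : (FractionalIdeal (𝓞 F.K)⁰ F.K)ˣ) :
          FractionalIdeal (𝓞 F.K)⁰ F.K) : ℚ) : ℝ) = 1
        simp⟩)
  · simp only [hunit]
    rw [mem_zpowers_unitPeriod]
    have hpow : ∀ {ε : (𝓞 F.K)ˣ} {n : ℤ}, (ε = η ^ n ∨ ε = -η ^ n) →
        v (algebraMap (𝓞 F.K) F.K ε) = Real.exp (L * n) := fun h => by
      rw [Real.exp_mul, Real.rpow_intCast, hLexp, F.place_zpow v h]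
    constructor
    · rintro ⟨ε, hε⟩
      obtain ⟨n, hn⟩ := hη ε
      refine ⟨n, ?_⟩
      have h1 : Real.exp (L * t.toAdd) = Real.exp (L * n) := by
        rw [hε, hpow hn]
      exact mul_left_cancel₀ hL0 (Real.exp_injective h1)
    · rintro ⟨n, hn⟩
      exact ⟨η ^ n, by rw [hpow (Or.inl rfl), hn]⟩
  · refine (hunit _ _).2 ?_
    rw [← hLexp]
    change Real.exp (L * 1) = _
    rw [mul_one]

end QuadField

lemma place_ratCast {K : Type} [Field K] [NumberField K] (v : InfinitePlace K) {t : ℚ}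
    (ht : 0 < t) : v (algebraMap ℚ K t) = t := by
  rw [← InfinitePlace.norm_embedding_eq, eq_ratCast, map_ratCast, Complex.norm_ratCast,
    abs_of_pos (by exact_mod_cast ht)]

namespace FieldPair

variable {S : Finset ℕ} {m : ℕ} {R : Type} [CommRing R] {σ : R ≃+* R}
  (q : FieldPair .plus m R σ)

/-- The product of a class and its conjugate comes from `U_R`. -/
lemma mul_gPic (b : Pic q.F.K m) : ∃ w, q.toPic w = b * gPic q.F.g m b := by
  obtain ⟨x, rfl⟩ := picMk_surjective b
  obtain ⟨β, hβ, t, ht, hβt⟩ := q.F.exists_mul_gId x.2.1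
  have hF : IsTotallyReal q.F.K := q.hasSign
  obtain ⟨v, v', hv, hw, hgv, hgv'⟩ := q.F.exists_places hF
  have h1 : (x.1.2 v : ℝ) * x.1.2 v' = t := by
    have h2 := q.F.absNorm_prId β
    rw [hβ, q.F.prod_places hF hv hw (fun w => w (β : q.F.K)), hβt, place_ratCast v ht,
      place_ratCast v' ht] at h2
    change ((FractionalIdeal.absNorm ((Units.val x.1.1 : FractionalIdeal (𝓞 q.F.K)⁰ q.F.K) *
      gFrac q.F.g (Units.val x.1.1)) : ℚ) : ℝ) = _ at h2
    rw [map_mul, absNorm_gFrac, Rat.cast_mul, x.2.2.2,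
      q.F.prod_places hF hv hw (fun w => (x.1.2 w : ℝ))] at h2
    exact (mul_self_inj (mul_pos (x.2.2.1 v) (x.2.2.1 v')).le (by exact_mod_cast ht.le)).1 h2
  have h2 : (x * gAraDiv q.F.g m x).1 = prIdReal q.F.K β := by
    refine Prod.ext hβ.symm (funext fun w => Units.ext ?_)
    change (x.1.2 w : ℝ) * x.1.2 (w.comap (q.F.g : q.F.K →+* q.F.K)) = w (β : q.F.K)
    rw [hβt, place_ratCast w ht]
    rcases hw w with rfl | rfl
    · rw [hgv, h1]
    · rw [hgv', mul_comm, h1]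
  obtain ⟨c, d, hcd⟩ := exists_quotient_of_mem_idSub (F := q.F.K) (m := m) (β := β) (by
    rw [hβ]
    exact mul_mem x.2.1 (gId_mem _ x.2.1))
  refine ⟨q.resToUR (resCls c * (resCls d)⁻¹), ?_⟩
  rw [toPic_resToUR, map_mul, map_inv, resToPic_resCls, resToPic_resCls, mul_inv_eq_iff_eq_mul]
  change picMk q.F.K m ⟨prIdReal q.F.K (copUnit m c), _⟩ =
    picMk q.F.K m (x * gAraDiv q.F.g m x) * picMk q.F.K m ⟨prIdReal q.F.K (copUnit m d), _⟩
  rw [← map_mul]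
  congr 1
  apply Subtype.ext
  change prIdReal q.F.K (copUnit m c) = (x * gAraDiv q.F.g m x).1 * prIdReal q.F.K (copUnit m d)
  rw [h2, ← map_mul, hcd]

/-- The projection to the quotient by the prime-to-`S` part. -/
def quotMk (S : Finset ℕ) : Pic q.F.K m →* (q.araQuot S).B :=
  mk' ((primeToS S (UR R)).map q.toPic)

lemma quotMk_surjective : Function.Surjective (q.quotMk S) := QuotientGroup.mk'_surjective _

lemma quotMk_eq_one {b : Pic q.F.K m} : q.quotMk S b = 1 ↔ ∃ w ∈ primeToS S (UR R), q.toPic w = b :=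
  eq_one_iff b

lemma araQuot_i (u : US S R) : (q.araQuot S).i u = q.quotMk S (q.toPic u.1) := rfl

lemma araQuot_i_eq (u : US S R) {w : UR R} (hw : w ∈ primeToS S (UR R)) :
    (q.araQuot S).i u = q.quotMk S (q.toPic (u.1 * w)) := by
  rw [map_mul, map_mul, q.quotMk_eq_one.2 ⟨w, hw, rfl⟩, mul_one, araQuot_i]

/-- The map to the class group. -/
def clQuot (S : Finset ℕ) : (q.araQuot S).B →* ClassGroup (𝓞 q.F.K) :=
  QuotientGroup.lift ((primeToS S (UR R)).map q.toPic)
    ((rayClToCl q.F.K m).comp (picToRayCl q.F.K m)) (by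
      rintro _ ⟨w, -, rfl⟩
      exact q.rayClToCl_toRayCl w)

lemma toPic_injective : Function.Injective q.toPic := by
  rw [injective_iff_map_eq_one]
  intro w hw
  have h := (q.toPic_eq_archToPic_iff w 1).1 (by rw [hw, map_one])
  obtain ⟨ε, h1, rfl⟩ := h
  have h2 : q.toPic (q.resToUR (unitRes m (-1))) = 1 ∧ q.resToUR (unitRes m (-1)) = 1 := by
    have h3 : q.resToUR (unitRes m (-1)) = 1 := by
      refine (eq_one_iff _).2 (Subgroup.mem_zpowers_iff.2 ⟨1, Units.ext ?_⟩)
      rw [zpow_one]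
      change _ = q.r.symm (Ideal.Quotient.mk _ (-1))
      simp
    exact ⟨by rw [h3, map_one], h3⟩
  rcases q.F.real_eq_one_or q.hasSign (fun v => (h1 v).symm) with rfl | rfl
  · rw [map_one, map_one]
  · exact h2.2

lemma araQuot_i_injective : Function.Injective (q.araQuot S).i := by
  rw [injective_iff_map_eq_one]
  intro u hu
  rw [araQuot_i, quotMk_eq_one] at hu
  obtain ⟨w, hw, h⟩ := hu
  rw [q.toPic_injective h] at hw
  exact Subtype.ext (eq_one_of_mem_sTorsion_primeToS u.2 hw)

lemma compPart_isExt (hG : GoodRing S σ) : (q.araQuot S).compPart.IsExt σ := by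
  have := hG.finite
  refine ⟨fun b => Subtype.ext ?_, fun u => Subtype.ext ?_, fun u v h =>
    q.araQuot_i_injective (congrArg Subtype.val h), fun b => ?_⟩
  · obtain ⟨x, hx⟩ := q.quotMk_surjective b.1
    change (q.araQuot S).g ((q.araQuot S).g b.1) = b.1
    rw [← hx]
    exact congrArg (q.quotMk S) (q.F.gPic_invol x)
  · exact congrArg (q.quotMk S) (q.gPic_toPic u.1)
  · obtain ⟨x, hx⟩ := q.quotMk_surjective b.1
    obtain ⟨w, hw⟩ := q.mul_gPic x
    obtain ⟨u, hu, w', hw', rfl⟩ := exists_sTorsion_mul_primeToS (G := UR R) hG.prime w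
    refine ⟨(⟨u, hu⟩ : US S R), Subtype.ext ?_⟩
    change (q.araQuot S).i ⟨u, hu⟩ = b.1 * (q.araQuot S).g b.1
    rw [q.araQuot_i_eq ⟨u, hu⟩ hw', hw, ← hx]
    rfl

/-- The one-parameter subgroup whose image is the identity component. -/
structure CptGen (S : Finset ℕ) (η : (𝓞 q.F.K)ˣ) where
  γ : Multiplicative ℝ →* (q.araQuot S).B
  cont : Continuous γ
  isOpen : IsOpenMap γ
  cl : ∀ t, q.clQuot S (γ t) = 1
  ker : ∀ b, q.clQuot S b = 1 → ∃ u t, (q.araQuot S).i u * γ t = b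
  period : ∀ t, γ t ∈ (q.araQuot S).i.range ↔ t ∈ zpowers unitPeriod
  unit : γ unitPeriod = q.quotMk S (q.toPic (q.resToUR (unitRes m η)))

lemma exists_cptGen (hG : GoodRing S σ) {η : (𝓞 q.F.K)ˣ} (hη : q.F.IsFundUnit η) :
    Nonempty (q.CptGen S η) := by
  have := hG.finite
  obtain ⟨γ, h1, h2, h3, h4, h5⟩ := q.F.exists_archGen q.hasSign hη m
  have hq : IsOpenMap (q.quotMk S) := QuotientGroup.isOpenMap_coe
  have hp : IsOpenMap (picMk q.F.K m) := QuotientGroup.isOpenMap_coe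
  have hqc : Continuous (q.quotMk S) := continuous_mk
  have hpc : Continuous (picMk q.F.K m) := continuous_mk
  refine ⟨(q.quotMk S).comp ((archToPic q.F.K m).comp γ), hqc.comp (hpc.comp h2),
    hq.comp (hp.comp h3), fun t => ?_, fun b hb => ?_, fun t => ?_, ?_⟩
  · change rayClToCl q.F.K m (picToRayCl q.F.K m (archToPic q.F.K m (γ t))) = 1
    rw [picToRayCl_archToPic, map_one]
  · obtain ⟨b, rfl⟩ := q.quotMk_surjective b
    obtain ⟨w, y, rfl⟩ := q.exists_toPic_mul_archToPic (b := b) hb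
    obtain ⟨u, hu, w', hw', rfl⟩ := exists_sTorsion_mul_primeToS (G := UR R) hG.prime w
    obtain ⟨t, rfl⟩ := h1 y
    refine ⟨(⟨u, hu⟩ : US S R), t, ?_⟩
    rw [q.araQuot_i_eq ⟨u, hu⟩ hw', map_mul]
    rfl
  · rw [← h4 t]
    constructor
    · rintro ⟨u, hu⟩
      have hu' : q.quotMk S (q.toPic u.1) = q.quotMk S (archToPic q.F.K m (γ t)) := hu
      rw [← mul_inv_eq_one, ← map_inv, ← map_mul, quotMk_eq_one] at hu'
      obtain ⟨w, -, hw⟩ := hu'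
      obtain ⟨ε, hε, -⟩ := (q.toPic_eq_archToPic_iff (w⁻¹ * u.1) (γ t)).1 (by
        rw [map_mul, map_inv, hw, mul_inv, inv_inv, mul_right_comm, inv_mul_cancel, one_mul])
      exact ⟨ε, hε⟩
    · rintro ⟨ε, hε⟩
      have h6 := (q.toPic_eq_archToPic_iff _ (γ t)).2 ⟨ε, hε, rfl⟩
      obtain ⟨u, hu, w', hw', h7⟩ :=
        exists_sTorsion_mul_primeToS (G := UR R) hG.prime (q.resToUR (unitRes m ε))
      refine ⟨(⟨u, hu⟩ : US S R), ?_⟩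
      rw [q.araQuot_i_eq ⟨u, hu⟩ hw', h7, h6]
      rfl
  · exact congrArg (q.quotMk S) ((q.toPic_eq_archToPic_iff _ _).2 ⟨η, h5, rfl⟩).symm

namespace CptGen

variable {q} {η : (𝓞 q.F.K)ˣ} (c : q.CptGen S η)

include c in
lemma clQuot_of_mem {b : (q.araQuot S).B}
    (hb : b ∈ Subgroup.connectedComponentOfOne (q.araQuot S).B) : q.clQuot S b = 1 := by
  have ho : IsOpen ((q.clQuot S).ker : Set (q.araQuot S).B) :=
    Subgroup.isOpen_mono (H₁ := c.γ.range) (by rintro _ ⟨t, rfl⟩; exact c.cl t)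
      (by rw [MonoidHom.coe_range]; exact c.isOpen.isOpen_range)
  have hcl : IsClopen ((q.clQuot S).ker : Set (q.araQuot S).B) :=
    ⟨Subgroup.isClosed_of_isOpen _ ho, ho⟩
  exact hcl.connectedComponent_subset (one_mem (q.clQuot S).ker) hb

lemma γ_mem (t : Multiplicative ℝ) :
    c.γ t ∈ Subgroup.connectedComponentOfOne (q.araQuot S).B := by
  have := (isPreconnected_range c.cont).subset_connectedComponent ⟨1, map_one c.γ⟩
  exact this ⟨t, rfl⟩

lemma mem_compSub_of_pow {b : (q.araQuot S).B} {n : ℕ} (hn : IsSNumber S n)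
    (h : b ^ n ∈ Subgroup.connectedComponentOfOne (q.araQuot S).B) :
    b ∈ ThetaSeq.compSub S (q.araQuot S).B :=
  ⟨n, hn, (eq_one_iff (b ^ n)).2 h⟩

/-- The one-parameter subgroup of the compact `S`-part. -/
def lift : Multiplicative ℝ →* (q.araQuot S).compPart.B :=
  c.γ.codRestrict (ThetaSeq.compSub S (q.araQuot S).B) fun t =>
    mem_compSub_of_pow IsSNumber.one (by rw [pow_one]; exact c.γ_mem t)

lemma mem_range_compPart {b : (q.araQuot S).compPart.B} :
    b ∈ (q.araQuot S).compPart.i.range ↔ b.1 ∈ (q.araQuot S).i.range :=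
  exists_congr fun _ => Subtype.ext_iff

lemma lift_isOpenMap : IsOpenMap ((q.araQuot S).compPart.barHom c.lift) := by
  have h1 : IsOpenMap c.lift := fun U hU => by
    refine ⟨c.γ '' U, c.isOpen U hU, ?_⟩
    ext b
    constructor
    · rintro ⟨t, ht, h⟩
      exact ⟨t, ht, Subtype.ext h⟩
    · rintro ⟨t, ht, rfl⟩
      exact ⟨t, ht, rfl⟩
  exact (QuotientGroup.isOpenMap_coe).comp h1

include c in
lemma exists_unitValue (hG : GoodRing S σ) : ∃ v ∈ UMinus S σ,
    (∃ w ∈ primeToS S (UR R), v.1 * w = q.resToUR (unitRes m η)) ∧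
    ∀ u, q.araCptCls S ∈ unitEvent u ↔ u ∈ uOrbit σ v := by
  have := hG.finite
  obtain ⟨u, hu, w', hw', h7⟩ :=
    exists_sTorsion_mul_primeToS (G := UR R) hG.prime (q.resToUR (unitRes m η))
  have hv : (q.araQuot S).compPart.i (⟨u, hu⟩ : US S R) = c.lift unitPeriod := by
    refine Subtype.ext ?_
    change (q.araQuot S).i ⟨u, hu⟩ = c.γ unitPeriod
    rw [c.unit, q.araQuot_i_eq ⟨u, hu⟩ hw', h7]
  have hΘ := q.compPart_isExt hG
  refine ⟨(⟨u, hu⟩ : US S R), (g_mem_iff hΘ _).1 ?_, ⟨w', hw', h7⟩, fun u' =>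
    mem_unitEvent_iff hG hΘ (c.cont.subtype_mk _) (fun t => ?_) c.lift_isOpenMap hv u'⟩
  · rw [hv]
    exact IsGen.g_apply (z := unitPeriod) hG multReal_div hΘ c.lift _
  · rw [mem_range_compPart]
    exact c.period t

include c in
lemma torsCls_mem_compEvent_iff (hG : GoodRing S σ) (hm : m ≠ 0) (E : Type) [CommGroup E] :
    torsCls (q.araCptCls S) ∈ compEvent S R E ↔ Nonempty (q.F.ClS S ≃* E) := by
  have := hG.finite
  let f₀ : (q.araQuot S).compPart.B →* q.F.ClS S :=
    ((q.clQuot S).comp (ThetaSeq.compSub S (q.araQuot S).B).subtype).codRestrict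
      (sTorsion S (ClassGroup (𝓞 q.F.K))) (by
        rintro ⟨b, n, hn, hb⟩
        exact ⟨n, hn, (map_pow (q.clQuot S) b n).symm.trans
          (c.clQuot_of_mem ((eq_one_iff (b ^ n)).1 hb))⟩)
  let f : (q.araQuot S).compPart.C →* q.F.ClS S := QuotientGroup.lift _ f₀ (by
    rintro _ ⟨u, rfl⟩
    exact Subtype.ext (q.rayClToCl_toRayCl u.1))
  have e : sTorsion S (q.F.ClS S) ≃* q.F.ClS S :=
    (MulEquiv.subgroupCongr (isSGroup_sTorsion S _)).trans Subgroup.topEquiv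
  have h : (⟦(q.araQuot S).compPart.tors⟧ : ThetaCls S R) ∈ compEvent S R E ↔
      Nonempty (sTorsion S (q.F.ClS S) ≃* E) := by
    refine ThetaSeq.mem_compEvent_tors_iff hG.prime _ f ?_ (IsDiv.almostDivisible ?_ S) E
    · rintro ⟨x, n, hn, hx⟩
      obtain ⟨y, rfl⟩ := rayClToCl_surjective (m := m) hm x
      obtain ⟨y, rfl⟩ := picToRayCl_surjective y
      have h1 : q.clQuot S (q.quotMk S y ^ n) = 1 := (map_pow (q.clQuot S) (q.quotMk S y) n).trans hx
      obtain ⟨u, t, hut⟩ := c.ker _ h1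
      obtain ⟨k, hk, hu⟩ := ThetaSeq.isSGroup_US.exists_pow u
      have h2 : q.quotMk S y ^ (n * k) ∈ Subgroup.connectedComponentOfOne (q.araQuot S).B := by
        rw [pow_mul, ← hut, mul_pow, ← map_pow, hu, map_one, one_mul, ← map_pow]
        exact c.γ_mem _
      exact ⟨QuotientGroup.mk (⟨_, mem_compSub_of_pow (hn.mul hk) h2⟩ :
        ThetaSeq.compSub S (q.araQuot S).B), rfl⟩
    · intro n hn x hx
      obtain ⟨b, rfl⟩ := mk_surjective x
      obtain ⟨u, t, hut⟩ := c.ker b.1 (congrArg Subtype.val (show f₀ b = 1 from hx))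
      obtain ⟨t', rfl⟩ := multReal_div n hn t
      refine ⟨(q.araQuot S).compPart.barHom c.lift t', Subtype.ext (c.cl t'), ?_⟩
      rw [← map_pow]
      refine QuotientGroup.eq.2 ⟨u, Subtype.ext ?_⟩
      change (q.araQuot S).i u = (c.γ (t' ^ n))⁻¹ * b.1
      rw [← hut, mul_comm, mul_inv_cancel_right]
  rw [araCptCls, ThetaSeq.mk_tors_out, h]
  exact ⟨fun ⟨x⟩ => ⟨e.symm.trans x⟩, fun ⟨x⟩ => ⟨e.trans x⟩⟩

end CptGen

end FieldPair

section MinusQuot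

variable {S : Finset ℕ} {R : Type} [CommRing R] {σ : R ≃+* R}

/-- The map from `U_R(S^∞)` to the `(-1)`-quotient. -/
def minusMk (S : Finset ℕ) (σ : R ≃+* R) (u : US S R) : MinusQuot S R σ := QuotientGroup.mk u.1

lemma minusMk_mul_primeToS (u : US S R) {w : UR R} (hw : w ∈ primeToS S (UR R)) :
    (QuotientGroup.mk (u.1 * w) : MinusQuot S R σ) = minusMk S σ u := by
  refine QuotientGroup.eq.2 (Subgroup.mem_sup_left ?_)
  have h : (u.1 * w)⁻¹ * u.1 = w⁻¹ := by
    rw [inv_mul_eq_iff_eq_mul, mul_assoc, mul_inv_cancel, mul_one]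
  exact h ▸ inv_mem hw

lemma minusMk_surjective (hG : GoodRing S σ) (x : MinusQuot S R σ) :
    ∃ u ∈ UMinus S σ, minusMk S σ u = x := by
  have := hG.finite
  obtain ⟨w, rfl⟩ := mk_surjective x
  obtain ⟨u, hu, w', hw', rfl⟩ := exists_sTorsion_mul_primeToS (G := UR R) hG.prime w
  obtain ⟨k, hk⟩ := hG.exists_sqrt ThetaSeq.isSGroup_US (⟨u, hu⟩ : US S R)
  set z := (⟨u, hu⟩ : US S R) ^ k
  refine ⟨z * (usMap S (σ : R →+* R) z)⁻¹, ?_, ?_⟩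
  · change usMap S (σ : R →+* R) _ = _
    rw [map_mul, map_inv, hG.invol, mul_inv, inv_inv, mul_comm]
  · rw [minusMk_mul_primeToS ⟨u, hu⟩ hw', ← hk]
    refine QuotientGroup.eq.2 (Subgroup.mem_sup_right (Subgroup.subset_closure ⟨z.1, ?_⟩))
    have : z * usMap S (σ : R →+* R) z = (z * (usMap S (σ : R →+* R) z)⁻¹)⁻¹ * z ^ 2 := by
      rw [mul_inv, inv_inv, pow_two, mul_comm z⁻¹, mul_assoc, inv_mul_cancel_left, mul_comm]
    exact congrArg Subtype.val this

lemma minusMk_injOn (hG : GoodRing S σ) : Set.InjOn (minusMk S σ) (UMinus S σ) := by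
  have := hG.finite
  intro u hu v hv h
  have hm : u⁻¹ * v ∈ uMinus S σ := mul_mem (inv_mem hu) hv
  suffices h1 : u⁻¹ * v = 1 from inv_mul_eq_one.1 h1
  generalize hx : u⁻¹ * v = x at hm
  have h1 : x.1 ∈ primeToS S (UR R) ⊔
      Subgroup.closure (Set.range fun x : UR R => x * urMap (σ : R →+* R) x) := by
    rw [← hx]
    exact QuotientGroup.eq.1 h
  obtain ⟨w, hw, y, hy, hwy⟩ := Subgroup.mem_sup.1 h1
  have h2 : ∃ z, z * urMap (σ : R →+* R) z = y := by
    refine Subgroup.closure_induction (fun _ h => h) ⟨1, by rw [map_one]; exact one_mul (1 : UR R)⟩ ?_ ?_ hy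
    · rintro _ _ _ _ ⟨a, rfl⟩ ⟨b, rfl⟩
      exact ⟨a * b, by rw [map_mul]; exact mul_mul_mul_comm (G := UR R) _ _ _ _⟩
    · rintro _ _ ⟨a, rfl⟩
      exact ⟨a⁻¹, by rw [map_inv]; exact (mul_inv (α := UR R) _ _).symm⟩
  obtain ⟨z, rfl⟩ := h2
  obtain ⟨a, ha, b, hb, rfl⟩ := exists_sTorsion_mul_primeToS (G := UR R) hG.prime z
  set a' : US S R := ⟨a, ha⟩
  have h3 : x = a' * usMap S (σ : R →+* R) a' := by
    rw [← mul_inv_eq_one]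
    refine Subtype.ext (eq_one_of_mem_sTorsion_primeToS (Subtype.mem _) ?_)
    have h4 : (x * (a' * usMap S (σ : R →+* R) a')⁻¹).1 = w * (b * urMap (σ : R →+* R) b) := by
      change x.1 * (a * urMap (σ : R →+* R) a)⁻¹ = _
      rw [← hwy, map_mul, mul_mul_mul_comm a, mul_comm (a * _), ← mul_assoc, mul_inv_cancel_right]
    rw [h4]
    exact mul_mem hw (mul_mem hb (map_mem_primeToS _ hb))
  have h5 : usMap S (σ : R →+* R) x = x := by rw [h3, map_mul, hG.invol, mul_comm]
  refine hG.eq_one_of_sq ThetaSeq.isSGroup_US ?_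
  rw [mem_uMinus, h5] at hm
  rw [pow_two]
  nth_rewrite 1 [hm]
  rw [inv_mul_cancel]

lemma card_minusQuot (hG : GoodRing S σ) : Nat.card (MinusQuot S R σ) = (UMinus S σ).ncard := by
  rw [← Set.ncard_univ, ← (minusMk_injOn hG).ncard_image]
  congr 1
  symm
  exact Set.eq_univ_of_forall fun x => minusMk_surjective hG x

end MinusQuot

lemma FieldPair.unitImage_eq_iff {S : Finset ℕ} {m : ℕ} {R : Type} [CommRing R] {σ : R ≃+* R}
    (q : FieldPair .plus m R σ) (hG : GoodRing S σ) {η : (𝓞 q.F.K)ˣ} {v : US S R}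
    (hv : v ∈ UMinus S σ) (h : ∃ w ∈ primeToS S (UR R), v.1 * w = q.resToUR (unitRes m η))
    {u : US S R} (hu : u ∈ UMinus S σ) : q.unitImage S η = minusMk S σ u ↔ v = u := by
  obtain ⟨w, hw, h⟩ := h
  have h1 : q.unitImage S η = minusMk S σ v := by
    rw [← minusMk_mul_primeToS v hw, h]
    rfl
  rw [h1]
  exact (minusMk_injOn hG).eq_iff hv hu

lemma card_and_mem_eq_sum {α β : Type*} [Finite α] (Q : α → Prop) (f : α → β) (A : Finset β) :
    Nat.card {a // Q a ∧ f a ∈ A} = ∑ b ∈ A, Nat.card {a // Q a ∧ f a = b} := by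
  classical
  have := Fintype.ofFinite α
  simp only [Nat.card_eq_fintype_card, Fintype.card_subtype]
  rw [Finset.card_eq_sum_card_fiberwise (f := f) (t := A) fun a ha =>
    ((Finset.mem_filter.1 ha).2).2]
  refine Finset.sum_congr rfl fun b hb => congrArg Finset.card ?_
  ext a
  simp only [Finset.mem_filter, Finset.mem_univ, true_and]
  exact ⟨fun h => ⟨h.1.1, h.2⟩, fun h => ⟨⟨h.1, h.2 ▸ hb⟩, h.2⟩⟩

lemma card_subtype_mono {α : Type*} [Finite α] {P Q : α → Prop} (h : ∀ a, P a → Q a) :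
    Nat.card {a // P a} ≤ Nat.card {a // Q a} :=
  Nat.card_le_card_of_injective _ (Subtype.map_injective h Function.injective_id)

lemma card_eq_and_add {α : Type*} [Finite α] (P Q : α → Prop) :
    Nat.card {a // P a} = Nat.card {a // ¬Q a ∧ P a} + Nat.card {a // Q a ∧ P a} := by
  classical
  have := Fintype.ofFinite α
  simp only [Nat.card_eq_fintype_card, Fintype.card_subtype]
  rw [← Finset.card_filter_add_card_filter_not (s := Finset.univ.filter P) (fun a => ¬ Q a)]
  simp only [Finset.filter_filter, not_not, and_comm]

lemma finite_quadField (X : ℝ) : Finite {F : QuadField // (F.conductor : ℝ) < X} := by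
  have hfin := finite_of_discr_bdd ℂ ⌈X⌉₊
  have hf : ∀ F : QuadField, FiniteDimensional ℚ F.K := fun F => NumberField.to_finiteDimensional
  have := hfin.to_subtype
  refine Finite.of_injective (fun F => (⟨⟨F.1.K, hf F.1⟩, ?_⟩ :
    {K : {F : IntermediateField ℚ ℂ // FiniteDimensional ℚ F} |
      haveI : NumberField K := @NumberField.mk _ _ inferInstance K.prop
      |discr K| ≤ ⌈X⌉₊})) ?_
  · have h : F.1.conductor ≤ ⌈X⌉₊ := by
      have := F.2.le.trans (Nat.le_ceil X)
      exact_mod_cast this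
    change |discr F.1.K| ≤ _
    rw [← Int.natCast_natAbs]
    exact_mod_cast h
  · rintro ⟨⟨K, h, g, hg⟩, hF⟩ ⟨⟨K', h', g', hg'⟩, hF'⟩ hK
    obtain rfl : K = K' := congrArg (fun x => x.1.1) hK
    suffices g = g' by subst this; rfl
    let F : QuadField := ⟨K, h, g, hg⟩
    let φ : K →+* ℂ := algebraMap K ℂ
    rcases F.embedding_eq φ (φ.comp (g' : K →+* K)) with h1 | h1
    · exact absurd (AlgEquiv.ext fun x => φ.injective (RingHom.congr_fun h1 x)) hg'
    · exact AlgEquiv.ext fun x => φ.injective (RingHom.congr_fun h1 x).symm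

section Fam

variable {S : Finset ℕ} {s : QSign} {m : ℕ} {R : Type} [CommRing R] {σ : R ≃+* R}

instance finite_fam [Finite R] (X : ℝ) : Finite (Fam s m R σ X) := by
  have := finite_quadField X
  have h : ∀ F : {F : QuadField // (F.conductor : ℝ) < X},
      Finite (R ≃+* 𝓞 F.1.K ⧸ Ideal.span {(m : 𝓞 F.1.K)}) := fun F => by
    by_cases hR : Nonempty (R ≃+* 𝓞 F.1.K ⧸ Ideal.span {(m : 𝓞 F.1.K)})
    · have := Finite.of_equiv R hR.some.toEquiv
      exact Finite.of_injective _ DFunLike.coe_injective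
    · have := not_nonempty_iff.1 hR
      infer_instance
  refine Finite.of_injective (fun q => (⟨⟨q.1.F, q.2⟩, q.1.r⟩ :
    Σ F : {F : QuadField // (F.conductor : ℝ) < X}, R ≃+* 𝓞 F.1.K ⧸ Ideal.span {(m : 𝓞 F.1.K)})) ?_
  rintro ⟨⟨F, r, _, _⟩, _⟩ ⟨⟨F', r', _, _⟩, _⟩ h
  obtain ⟨h1, h2⟩ := Sigma.mk.inj_iff.1 h
  obtain rfl : F = F' := congrArg Subtype.val h1
  obtain rfl : r = r' := eq_of_heq h2
  rfl

lemma Proportion.congr {P Q : FieldPair s m R σ → Prop} {a : ℝ} (h : Proportion s m σ P a)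
    (hPQ : ∀ q, P q ↔ Q q) : Proportion s m σ Q a := by
  rwa [show Q = P from funext fun q => propext (hPQ q).symm]

lemma tendsto_card_of_finsum [Finite R] {T : FieldPair s m R σ → Prop} {f : FieldPair s m R σ → ℂ}
    {a : ℝ} (h1 : ∀ q, T q → f q = 1) (h0 : ∀ q, ¬T q → f q = 0)
    (h : Tendsto (fun X : ℝ => (∑ᶠ q : Fam s m R σ X, f q.1) / (Nat.card (Fam s m R σ X) : ℂ))
      atTop (𝓝 (a : ℂ))) : Proportion s m σ T a := by
  classical
  refine (tendsto_ofReal_iff (f := fun X : ℝ =>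
    (Nat.card {q : Fam s m R σ X // T q.1} : ℝ) / Nat.card (Fam s m R σ X))).1 ?_
  convert h using 2 with X
  have := Fintype.ofFinite (Fam s m R σ X)
  have h2 : ∀ q : Fam s m R σ X, f q.1 = if T q.1 then 1 else 0 := fun q => by
    split_ifs with hq
    exacts [h1 _ hq, h0 _ hq]
  simp only [finsum_eq_sum_of_fintype, h2, Finset.sum_boole, Nat.card_eq_fintype_card,
    Fintype.card_subtype]
  push_cast
  rfl

lemma HeuristicHolds.proportion [Finite R] {T : Set (ThetaCls S R)}
    (h : HeuristicHolds S s m σ (ind T)) :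
    Proportion s m σ (fun q => ¬q.F.Exceptional ∧ q.araTorsCls S ∈ T) (measDisc σ s T) := by
  classical
  rw [HeuristicHolds, expDisc_ind] at h
  refine tendsto_card_of_finsum (f := fun q => if q.F.Exceptional then 0 else
    ind T (q.araTorsCls S)) (fun q hq => ?_) (fun q hq => ?_) h
  · rw [if_neg hq.1, ind, Set.indicator_of_mem hq.2]
  · by_cases hE : q.F.Exceptional
    · rw [if_pos hE]
    · rw [if_neg hE, ind, Set.indicator_of_notMem fun h => hq ⟨hE, h⟩]

lemma HeuristicHoldsCpt.proportion [Finite R] {T : Set (ThetaCls S R)}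
    (h : HeuristicHoldsCpt S m σ (ind T)) :
    Proportion .plus m σ (fun q => q.araCptCls S ∈ T) (measCpt σ .plus T) := by
  rw [HeuristicHoldsCpt, expCpt_ind] at h
  exact tendsto_card_of_finsum (f := fun q => ind T (q.araCptCls S))
    (fun q hq => Set.indicator_of_mem hq _) (fun q hq => Set.indicator_of_notMem hq _) h

lemma hasSum_clMeasure (hS : ∀ p ∈ S, p.Prime) (s : QSign) :
    HasSum (fun c : SCls S => clMeasure S c.rep s) 1 := by
  have h := tsum_sCls hS s
  have hne : ∑' c : SCls S, ((Nat.card c.rep : ENNReal) ^ s.exp * Nat.card (c.rep ≃* c.rep))⁻¹ ≠ ⊤ :=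
    h ▸ ENNReal.ofReal_ne_top
  have h1 := (ENNReal.hasSum_toReal hne).mul_left (clConst S s)⁻¹
  rw [← ENNReal.tsum_toReal_eq (ENNReal.ne_top_of_tsum_ne_top hne), h,
    ENNReal.toReal_ofReal (clConst_pos hS s).le, inv_mul_cancel₀ (clConst_pos hS s).ne'] at h1
  refine (funext fun c => ?_ : (fun c : SCls S => clMeasure S c.rep s) = _) ▸ h1
  rw [clMeasure_eq, ENNReal.toReal_inv, ENNReal.toReal_mul, ENNReal.toReal_pow]
  rfl

/-- No mass escapes to the exceptional fields. -/
lemma proportion_exceptional [Finite R] (hS : ∀ p ∈ S, p.Prime)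
    (h : ∀ c : SCls S, Proportion s m σ
      (fun q => ¬q.F.Exceptional ∧ Nonempty (q.F.ClS S ≃* c.rep)) (clMeasure S c.rep s)) :
    Proportion s m σ (fun q => q.F.Exceptional) 0 := by
  classical
  refine tendsto_order.2 ⟨fun a ha => Eventually.of_forall fun X => ha.trans_le (by positivity),
    fun δ hδ => ?_⟩
  obtain ⟨A, hA⟩ := ((tendsto_order.1 (hasSum_clMeasure hS s)).1 (1 - δ) (by linarith)).exists
  have h1 := (tendsto_order.1 (tendsto_finsetSum A fun c _ => h c)).1 _ hA
  filter_upwards [h1] with X hX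
  let f : Fam s m R σ X → SCls S := fun q =>
    ⟦{ carrier := q.1.F.ClS S, sgrp := isSGroup_sTorsion S _ }⟧
  have h2 : ∀ (q : Fam s m R σ X) c, Nonempty (q.1.F.ClS S ≃* c.rep) ↔ f q = c := fun q c =>
    (SCls.mk_eq_iff { carrier := q.1.F.ClS S, sgrp := isSGroup_sTorsion S _ } c).symm
  simp only [h2] at hX
  rw [← Finset.sum_div, ← Nat.cast_sum, ← card_and_mem_eq_sum] at hX
  have h3 := card_eq_and_add (fun _ : Fam s m R σ X => True) fun q => q.1.F.Exceptional
  have h4 := card_subtype_mono (α := Fam s m R σ X) (P := fun q => ¬q.1.F.Exceptional ∧ f q ∈ A)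
    (Q := fun q => ¬q.1.F.Exceptional ∧ True) fun q hq => ⟨hq.1, trivial⟩
  simp only [and_true] at h3 h4
  rw [Nat.card_congr (Equiv.subtypeUnivEquiv fun _ => trivial)] at h3
  rcases (Nat.card (Fam s m R σ X)).eq_zero_or_pos with h0 | h0
  · rw [h0]; simpa using hδ
  · rw [lt_div_iff₀ (by exact_mod_cast h0)] at hX
    rw [div_lt_iff₀ (by exact_mod_cast h0)]
    have h5 : (Nat.card (Fam s m R σ X) : ℝ) = _ := congrArg Nat.cast h3
    push_cast at h5
    have h6 : (Nat.card {q : Fam s m R σ X // ¬q.1.F.Exceptional ∧ f q ∈ A} : ℝ) ≤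
      Nat.card {q : Fam s m R σ X // ¬q.1.F.Exceptional} := by exact_mod_cast h4
    linarith

lemma Proportion.of_not_exceptional [Finite R] {P : FieldPair s m R σ → Prop} {a : ℝ}
    (h : Proportion s m σ (fun q => ¬q.F.Exceptional ∧ P q) a)
    (h0 : Proportion s m σ (fun q => q.F.Exceptional) 0) : Proportion s m σ P a := by
  have h1 := h.add h0
  rw [add_zero] at h1
  refine tendsto_of_tendsto_of_tendsto_of_le_of_le h h1 (fun X => ?_) (fun X => ?_)
  · refine div_le_div_of_nonneg_right ?_ (Nat.cast_nonneg _)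
    exact Nat.cast_le.2 <| card_subtype_mono (α := Fam s m R σ X)
      (P := fun q => ¬q.1.F.Exceptional ∧ P q.1) (Q := fun q => P q.1) fun q h => h.2
  · dsimp only
    rw [← add_div]
    refine div_le_div_of_nonneg_right ?_ (Nat.cast_nonneg _)
    have h2 := card_eq_and_add (fun q : Fam s m R σ X => P q.1) fun q => q.1.F.Exceptional
    have h3 := card_subtype_mono (α := Fam s m R σ X) (P := fun q => q.1.F.Exceptional ∧ P q.1)
      (Q := fun q => q.1.F.Exceptional) fun q h => h.1
    exact_mod_cast h2.le.trans (Nat.add_le_add_left h3 _)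

lemma proportion_clS [Finite R] (hG : GoodRing S σ) (hm : m ≠ 0)
    (h : ∀ (E : Type) [CommGroup E] [Finite E], IsSGroup S E →
      HeuristicHolds S s m σ (ind (compEvent S R E))) (E : Type) [CommGroup E] [Finite E]
    (hES : IsSGroup S E) :
    Proportion s m σ (fun q => Nonempty (q.F.ClS S ≃* E)) (clMeasure S E s) := by
  have key : ∀ (E : Type) [CommGroup E] [Finite E], IsSGroup S E → Proportion s m σ
      (fun q => ¬q.F.Exceptional ∧ Nonempty (q.F.ClS S ≃* E)) (clMeasure S E s) :=
    fun E _ _ hES => by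
      rw [← measDisc_compEvent hG s hES]
      exact (h E hES).proportion.congr fun q =>
        and_congr_right fun _ => q.araTorsCls_mem_compEvent_iff hG hm E
  exact (key E hES).of_not_exceptional
    (proportion_exceptional hG.prime fun c => key c.rep c.out.sgrp)

end Fam

/-- `(R, σ)` admits enough automorphisms commuting with `σ`. -/
def HasCommLifts (S : Finset ℕ) {R : Type} [CommRing R] (σ : R ≃+* R) : Prop :=
  ∀ ρ : R ≃+* R, ∃ ρ' : R ≃+* R, (∀ x, ρ' (σ x) = σ (ρ' x)) ∧
    ∀ u : US S R, usMap S (ρ' : R →+* R) u = usMap S (ρ : R →+* R) u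

namespace FieldPair

variable {S : Finset ℕ} {s : QSign} {m : ℕ} {R : Type} [CommRing R] {σ : R ≃+* R}

/-- The action of automorphisms of `(R, σ)` on pairs `(F, r)`. -/
def twist (q : FieldPair s m R σ) (ρ : R ≃+* R) (hρ : ∀ x, ρ (σ x) = σ (ρ x)) :
    FieldPair s m R σ where
  F := q.F
  r := ρ.symm.trans q.r
  hasSign := q.hasSign
  equivariant x α h := by
    refine (q.equivariant _ α h).trans (congrArg q.r (ρ.injective ?_))
    change ρ (σ (ρ.symm x)) = ρ (ρ.symm (σ x))
    rw [hρ, ρ.apply_symm_apply, ρ.apply_symm_apply]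

variable (ρ : R ≃+* R) (hρ : ∀ x, ρ (σ x) = σ (ρ x))

lemma twist_injective : Function.Injective fun q : FieldPair s m R σ => q.twist ρ hρ := by
  rintro ⟨F, r, _, _⟩ ⟨F', r', _, _⟩ h
  obtain ⟨h1, h2⟩ := FieldPair.mk.inj h
  subst h1
  have h3 := eq_of_heq h2
  obtain rfl : r = r' := RingEquiv.ext fun x => by simpa using RingEquiv.congr_fun h3 (ρ x)
  rfl

variable (q : FieldPair s m R σ)

lemma twist_toPic (w : UR R) : (q.twist ρ hρ).toPic (urMap (ρ : R →+* R) w) = q.toPic w := by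
  obtain ⟨a, rfl⟩ := mk_surjective w
  refine congrArg (resToPic m) (Units.ext ?_)
  exact congrArg q.r (ρ.symm_apply_apply _)

end FieldPair

section Units

variable {S : Finset ℕ} {m : ℕ} {R : Type} [CommRing R] {σ : R ≃+* R}

lemma proportion_unitImage [Finite R] (hG : GoodRing S σ) (hL : HasCommLifts S σ)
    {η : ∀ F : QuadField, (𝓞 F.K)ˣ} (hη : ∀ F : QuadField, F.HasSign .plus → F.IsFundUnit (η F))
    (C : QuadField → Prop) {u : US S R} (hu : u ∈ UMinus S σ) {a b : ℝ}
    (h : Proportion .plus m σ (fun q => C q.F ∧ q.araCptCls S ∈ unitEvent u)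
      (a * ((uOrbit σ u).ncard / b))) :
    Proportion .plus m σ (fun q => C q.F ∧ q.unitImage S (η q.F) = minusMk S σ u) (a * (1 / b)) := by
  classical
  have := hG.finiteU
  have hval : ∀ q : FieldPair .plus m R σ, ∃ v ∈ UMinus S σ,
      (∃ w ∈ primeToS S (UR R), v.1 * w = q.resToUR (unitRes m (η q.F))) ∧
      ∀ u, q.araCptCls S ∈ unitEvent u ↔ u ∈ uOrbit σ v := fun q =>
    (q.exists_cptGen hG (hη _ q.hasSign)).some.exists_unitValue hG
  choose val hv hw hval using hval
  have hiff : ∀ (q : FieldPair .plus m R σ) {u : US S R}, u ∈ UMinus S σ →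
      (q.unitImage S (η q.F) = minusMk S σ u ↔ val q = u) := fun q _ hu =>
    q.unitImage_eq_iff hG (hv q) (hw q) hu
  have htw : ∀ (q : FieldPair .plus m R σ) (ρ : R ≃+* R) (hρ : ∀ x, ρ (σ x) = σ (ρ x)),
      val (q.twist ρ hρ) = usMap S (ρ : R →+* R) (val q) := fun q ρ hρ => by
    have h1 : usMap S (ρ : R →+* R) (val q) ∈ UMinus S σ :=
      uOrbit_subset hG (hv q) ⟨ρ, fun u => hG.comm ρ u, rfl⟩
    refine (hiff (q.twist ρ hρ) h1).1 (((q.twist ρ hρ).unitImage_eq_iff hG h1 ?_ h1).2 rfl)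
    obtain ⟨w, hw1, hw2⟩ := hw q
    refine ⟨urMap (ρ : R →+* R) w, map_mem_primeToS _ hw1, ?_⟩
    exact (map_mul (urMap (ρ : R →+* R)) _ _).symm.trans (congrArg _ hw2)
  have hle : ∀ (X : ℝ) {u v : US S R}, v ∈ uOrbit σ u →
      Nat.card {q : Fam .plus m R σ X // C q.1.F ∧ val q.1 = u} ≤
      Nat.card {q : Fam .plus m R σ X // C q.1.F ∧ val q.1 = v} := by
    rintro X u _ ⟨ρ, -, rfl⟩
    obtain ⟨ρ', h1, h2⟩ := hL ρ
    refine Nat.card_le_card_of_injective (fun q => ⟨⟨q.1.1.twist ρ' h1, q.1.2⟩, q.2.1, ?_⟩) ?_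
    · rw [htw, q.2.2, h2]
    · intro q q' h
      exact Subtype.ext (Subtype.ext (FieldPair.twist_injective ρ' h1
        (congrArg (fun q => q.1.1) h)))
  let A := (uOrbit σ u).toFinite.toFinset
  have hA : (A.card : ℝ) = (uOrbit σ u).ncard := by rw [Set.ncard_eq_toFinset_card]
  have hA0 : (A.card : ℝ) ≠ 0 := by
    have : u ∈ A := (Set.Finite.mem_toFinset _).2
      ⟨RingEquiv.refl R, fun w => hG.comm _ w, (usMap_id S u).symm⟩
    exact_mod_cast (Finset.card_pos.2 ⟨u, this⟩).ne'
  have h1 := h.congr (Q := fun q => C q.F ∧ val q ∈ A) fun q => and_congr_right fun _ => by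
    rw [hval, Set.Finite.mem_toFinset]
    exact ⟨uOrbit_symm hG, uOrbit_symm hG⟩
  rw [← hA] at h1
  have h2 := h1.const_mul (A.card : ℝ)⁻¹
  refine Proportion.congr (P := fun q => C q.F ∧ val q = u) ?_ fun q =>
    and_congr_right fun _ => (hiff q hu).symm
  rw [mul_div_left_comm, inv_mul_cancel_left₀ hA0, ← mul_one_div] at h2
  refine h2.congr fun X => ?_
  have h3 := card_and_mem_eq_sum (fun q : Fam .plus m R σ X => C q.1.F) (fun q => val q.1) A
  rw [Finset.sum_congr rfl fun v hv => le_antisymm (hle X (uOrbit_symm hG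
    ((Set.Finite.mem_toFinset _).1 hv))) (hle X ((Set.Finite.mem_toFinset _).1 hv)),
    Finset.sum_const, smul_eq_mul] at h3
  rw [h3]
  push_cast
  rw [mul_div_assoc, inv_mul_cancel_left₀ hA0]

end Units

section ExtOrbit

variable {S : Finset ℕ} {R : Type} [CommRing R] {σ : R ≃+* R} {E : Type} [CommGroup E]

lemma SameOrbit.mem_extSet (hG : GoodRing S σ) {ε ε' : ExtCls S R E} (h : SameOrbit ε ε')
    {V : Subgroup (US S R)} (hε : ε ∈ extSet E σ V) :
    ∃ ρ : R ≃+* R, ε' ∈ extSet E σ (V.map (usEquiv S ρ : US S R →* US S R)) := by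
  obtain ⟨f, ρ, β, hg, hi, hp⟩ := h
  obtain ⟨h1, h2, h3, h4, h5, h6⟩ := hε
  have hu : ∀ u, ∃ w, usMap S (ρ : R →+* R) w = u := (usEquiv S ρ).surjective
  refine ⟨ρ, fun y => ?_, fun u => ?_, fun y => ?_, ?_, ?_, fun x => ?_⟩
  · obtain ⟨x, rfl⟩ := f.surjective y
    rw [← hg, ← hg, h1]
  · obtain ⟨w, rfl⟩ := hu u
    rw [← hi, ← hg, h2, hi, hG.comm]
  · obtain ⟨x, rfl⟩ := f.surjective y
    rw [← hg, hp, hp, h3, map_inv]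
  · ext u
    obtain ⟨w, rfl⟩ := hu u
    rw [MonoidHom.mem_ker, ← hi, EmbeddingLike.map_eq_one_iff, ← MonoidHom.mem_ker, h4]
    exact (Subgroup.mem_map_iff_mem (usEquiv S ρ).injective).symm
  · ext y
    obtain ⟨x, rfl⟩ := f.surjective y
    rw [MonoidHom.mem_ker, hp, EmbeddingLike.map_eq_one_iff, ← MonoidHom.mem_ker, h5]
    constructor
    · rintro ⟨u, rfl⟩
      exact ⟨_, (hi u).symm⟩
    · rintro ⟨u, h⟩
      obtain ⟨w, rfl⟩ := hu u
      exact ⟨w, f.injective ((hi w).trans h)⟩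
  · obtain ⟨y, hy⟩ := h6 (β.symm x)
    exact ⟨f y, by rw [hp, hy, β.apply_symm_apply]⟩

lemma extSet_ncard_ne_zero (hG : GoodRing S σ) [Finite E] {V : Subgroup (US S R)}
    (hV : V ≤ uMinus S σ) : (extSet E σ V).ncard ≠ 0 := fun h0 => by
  have := hG.finiteU
  obtain ⟨ι, _, e, d, hE, -⟩ := exists_isPres E
  have h := card_extSet hG hE hV
  rw [h0, zero_mul] at h
  exact Nat.card_pos.ne' h

lemma finite_orbit (hG : GoodRing S σ) [Finite E] {u : US S R} (hu : u ∈ UMinus S σ)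
    {ε : ExtCls S R E} (hε : ε ∈ extSet E σ (zpowers u)) :
    {ε' | SameOrbit ε ε'}.Finite := by
  have := hG.finiteU
  refine (Set.finite_iUnion (ι := uMinus S σ) (f := fun v => extSet E σ (zpowers v.1))
    fun v => Set.finite_of_ncard_ne_zero
      (extSet_ncard_ne_zero hG (Subgroup.zpowers_le.2 v.2))).subset fun ε' h => ?_
  obtain ⟨ρ, h1⟩ := h.mem_extSet hG hε
  rw [MonoidHom.map_zpowers] at h1
  exact Set.mem_iUnion.2 ⟨⟨_, (hG.ringAut_mem ⟨ρ, fun _ => rfl⟩).2 hu⟩, h1⟩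

lemma extSet_unique {ε : ExtCls S R E} {V V' : Subgroup (US S R)} (h : ε ∈ extSet E σ V)
    (h' : ε ∈ extSet E σ V') : V = V' := h.2.2.2.1.symm.trans h'.2.2.2.1

lemma card_orbit_pairs (hG : GoodRing S σ) {u : US S R} {ε : ExtCls S R E}
    (hε : ε ∈ extSet E σ (zpowers u)) :
    Set.ncard {x : US S R × ExtCls S R E | x.1 ∈ UMinus S σ ∧
        x.2 ∈ extSet E σ (zpowers x.1) ∧ SameOrbit ε x.2} =
      Nat.card {w : US S R // w ∈ UMinus S σ ∧ zpowers w = zpowers u} *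
        {ε' | SameOrbit ε ε'}.ncard := by
  rw [← Nat.card_coe_set_eq, ← Nat.card_coe_set_eq, ← Nat.card_prod]
  have h : ∀ ε' : {ε' | SameOrbit ε ε'}, ∃ ρ : R ≃+* R, ∀ w : US S R,
      ε'.1 ∈ extSet E σ (zpowers (usEquiv S ρ w)) ↔
        zpowers w = zpowers u := fun ε' => by
    obtain ⟨ρ, h1⟩ := ε'.2.mem_extSet hG hε
    refine ⟨ρ, fun w => ?_⟩
    have h2 : zpowers (usEquiv S ρ w) = (zpowers w).map
      (usEquiv S ρ : US S R →* US S R) := ((usEquiv S ρ : US S R →* US S R).map_zpowers w).symm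
    rw [h2]
    refine ⟨fun h3 => ?_, fun h3 => by rw [h3]; exact h1⟩
    exact Subgroup.map_injective (usEquiv S ρ).injective (extSet_unique h3 h1)
  choose ρ hρ using h
  have hm : ∀ (ρ : R ≃+* R) w, usEquiv S ρ w ∈ UMinus S σ ↔ w ∈ UMinus S σ :=
    fun ρ w => hG.ringAut_mem ⟨ρ, fun _ => rfl⟩
  exact Nat.card_congr
    { toFun := fun x => (⟨(usEquiv S (ρ ⟨x.1.2, x.2.2.2⟩)).symm x.1.1,
        (hm (ρ ⟨x.1.2, x.2.2.2⟩) _).1 (by rw [MulEquiv.apply_symm_apply]; exact x.2.1),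
        (hρ ⟨x.1.2, x.2.2.2⟩ _).1 (by rw [MulEquiv.apply_symm_apply]; exact x.2.2.1)⟩,
        ⟨x.1.2, x.2.2.2⟩)
      invFun := fun y => ⟨(usEquiv S (ρ y.2) y.1.1, y.2.1), (hm _ _).2 y.1.2.1,
        (hρ y.2 _).2 y.1.2.2, y.2.2⟩
      left_inv := fun x => Subtype.ext (Prod.ext (MulEquiv.apply_symm_apply _ _) rfl)
      right_inv := fun y => Prod.ext (Subtype.ext (MulEquiv.symm_apply_apply _ _)) rfl }

end ExtOrbit

section Triples

variable {S : Finset ℕ} {s : QSign} {m : ℕ} {R : Type} [CommRing R] {σ : R ≃+* R}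
  {E : Type} [CommGroup E]

/-- Elements of `ℱ_X` with an isomorphism between the `S`-part of the class group and `E`. -/
abbrev Marked (S : Finset ℕ) (s : QSign) (m : ℕ) {R : Type} [CommRing R] (σ : R ≃+* R)
    (E : Type) [CommGroup E] (X : ℝ) : Type :=
  Σ q : Fam s m R σ X, (q.1.F.ClS S ≃* E)

instance [Finite R] [Finite E] (X : ℝ) : Finite (Marked S s m σ E X) := by
  have : ∀ q : Fam s m R σ X, Finite (q.1.F.ClS S ≃* E) := fun q =>
    Finite.of_injective _ DFunLike.coe_injective
  infer_instance

/-- The number of marked elements with a given property, relative to `ℱ_X`, tends to `a`. -/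
def MarkedDensity (S : Finset ℕ) (s : QSign) (m : ℕ) {R : Type} [CommRing R] (σ : R ≃+* R)
    (E : Type) [CommGroup E] (Q : ∀ q : FieldPair s m R σ, (q.F.ClS S ≃* E) → Prop) (a : ℝ) : Prop :=
  Tendsto (fun X : ℝ => (Nat.card {t : Marked S s m σ E X // Q t.1.1 t.2} : ℝ) /
    Nat.card (Fam s m R σ X)) atTop (𝓝 a)

lemma MarkedDensity.congr {P Q : ∀ q : FieldPair s m R σ, (q.F.ClS S ≃* E) → Prop} {a : ℝ}
    (h : MarkedDensity S s m σ E P a) (hPQ : ∀ q ι, P q ι ↔ Q q ι) :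
    MarkedDensity S s m σ E Q a := by
  rwa [show Q = P from funext fun q => funext fun ι => propext (hPQ q ι).symm]

lemma card_marked {X : ℝ} {P : Fam s m R σ X → Prop}
    (hP : ∀ q, P q → Nonempty (q.1.F.ClS S ≃* E)) :
    Nat.card {t : Marked S s m σ E X // P t.1} = Nat.card {q // P q} * Nat.card (E ≃* E) := by
  rw [← Nat.card_prod]
  refine Nat.card_congr ((Equiv.subtypeSigmaEquiv _ P).trans ((Equiv.sigmaCongrRight fun q => ?_).trans
    (Equiv.sigmaEquivProd _ _)))
  let e := (hP q.1 q.2).some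
  exact ⟨fun ι => e.symm.trans ι, fun β => e.trans β, fun ι => by ext; simp, fun β => by ext; simp⟩

lemma markedDensity_iff [Finite E] {P : FieldPair s m R σ → Prop}
    (hP : ∀ q, P q → Nonempty (q.F.ClS S ≃* E)) {a : ℝ} :
    MarkedDensity S s m σ E (fun q _ => P q) (a * Nat.card (E ≃* E)) ↔ Proportion s m σ P a := by
  have h0 : (Nat.card (E ≃* E) : ℝ) ≠ 0 := by
    have : Finite (E ≃* E) := Finite.of_injective _ DFunLike.coe_injective
    exact_mod_cast Nat.card_pos.ne'
  have h1 : ∀ X : ℝ, (Nat.card {t : Marked S s m σ E X // P t.1.1} : ℝ) / Nat.card (Fam s m R σ X)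
      = (Nat.card {q : Fam s m R σ X // P q.1} : ℝ) / Nat.card (Fam s m R σ X) *
        Nat.card (E ≃* E) := fun X => by
    rw [card_marked (P := fun q => P q.1) fun q => hP q.1]
    push_cast
    ring
  simp only [MarkedDensity, Proportion, h1]
  refine ⟨fun h => ?_, fun h => h.mul_const _⟩
  have h2 := h.mul_const (Nat.card (E ≃* E) : ℝ)⁻¹
  simpa only [mul_inv_cancel_right₀ h0] using h2

lemma FieldPair.twist_finCls {q : FieldPair s m R σ} {ι : q.F.ClS S ≃* E} {ε' : ExtCls S R E}
    (f : (q.finCls ι).out.X ≃* ε'.out.X) (ρ : R ≃+* R) (hρ : ∀ x, ρ (σ x) = σ (ρ x)) (β : E ≃* E)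
    (h1 : ∀ x, f ((q.finCls ι).out.g x) = ε'.out.g (f x))
    (h2 : ∀ u, f ((q.finCls ι).out.i u) = ε'.out.i (usMap S (ρ : R →+* R) u))
    (h3 : ∀ x, ε'.out.p (f x) = β ((q.finCls ι).out.p x)) :
    (q.twist ρ hρ).finCls (ι.trans β) = ε' := by
  obtain ⟨h, g1, g2, g3⟩ := Setoid.symm (q.finData ι).out_equiv
  rw [← Quotient.out_eq ε']
  refine Quotient.sound (a := (q.twist ρ hρ).finData (ι.trans β))
    ⟨MulEquiv.trans h f, fun x => ?_, fun u => ?_, fun x => ?_⟩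
  · exact (congrArg f (g1 x)).trans (h1 _)
  · obtain ⟨w, rfl⟩ := (usEquiv S ρ).surjective u
    have : ((q.twist ρ hρ).finData (ι.trans β)).i (usEquiv S ρ w) = (q.finData ι).i w :=
      Subtype.ext (congrArg (picToRayCl q.F.K m) (q.twist_toPic ρ hρ w.1))
    rw [this]
    exact (congrArg f (g2 w)).trans (h2 _)
  · exact (h3 _).trans (congrArg β (g3 x))

lemma card_marked_le [Finite R] [Finite E] (hL : HasCommLifts S σ) (X : ℝ) {ε ε' : ExtCls S R E}
    (h : SameOrbit ε ε') :
    Nat.card {t : Marked S s m σ E X // ¬t.1.1.F.Exceptional ∧ t.1.1.finCls t.2 = ε} ≤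
      Nat.card {t : Marked S s m σ E X // ¬t.1.1.F.Exceptional ∧ t.1.1.finCls t.2 = ε'} := by
  obtain ⟨f, ρ, β, h1, h2, h3⟩ := h
  obtain ⟨ρ', h4, h5⟩ := hL ρ
  refine Nat.card_le_card_of_injective
    (fun t => ⟨⟨⟨t.1.1.1.twist ρ' h4, t.1.1.2⟩, t.1.2.trans β⟩, t.2.1, ?_⟩) ?_
  · obtain ⟨t, -, rfl⟩ := t
    exact FieldPair.twist_finCls f ρ' h4 β h1 (fun u => by rw [h2, h5]) h3
  · rintro ⟨⟨⟨q, hq⟩, ι⟩, ht⟩ ⟨⟨⟨q', hq'⟩, ι'⟩, ht'⟩ h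
    have h6 := congrArg Subtype.val h
    obtain ⟨h7, h8⟩ := Sigma.mk.inj_iff.1 h6
    obtain rfl : q = q' := FieldPair.twist_injective ρ' h4 (congrArg Subtype.val h7)
    obtain rfl : ι = ι' := MulEquiv.ext fun x =>
      β.injective (MulEquiv.congr_fun (eq_of_heq h8) x)
    rfl

lemma markedDensity_finCls [Finite R] [Finite E] (hG : GoodRing S σ) (hL : HasCommLifts S σ)
    (hm : m ≠ 0) {u : US S R} (hu : u ∈ UMinus S σ) {ε : ExtCls S R E}
    (hε : ε ∈ extSet E σ (zpowers u)) (h : HeuristicHolds S s m σ (ind (extEvent ε)))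
    {κ : ℝ} (hκ : measDisc σ s (extEvent ε) = κ * {ε' | SameOrbit ε ε'}.ncard) :
    MarkedDensity S s m σ E (fun q ι => ¬q.F.Exceptional ∧ q.finCls ι = ε)
      (κ * Nat.card (E ≃* E)) := by
  classical
  have hO := finite_orbit hG hu hε
  let A := hO.toFinset
  have hA : (A.card : ℝ) = {ε' | SameOrbit ε ε'}.ncard := by rw [Set.ncard_eq_toFinset_card _ hO]
  have hA0 : (A.card : ℝ) ≠ 0 := by
    have : ε ∈ A := hO.mem_toFinset.2 (sameOrbit_refl ε)
    exact_mod_cast (Finset.card_pos.2 ⟨ε, this⟩).ne'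
  have h1 := (markedDensity_iff (E := E) fun q hq =>
    (q.araTorsCls_mem_compEvent_iff hG hm E).1 (extEvent_subset ε hq.2)).2 h.proportion
  rw [hκ, ← hA] at h1
  have h2 := Tendsto.const_mul (A.card : ℝ)⁻¹ h1
  rw [mul_right_comm, mul_comm _ (A.card : ℝ), inv_mul_cancel_left₀ hA0] at h2
  refine h2.congr fun X => ?_
  have h3 := card_and_mem_eq_sum (fun t : Marked S s m σ E X => ¬t.1.1.F.Exceptional)
    (fun t => t.1.1.finCls t.2) A
  rw [Finset.sum_congr rfl fun ε' h' => le_antisymm (card_marked_le hL X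
    (hO.mem_toFinset.1 h').symm) (card_marked_le hL X (hO.mem_toFinset.1 h')),
    Finset.sum_const, smul_eq_mul] at h3
  rw [← Nat.card_congr (Equiv.subtypeEquivRight (p := fun t : Marked S s m σ E X =>
    ¬t.1.1.F.Exceptional ∧ t.1.1.araTorsCls S ∈ extEvent ε) fun t => and_congr_right fun _ => by
      rw [t.1.1.araTorsCls_mem_extEvent_iff hG hm t.2]; exact hO.mem_toFinset.symm)] at h3
  rw [h3]
  push_cast
  rw [mul_div_assoc, inv_mul_cancel_left₀ hA0]

lemma MarkedDensity.of_not_exceptional [Finite R] [Finite E]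
    {Q : ∀ q : FieldPair s m R σ, (q.F.ClS S ≃* E) → Prop} {a : ℝ}
    (h : MarkedDensity S s m σ E (fun q ι => ¬q.F.Exceptional ∧ Q q ι) a)
    (h0 : Proportion s m σ (fun q => q.F.Exceptional) 0) : MarkedDensity S s m σ E Q a := by
  have h1 : MarkedDensity S s m σ E (fun q ι => q.F.Exceptional ∧ Q q ι) 0 := by
    have h2 := h0.mul_const (Nat.card (E ≃* E) : ℝ)
    rw [zero_mul] at h2
    refine squeeze_zero (fun X => by positivity) (fun X => ?_) h2
    rw [div_mul_eq_mul_div]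
    refine div_le_div_of_nonneg_right ?_ (Nat.cast_nonneg _)
    have h3 := card_subtype_mono (α := Marked S s m σ E X)
      (P := fun t => t.1.1.F.Exceptional ∧ Q t.1.1 t.2)
      (Q := fun t => t.1.1.F.Exceptional ∧ Nonempty (t.1.1.F.ClS S ≃* E)) fun t ht => ⟨ht.1, ⟨t.2⟩⟩
    rw [card_marked (P := fun q : Fam s m R σ X => q.1.F.Exceptional ∧ Nonempty (q.1.F.ClS S ≃* E))
      fun q hq => hq.2] at h3
    have h4 := card_subtype_mono (α := Fam s m R σ X)
      (P := fun q => q.1.F.Exceptional ∧ Nonempty (q.1.F.ClS S ≃* E))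
      (Q := fun q => q.1.F.Exceptional) fun q hq => hq.1
    exact_mod_cast h3.trans (Nat.mul_le_mul_right _ h4)
  have h2 := Tendsto.add h h1
  rw [add_zero] at h2
  refine h2.congr fun X => ?_
  rw [← add_div, card_eq_and_add (fun t : Marked S s m σ E X => Q t.1.1 t.2)
    fun t => t.1.1.F.Exceptional]
  push_cast
  rfl

lemma markedDensity_unitKer [Finite R] [Finite E] (hG : GoodRing S σ) (hm : m ≠ 0)
    {V : Subgroup (US S R)} (hT : (extSet E σ V).Finite) {a : ℝ}
    (h : ∀ ε ∈ extSet E σ V, MarkedDensity S s m σ E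
      (fun q ι => ¬q.F.Exceptional ∧ q.finCls ι = ε) a) :
    MarkedDensity S s m σ E (fun q _ => ¬q.F.Exceptional ∧ q.unitKer S = V)
      ((extSet E σ V).ncard * a) := by
  have h1 := tendsto_finsetSum hT.toFinset fun ε hε => h ε (hT.mem_toFinset.1 hε)
  rw [Finset.sum_const, nsmul_eq_mul, ← Set.ncard_eq_toFinset_card _ hT] at h1
  refine h1.congr fun X => ?_
  rw [← Finset.sum_div, ← Nat.cast_sum, ← card_and_mem_eq_sum]
  refine congrArg (fun n : ℕ => (n : ℝ) / _) (Nat.card_congr (Equiv.subtypeEquivRight fun t =>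
    and_congr_right fun _ => ?_))
  have h2 := t.1.1.finCls_mem_extSet hG hm t.2
  rw [hT.mem_toFinset]
  exact ⟨fun h => extSet_unique h2 h, fun h => h ▸ h2⟩

lemma equidistributed_of [Finite R] [Finite E] (hG : GoodRing S σ) (hm : m ≠ 0)
    {V : Subgroup (US S R)} (hT : (extSet E σ V).ncard ≠ 0) {P : Subgroup (US S R) → Prop}
    (hP : ∀ q : FieldPair s m R σ, ¬q.F.Exceptional → (P (q.unitKer S) ↔ q.unitKer S = V))
    {a : ℝ} (ha : a ≠ 0) (h : ∀ ε ∈ extSet E σ V, MarkedDensity S s m σ E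
      (fun q ι => ¬q.F.Exceptional ∧ q.finCls ι = ε) a)
    (h0 : Proportion s m σ (fun q => q.F.Exceptional) 0) :
    Equidistributed S s m σ E P (extSet E σ V) := by
  intro ε hε
  have h1 : MarkedDensity S s m σ E (fun q ι => P (q.unitKer S) ∧ q.finCls ι = ε) a := by
    refine MarkedDensity.of_not_exceptional ?_ h0
    refine (h ε hε).congr fun q ι =>
      and_congr_right fun hq => (and_iff_right_of_imp fun hι => ?_).symm
    rw [hP q hq]
    exact extSet_unique (q.finCls_mem_extSet hG hm ι) (hι ▸ hε)
  have h2 : MarkedDensity S s m σ E (fun q _ => P (q.unitKer S)) ((extSet E σ V).ncard * a) := by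
    refine MarkedDensity.of_not_exceptional ?_ h0
    exact (markedDensity_unitKer hG hm (Set.finite_of_ncard_ne_zero hT) h).congr fun q ι =>
      and_congr_right fun hq => (hP q hq).symm
  have hne : ((extSet E σ V).ncard * a : ℝ) ≠ 0 := mul_ne_zero (by exact_mod_cast hT) ha
  have h3 := Tendsto.div h1 h2 hne
  rw [div_mul_cancel_right₀ ha, ← one_div] at h3
  refine h3.congr' ?_
  filter_upwards [Tendsto.eventually_ne h2 hne] with X hX
  have hF : (Nat.card (Fam s m R σ X) : ℝ) ≠ 0 := fun h => hX (by rw [h, div_zero])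
  rw [Pi.div_apply, div_div_div_cancel_right₀ hF]
  let e : Triples S s m σ E P X ≃ {t : Marked S s m σ E X // P (t.1.1.unitKer S)} :=
    (Equiv.subtypeSigmaEquiv (fun q : Fam s m R σ X => q.1.F.ClS S ≃* E)
      fun q => P (q.1.unitKer S)).symm
  rw [Nat.card_congr e, Nat.card_congr ((e.subtypeEquiv (p := fun t => t.1.1.1.finCls t.2 = ε)
    (q := fun t => t.1.1.1.finCls t.1.2 = ε) fun t => Iff.rfl).trans
    (Equiv.subtypeSubtypeEquivSubtypeInter _ fun t : Marked S s m σ E X => t.1.1.finCls t.2 = ε))]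

end Triples

section Main

variable {S : Finset ℕ} {m : ℕ} {R : Type} [CommRing R] {σ : R ≃+* R}

lemma equidistributed_minus [Finite R] (hG : GoodRing S σ) (hL : HasCommLifts S σ) (hm : m ≠ 0)
    (h : ∀ (E : Type) [CommGroup E] [Finite E], IsSGroup S E →
      ∀ ε ∈ extSet E σ (⊥ : Subgroup (US S R)), HeuristicHolds S .minus m σ (ind (extEvent ε)))
    (E : Type) [CommGroup E] [Finite E] (hES : IsSGroup S E) :
    Equidistributed S .minus m σ E (fun _ => True) (extSet E σ (⊥ : Subgroup (US S R))) := by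
  have hT : ∀ (E : Type) [CommGroup E] [Finite E],
      (extSet E σ (⊥ : Subgroup (US S R))).ncard ≠ 0 := fun E _ _ =>
    extSet_ncard_ne_zero hG bot_le
  have key : ∀ (E : Type) [CommGroup E] [Finite E], IsSGroup S E →
      ∀ ε ∈ extSet E σ (⊥ : Subgroup (US S R)), MarkedDensity S .minus m σ E
        (fun q ι => ¬q.F.Exceptional ∧ q.finCls ι = ε)
        (clMeasure S E .minus / (extSet E σ (⊥ : Subgroup (US S R))).ncard *
          Nat.card (E ≃* E)) := fun E _ _ hES ε hε => by
    refine markedDensity_finCls hG hL hm (one_mem (uMinus S σ))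
      (by rwa [Subgroup.zpowers_one_eq_bot]) (h E hES ε hε) ?_
    have h1 := measDisc_extEvent_div_minus hG hES hε
    rw [measDisc_compEvent hG _ hES, div_eq_iff (clMeasure_ne_zero hG.prime _)] at h1
    have h2 : {ε' ∈ extSet E σ (⊥ : Subgroup (US S R)) | SameOrbit ε ε'} =
        {ε' | SameOrbit ε ε'} := Set.sep_eq_of_subset fun ε' h => by
      obtain ⟨ρ, h⟩ := SameOrbit.mem_extSet hG h hε
      rwa [Subgroup.map_bot] at h
    rw [h1, h2]
    ring
  refine equidistributed_of hG hm (hT E) (fun q hq => iff_of_true trivial (q.unitKer_minus hq)) ?_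
    (key E hES) (proportion_exceptional hG.prime fun c => ?_)
  · have : Finite (E ≃* E) := Finite.of_injective _ DFunLike.coe_injective
    exact mul_ne_zero (div_ne_zero (clMeasure_ne_zero hG.prime _) (by exact_mod_cast hT E))
      (by exact_mod_cast Nat.card_pos.ne')
  · have h1 := markedDensity_unitKer hG hm (Set.finite_of_ncard_ne_zero (hT c.rep))
      (key c.rep c.out.sgrp)
    rw [← mul_assoc, mul_div_cancel₀ _ (by exact_mod_cast hT c.rep)] at h1
    refine (markedDensity_iff (E := c.rep) fun q hq => hq.2).1 ?_
    exact h1.congr fun q ι =>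
      and_congr_right fun hq => iff_of_true (q.unitKer_minus hq) ⟨ι⟩

lemma equidistributed_plus [Finite R] (hG : GoodRing S σ) (hL : HasCommLifts S σ) (hm : m ≠ 0)
    (E : Type) [CommGroup E] [Finite E] (hES : IsSGroup S E) {u : US S R} (hu : u ∈ UMinus S σ)
    (h : ∀ ε ∈ extSet E σ (zpowers u), HeuristicHolds S .plus m σ (ind (extEvent ε))) :
    Equidistributed S .plus m σ E (fun V => V = zpowers u)
      (extSet E σ (zpowers u)) := by
  have := hG.finiteU
  have hT := extSet_ncard_ne_zero (E := E) hG (Subgroup.zpowers_le.2 hu : _ ≤ uMinus S σ)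
  have hU : ((UMinus S σ).ncard : ℝ) ≠ 0 := by
    exact Nat.cast_ne_zero.2 ((Set.ncard_pos (Set.toFinite _)).2 ⟨u, hu⟩).ne'
  have hg : (Nat.card {w : US S R // w ∈ UMinus S σ ∧
      zpowers w = zpowers u} : ℝ) ≠ 0 := by
    have : Nonempty {w : US S R // w ∈ UMinus S σ ∧
      zpowers w = zpowers u} := ⟨u, hu, rfl⟩
    exact_mod_cast Nat.card_pos.ne'
  have : Finite (E ≃* E) := Finite.of_injective _ DFunLike.coe_injective
  have hA : (Nat.card (E ≃* E) : ℝ) ≠ 0 := by exact_mod_cast Nat.card_pos.ne'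
  have hT' : ((extSet E σ (zpowers u)).ncard : ℝ) ≠ 0 := by exact_mod_cast hT
  refine equidistributed_of hG hm hT (fun q _ => Iff.rfl) (mul_ne_zero (mul_ne_zero (div_ne_zero hg
    (mul_ne_zero hU hT')) (clMeasure_ne_zero (E := E) hG.prime .plus)) hA)
    (fun ε hε => markedDensity_finCls hG hL hm hu hε (h ε hε) ?_) ?_
  · have h1 := measDisc_extEvent_div_plus hG hES hu hε
    rw [measDisc_compEvent hG _ hES, div_eq_iff (clMeasure_ne_zero hG.prime _),
      card_orbit_pairs hG hε] at h1
    rw [h1]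
    push_cast
    ring
  · refine tendsto_const_nhds.congr fun X => ?_
    have : IsEmpty {q : Fam .plus m R σ X // q.1.F.Exceptional} :=
      ⟨fun q => q.1.1.F.not_exceptional_of_real q.1.1.hasSign q.2⟩
    simp

end Main

open scoped TensorProduct

namespace QuadField

variable (F : QuadField) (m : ℕ)

/-- The completions of `F` at the primes dividing `m`. -/
def localData : LocalData m :=
  have : Algebra.FormallyEtale ℚ F.K := Algebra.FormallyEtale.of_isSeparable ℚ F.K
  have : Algebra.FinitePresentation ℚ F.K := Algebra.FinitePresentation.of_finiteType.1 inferInstance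
  have : Algebra.Etale ℚ F.K := ⟨inferInstance, inferInstance⟩
  { A := fun p => ℚ_[(p : ℕ)] ⊗[ℚ] F.K
    finrank_eq := fun p => by rw [Module.finrank_baseChange, F.finrank_eq]
    τ := fun p => Algebra.TensorProduct.congr AlgEquiv.refl F.g
    τ_ne := fun p h => F.g_ne (AlgEquiv.ext fun x => by
      have h1 := AlgEquiv.congr_fun h ((1 : ℚ_[(p : ℕ)]) ⊗ₜ[ℚ] x)
      rw [Algebra.TensorProduct.congr_apply, Algebra.TensorProduct.map_tmul] at h1
      exact Algebra.TensorProduct.includeRight_injective (A := ℚ_[(p : ℕ)]) (B := F.K)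
        (algebraMap ℚ ℚ_[(p : ℕ)]).injective h1) }

/-- The embedding of `F` in its completion at `p`. -/
def toLocal (p : m.primeFactors) : F.K →+* (F.localData m).A p :=
  (Algebra.TensorProduct.includeRight (R := ℚ) (A := ℚ_[(p : ℕ)]) (B := F.K)).toRingHom

lemma toLocal_g (p : m.primeFactors) (x : F.K) :
    F.toLocal m p (F.g x) = (F.localData m).τ p (F.toLocal m p x) :=
  (Algebra.TensorProduct.map_tmul (AlgHom.id ℚ_[(p : ℕ)] ℚ_[(p : ℕ)]) (F.g : F.K →ₐ[ℚ] F.K) 1 x).symm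

/-- The embedding of `𝓞_F` in the product of its completions at the primes dividing `m`. -/
def toOA : 𝓞 F.K →+* (F.localData m).OA :=
  RingHom.pi fun p => ((F.toLocal m p).comp (algebraMap (𝓞 F.K) F.K)).codRestrict
    (integralClosure ℤ_[(p : ℕ)] ((F.localData m).A p)) fun x => by
      have h : IsIntegral ℤ (F.toLocal m p x) :=
        x.2.map (F.toLocal m p : F.K →+* _).toIntAlgHom
      exact h.tower_top

lemma toOA_gInt (x : 𝓞 F.K) : F.toOA m (gInt F.g x) = (F.localData m).τO (F.toOA m x) :=
  funext fun p => Subtype.ext (F.toLocal_g m p x)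

lemma dvd_of_toOA {m : ℕ} (hm : m ≠ 0) (x : 𝓞 F.K) (h : (m : (F.localData m).OA) ∣ F.toOA m x) :
    (m : 𝓞 F.K) ∣ x := by
  obtain ⟨y, hy⟩ := h
  have hmK : (m : F.K) ≠ 0 := by exact_mod_cast hm
  have hy' : ∀ p, F.toLocal m p x = m * (y p).1 := fun p =>
    congrArg Subtype.val (congrFun hy p)
  have hint : ∀ p : m.primeFactors, (∃ c : ℤ_[(p : ℕ)], (y p).1 + (F.localData m).τ p (y p).1 =
      algebraMap ℚ_[(p : ℕ)] _ (c : ℚ_[(p : ℕ)])) ∧ ∃ c : ℤ_[(p : ℕ)],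
      (y p).1 * (F.localData m).τ p (y p).1 = algebraMap ℚ_[(p : ℕ)] _ (c : ℚ_[(p : ℕ)]) := by
    intro p
    have : Nontrivial ((F.localData m).A p) := Module.nontrivial_of_finrank_pos
      (R := ℚ_[(p : ℕ)]) (by rw [(F.localData m).finrank_eq]; norm_num)
    obtain ⟨-, ⟨t, ht⟩, ⟨n, hn⟩⟩ := invol_of_quadratic (two_ne_zero (α := ℚ_[(p : ℕ)]))
      ((F.localData m).finrank_eq p) ((F.localData m).τ_ne p) (y p).1
    have hτ := isIntegral_algEquiv ((F.localData m).τ p) (y p).2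
    obtain ⟨t', rfl⟩ := exists_padicInt_of_isIntegral (ht ▸ (y p).2.add hτ)
    obtain ⟨n', rfl⟩ := exists_padicInt_of_isIntegral (hn ▸ (y p).2.mul hτ)
    exact ⟨⟨t', ht⟩, n', hn⟩
  have hcast : ∀ (p : m.primeFactors) (k : ℤ) (c : ℤ_[(p : ℕ)]), F.toLocal m p k =
      algebraMap ℚ_[(p : ℕ)] _ (c : ℚ_[(p : ℕ)]) → (k : ℤ_[(p : ℕ)]) = c := fun p k c h => by
    have : Nontrivial ((F.localData m).A p) := Module.nontrivial_of_finrank_pos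
      (R := ℚ_[(p : ℕ)]) (by rw [(F.localData m).finrank_eq]; norm_num)
    rw [map_intCast, ← map_intCast (algebraMap ℚ_[(p : ℕ)] ((F.localData m).A p))] at h
    exact PadicInt.ext ((PadicInt.coe_intCast k).trans
      ((algebraMap ℚ_[(p : ℕ)] ((F.localData m).A p)).injective h))
  obtain ⟨a, ha⟩ := F.exists_trace x
  obtain ⟨b, hb⟩ := F.exists_norm x
  replace ha : (x : F.K) + F.g x = a := congrArg (algebraMap (𝓞 F.K) F.K) ha
  replace hb : (x : F.K) * F.g x = b := congrArg (algebraMap (𝓞 F.K) F.K) hb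
  have hda : (m : ℤ) ∣ a := int_dvd_of_forall hm a fun p => by
    obtain ⟨⟨c, hc⟩, -⟩ := hint p
    refine ⟨c, hcast p a (m * c) ?_⟩
    rw [← ha, map_add, toLocal_g, hy', map_mul, map_natCast, ← mul_add, hc,
      PadicInt.coe_mul, PadicInt.coe_natCast, map_mul, map_natCast]
  have hdb : ∀ p : m.primeFactors, ∃ c : ℤ_[(p : ℕ)], (b : ℤ_[(p : ℕ)]) = m * (m * c) := fun p => by
    obtain ⟨-, ⟨c, hc⟩⟩ := hint p
    refine ⟨c, hcast p b _ ?_⟩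
    rw [← hb, map_mul, toLocal_g, hy', map_mul, map_natCast, mul_mul_mul_comm, hc,
      PadicInt.coe_mul, PadicInt.coe_mul, PadicInt.coe_natCast, map_mul, map_mul, map_natCast, mul_assoc]
  obtain ⟨b, rfl⟩ := int_dvd_of_forall hm b fun p => ⟨_, (hdb p).choose_spec⟩
  obtain ⟨b, rfl⟩ := int_dvd_of_forall hm b fun p => by
    obtain ⟨c, hc⟩ := hdb p
    push_cast at hc
    exact ⟨c, mul_left_cancel₀ (Nat.cast_ne_zero.2 hm) hc⟩
  obtain ⟨a, rfl⟩ := hda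
  push_cast at ha hb
  have hz : IsIntegral ℤ ((x : F.K) / m) := by
    refine ⟨.X ^ 2 + (.C (-a) * .X + .C b), Polynomial.monic_X_pow_add ?_, ?_⟩
    · exact Polynomial.degree_linear_lt
    · simp only [Polynomial.eval₂_add, Polynomial.eval₂_mul, Polynomial.eval₂_X_pow,
        Polynomial.eval₂_C, Polynomial.eval₂_X, algebraMap_int_eq, Int.coe_castRingHom, Int.cast_neg]
      field_simp
      linear_combination (x : F.K) * ha - hb
  refine ⟨⟨_, hz⟩, RingOfIntegers.ext ?_⟩
  change (x : F.K) = m * ((x : F.K) / m)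
  field_simp

lemma card_quot (hm : m ≠ 0) : Nat.card (𝓞 F.K ⧸ Ideal.span {(m : 𝓞 F.K)}) = m ^ 2 ∧
    Finite (𝓞 F.K ⧸ Ideal.span {(m : 𝓞 F.K)}) := by
  have h : Nat.card (𝓞 F.K ⧸ Ideal.span {(m : 𝓞 F.K)}) = m ^ 2 := by
    refine (Ideal.absNorm_span_natCast (S := 𝓞 F.K) m).trans ?_
    rw [RingOfIntegers.rank, F.finrank_eq]
  exact ⟨h, Nat.finite_of_card_ne_zero (h ▸ pow_ne_zero 2 hm)⟩

/-- The action of `g` on `𝓞_F / m`. -/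
def gMod : 𝓞 F.K ⧸ Ideal.span {(m : 𝓞 F.K)} ≃+* 𝓞 F.K ⧸ Ideal.span {(m : 𝓞 F.K)} :=
  Ideal.quotientEquiv _ _ (gInt F.g) (by simp [Ideal.map_span])

lemma exists_localData_equiv (hm : m ≠ 0) :
    ∃ (D : LocalData m) (r : D.R ≃+* 𝓞 F.K ⧸ Ideal.span {(m : 𝓞 F.K)}),
      ∀ x, F.gMod m (r x) = r (D.σ x) := by
  set D := F.localData m
  obtain ⟨hc, hfin⟩ := F.card_quot m hm
  have hQ := D.quadRing hm
  have := hQ.finite hm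
  let f : 𝓞 F.K ⧸ Ideal.span {(m : 𝓞 F.K)} →+* D.R :=
    Ideal.quotientMap _ (F.toOA m) (Ideal.span_le.2 (Set.singleton_subset_iff.2
      (by
        change F.toOA m m ∈ Ideal.span {(m : D.OA)}
        rw [map_natCast]
        exact Ideal.mem_span_singleton_self _)))
  have hf : Function.Injective f := (injective_iff_map_eq_zero f).2 fun x hx => by
    obtain ⟨x, rfl⟩ := Ideal.Quotient.mk_surjective x
    rw [Ideal.quotientMap_mk, Ideal.Quotient.eq_zero_iff_mem, Ideal.mem_span_singleton] at hx
    rw [Ideal.Quotient.eq_zero_iff_mem, Ideal.mem_span_singleton]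
    exact F.dvd_of_toOA hm x hx
  let e := RingEquiv.ofBijective f (hf.bijective_of_nat_card_le ((hQ.card_le hm).trans hc.ge))
  refine ⟨D, e.symm, fun x => ?_⟩
  obtain ⟨x, rfl⟩ := e.surjective x
  rw [e.symm_apply_apply, e.eq_symm_apply]
  obtain ⟨x, rfl⟩ := Ideal.Quotient.mk_surjective x
  exact congrArg (Ideal.Quotient.mk _) (F.toOA_gInt m x)

end QuadField

/-- The totally split local data. -/
def splitData (m : ℕ) : LocalData m where
  A p := Fin 2 → ℚ_[(p : ℕ)]
  finrank_eq p := Module.finrank_fin_fun _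
  τ p := AlgEquiv.piCongrLeft' ℚ_[(p : ℕ)] (fun _ => ℚ_[(p : ℕ)]) (Equiv.swap (0 : Fin 2) 1)
  τ_ne p h := by
    have := congrFun (AlgEquiv.congr_fun h (fun i => if i = 0 then 1 else 0)) 0
    simp [AlgEquiv.piCongrLeft'] at this

lemma tendsto_sum_div_sum {I : Type*} [Fintype I] [Nonempty I] {n N : I → ℝ → ℝ} {μ : ℝ}
    (hμ : μ ≠ 0) (hN : ∀ c X, 0 ≤ N c X)
    (h : ∀ c, Tendsto (fun X => n c X / N c X) atTop (𝓝 μ)) :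
    Tendsto (fun X => (∑ c, n c X) / ∑ c, N c X) atTop (𝓝 μ) := by
  rw [tendsto_iff_norm_sub_tendsto_zero]
  have h1 : Tendsto (fun X => ∑ c, ‖n c X / N c X - μ‖) atTop (𝓝 0) := by
    have := tendsto_finsetSum Finset.univ fun c _ => tendsto_iff_norm_sub_tendsto_zero.1 (h c)
    rwa [Finset.sum_const_zero] at this
  refine squeeze_zero' (Eventually.of_forall fun X => norm_nonneg _) ?_ h1
  filter_upwards [eventually_all.2 fun c => (h c).eventually_ne hμ] with X hX
  have h2 : ∀ c, 0 < N c X := fun c => (hN c X).lt_of_ne fun h0 => hX c (by rw [← h0, div_zero])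
  have h3 : 0 < ∑ c, N c X := Finset.sum_pos (fun c _ => h2 c) Finset.univ_nonempty
  have h4 : (∑ c, n c X) / ∑ c, N c X - μ = (∑ c, N c X * (n c X / N c X - μ)) / ∑ c, N c X := by
    rw [eq_div_iff h3.ne', sub_mul, div_mul_cancel₀ _ h3.ne', Finset.mul_sum,
      ← Finset.sum_sub_distrib]
    exact Finset.sum_congr rfl fun c _ => by rw [mul_sub, mul_div_cancel₀ _ (h2 c).ne', mul_comm μ]
  rw [h4, norm_div, div_le_iff₀ (norm_pos_iff.2 h3.ne'), Real.norm_of_nonneg h3.le, mul_comm,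
    Finset.mul_sum]
  refine (norm_sum_le _ _).trans (Finset.sum_le_sum fun c _ => ?_)
  rw [norm_mul, Real.norm_of_nonneg (h2 c).le]
  exact mul_le_mul_of_nonneg_right
    (Finset.single_le_sum (fun c _ => (h2 c).le) (Finset.mem_univ c)) (norm_nonneg _)

section Equivariant

variable {A B R : Type} [CommRing A] [CommRing B] [CommRing R] {σ : R ≃+* R} {τ : A ≃+* A}
  {υ : B ≃+* B}

/-- Equivariant ring isomorphisms. -/
def EquivIso (σ : R ≃+* R) (τ : A ≃+* A) : Type := {r : R ≃+* A // ∀ x, τ (r x) = r (σ x)}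

namespace EquivIso

/-- The inverse of an equivariant isomorphism. -/
def symm (e : EquivIso σ τ) : EquivIso τ σ :=
  ⟨e.1.symm, fun x => by rw [e.1.eq_symm_apply, ← e.2, e.1.apply_symm_apply]⟩

/-- The composition of equivariant isomorphisms. -/
def trans (r : EquivIso σ τ) (e : EquivIso τ υ) : EquivIso σ υ :=
  ⟨r.1.trans e.1, fun x => by rw [RingEquiv.trans_apply, RingEquiv.trans_apply, e.2, r.2]⟩

/-- Composition with an equivariant isomorphism. -/
def congrRight (σ : R ≃+* R) (e : EquivIso τ υ) : EquivIso σ τ ≃ EquivIso σ υ where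
  toFun r := r.trans e
  invFun r := r.trans e.symm
  left_inv r := Subtype.ext (RingEquiv.ext fun x => e.1.symm_apply_apply (r.1 x))
  right_inv r := Subtype.ext (RingEquiv.ext fun x => e.1.apply_symm_apply (r.1 x))

lemma card_ne_zero [Finite R] (r : EquivIso σ τ) : Nat.card (EquivIso σ τ) ≠ 0 := by
  have := Finite.of_equiv R r.1.toEquiv
  have : Finite (R ≃+* A) := Finite.of_injective _ DFunLike.coe_injective
  have : Finite (EquivIso σ τ) := Subtype.finite
  have : Nonempty (EquivIso σ τ) := ⟨r⟩
  exact Nat.card_pos.ne'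

/-- The transport of structure through bijections with a finite type. -/
lemma nonempty_of_code {n : ℕ} (b : R ≃ Fin n) (b' : A ≃ Fin n)
    (h1 : (fun x y => b (b.symm x + b.symm y)) = fun x y => b' (b'.symm x + b'.symm y))
    (h2 : (fun x y => b (b.symm x * b.symm y)) = fun x y => b' (b'.symm x * b'.symm y))
    (h3 : (fun x => b (σ (b.symm x))) = fun x => b' (τ (b'.symm x))) :
    Nonempty (EquivIso σ τ) := by
  simp only [funext_iff] at h1 h2 h3
  refine ⟨⟨⟨b.trans b'.symm, fun x y => ?_, fun x y => ?_⟩, fun x => ?_⟩⟩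
  · simpa [Equiv.symm_apply_eq] using h2 (b x) (b y)
  · simpa [Equiv.symm_apply_eq] using h1 (b x) (b y)
  · simpa [Equiv.eq_symm_apply] using (h3 (b x)).symm

end EquivIso

end Equivariant

namespace QuadField

/-- Isomorphism of the rings `𝓞_F / m` with the action of `C₂`. -/
def modSetoid (m : ℕ) : Setoid QuadField where
  r F F' := Nonempty (EquivIso (F.gMod m) (F'.gMod m))
  iseqv := ⟨fun _ => ⟨RingEquiv.refl _, fun _ => rfl⟩, fun ⟨e⟩ => ⟨e.symm⟩,
    fun ⟨e⟩ ⟨e'⟩ => ⟨e.trans e'⟩⟩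

lemma finite_modClasses {m : ℕ} (hm : m ≠ 0) : Finite (Quotient (modSetoid m)) := by
  have b : ∀ F : QuadField, (𝓞 F.K ⧸ Ideal.span {(m : 𝓞 F.K)}) ≃ Fin (m ^ 2) := fun F =>
    have := (F.card_quot m hm).2
    Finite.equivFinOfCardEq (F.card_quot m hm).1
  refine Finite.of_injective (fun c : Quotient (modSetoid m) =>
    ((fun x y => b c.out ((b c.out).symm x + (b c.out).symm y),
      fun x y => b c.out ((b c.out).symm x * (b c.out).symm y),
      fun x => b c.out (c.out.gMod m ((b c.out).symm x))) :
      (Fin (m ^ 2) → Fin (m ^ 2) → Fin (m ^ 2)) × (Fin (m ^ 2) → Fin (m ^ 2) → Fin (m ^ 2)) ×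
        (Fin (m ^ 2) → Fin (m ^ 2)))) fun c c' h => ?_
  exact Quotient.out_equiv_out.1 (EquivIso.nonempty_of_code (b c.out) (b c'.out)
    (congrArg Prod.fst h) (congrArg (fun x => x.2.1) h) (congrArg (fun x => x.2.2) h))

lemma gMod_mk (F : QuadField) (m : ℕ) (α : 𝓞 F.K) :
    F.gMod m (Ideal.Quotient.mk _ α) = Ideal.Quotient.mk _ (gInt F.g α) := rfl

/-- The pair of a field and an equivariant isomorphism. -/
def toPair {s : QSign} {m : ℕ} {R : Type} [CommRing R] {σ : R ≃+* R} (F : QuadField)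
    (hF : F.HasSign s) (r : EquivIso σ (F.gMod m)) : FieldPair s m R σ :=
  ⟨F, r.1, hF, fun x α h => by rw [← r.2 x, ← h, gMod_mk]⟩

lemma gMod_r {s : QSign} {m : ℕ} {R : Type} [CommRing R] {σ : R ≃+* R} (q : FieldPair s m R σ)
    (x : R) : q.F.gMod m (q.r x) = q.r (σ x) := by
  obtain ⟨α, hα⟩ := Ideal.Quotient.mk_surjective (q.r x)
  rw [← q.equivariant x α hα, ← hα]
  rfl

lemma card_fam (s : QSign) {m : ℕ} {R : Type} [CommRing R] [Finite R] {σ : R ≃+* R}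
    (F₀ : QuadField) (r₀ : EquivIso σ (F₀.gMod m)) : ∃ a : ℕ, a ≠ 0 ∧
      ∀ (X : ℝ) (C : QuadField → Prop), Nat.card {q : Fam s m R σ X // C q.1.F} = a *
        Nat.card {F : {F : QuadField // (F.conductor : ℝ) < X} //
          (F.1.HasSign s ∧ C F.1) ∧ (modSetoid m) F₀ F.1} := by
  refine ⟨_, r₀.card_ne_zero, fun X C => ?_⟩
  rw [mul_comm, ← Nat.card_prod]
  let I := {F : {F : QuadField // (F.conductor : ℝ) < X} //
    (F.1.HasSign s ∧ C F.1) ∧ (modSetoid m) F₀ F.1}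
  let e1 : {q : Fam s m R σ X // C q.1.F} ≃ Σ F : I, EquivIso σ (F.1.1.gMod m) :=
    { toFun := fun q => ⟨⟨⟨q.1.1.F, q.1.2⟩, ⟨q.1.1.hasSign, q.2⟩,
        ⟨r₀.symm.trans ⟨q.1.1.r, gMod_r q.1.1⟩⟩⟩, ⟨q.1.1.r, gMod_r q.1.1⟩⟩
      invFun := fun F => ⟨⟨F.1.1.1.toPair F.1.2.1.1 F.2, F.1.1.2⟩, F.1.2.1.2⟩
      left_inv := fun q => rfl
      right_inv := fun F => rfl }
  let e2 : ∀ F : I, EquivIso σ (F.1.1.gMod m) ≃ EquivIso σ (F₀.gMod m) := fun F =>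
    (EquivIso.congrRight σ F.2.2.some).symm
  exact Nat.card_congr (e1.trans ((Equiv.sigmaCongrRight e2).trans
    (Equiv.sigmaEquivProd I (EquivIso σ (F₀.gMod m)))))

end QuadField

lemma tendsto_class {m : ℕ} (s : QSign) {R : Type} [CommRing R] [Finite R] {σ : R ≃+* R}
    (F₀ : QuadField) (r₀ : EquivIso σ (F₀.gMod m)) (C : QuadField → Prop) {a : ℝ}
    (h : Proportion s m σ (fun q => C q.F) a) :
    Tendsto (fun X : ℝ => (Nat.card {F : {F : QuadField // (F.conductor : ℝ) < X} //
        (F.1.HasSign s ∧ C F.1) ∧ (QuadField.modSetoid m) F₀ F.1} : ℝ) /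
      Nat.card {F : {F : QuadField // (F.conductor : ℝ) < X} //
        (F.1.HasSign s ∧ True) ∧ (QuadField.modSetoid m) F₀ F.1}) atTop (𝓝 a) := by
  obtain ⟨n, hn, hcard⟩ := QuadField.card_fam s F₀ r₀
  refine Tendsto.congr (fun X => ?_) h
  have h1 := hcard X C
  have h2 := hcard X fun _ => True
  rw [Nat.card_congr (Equiv.subtypeUnivEquiv fun _ => trivial)] at h2
  rw [h1, h2, Nat.cast_mul, Nat.cast_mul]
  exact mul_div_mul_left _ _ (Nat.cast_ne_zero.2 hn)

theorem tendsto_clS {S : Finset ℕ} (hS : ∀ p ∈ S, p.Prime) {m : ℕ} (hm : m ≠ 0) (s : QSign)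
    (E : Type) [CommGroup E] [Finite E]
    (h : ∀ D : LocalData m, Proportion s m D.σ (fun q => Nonempty (q.F.ClS S ≃* E))
      (clMeasure S E s)) :
    Tendsto (fun X : ℝ => (Nat.card {F : QuadField // F.HasSign s ∧ (F.conductor : ℝ) < X ∧
        Nonempty (F.ClS S ≃* E)} : ℝ) /
      Nat.card {F : QuadField // F.HasSign s ∧ (F.conductor : ℝ) < X}) atTop
      (𝓝 (clMeasure S E s)) := by
  classical
  have hμ : clMeasure S E s ≠ 0 := clMeasure_ne_zero hS s
  have := QuadField.finite_modClasses hm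
  have := Fintype.ofFinite (Quotient (QuadField.modSetoid m))
  have : Nonempty (Quotient (QuadField.modSetoid m)) := by
    obtain ⟨X, hX⟩ := ((h (splitData m)).eventually_ne hμ).exists
    obtain ⟨q⟩ : Nonempty (Fam s m (splitData m).R (splitData m).σ X) := by
      by_contra hc
      rw [not_nonempty_iff] at hc
      exact hX (by simp)
    exact ⟨Quotient.mk _ q.1.F⟩
  let n : (QuadField → Prop) → Quotient (QuadField.modSetoid m) → ℝ → ℝ := fun C c X =>
    Nat.card {F : {F : QuadField // (F.conductor : ℝ) < X} //
      (F.1.HasSign s ∧ C F.1) ∧ Quotient.mk (QuadField.modSetoid m) F.1 = c}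
  have hn : ∀ c, Tendsto (fun X => n (fun F => Nonempty (F.ClS S ≃* E)) c X /
      n (fun _ => True) c X) atTop (𝓝 (clMeasure S E s)) := fun c => by
    have hcl : ∀ F : QuadField, Quotient.mk (QuadField.modSetoid m) F = c ↔
        (QuadField.modSetoid m) c.out F := fun F => by
      conv_lhs => rw [← Quotient.out_eq c, eq_comm]
      exact Quotient.eq
    simp only [n, hcl]
    obtain ⟨D, r, hr⟩ := c.out.exists_localData_equiv m hm
    have := (D.quadRing hm).finite hm
    exact tendsto_class s c.out ⟨r, hr⟩ (fun F => Nonempty (F.ClS S ≃* E)) (h D)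
  have key := tendsto_sum_div_sum hμ (fun c X => Nat.cast_nonneg _) hn
  have hsum : ∀ (C : QuadField → Prop) (X : ℝ), ∑ c, n C c X =
      Nat.card {F : QuadField // F.HasSign s ∧ (F.conductor : ℝ) < X ∧ C F} := fun C X => by
    have := finite_quadField X
    have h1 := card_and_mem_eq_sum (fun F : {F : QuadField // (F.conductor : ℝ) < X} =>
      F.1.HasSign s ∧ C F.1) (fun F => Quotient.mk (QuadField.modSetoid m) F.1) Finset.univ
    rw [← Nat.cast_sum, ← h1]
    refine congrArg Nat.cast (Nat.card_congr ((Equiv.subtypeSubtypeEquivSubtypeInter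
      (fun F : QuadField => (F.conductor : ℝ) < X) fun F : QuadField => (F.HasSign s ∧ C F) ∧
        Quotient.mk (QuadField.modSetoid m) F ∈ Finset.univ).trans
      (Equiv.subtypeEquivRight fun F => ?_)))
    simp only [Finset.mem_univ, and_true]
    exact and_left_comm
  refine key.congr fun X => ?_
  have h1 := hsum (fun _ => True) X
  have h2 := hsum (fun F => Nonempty (F.ClS S ≃* E)) X
  simp only [and_true] at h1
  rw [← h1, ← h2]

end RayClass

end

theorem mainTheorem1 (S : Finset ℕ) (hS : ∀ p ∈ S, p.Prime ∧ p ≠ 2) (m : ℕ) (hm : m ≠ 0) :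
    -- the statements for the family of quadratic fields attached to one choice of `R`
    (∀ D : LocalData m,
      -- the pushforward of `ℙ^±` under `Θ ↦ π⁰(C)` is the Cohen–Lenstra measure
      (∀ (s : QSign) (E : Type) [CommGroup E] [Finite E], IsSGroup S E →
        measDisc D.σ s (compEvent S D.R E) = clMeasure S E s) ∧
      -- the pushforward of `ℙ_cpt^+` under `Θ ↦ φ(Θ)(λ)` is uniform
      (∀ u ∈ UMinus S D.σ, measCpt D.σ .plus (unitEvent u) =
        ((uOrbit D.σ u).ncard : ℝ) / ((UMinus S D.σ).ncard : ℝ)) ∧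
      -- the two maps are independent
      (∀ (E : Type) [CommGroup E] [Finite E], IsSGroup S E → ∀ u ∈ UMinus S D.σ,
        measCpt D.σ .plus (unitEvent u ∩ torsCls ⁻¹' compEvent S D.R E) =
          clMeasure S E .plus * (((uOrbit D.σ u).ncard : ℝ) / ((UMinus S D.σ).ncard : ℝ))) ∧
      -- conditionally on `C`, the pair `(φ(Θ), π⁰(Θ))` is equidistributed
      (∀ (E : Type) [CommGroup E] [Finite E], IsSGroup S E → ∀ u ∈ UMinus S D.σ,
        ∀ ε ∈ extSet E D.σ (Subgroup.zpowers u),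
        measDisc D.σ .plus (extEvent ε) / measDisc D.σ .plus (compEvent S D.R E) =
          (Set.ncard {x : US S D.R × ExtCls S D.R E | x.1 ∈ UMinus S D.σ ∧
              x.2 ∈ extSet E D.σ (Subgroup.zpowers x.1) ∧ SameOrbit ε x.2} : ℝ) /
            (((UMinus S D.σ).ncard : ℝ) * ((extSet E D.σ (Subgroup.zpowers u)).ncard : ℝ))) ∧
      -- for imaginary quadratic fields, the class of `Θ` in `Ext¹` is equidistributed
      (∀ (E : Type) [CommGroup E] [Finite E], IsSGroup S E →
        ∀ ε ∈ extSet E D.σ (⊥ : Subgroup (US S D.R)),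
        measDisc D.σ .minus (extEvent ε) / measDisc D.σ .minus (compEvent S D.R E) =
          (Set.ncard {ε' ∈ extSet E D.σ (⊥ : Subgroup (US S D.R)) | SameOrbit ε ε'} : ℝ) /
            ((extSet E D.σ (⊥ : Subgroup (US S D.R))).ncard : ℝ)) ∧
      -- (1) Cohen–Lenstra heuristic
      (∀ s : QSign,
        (∀ (E : Type) [CommGroup E] [Finite E], IsSGroup S E →
          HeuristicHolds S s m D.σ (ind (compEvent S D.R E))) →
        ∀ (E : Type) [CommGroup E] [Finite E], IsSGroup S E →
          Proportion s m D.σ (fun q => Nonempty (q.F.ClS S ≃* E)) (clMeasure S E s)) ∧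
      -- (2) equidistribution of the image of the fundamental unit
      ((∀ u ∈ UMinus S D.σ, HeuristicHoldsCpt S m D.σ (ind (unitEvent u))) →
        ∀ η : ∀ F : QuadField, (NumberField.RingOfIntegers F.K)ˣ,
          (∀ F : QuadField, F.HasSign .plus → F.IsFundUnit (η F)) →
          ∀ w : MinusQuot S D.R D.σ,
            Proportion .plus m D.σ (fun q => q.unitImage S (η q.F) = w)
              (1 / (Nat.card (MinusQuot S D.R D.σ) : ℝ))) ∧
      -- (3) independence of the class group and the image of the fundamental unit
      ((∀ (E : Type) [CommGroup E] [Finite E], IsSGroup S E → ∀ u ∈ UMinus S D.σ,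
          HeuristicHoldsCpt S m D.σ (ind (unitEvent u ∩ torsCls ⁻¹' compEvent S D.R E))) →
        ∀ η : ∀ F : QuadField, (NumberField.RingOfIntegers F.K)ˣ,
          (∀ F : QuadField, F.HasSign .plus → F.IsFundUnit (η F)) →
          ∀ (E : Type) [CommGroup E] [Finite E], IsSGroup S E → ∀ w : MinusQuot S D.R D.σ,
            Proportion .plus m D.σ
              (fun q => Nonempty (q.F.ClS S ≃* E) ∧ q.unitImage S (η q.F) = w)
              (clMeasure S E .plus * (1 / (Nat.card (MinusQuot S D.R D.σ) : ℝ)))) ∧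
      -- (4) equidistribution of ray class extensions of imaginary quadratic fields
      ((∀ (E : Type) [CommGroup E] [Finite E], IsSGroup S E →
          ∀ ε ∈ extSet E D.σ (⊥ : Subgroup (US S D.R)),
            HeuristicHolds S .minus m D.σ (ind (extEvent ε))) →
        ∀ (G : Type) [CommGroup G] [Finite G], IsSGroup S G →
          Equidistributed S .minus m D.σ G (fun _ => True)
            (extSet G D.σ (⊥ : Subgroup (US S D.R)))) ∧
      -- (5) equidistribution of ray class extensions of real quadratic fields
      ((∀ (E : Type) [CommGroup E] [Finite E], IsSGroup S E → ∀ u ∈ UMinus S D.σ,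
          ∀ ε ∈ extSet E D.σ (Subgroup.zpowers u),
            HeuristicHolds S .plus m D.σ (ind (extEvent ε))) →
        ∀ (A : Type) [CommGroup A] [Finite A], IsSGroup S A → ∀ u ∈ UMinus S D.σ,
          Equidistributed S .plus m D.σ A (fun V => V = Subgroup.zpowers u)
            (extSet A D.σ (Subgroup.zpowers u)))) ∧
    -- the Cohen–Lenstra heuristic for all imaginary, respectively real quadratic fields
    (∀ s : QSign,
      (∀ (D : LocalData m) (E : Type) [CommGroup E] [Finite E], IsSGroup S E →
        HeuristicHolds S s m D.σ (ind (compEvent S D.R E))) →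
      ∀ (E : Type) [CommGroup E] [Finite E], IsSGroup S E →
        Filter.Tendsto (fun X : ℝ =>
          (Nat.card {F : QuadField // F.HasSign s ∧ (F.conductor : ℝ) < X ∧
            Nonempty (F.ClS S ≃* E)} : ℝ) /
          Nat.card {F : QuadField // F.HasSign s ∧ (F.conductor : ℝ) < X})
          Filter.atTop (nhds (clMeasure S E s))) := by
  have hp : ∀ p ∈ S, p.Prime := fun p h => (hS p h).1
  refine ⟨fun D => ?_, fun s h E _ _ hES => tendsto_clS hp hm s E fun D => ?_⟩
  · have hQ := D.quadRing hm
    have hG : GoodRing S D.σ := hQ.goodRing hm hS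
    have hL : HasCommLifts S D.σ := fun ρ => hQ.exists_comm hm hS ρ
    have := hQ.finite hm
    refine ⟨fun s E _ _ hES => measDisc_compEvent hG s hES, fun u hu => measCpt_unitEvent hG hu,
      fun E _ _ hES u hu => measCpt_unitEvent_inter hG hES hu,
      fun E _ _ hES u hu ε hε => measDisc_extEvent_div_plus hG hES hu hε,
      fun E _ _ hES ε hε => measDisc_extEvent_div_minus hG hES hε,
      fun s h E _ _ hES => proportion_clS hG hm h E hES, fun h η hη w => ?_,
      fun h η hη E _ _ hES w => ?_, fun h E _ _ hES => equidistributed_minus hG hL hm h E hES,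
      fun h E _ _ hES u hu => equidistributed_plus hG hL hm E hES hu (h E hES u hu)⟩
    · obtain ⟨u, hu, rfl⟩ := minusMk_surjective hG w
      have h1 := (h u hu).proportion
      rw [measCpt_unitEvent hG hu] at h1
      rw [card_minusQuot hG]
      simpa only [true_and, one_mul] using proportion_unitImage hG hL hη (fun _ => True) hu
        (a := 1) (by simpa only [true_and, one_mul] using h1)
    · obtain ⟨u, hu, rfl⟩ := minusMk_surjective hG w
      have h1 := (h E hES u hu).proportion
      rw [measCpt_unitEvent_inter hG hES hu] at h1
      rw [card_minusQuot hG]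
      refine proportion_unitImage hG hL hη (fun F => Nonempty (F.ClS S ≃* E)) hu
        (h1.congr fun q => ?_)
      obtain ⟨c⟩ := q.exists_cptGen hG (hη _ q.hasSign)
      rw [← c.torsCls_mem_compEvent_iff hG hm E]
      exact and_comm
  · have hQ := D.quadRing hm
    have := hQ.finite hm
    exact proportion_clS (hQ.goodRing hm hS) hm (h D) E hES
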